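/- Let $n\ge 2$. **The moduli space.** A *nodal quilted disk* with markings $z_0,\dots,z_n$ is a tree of closed unit disks (the components), adjacent components being glued at a pair of boundary points (nodes), together with boundary points $z_0,\dots,z_n$ (markings) such that on each component the special points (nodes and markings) are distinct, the markings being in counterclockwise order $z_0,\dots,z_n$ around the boundary of the nodal disk. For a component $\alpha$ let $z_{\alpha i}$ be the special point of $\alpha$ that is $z_i$ or the node closest to $z_i$. Some components are *quilted*, i.e. equipped with a circle in the disk (the seam) of radius in $(0,1)$, tangent to the boundary at $z_{\alpha 0}$; for each $i\ge1$, exactly one component on the path from the component of $z_i$ to that of $z_0$ is quilted. It is *stable* if each quilted (resp. unquilted) component has at least $2$ (resp. $3$) special points. An isomorphism is an isomorphism of trees with holomorphic isomorphisms of the components that preserve nodes, markings and seams. The *combinatorial type* is the tree of components with the markings as labelled semi-infinite edges and the quilted components as colored vertices. $\overline M_{n,1}$ is the set of isomorphism classes of stable nodal quilted disks. With $\rho(w_1,w_2,w_3,w_4)=\frac{(w_2-w_3)(w_4-w_1)}{(w_1-w_2)(w_3-w_4)}$ put, for $0\le i<j<k<l\le n$, $\rho_{ijkl}=\rho(z_{\alpha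 i},z_{\alpha j},z_{\alpha k},z_{\alpha l})\in[-\infty,0]$ for any component $\alpha$ on which at least three of these points are distinct ($-\infty$ if $z_{\alpha i}=z_{\alpha j}$ or $z_{\alpha k}=z_{\alpha l}$). For $1\le i<j\le n$ let $\alpha$ be the component on which $z_{\alpha 0},z_{\alpha i},z_{\alpha j}$ are distinct, and put $\rho_{ij}=\operatorname{Im}\rho(z_{\alpha i},z_{\alpha j},z_{\alpha 0},w)$ for any point $w\ne z_{\alpha0}$ of the seam if $\alpha$ is quilted; otherwise $\rho_{ij}=0$ if no component on the path from $\alpha$ to the component of $z_0$ is quilted, and $\rho_{ij}=\infty$ if one is. The topology on $\overline M_{n,1}$ is pulled back along the map to $[-\infty,0]^{\binom{n+1}{4}}\times[0,\infty]^{\binom n2}$ given by all $\rho_{ijkl}$ and $\rho_{ij}$. **The multiplihedron.** Stasheff's multiplihedron $J_n$ has one cell for each way of (partially) bracketing $n$ variables $x_1,\dots,x_n$ and applying an operation $f$, such as $(f(x_1)f(x_2x_3))f(x_4)$. A cell is a face of another if the expression of the second is obtained from that of the first by removing brackets, where fusing a product $f(A_1)\cdots f(A_k)$ into $f(A_1\cdots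 A_k)$ also counts as removing brackets; the largest cell is $f(x_1\cdots x_n)$, and the facets are $J_{i_1}\times\cdots\times J_{i_j}\times K_j$ ($i_1+\dots+i_j=n$, $j\ge2$) and $J_{n-e+1}\times K_e$ ($2\le e\le n$), $K_j$ being the associahedra. The complex is built inductively, each closed cell being the cone on the union of its proper faces. **Theorem.** The subsets of $\overline M_{n,1}$ of fixed combinatorial type are the open cells of a CW structure on $\overline M_{n,1}$, the cells of $J_n$ are the open cells of a CW structure on $J_n$, and with these structures $\overline M_{n,1}$ is isomorphic to $J_n$ as a CW complex: there is a homeomorphism $\overline M_{n,1}\to J_n$ that maps the open $d$-cells bijectively to the open $d$-cells for each $d$. -/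

import Mathlib

open scoped ComplexConjugate

noncomputable section

namespace Quilt

/-! ### The disk, its automorphisms, cross-ratios -/

/-- A holomorphic automorphism of the closed unit disk, i.e. an element of `SU(1,1)`, acting by
the fractional linear transformation `z ↦ (a z + b) / (b̄ z + ā)` with `|a|² - |b|² = 1`. -/
structure DiskAut where
  a : ℂ
  b : ℂ
  det : Complex.normSq a - Complex.normSq b = 1

/-- The fractional linear transformation given by a disk automorphism. -/
def DiskAut.app (φ : DiskAut) (z : ℂ) : ℂ :=
  (φ.a * z + φ.b) / (conj φ.b * z + conj φ.a)

/-- The cross-ratio of four points, that is, the image of `w₄` under the fractional linear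
transformation that sends `w₁, w₂, w₃` to `0, 1, ∞`. -/
def crossRatio (w₁ w₂ w₃ w₄ : ℂ) : ℂ :=
  ((w₂ - w₃) * (w₄ - w₁)) / ((w₁ - w₂) * (w₃ - w₄))

/-- The cross-ratio of four points of the circle in (weak) cyclic order, at least three of which
are distinct, as an element of `[-∞, 0]`.  It is `-∞` if `w₁ = w₂` or `w₃ = w₄`, and (by the
formula) `0` if `w₂ = w₃` or `w₁ = w₄`. -/
def boundaryCrossRatio (w₁ w₂ w₃ w₄ : ℂ) : EReal :=
  open Classical in
  if w₁ = w₂ ∨ w₃ = w₄ then ⊥ else ((crossRatio w₁ w₂ w₃ w₄).re : EReal)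

/-! ### Nodal quilted disks -/

/-- The data of a nodal quilted disk with markings `z₀, …, zₙ`: a tree whose vertices are the disk
components (copies of the closed unit disk) and whose edges are the nodes; the component
and the position of every marking; for adjacent components `α, β` the boundary
point `node α β` of `α` which is glued to the boundary point `node β α` of `β`; the set of quilted
components, and the radius of the seam of each of them.
(The values of `node` at non-adjacent pairs and of `radius` at unquilted components are irrelevant;
they enter none of the notions below.) -/
structure NodalData (n : ℕ) where
  numComp : ℕ
  tree : SimpleGraph (Fin numComp)
  isTree : tree.IsTree
  comp : Fin (n + 1) → Fin numComp
  mark : Fin (n + 1) → Circle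
  node : Fin numComp → Fin numComp → Circle
  quilted : Set (Fin numComp)
  radius : Fin numComp → ℝ

namespace NodalData

variable {n : ℕ} (S : NodalData n)

/-- The non-self-crossing path between two components. -/
def path (α β : Fin S.numComp) : S.tree.Walk α β :=
  (S.isTree.existsUnique_path α β).choose

/-- The special point `z_{α i}` of the component `α` that is either the marking `z_i`, or the node
closest to `z_i`. -/
def special (α : Fin S.numComp) (i : Fin (n + 1)) : ℂ :=
  open Classical in
  if S.comp i = α then (S.mark i : ℂ) else (S.node α (S.path α (S.comp i)).snd : ℂ)

/-- The seam of a quilted component `α`: the circle of the given radius in the unit disk that is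
tangent to the boundary at the special point `z_{α 0}` in the direction of the root. -/
def seam (α : Fin S.numComp) : Set ℂ :=
  Metric.sphere ((1 - (S.radius α : ℂ)) * S.special α 0) (S.radius α)

/-- The component `α` lies strictly on the root side of the quilted components: the path from `α`
to the component of `z₀` meets no quilted component. -/
def RootSide (α : Fin S.numComp) : Prop :=
  ∀ β ∈ (S.path α (S.comp 0)).support, β ∉ S.quilted

/-- The number of special points (markings and nodes) of a component. -/
def numSpecial (α : Fin S.numComp) : ℕ :=
  {i | S.comp i = α}.ncard + (S.tree.neighborSet α).ncard

/-- `S` is a stable nodal quilted disk with `n + 1` markings. -/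
structure IsStable : Prop where
  mark_ne_mark : ∀ i j, i ≠ j → S.comp i = S.comp j → S.mark i ≠ S.mark j
  node_ne_node : ∀ α β γ, S.tree.Adj α β → S.tree.Adj α γ → β ≠ γ → S.node α β ≠ S.node α γ
  mark_ne_node : ∀ i β, S.tree.Adj (S.comp i) β → S.mark i ≠ S.node (S.comp i) β
  /-- Seams are circles inside the disk. -/
  radius_mem : ∀ α ∈ S.quilted, S.radius α ∈ Set.Ioo (0 : ℝ) 1
  /-- Between each `z_i`, `i ≠ 0`, and the root there is exactly one quilted component. -/
  colored : ∀ i, i ≠ 0 →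
    ∃! α, α ∈ (S.path (S.comp i) (S.comp 0)).support ∧ α ∈ S.quilted
  /-- The markings are in counterclockwise order `z₀, …, zₙ` around the boundary of the nodal
  disk: on each component, any three of the points `z_{α i}` that are distinct span a positively
  oriented triangle if taken in the order of their indices. (The quantity is `0` if two of the
  points coincide.) -/
  cyclic : ∀ α, ∀ i j k : Fin (n + 1), i < j → j < k →
    0 ≤ (conj (S.special α j - S.special α i) * (S.special α k - S.special α i)).im
  stable_quilted : ∀ α ∈ S.quilted, 2 ≤ S.numSpecial α
  stable_unquilted : ∀ α, α ∉ S.quilted → 3 ≤ S.numSpecial α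

/-- The cross-ratio `ρ_{ijkl}` of a nodal disk, evaluated at a component where at least three of
the four points `z_{α i}, z_{α j}, z_{α k}, z_{α l}` are distinct. (Such a component exists and the
value is the same for all of them, so that the supremum is that value.) -/
def rho (i j k l : Fin (n + 1)) : EReal :=
  ⨆ α : {α : Fin S.numComp // 3 ≤
      ({S.special α i, S.special α j, S.special α k, S.special α l} : Set ℂ).ncard},
    boundaryCrossRatio (S.special α i) (S.special α j) (S.special α k) (S.special α l)

/-- The contribution of the component `α` to `ρ_{ij}`. On a quilted component it is the imaginary
part of the image of any point `w ≠ z_{α 0}` of the seam under the transformation that sends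
`z_{α i}, z_{α j}, z_{α 0}` to `0, 1, ∞` (all these points `w` give the same value). -/
def seamRatioAt (α : Fin S.numComp) (i j : Fin (n + 1)) : EReal :=
  open Classical in
  if α ∈ S.quilted then
    ⨆ w : {w : ℂ // w ∈ S.seam α ∧ w ≠ S.special α 0},
      ((crossRatio (S.special α i) (S.special α j) (S.special α 0) w).im : EReal)
  else if S.RootSide α then 0 else ⊤

/-- The cross-ratio `ρ_{ij}`, `i ≠ j`, `i, j ≠ 0`, of a nodal quilted disk, evaluated at the unique
component where `z_{α 0}, z_{α i}, z_{α j}` are distinct. -/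
def seamRatio (i j : Fin (n + 1)) : EReal :=
  ⨆ α : {α : Fin S.numComp // S.special α 0 ≠ S.special α i ∧ S.special α 0 ≠ S.special α j ∧
      S.special α i ≠ S.special α j},
    S.seamRatioAt α i j

end NodalData

/-- Isomorphism of nodal quilted disks: an isomorphism of the trees, and on each component a
holomorphic isomorphism of disks, preserving markings, nodes and seams. (This is an equivalence relation on
stable nodal quilted disks.) -/
def Iso {n : ℕ} (S S' : NodalData n) : Prop :=
  ∃ (f : S.tree ≃g S'.tree) (φ : Fin S.numComp → DiskAut),
    (∀ i, f (S.comp i) = S'.comp i) ∧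
    (∀ i, (φ (S.comp i)).app (S.mark i) = S'.mark i) ∧
    (∀ α β, S.tree.Adj α β → (φ α).app (S.node α β) = S'.node (f α) (f β)) ∧
    (∀ α, f α ∈ S'.quilted ↔ α ∈ S.quilted) ∧
    (∀ α ∈ S.quilted, (φ α).app '' S.seam α = S'.seam (f α))

/-- `S` and `S'` have the same combinatorial type: there is an isomorphism between their trees that
preserves the (labelled) semi-infinite edges and the colored vertices. (The cyclic order of
the edges at each vertex is determined by the labels of the semi-infinite edges.) -/
def SameType {n : ℕ} (S S' : NodalData n) : Prop :=
  ∃ f : S.tree ≃g S'.tree, (∀ i, f (S.comp i) = S'.comp i) ∧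
    ∀ α, f α ∈ S'.quilted ↔ α ∈ S.quilted

/-- Stable nodal quilted disks with `n + 1` markings. -/
def StableDisk (n : ℕ) : Type := {S : NodalData n // S.IsStable}

/-- The set of isomorphism classes of stable nodal quilted disks with `n + 1` markings. -/
def Moduli (n : ℕ) : Type :=
  Quot (fun S S' : StableDisk n => Iso S.1 S'.1)

/-! ### Invariance of the cross-ratios -/

lemma DiskAut.denom_ne_zero (φ : DiskAut) {z : ℂ} (hz : ‖z‖ ≤ 1) :
    conj φ.b * z + conj φ.a ≠ 0 := by
  intro h
  have h1 : conj φ.a = -(conj φ.b * z) := by linear_combination h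
  have h2 : ‖φ.a‖ = ‖φ.b‖ * ‖z‖ := by
    have := congrArg norm h1
    simpa using this
  have h3 := φ.det
  rw [Complex.normSq_eq_norm_sq, Complex.normSq_eq_norm_sq, h2] at h3
  have h4 : ‖z‖ ^ 2 ≤ 1 := by
    have := norm_nonneg z
    nlinarith
  nlinarith [sq_nonneg ‖φ.b‖, mul_nonneg (sq_nonneg ‖φ.b‖) (sub_nonneg.2 h4)]

lemma DiskAut.det' (φ : DiskAut) : φ.a * conj φ.a - φ.b * conj φ.b = 1 := by
  rw [Complex.mul_conj, Complex.mul_conj]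
  exact_mod_cast φ.det

lemma DiskAut.app_sub (φ : DiskAut) {z w : ℂ} (hz : ‖z‖ ≤ 1) (hw : ‖w‖ ≤ 1) :
    φ.app z - φ.app w =
      (z - w) / ((conj φ.b * z + conj φ.a) * (conj φ.b * w + conj φ.a)) := by
  have h1 := φ.denom_ne_zero hz
  have h2 := φ.denom_ne_zero hw
  unfold DiskAut.app
  rw [div_sub_div _ _ h1 h2]
  congr 1
  linear_combination (z - w) * φ.det'

lemma DiskAut.app_eq_iff (φ : DiskAut) {z w : ℂ} (hz : ‖z‖ ≤ 1) (hw : ‖w‖ ≤ 1) :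
    φ.app z = φ.app w ↔ z = w := by
  rw [← sub_eq_zero, φ.app_sub hz hw, div_eq_zero_iff, sub_eq_zero]
  simp [φ.denom_ne_zero hz, φ.denom_ne_zero hw]

lemma DiskAut.crossRatio_app (φ : DiskAut) {z₁ z₂ z₃ z₄ : ℂ} (h₁ : ‖z₁‖ ≤ 1) (h₂ : ‖z₂‖ ≤ 1)
    (h₃ : ‖z₃‖ ≤ 1) (h₄ : ‖z₄‖ ≤ 1) :
    crossRatio (φ.app z₁) (φ.app z₂) (φ.app z₃) (φ.app z₄) = crossRatio z₁ z₂ z₃ z₄ := by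
  have d₁ := φ.denom_ne_zero h₁
  have d₂ := φ.denom_ne_zero h₂
  have d₃ := φ.denom_ne_zero h₃
  have d₄ := φ.denom_ne_zero h₄
  unfold crossRatio
  rw [φ.app_sub h₂ h₃, φ.app_sub h₄ h₁, φ.app_sub h₁ h₂, φ.app_sub h₃ h₄, div_mul_div_comm,
    div_mul_div_comm, div_div_div_eq]
  rw [mul_comm ((conj φ.b * z₂ + conj φ.a) * (conj φ.b * z₃ + conj φ.a) * _)]
  have e : (conj φ.b * z₁ + conj φ.a) * (conj φ.b * z₂ + conj φ.a) *
      ((conj φ.b * z₃ + conj φ.a) * (conj φ.b * z₄ + conj φ.a)) =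
      (conj φ.b * z₂ + conj φ.a) * (conj φ.b * z₃ + conj φ.a) *
      ((conj φ.b * z₄ + conj φ.a) * (conj φ.b * z₁ + conj φ.a)) := by ring
  rw [e]
  exact mul_div_mul_right _ _ (by simp [d₁, d₂, d₃, d₄])

namespace NodalData

variable {n : ℕ} {S S' : NodalData n}

lemma path_isPath (S : NodalData n) (α β : Fin S.numComp) : (S.path α β).IsPath :=
  (S.isTree.existsUnique_path α β).choose_spec.1

lemma path_map (f : S.tree ≃g S'.tree) (α β : Fin S.numComp) :
    S'.path (f α) (f β) = (S.path α β).map f.toHom :=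
  (S'.isTree.existsUnique_path (f α) (f β)).unique (S'.path_isPath _ _)
    ((S.path_isPath α β).map f.injective)

lemma norm_special (S : NodalData n) (α : Fin S.numComp) (i : Fin (n + 1)) :
    ‖S.special α i‖ = 1 := by
  unfold special
  split_ifs
  · exact Circle.norm_coe _
  · exact Circle.norm_coe _

lemma special_map (f : S.tree ≃g S'.tree) (φ : Fin S.numComp → DiskAut)
    (hc : ∀ i, f (S.comp i) = S'.comp i)
    (hm : ∀ i, (φ (S.comp i)).app (S.mark i) = S'.mark i)
    (hn : ∀ α β, S.tree.Adj α β → (φ α).app (S.node α β) = S'.node (f α) (f β))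
    (α : Fin S.numComp) (i : Fin (n + 1)) :
    S'.special (f α) i = (φ α).app (S.special α i) := by
  unfold special
  by_cases h : S.comp i = α
  · subst h
    simp [hc, hm]
  · have h' : S'.comp i ≠ f α := fun e => h (f.injective ((hc i).trans e))
    rw [if_neg h, if_neg h']
    have hnil : ¬ (S.path α (S.comp i)).Nil := fun hh => h hh.eq.symm
    rw [hn _ _ (SimpleGraph.Walk.adj_snd hnil)]
    congr 2
    rw [← hc, path_map]
    simp [SimpleGraph.Walk.snd, SimpleGraph.Walk.getVert_map]

lemma norm_le_of_mem_seam {α : Fin S.numComp} (hr : S.radius α ∈ Set.Ioo (0 : ℝ) 1) {w : ℂ}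
    (hw : w ∈ S.seam α) : ‖w‖ ≤ 1 := by
  have h1 : ‖w - (1 - (S.radius α : ℂ)) * S.special α 0‖ = S.radius α := by
    simpa [seam, dist_eq_norm] using hw
  have h2 : ‖(1 - (S.radius α : ℂ)) * S.special α 0‖ = 1 - S.radius α := by
    rw [norm_mul, norm_special, mul_one, ← Complex.ofReal_one, ← Complex.ofReal_sub,
      Complex.norm_real, Real.norm_of_nonneg (by linarith [hr.2])]
  calc ‖w‖ = ‖(w - (1 - (S.radius α : ℂ)) * S.special α 0) +
        (1 - (S.radius α : ℂ)) * S.special α 0‖ := by ring_nf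
    _ ≤ _ := norm_add_le _ _
    _ = 1 := by rw [h1, h2]; ring

lemma rootSide_map (f : S.tree ≃g S'.tree) (hc : ∀ i, f (S.comp i) = S'.comp i)
    (hq : ∀ α, f α ∈ S'.quilted ↔ α ∈ S.quilted) (α : Fin S.numComp) :
    S'.RootSide (f α) ↔ S.RootSide α := by
  unfold RootSide
  rw [← hc, path_map]
  simp [SimpleGraph.Walk.support_map, hq]

lemma rho_eq_of_iso (h : Iso S S') (i j k l : Fin (n + 1)) : S.rho i j k l = S'.rho i j k l := by
  obtain ⟨f, φ, hc, hm, hn, hq, hs⟩ := h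
  have sp := special_map f φ hc hm hn
  have le := fun α i => (norm_special S α i).le
  unfold rho
  refine Equiv.iSup_congr (f.toEquiv.subtypeEquiv fun α => ?_) fun α => ?_
  · change _ ↔ 3 ≤ ({S'.special (f α) i, S'.special (f α) j, S'.special (f α) k,
      S'.special (f α) l} : Set ℂ).ncard
    have himg : ({S'.special (f α) i, S'.special (f α) j, S'.special (f α) k,
        S'.special (f α) l} : Set ℂ) =
        (φ α).app '' {S.special α i, S.special α j, S.special α k, S.special α l} := by
      simp only [sp, Set.image_insert_eq, Set.image_singleton]
    rw [himg, Set.InjOn.ncard_image]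
    have hle : ∀ x ∈ ({S.special α i, S.special α j, S.special α k, S.special α l} : Set ℂ),
        ‖x‖ ≤ 1 := by
      rintro x (rfl | rfl | rfl | rfl) <;> exact le _ _
    intro x hx y hy hxy
    exact ((φ α).app_eq_iff (hle x hx) (hle y hy)).1 hxy
  · change boundaryCrossRatio (S'.special (f α) i) (S'.special (f α) j) (S'.special (f α) k)
      (S'.special (f α) l) = _
    simp only [sp, boundaryCrossRatio, (φ α).app_eq_iff (le _ _) (le _ _),
      (φ α).crossRatio_app (le _ _) (le _ _) (le _ _) (le _ _)]

lemma seamRatio_eq_of_iso (hS : S.IsStable) (h : Iso S S') (i j : Fin (n + 1)) :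
    S.seamRatio i j = S'.seamRatio i j := by
  obtain ⟨f, φ, hc, hm, hn, hq, hs⟩ := h
  have sp := special_map f φ hc hm hn
  have le := fun α i => (norm_special S α i).le
  unfold seamRatio
  refine Equiv.iSup_congr (f.toEquiv.subtypeEquiv fun α => ?_) fun α => ?_
  · change _ ↔ S'.special (f α) 0 ≠ S'.special (f α) i ∧ S'.special (f α) 0 ≠ S'.special (f α) j ∧
      S'.special (f α) i ≠ S'.special (f α) j
    simp only [sp, ne_eq, (φ α).app_eq_iff (le _ _) (le _ _)]
  · obtain ⟨α, _⟩ := α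
    change S'.seamRatioAt (f α) i j = S.seamRatioAt α i j
    unfold seamRatioAt
    rw [hq, rootSide_map f hc hq]
    by_cases hα : α ∈ S.quilted
    · rw [if_pos hα, if_pos hα]
      have hle : ∀ w ∈ S.seam α, ‖w‖ ≤ 1 := fun w => norm_le_of_mem_seam (hS.radius_mem α hα)
      apply le_antisymm
      · refine iSup_le ?_
        rintro ⟨w', hw', hne⟩
        rw [← hs α hα] at hw'
        obtain ⟨w, hw, rfl⟩ := hw'
        refine le_iSup_of_le ⟨w, hw, ?_⟩ ?_
        · rintro rfl
          exact hne (sp α 0).symm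
        · simp only [sp]
          rw [(φ α).crossRatio_app (le _ _) (le _ _) (le _ _) (hle w hw)]
      · refine iSup_le ?_
        rintro ⟨w, hw, hne⟩
        refine le_iSup_of_le ⟨(φ α).app w, hs α hα ▸ Set.mem_image_of_mem _ hw, ?_⟩ ?_
        · rw [sp, ne_eq, (φ α).app_eq_iff (hle w hw) (le _ _)]
          exact hne
        · simp only [sp]
          rw [(φ α).crossRatio_app (le _ _) (le _ _) (le _ _) (hle w hw)]
    · rw [if_neg hα, if_neg hα]

end NodalData

/-! ### Topology and stratification of the moduli space -/

/-- The map to a product of closed intervals given by all cross-ratios `ρ_{ijkl}`,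
`0 ≤ i < j < k < l ≤ n`, and `ρ_{ij}`, `1 ≤ i < j ≤ n`. -/
def Moduli.embedding (n : ℕ) :
    Moduli n → ((Fin 4 ↪o Fin (n + 1)) → EReal) × ((Fin 2 ↪o Fin n) → EReal) :=
  Quot.lift
    (fun S => (fun q => S.1.rho (q 0) (q 1) (q 2) (q 3),
      fun q => S.1.seamRatio (q 0).succ (q 1).succ))
    (by
      intro S S' h
      refine Prod.ext ?_ ?_
      · funext q
        exact NodalData.rho_eq_of_iso h _ _ _ _
      · funext q
        exact NodalData.seamRatio_eq_of_iso S.2 h _ _)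

/-- The topology on the moduli space is pulled back along the cross-ratio map. -/
instance (n : ℕ) : TopologicalSpace (Moduli n) :=
  TopologicalSpace.induced (Moduli.embedding n) inferInstance

/-- The subset of isomorphism classes of the same combinatorial type as `S`. -/
def Moduli.stratum {n : ℕ} (S : StableDisk n) : Set (Moduli n) :=
  {x | ∃ S' : StableDisk n, SameType S.1 S'.1 ∧ Quot.mk _ S' = x}

/-- The decomposition of the moduli space by combinatorial type. -/
def Moduli.strata (n : ℕ) : Set (Set (Moduli n)) := Set.range Moduli.stratum

/-! ### The multiplihedron -/

/-- The indices of a nonempty subword `x_i x_{i+1} ⋯ x_j`. -/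
def IsWord {n : ℕ} (I : Finset (Fin n)) : Prop :=
  I.Nonempty ∧ (I : Set (Fin n)).OrdConnected

/-- Any two members are nested or disjoint. -/
def Laminar {n : ℕ} (F : Finset (Finset (Fin n))) : Prop :=
  ∀ I ∈ F, ∀ J ∈ F, I ⊆ J ∨ J ⊆ I ∨ Disjoint I J

/-- A (partial) bracketing of the variables `x₁, …, xₙ` with an application of an operation `f`.
`outer` consists of the index sets of the subexpressions that involve `f`: the minimal ones are
the arguments of the copies of `f`, so they cover all variables, the others are the bracketed
products of such subexpressions, up to the whole expression. `inner` consists of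
the brackets inside the arguments of the copies of `f`.

In terms of trees, `outer` consists of the sets of leaves behind the colored vertices
(minimal members) and behind the vertices on the root side of them, `inner` of the sets of leaves
behind the vertices on the leaf side of the colored vertices. -/
@[ext]
structure PaintedBracketing (n : ℕ) where
  inner : Finset (Finset (Fin n))
  outer : Finset (Finset (Fin n))
  inner_word : ∀ I ∈ inner, IsWord I ∧ 2 ≤ I.card
  inner_laminar : Laminar inner
  outer_word : ∀ J ∈ outer, IsWord J
  outer_laminar : Laminar outer
  univ_mem : Finset.univ ∈ outer
  cover : ∀ i, ∃ J, Minimal (· ∈ outer) J ∧ i ∈ J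
  inner_le : ∀ I ∈ inner, ∃ J, Minimal (· ∈ outer) J ∧ I ⊆ J

namespace PaintedBracketing

variable {n : ℕ}

/-- The face relation: `T ≤ T'` if `T'` is obtained from `T` by removing brackets.
The largest element is `f(x₁ ⋯ xₙ)`, with `inner = ∅` and `outer = {{1, …, n}}`. The maximal
elements among the others are those with `inner = {I}`, `outer = {{1, …, n}}`, where `I` is a
subword of length `e ≥ 2` (the facet `J_{n-e+1} × K_e`), and those with `inner = ∅`,
`outer = {I₁, …, I_j, {1, …, n}}`, where `{1, …, n}` is the concatenation of the `j ≥ 2` subwords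
`I_k` of length `i_k` (the facet `J_{i₁} × ⋯ × J_{i_j} × K_j`). -/
instance : PartialOrder (PaintedBracketing n) :=
  PartialOrder.lift
    (fun T => (OrderDual.toDual T.inner, OrderDual.toDual T.outer))
    (by
      intro T T' h
      simp only [Prod.mk.injEq, EmbeddingLike.apply_eq_iff_eq] at h
      exact PaintedBracketing.ext h.1 h.2)

instance : Finite (PaintedBracketing n) :=
  Finite.of_injective (fun T => (T.inner, T.outer)) (by
    intro T T' h
    simp only [Prod.mk.injEq] at h
    exact PaintedBracketing.ext h.1 h.2)

instance : Fintype (PaintedBracketing n) := Fintype.ofFinite _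

end PaintedBracketing

/-- The complex with one cell for each element `p` of a finite poset `P` that is built by
induction over `P`: the closed cell of `p` is the cone, with apex `p`, on the union of the
closed cells of the elements `q < p`. Its points are the formal convex combinations of apices of
cells `p₁ < ⋯ < p_r`. -/
def IteratedCone (P : Type) [PartialOrder P] [Fintype P] : Type :=
  {w : P → ℝ // (∀ p, 0 ≤ w p) ∧ ∑ p, w p = 1 ∧ IsChain (· ≤ ·) {p | w p ≠ 0}}

namespace IteratedCone

variable {P : Type} [PartialOrder P] [Fintype P]

instance : TopologicalSpace (IteratedCone P) := instTopologicalSpaceSubtype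

/-- The closed cell of `p`. -/
def closedCell (p : P) : Set (IteratedCone P) := {w | ∀ q, w.1 q ≠ 0 → q ≤ p}

/-- The open cell of `p`: the closed cell, without the closed cells of the `q < p`. -/
def openCell (p : P) : Set (IteratedCone P) := closedCell p \ ⋃ q < p, closedCell q

end IteratedCone

/-- The multiplihedron `J_n`: the complex whose cells correspond to the bracketings of
`x₁, …, xₙ` with an application of `f`, each closed cell being the cone on the union of its
proper faces. -/
abbrev Multiplihedron (n : ℕ) : Type := IteratedCone (PaintedBracketing n)

/-- The cells of the multiplihedron. -/
def Multiplihedron.cells (n : ℕ) : Set (Set (Multiplihedron n)) :=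
  Set.range (IteratedCone.openCell (P := PaintedBracketing n))

/-! ### Isomorphisms of CW complexes -/

/-- The set of open cells of a space with the structure of a CW complex. -/
def openCells (X : Type) [TopologicalSpace X] [Topology.CWComplex (Set.univ : Set X)] :
    Set (Set X) :=
  {e | ∃ (d : ℕ) (c : Topology.RelCWComplex.cell (Set.univ : Set X) d),
    e = Topology.RelCWComplex.openCell d c}

/-- `h` is an isomorphism of CW complexes: a homeomorphism that induces for each `d` a bijection
between the open `d`-cells. -/
def IsCWIso {X Y : Type} [TopologicalSpace X] [TopologicalSpace Y]
    [Topology.CWComplex (Set.univ : Set X)] [Topology.CWComplex (Set.univ : Set Y)]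
    (h : X ≃ₜ Y) : Prop :=
  ∀ d : ℕ, ∃ e : Topology.RelCWComplex.cell (Set.univ : Set X) d ≃
      Topology.RelCWComplex.cell (Set.univ : Set Y) d,
    ∀ c, h '' Topology.RelCWComplex.openCell d c = Topology.RelCWComplex.openCell d (e c)

end Quilt

end

/-! The proof identifies both spaces with one convex polytope, a Minkowski sum of simplices whose
faces correspond to painted bracketings.

From disks to ratios. On each component put the special point towards `z₀` at infinity. The
component becomes the upper half plane, the variables behind it become weakly increasing real
numbers, and a seam becomes a horizontal line. For `i < j` consider the only component that
separates `z₀`, `z_i` and `z_j`. The distances there between consecutive variables from `i` to `j`,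
divided by their sum, form a point of the simplex on the gaps `k` with `i < k ≤ j`, gap `k` lying
between `k - 1` and `k`. A second point arises if the height of the seam is counted as one more
distance, stored at the index `0`, which is never such a gap; the height is zero on the root side of
the quilted components and infinite on the leaf side. These ratios are complete coordinates. For
nested blocks they are proportional (`size_mul_size`, `compatible`); all cross-ratios are continuous
functions of them that in turn determine them (`embedding_mk`, `crossRatios_injOn`); disks with
equal ratios are isomorphic (`iso_of_ratio_eq`); and every compatible family comes from a disk
(`model_ratio`). Since the compatible families form a compact set, the moduli space is homeomorphic
to it (`Moduli.isEmbedding_ratio`).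

From ratios to a polytope. Adding the points of all the simplices plays the role of a moment map. It
is injective on compatible families, because the logarithm is strictly increasing and the
differences of logarithms are, up to a constant on each block, independent of the block
(`total_injOn`). It reaches every point of the Minkowski sum, because the family of maximal entropy
with a given total is compatible (`exists_compatible`).

Faces. The supports of compatible families are those of painted bracketings: gap `k` is in the
support for `(i, j)` if the smallest bracket around `i` and `j` is divided there, and the seam
competes as a further gap. The `weight` of a bracketing attains its maximum on each block exactly on
the support, so it cuts out a face (`exists_functional`). Conversely the compatibility relations
force a support to be that of a bracketing (`SupportSystem.exists_bracketing`), and inclusion of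
supports is the face order (`le_iff_dom`). On the side of disks, the support of the ratios records
the brackets given by the components (`ratio_support`), so strata are sets of fixed support.

From the polytope to CW complexes. Every face is a compact convex set, hence a ball
(`exists_embedding_ball`), and it is the cone over the union of its proper faces from any point of
its relative interior. So the piecewise linear map `bary` is a homeomorphism from the iterated cone
onto the polytope that respects cells. Both CW structures are pulled back from the same balls, and
the homeomorphism between the two spaces over the polytope matches their cells. -/

open scoped ComplexConjugate

noncomputable section

namespace Quilt

/-! ### CW structures from embedded balls -/

section CellMap

variable {V X E : Type} [Nonempty V] [Nonempty X]

/-- The partial equivalence between `s ⊆ V` and the part of `X` that is covered by `f '' s`, where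
`X` is regarded as a subset of `E` by means of `h`. -/
def cellMap (h : X → E) (f : V → E) (s : Set V) (hh : Function.Injective h)
    (hf : Function.Injective f) (hs : f '' s ⊆ Set.range h) : PartialEquiv V X where
  toFun t := Function.invFun h (f t)
  invFun x := Function.invFun f (h x)
  source := s
  target := h ⁻¹' (f '' s)
  map_source' t ht := by
    change h (Function.invFun h (f t)) ∈ f '' s
    rw [Function.invFun_eq (hs ⟨t, ht, rfl⟩)]
    exact ⟨t, ht, rfl⟩
  map_target' x hx := by
    obtain ⟨t, ht, htx⟩ := hx
    rw [← htx, Function.leftInverse_invFun hf]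
    exact ht
  left_inv' t ht := by
    rw [Function.invFun_eq (hs ⟨t, ht, rfl⟩), Function.leftInverse_invFun hf]
  right_inv' x hx := by
    obtain ⟨t, ht, htx⟩ := hx
    rw [← htx, Function.leftInverse_invFun hf, htx, Function.leftInverse_invFun hh]

/-- The underlying function of `cellMap` is defined on all of `V`, so `t` need not lie in the source
`s`. This is needed for the sphere and the closed ball, whose images are not covered by the partial
equivalence on the open ball. -/
lemma cellMap_image (h : X → E) (f : V → E) (s : Set V) (hh : Function.Injective h)
    (hf : Function.Injective f) (hs : f '' s ⊆ Set.range h) {t : Set V}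
    (ht : f '' t ⊆ Set.range h) : cellMap h f s hh hf hs '' t = h ⁻¹' (f '' t) := by
  ext x
  constructor
  · rintro ⟨a, ha, rfl⟩
    change h (Function.invFun h (f a)) ∈ f '' t
    rw [Function.invFun_eq (ht ⟨a, ha, rfl⟩)]
    exact ⟨a, ha, rfl⟩
  · rintro ⟨a, ha, hax⟩
    refine ⟨a, ha, ?_⟩
    change Function.invFun h (f a) = x
    rw [hax, Function.leftInverse_invFun hh]

end CellMap

section EmbeddedCells

variable {P E : Type} [TopologicalSpace E]

/-- A finite family of embedded balls that fit together to a CW complex. -/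
structure CellFamily (P E : Type) [TopologicalSpace E] where
  dim : P → ℕ
  chart : ∀ p, (Fin (dim p) → ℝ) → E
  isEmbedding : ∀ p, Topology.IsEmbedding (chart p)
  disjoint : ∀ p q, p ≠ q →
    Disjoint (chart p '' Metric.ball 0 1) (chart q '' Metric.ball 0 1)
  boundary : ∀ p, chart p '' Metric.sphere 0 1 ⊆
    ⋃ q ∈ {q | dim q < dim p}, chart q '' Metric.closedBall 0 1

namespace CellFamily

variable (F : CellFamily P E)

/-- The union of the closed cells. -/
def carrier : Set E := ⋃ p, F.chart p '' Metric.closedBall 0 1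

lemma image_closedBall_subset (p : P) : F.chart p '' Metric.closedBall 0 1 ⊆ F.carrier :=
  Set.subset_iUnion (fun p => F.chart p '' Metric.closedBall 0 1) p

/-- The chart of a cell of known dimension. -/
def chartOf {m : ℕ} (c : {p : P // F.dim p = m}) (t : Fin m → ℝ) : E :=
  F.chart c.1 (fun i => t (Fin.cast c.2 i))

variable {X : Type} [TopologicalSpace X] [Nonempty X]

lemma isEmbedding_chartOf {m : ℕ} (c : {p : P // F.dim p = m}) :
    Topology.IsEmbedding (F.chartOf c) := by
  obtain ⟨p, rfl⟩ := c
  exact F.isEmbedding p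

lemma chartOf_subset {m : ℕ} (c : {p : P // F.dim p = m}) :
    F.chartOf c '' Metric.closedBall 0 1 ⊆ F.carrier := by
  obtain ⟨p, rfl⟩ := c
  exact F.image_closedBall_subset p

/-- The CW structure on a space which is identified with the union of the cells. -/
@[reducible]
def cw [Finite P] (h : X → E) (hh : Topology.IsEmbedding h) (hr : Set.range h = F.carrier) :
    Topology.CWComplex (Set.univ : Set X) :=
  have hsub : ∀ {m : ℕ} (c : {p : P // F.dim p = m}) (s : Set (Fin m → ℝ)),
      s ⊆ Metric.closedBall 0 1 → F.chartOf c '' s ⊆ Set.range h := fun c s hs => by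
    rw [hr]
    exact (Set.image_mono hs).trans (F.chartOf_subset c)
  have himg : ∀ {m : ℕ} (c : {p : P // F.dim p = m}) (s : Set (Fin m → ℝ)),
      s ⊆ Metric.closedBall 0 1 →
      cellMap h (F.chartOf c) (Metric.ball 0 1) hh.injective (F.isEmbedding_chartOf c).injective
        (hsub c _ Metric.ball_subset_closedBall) '' s = h ⁻¹' (F.chartOf c '' s) :=
    fun c s hs => cellMap_image _ _ _ _ _ _ (hsub c s hs)
  -- With finitely many cells, closure finiteness and the weak topology need no verification.
  Topology.CWComplex.mkFinite Set.univ
    (cell := fun m => {p : P // F.dim p = m})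
    (map := fun m c => cellMap h (F.chartOf c) (Metric.ball 0 1) hh.injective
      (F.isEmbedding_chartOf c).injective (hsub c _ Metric.ball_subset_closedBall))
    (eventually_isEmpty_cell := by
      obtain ⟨N, hN⟩ := (Set.finite_range F.dim).bddAbove
      filter_upwards [Filter.eventually_gt_atTop N] with m hm
      refine ⟨fun c => ?_⟩
      have := hN ⟨c.1, rfl⟩
      omega)
    (finite_cell := fun m => inferInstance)
    (source_eq := fun m c => rfl)
    (continuousOn := by
      intro m c
      rw [hh.continuousOn_iff]
      refine (F.isEmbedding_chartOf c).continuous.continuousOn.congr fun t ht => ?_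
      exact Function.invFun_eq (hsub c _ subset_rfl ⟨t, ht, rfl⟩))
    (continuousOn_symm := by
      intro m c
      rw [(F.isEmbedding_chartOf c).continuousOn_iff]
      refine hh.continuous.continuousOn.congr fun x hx => ?_
      obtain ⟨t, ht, htx⟩ := hx
      exact Function.invFun_eq ⟨t, htx⟩)
    (pairwiseDisjoint' := by
      rintro ⟨m, c⟩ - ⟨k, c'⟩ - hne
      change Disjoint (_ '' _) (_ '' _)
      rw [himg c _ Metric.ball_subset_closedBall, himg c' _ Metric.ball_subset_closedBall]
      obtain ⟨p, rfl⟩ := c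
      obtain ⟨q, rfl⟩ := c'
      refine (F.disjoint p q ?_).preimage h
      rintro rfl
      exact hne rfl)
    (mapsTo_iff_image_subset := by
      intro m c
      rw [Set.mapsTo_iff_image_subset, himg c _ Metric.sphere_subset_closedBall]
      obtain ⟨p, rfl⟩ := c
      intro x hx
      obtain ⟨q, hq, hxq⟩ := Set.mem_iUnion₂.1 (F.boundary p hx)
      refine Set.mem_iUnion₂.2 ⟨F.dim q, hq, Set.mem_iUnion.2 ⟨⟨q, rfl⟩, ?_⟩⟩
      rw [himg _ _ subset_rfl]
      exact hxq)
    (union' := by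
      refine Set.eq_univ_of_forall fun x => ?_
      have hx : h x ∈ F.carrier := hr ▸ ⟨x, rfl⟩
      obtain ⟨q, hxq⟩ := Set.mem_iUnion.1 hx
      refine Set.mem_iUnion₂.2 ⟨F.dim q, ⟨q, rfl⟩, ?_⟩
      rw [himg _ _ subset_rfl]
      exact hxq)

lemma openCell_cw [Finite P] (h : X → E) (hh : Topology.IsEmbedding h)
    (hr : Set.range h = F.carrier) (m : ℕ) (c : {p : P // F.dim p = m}) :
    letI := F.cw h hh hr
    Topology.RelCWComplex.openCell (C := (Set.univ : Set X)) (D := ∅) m c =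
      h ⁻¹' (F.chart c.1 '' Metric.ball 0 1) := by
  have hs : F.chartOf c '' Metric.ball 0 1 ⊆ Set.range h := by
    rw [hr]
    exact (Set.image_mono Metric.ball_subset_closedBall).trans (F.chartOf_subset c)
  refine (cellMap_image h (F.chartOf c) _ hh.injective (F.isEmbedding_chartOf c).injective
    hs hs).trans ?_
  obtain ⟨p, rfl⟩ := c
  rfl

lemma openCells_cw [Finite P] (h : X → E) (hh : Topology.IsEmbedding h)
    (hr : Set.range h = F.carrier) :
    letI := F.cw h hh hr
    openCells X = Set.range fun p => h ⁻¹' (F.chart p '' Metric.ball 0 1) := by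
  let _ := F.cw h hh hr
  ext e
  constructor
  · rintro ⟨m, c, rfl⟩
    exact ⟨c.1, (F.openCell_cw h hh hr m c).symm⟩
  · rintro ⟨p, rfl⟩
    exact ⟨F.dim p, (⟨p, rfl⟩ : {q : P // F.dim q = F.dim p}),
      (F.openCell_cw h hh hr _ (⟨p, rfl⟩ : {q : P // F.dim q = F.dim p})).symm⟩

/-- Both structures come from the same family of balls, so their cells have the same index types,
and a homeomorphism over `E` induces the identity on the indices. -/
lemma isCWIso_cw [Finite P] {Y : Type} [TopologicalSpace Y] [Nonempty Y] (h : X → E)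
    (hh : Topology.IsEmbedding h) (hr : Set.range h = F.carrier) (k : Y → E)
    (hk : Topology.IsEmbedding k) (hkr : Set.range k = F.carrier) (e : X ≃ₜ Y)
    (he : ∀ x, k (e x) = h x) :
    letI := F.cw h hh hr
    letI := F.cw k hk hkr
    IsCWIso e := by
  let _ := F.cw h hh hr
  let _ := F.cw k hk hkr
  intro m
  refine ⟨Equiv.refl {p : P // F.dim p = m}, fun c => ?_⟩
  refine (congrArg (e '' ·) (F.openCell_cw h hh hr m c)).trans
    (Eq.trans ?_ (F.openCell_cw k hk hkr m c).symm)
  ext y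
  constructor
  · rintro ⟨x, hx, rfl⟩
    refine (?_ : k (e x) ∈ F.chart c.1 '' Metric.ball 0 1)
    rw [he]
    exact hx
  · intro hy
    refine ⟨e.symm y, ?_, e.apply_symm_apply y⟩
    change h (e.symm y) ∈ F.chart c.1 '' Metric.ball 0 1
    rw [← he, e.apply_symm_apply]
    exact hy

end CellFamily

end EmbeddedCells

/-! ### Compact convex sets are balls -/

section ConvexBall

variable {E : Type} [NormedAddCommGroup E] [NormedSpace ℝ E] [FiniteDimensional ℝ E]

/-- The points of `C` at which any segment in `C` can be prolonged. -/
def prolongable (C : Set E) : Set E :=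
  {x | x ∈ C ∧ ∀ x' ∈ C, ∃ ε : ℝ, 0 < ε ∧ x + ε • (x - x') ∈ C}

/-- In linear coordinates on its direction space `C` has nonempty interior, and a bounded convex set
with interior points is carried to the unit ball by a homeomorphism of the whole coordinate space.
Prolongability describes the relative interior without mention of the coordinates. -/
lemma exists_embedding_ball {C : Set E} (hc : IsCompact C) (hconv : Convex ℝ C)
    (hne : C.Nonempty) :
    ∃ f : (Fin (Module.finrank ℝ (vectorSpan ℝ C)) → ℝ) → E, Topology.IsEmbedding f ∧
      f '' Metric.closedBall 0 1 = C ∧ f '' Metric.ball 0 1 = prolongable C := by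
  obtain ⟨v, hv⟩ := hne
  set D := vectorSpan ℝ C with hD
  set d := Module.finrank ℝ D with hd
  let b : (Fin d → ℝ) ≃L[ℝ] D := ContinuousLinearEquiv.ofFinrankEq (by simp [hd])
  let ψ : (Fin d → ℝ) →ᵃ[ℝ] E :=
    { toFun := fun t => (b t : E) + v
      linear := D.subtype ∘ₗ (b : (Fin d → ℝ) →ₗ[ℝ] D)
      map_vadd' := fun t s => by simp [add_assoc] }
  have hψ : ∀ t, ψ t = (b t : E) + v := fun t => rfl
  have hlin : Function.Injective ψ.linear := by
    intro s t hst
    exact b.injective (Subtype.ext hst)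
  have hψe : Topology.IsClosedEmbedding ψ := by
    have h1 : Topology.IsClosedEmbedding (fun x : D => (x : E)) :=
      (Submodule.closed_of_finiteDimensional D).isClosedEmbedding_subtypeVal
    exact ((Homeomorph.addRight v).isClosedEmbedding.comp h1).comp b.toHomeomorph.isClosedEmbedding
  set C' : Set (Fin d → ℝ) := ψ ⁻¹' C with hC'
  have himg : ψ '' C' = C := by
    refine Set.image_preimage_eq_of_subset fun x hx => ?_
    have : x - v ∈ D := vsub_mem_vectorSpan ℝ hx hv
    exact ⟨b.symm ⟨x - v, this⟩, by simp [hψ]⟩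
  have hconv' : Convex ℝ C' := hconv.affine_preimage ψ
  have hcomp' : IsCompact C' := hψe.isCompact_preimage hc
  have hne' : C'.Nonempty := by
    obtain ⟨t, ht, -⟩ : v ∈ ψ '' C' := himg ▸ hv
    exact ⟨t, ht⟩
  have hint : (interior C').Nonempty := by
    rw [hconv'.interior_nonempty_iff_affineSpan_eq_top,
      AffineSubspace.affineSpan_eq_top_iff_vectorSpan_eq_top_of_nonempty _ _ _ hne']
    have h1 : (vectorSpan ℝ C').map ψ.linear = D := by
      rw [AffineMap.map_vectorSpan, himg]
    refine Submodule.map_injective_of_injective hlin ?_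
    rw [h1, Submodule.map_top]
    change D = LinearMap.range (D.subtype ∘ₗ (b : (Fin d → ℝ) →ₗ[ℝ] D))
    rw [LinearMap.range_comp_of_range_eq_top _ (LinearMap.range_eq_top.2 b.surjective),
      Submodule.range_subtype]
  obtain ⟨e, he1, he2, -⟩ :=
    exists_homeomorph_image_interior_closure_frontier_eq_unitBall hconv' hint hcomp'.isBounded
  rw [hcomp'.isClosed.closure_eq] at he2
  refine ⟨ψ ∘ e.symm, hψe.isEmbedding.comp e.symm.isEmbedding, ?_, ?_⟩
  · rw [Set.image_comp, ← he2, ← Set.image_comp e.symm e]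
    simp [himg]
  · rw [Set.image_comp, ← he1, ← Set.image_comp e.symm e]
    simp only [Homeomorph.symm_comp_self, Set.image_id]
    ext x
    constructor
    · rintro ⟨t, ht, rfl⟩
      refine ⟨interior_subset (s := C') ht, fun x' hx' => ?_⟩
      obtain ⟨t', ht', rfl⟩ : x' ∈ ψ '' C' := himg ▸ hx'
      have hcont : Filter.Tendsto (fun ε : ℝ => t + ε • (t - t')) (nhdsWithin 0 (Set.Ioi 0))
          (nhds t) := by
        have : Continuous (fun ε : ℝ => t + ε • (t - t')) := by fun_prop
        have h0 := this.tendsto 0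
        simp only [zero_smul, add_zero] at h0
        exact h0.mono_left nhdsWithin_le_nhds
      obtain ⟨ε, hε, hε0⟩ := ((hcont.eventually (mem_interior_iff_mem_nhds.1 ht)).and
        self_mem_nhdsWithin).exists
      refine ⟨ε, hε0, ?_⟩
      have : ψ (t + ε • (t - t')) = ψ t + ε • (ψ t - ψ t') := by simp [hψ]; abel
      rw [← this]
      exact hε
    · rintro ⟨hx, hpro⟩
      obtain ⟨t, ht, rfl⟩ : x ∈ ψ '' C' := himg ▸ hx
      obtain ⟨t0, ht0⟩ := hint
      obtain ⟨ε, hε, hmem⟩ := hpro (ψ t0) (interior_subset (s := C') ht0)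
      have : ψ (t + ε • (t - t0)) = ψ t + ε • (ψ t - ψ t0) := by simp [hψ]; abel
      rw [← this] at hmem
      refine ⟨t, ?_, rfl⟩
      refine hconv'.openSegment_interior_self_subset_interior ht0 (y := t + ε • (t - t0)) hmem ?_
      -- The point `t` divides the segment from the interior point `t0` to the prolonged point `t +
      -- ε (t - t0)` in the ratio `1 : ε`.
      refine ⟨ε / (1 + ε), 1 / (1 + ε), by positivity, by positivity, by field_simp; ring, ?_⟩
      ext i
      simp
      field_simp
      ring

end ConvexBall

/-! ### Convex cells indexed by a finite poset -/

section ConeSystem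

variable {P : Type} [PartialOrder P] [Fintype P]
variable {E : Type} [NormedAddCommGroup E] [NormedSpace ℝ E] [FiniteDimensional ℝ E]

/-- A family of compact convex sets in an affine hyperplane that are related like the faces of a
convex polytope, with a point in the relative interior of each of them. -/
structure ConeSystem (C : P → Set E) (v : P → E) : Prop where
  isCompact : ∀ p, IsCompact (C p)
  convex : ∀ p, Convex ℝ (C p)
  mem : ∀ p, v p ∈ C p
  mono : ∀ p q, p ≤ q → C p ⊆ C q
  height : ∃ ht : E →ₗ[ℝ] ℝ, ∀ p, ∀ x ∈ C p, ht x = 1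
  sep : ∀ p, ∃ l : E →ₗ[ℝ] ℝ, (∀ q, ∀ x ∈ C q, l x ≤ 0) ∧ (∀ x ∈ C p, l x = 0) ∧
    ∀ q, ¬ q ≤ p → l (v q) < 0
  ext : ∀ q, ∀ x ∈ C q, (∃ p < q, x ∈ C p) ∨ x ∈ prolongable (C q)

/-- The map from the iterated cone that is given by the apices of the cells. -/
def bary (v : P → E) (w : IteratedCone P) : E := ∑ p, w.1 p • v p

namespace IteratedCone

lemma continuous_bary (v : P → E) : Continuous (bary v) := by
  unfold bary
  refine continuous_finsetSum _ fun p _ => ?_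
  exact ((continuous_apply p).comp continuous_subtype_val).smul continuous_const

instance : CompactSpace (IteratedCone P) := by
  refine isCompact_iff_compactSpace.1 (?_ : IsCompact {w : P → ℝ | _})
  -- The chain condition says that `w p * w q` vanishes for incomparable `p` and `q`, which is
  -- visibly closed.
  have hsub : {w : P → ℝ | (∀ p, 0 ≤ w p) ∧ ∑ p, w p = 1 ∧ IsChain (· ≤ ·) {p | w p ≠ 0}} =
      {w : P → ℝ | ∀ p, 0 ≤ w p} ∩ {w | ∑ p, w p = 1} ∩
        {w | ∀ p q, ¬ (p ≤ q ∨ q ≤ p) → w p * w q = 0} := by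
    ext w
    constructor
    · rintro ⟨h1, h2, h3⟩
      refine ⟨⟨h1, h2⟩, fun p q hpq => ?_⟩
      by_contra hne
      refine hpq (h3.total (x := p) (y := q) ?_ ?_)
      · exact left_ne_zero_of_mul hne
      · exact right_ne_zero_of_mul hne
    · rintro ⟨⟨h1, h2⟩, h3⟩
      refine ⟨h1, h2, fun p hp q hq _ => ?_⟩
      by_contra hpq
      exact mul_ne_zero hp hq (h3 p q hpq)
  rw [hsub]
  refine IsCompact.of_isClosed_subset (isCompact_univ_pi fun _ : P => isCompact_Icc (a := (0 : ℝ))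
    (b := 1)) ?_ ?_
  · refine (IsClosed.inter ?_ ?_).inter ?_
    · simp only [Set.ofPred_forall]
      exact isClosed_iInter fun p => isClosed_le continuous_const (continuous_apply p)
    · exact isClosed_eq (by fun_prop) continuous_const
    · simp only [Set.ofPred_forall]
      exact isClosed_iInter fun p => isClosed_iInter fun q => isClosed_iInter fun _ =>
        isClosed_eq (by fun_prop) continuous_const
  · rintro w ⟨⟨h1, h2⟩, -⟩ p -
    refine ⟨h1 p, ?_⟩
    rw [← (h2 : ∑ p, w p = 1)]
    exact Finset.single_le_sum (fun q _ => h1 q) (Finset.mem_univ p)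

/-- The apex of a cell. -/
def apex (p : P) : IteratedCone P := by
  classical
  exact ⟨Pi.single p 1, fun q => by
    by_cases h : q = p
    · subst h; simp
    · simp [h], by simp, by
    intro q hq r hr hne
    have h1 : q = p := by by_contra h; simp [h] at hq
    have h2 : r = p := by by_contra h; simp [h] at hr
    exact absurd (h1.trans h2.symm) hne⟩

lemma exists_max (w : IteratedCone P) : ∃ p, w.1 p ≠ 0 ∧ ∀ q, w.1 q ≠ 0 → q ≤ p := by
  have hne : {p | w.1 p ≠ 0}.Nonempty := by
    by_contra h
    rw [Set.not_nonempty_iff_eq_empty] at h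
    have : ∑ p, w.1 p = 0 := Finset.sum_eq_zero fun p _ => by
      by_contra hp
      exact (Set.eq_empty_iff_forall_notMem.1 h p) hp
    have h2 := w.2.2.1
    rw [this] at h2
    exact zero_ne_one h2
  obtain ⟨p, hp⟩ := (Set.toFinite {p | w.1 p ≠ 0}).exists_maximal hne
  refine ⟨p, hp.1, fun q hq => ?_⟩
  rcases w.2.2.2.total hp.1 hq with h | h
  · exact hp.2 hq h
  · exact h

end IteratedCone

/-! ### The iterated cone of a cone system -/

namespace ConeSystem

variable {C : P → Set E} {v : P → E} (h : ConeSystem C v)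

include h

/-- The functional of `sep` at the maximum of one support kills that combination, hence the other
one too, so the other support lies below this maximum. Thus both supports have the same maximum.
Subtracting the smaller of its two coefficients on both sides shrinks a support, and the induction
is on the total size `N` of the supports. The height functional deals with an empty support. -/
lemma sum_eq_sum_imp_eq_aux (N : ℕ) (w w' : P → ℝ) (hN : {p | w p ≠ 0}.ncard +
    {p | w' p ≠ 0}.ncard ≤ N) (hw : ∀ p, 0 ≤ w p) (hw' : ∀ p, 0 ≤ w' p)
    (hc : IsChain (· ≤ ·) {p | w p ≠ 0}) (hc' : IsChain (· ≤ ·) {p | w' p ≠ 0})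
    (heq : ∑ p, w p • v p = ∑ p, w' p • v p) : w = w' := by
  classical
  obtain ⟨ht, hht⟩ := h.height
  induction N generalizing w w' with
  | zero =>
    have h1 : {p | w p ≠ 0} = ∅ := by
      rw [← Set.ncard_eq_zero (Set.toFinite _)]; omega
    have h2 : {p | w' p ≠ 0} = ∅ := by
      rw [← Set.ncard_eq_zero (Set.toFinite _)]; omega
    ext p
    have e1 : w p = 0 := by by_contra hp; exact Set.eq_empty_iff_forall_notMem.1 h1 p hp
    have e2 : w' p = 0 := by by_contra hp; exact Set.eq_empty_iff_forall_notMem.1 h2 p hp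
    rw [e1, e2]
  | succ N ih =>
    -- the maximum of the support of one family bounds the support of the other one
    have key : ∀ u u' : P → ℝ, (∀ p, 0 ≤ u' p) → ∑ p, u p • v p = ∑ p, u' p • v p →
        ∀ p, (∀ q, u q ≠ 0 → q ≤ p) → ∀ q, u' q ≠ 0 → q ≤ p := by
      intro u u' hu' he p hp q hq
      by_contra hqp
      obtain ⟨l, hl1, hl2, hl3⟩ := h.sep p
      have e1 : l (∑ p, u p • v p) = 0 := by
        rw [map_sum]
        refine Finset.sum_eq_zero fun r _ => ?_
        by_cases hr : u r = 0
        · simp [hr]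
        · rw [map_smul, hl2 _ (h.mono r p (hp r hr) (h.mem r)), smul_zero]
      rw [he, map_sum] at e1
      have e2 : ∑ r, l (u' r • v r) < ∑ r : P, (0 : ℝ) := by
        refine Finset.sum_lt_sum (fun r _ => ?_) ⟨q, Finset.mem_univ q, ?_⟩
        · rw [map_smul, smul_eq_mul]
          exact mul_nonpos_of_nonneg_of_nonpos (hu' r) (hl1 r _ (h.mem r))
        · rw [map_smul, smul_eq_mul]
          exact mul_neg_of_pos_of_neg (lt_of_le_of_ne (hu' q) (Ne.symm hq)) (hl3 q hqp)
      simp only [Finset.sum_const_zero] at e2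
      exact e2.ne e1
    have sumh : ∀ u : P → ℝ, ht (∑ p, u p • v p) = ∑ p, u p := by
      intro u
      rw [map_sum]
      exact Finset.sum_congr rfl fun p _ => by
        rw [map_smul, hht p _ (h.mem p), smul_eq_mul, mul_one]
    have zero_of_empty : ∀ u u' : P → ℝ, (∀ p, 0 ≤ u' p) →
        ∑ p, u p • v p = ∑ p, u' p • v p → {p | u p ≠ 0} = ∅ → u = u' := by
      intro u u' hu' he hu
      have e1 : ∀ p, u p = 0 := fun p => by
        by_contra hp; exact Set.eq_empty_iff_forall_notMem.1 hu p hp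
      have e2 := congrArg ht he
      rw [sumh, sumh, Finset.sum_eq_zero fun p _ => e1 p] at e2
      ext p
      rw [e1 p]
      exact ((Finset.sum_eq_zero_iff_of_nonneg fun q _ => hu' q).1 e2.symm p
        (Finset.mem_univ p)).symm
    have max_of : ∀ u : P → ℝ, IsChain (· ≤ ·) {p | u p ≠ 0} → {p | u p ≠ 0}.Nonempty →
        ∃ p, u p ≠ 0 ∧ ∀ q, u q ≠ 0 → q ≤ p := by
      intro u hu hne
      obtain ⟨p, hp⟩ := (Set.toFinite {p | u p ≠ 0}).exists_maximal hne
      exact ⟨p, hp.1, fun q hq => (hu.total hp.1 hq).elim (fun h => hp.2 hq h) id⟩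
    rcases Set.eq_empty_or_nonempty {p | w p ≠ 0} with he | hne
    · exact zero_of_empty w w' hw' heq he
    rcases Set.eq_empty_or_nonempty {p | w' p ≠ 0} with he' | hne'
    · exact (zero_of_empty w' w hw heq.symm he').symm
    obtain ⟨p, hp, hpm⟩ := max_of w hc hne
    obtain ⟨p', hp', hpm'⟩ := max_of w' hc' hne'
    have hpp : p' = p := le_antisymm (key w w' hw' heq p hpm p' hp')
      (key w' w hw heq.symm p' hpm' p hp)
    subst hpp
    -- the step that removes the smaller of the two coefficients
    have step : ∀ u u' : P → ℝ, {p | u p ≠ 0}.ncard + {p | u' p ≠ 0}.ncard ≤ N + 1 →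
        (∀ p, 0 ≤ u p) → (∀ p, 0 ≤ u' p) →
        IsChain (· ≤ ·) {p | u p ≠ 0} → IsChain (· ≤ ·) {p | u' p ≠ 0} →
        ∑ p, u p • v p = ∑ p, u' p • v p → u p' ≠ 0 → u p' ≤ u' p' → u = u' := by
      intro u u' hcard hu hu' hcu hcu' he hup hle
      set s := Function.update u p' 0 with hs
      set s' := Function.update u' p' (u' p' - u p') with hs'
      have hsup : {p | s p ≠ 0} ⊆ {p | u p ≠ 0} := by
        intro q hq
        by_cases hqp : q = p'
        · subst hqp; simp [hs] at hq
        · simpa [hs, hqp] using hq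
      have hsup' : {p | s' p ≠ 0} ⊆ {p | u' p ≠ 0} := by
        intro q hq
        by_cases hqp : q = p'
        · subst hqp
          exact (lt_of_lt_of_le (lt_of_le_of_ne (hu q) (Ne.symm hup)) hle).ne'
        · simpa [hs', hqp] using hq
      have hlt : {p | s p ≠ 0}.ncard < {p | u p ≠ 0}.ncard := by
        refine Set.ncard_lt_ncard ⟨hsup, fun hh => ?_⟩ (Set.toFinite _)
        have : s p' ≠ 0 := hh hup
        simp [hs] at this
      have hle' := Set.ncard_le_ncard hsup' (Set.toFinite _)
      have hsum : ∀ x : P → ℝ, ∀ c : ℝ,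
          ∑ p, Function.update x p' c p • v p = ∑ p, x p • v p + (c - x p') • v p' := by
        intro x c
        rw [← sub_eq_iff_eq_add', ← Finset.sum_sub_distrib]
        rw [Finset.sum_eq_single p']
        · simp [sub_smul]
        · intro q _ hq
          simp [hq]
        · simp
      have hss : s = s' := by
        refine ih s s' (by omega) ?_ ?_ (hcu.mono hsup) (hcu'.mono hsup') ?_
        · intro q
          by_cases hqp : q = p'
          · subst hqp; simp [hs]
          · simpa [hs, hqp] using hu q
        · intro q
          by_cases hqp : q = p'
          · subst hqp; simp [hs', hle]
          · simpa [hs', hqp] using hu' q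
        · rw [hs, hs', hsum, hsum, he]
          simp
      ext q
      have hq := congrFun hss q
      by_cases hqp : q = p'
      · subst hqp
        simp only [hs, hs', Function.update_self] at hq
        linarith
      · simpa [hs, hs', hqp] using hq
    rcases le_total (w p') (w' p') with hle | hle
    · exact step w w' hN hw hw' hc hc' heq hp hle
    · exact (step w' w (by omega) hw' hw hc' hc heq.symm hp' hle).symm

lemma bary_injective : Function.Injective (bary v) := fun w w' he =>
  Subtype.ext (h.sum_eq_sum_imp_eq_aux _ w.1 w'.1 le_rfl w.2.1 w'.2.1 w.2.2.2 w'.2.2.2 he)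

lemma bary_mem {p : P} {w : IteratedCone P} (hw : w ∈ IteratedCone.closedCell p) :
    bary v w ∈ C p := by
  classical
  have h1 : bary v w = ∑ q ∈ Finset.univ.filter (fun q => w.1 q ≠ 0), w.1 q • v q := by
    unfold bary
    rw [Finset.sum_filter]
    refine Finset.sum_congr rfl fun q _ => ?_
    by_cases hq : w.1 q = 0 <;> simp [hq]
  rw [h1]
  refine (h.convex p).sum_mem (fun q _ => w.2.1 q) ?_ ?_
  · rw [Finset.sum_filter_ne_zero]
    exact w.2.2.1
  · intro q hq
    exact h.mono q p (hw q (Finset.mem_filter.1 hq).2) (h.mem q)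

/-- The functional of `sep p` vanishes at `x` and is negative at `v q`. Beyond `x` on the ray from
`v q` it would be positive, which is impossible in `C q`. -/
lemma notMem_prolongable {p q : P} (hqp : ¬ q ≤ p) {x : E} (hx : x ∈ C p) :
    x ∉ prolongable (C q) := by
  rintro ⟨-, hpro⟩
  obtain ⟨l, hl1, hl2, hl3⟩ := h.sep p
  obtain ⟨ε, hε, hmem⟩ := hpro (v q) (h.mem q)
  have h1 := hl1 q _ hmem
  rw [map_add, map_smul, map_sub, hl2 x hx, smul_eq_mul] at h1
  have h2 := hl3 q hqp
  nlinarith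

lemma prolongable_eq (q : P) : prolongable (C q) = C q \ ⋃ p < q, C p := by
  ext x
  constructor
  · intro hx
    refine ⟨hx.1, fun hx' => ?_⟩
    obtain ⟨p, hp, hxp⟩ := Set.mem_iUnion₂.1 hx'
    exact h.notMem_prolongable (not_le_of_gt hp) hxp hx
  · rintro ⟨hx, hx'⟩
    rcases h.ext q x hx with ⟨p, hp, hxp⟩ | hpro
    · exact absurd (Set.mem_iUnion₂.2 ⟨p, hp, hxp⟩) hx'
    · exact hpro

/-- The convex set `C q` is the cone with apex `v q` over its proper faces: the ray from `v q`
through `x` leaves `C q` at a point that is not prolongable, hence lies in a proper face, and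
induction applies there. -/
lemma exists_bary_eq (q : P) : ∀ x ∈ C q, ∃ w ∈ IteratedCone.closedCell q, bary v w = x := by
  classical
  induction q using WellFoundedLT.induction with
  | ind q ih =>
  intro x hx
  by_cases hlow : ∃ p < q, x ∈ C p
  · obtain ⟨p, hp, hxp⟩ := hlow
    obtain ⟨w, hw, rfl⟩ := ih p hp x hxp
    exact ⟨w, fun r hr => (hw r hr).trans hp.le, rfl⟩
  by_cases hxv : x = v q
  · refine ⟨IteratedCone.apex q, fun r hr => ?_, ?_⟩
    · by_contra hrq
      have : r ≠ q := fun e => hrq e.le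
      simp [IteratedCone.apex, this] at hr
    · unfold bary IteratedCone.apex
      rw [Finset.sum_eq_single q]
      · simp [hxv]
      · intro r _ hr
        simp [hr]
      · simp
  -- prolong the segment from `v q` to `x` as far as possible
  have hxv' : x - v q ≠ 0 := sub_ne_zero.2 hxv
  set g : ℝ → E := fun s => v q + s • (x - v q) with hg
  have hgc : Topology.IsClosedEmbedding g := by
    have h1 : Topology.IsClosedEmbedding fun s : ℝ => s • (x - v q) :=
      isClosedEmbedding_smul_left hxv'
    exact (Homeomorph.addLeft (v q)).isClosedEmbedding.comp h1
  have hcomp : IsCompact (g ⁻¹' C q) := hgc.isCompact_preimage (h.isCompact q)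
  have h1mem : (1 : ℝ) ∈ g ⁻¹' C q := by simpa [hg] using hx
  obtain ⟨s, hs⟩ := hcomp.exists_isGreatest ⟨1, h1mem⟩
  have hs1 : 1 ≤ s := hs.2 h1mem
  have hend : ∃ p < q, g s ∈ C p := by
    rcases h.ext q (g s) hs.1 with hp | hpro
    · exact hp
    · obtain ⟨ε, hε, hmem⟩ := hpro.2 (v q) (h.mem q)
      have : g s + ε • (g s - v q) = g (s + ε * s) := by
        simp only [hg, add_sub_cancel_left, add_smul, smul_smul, add_assoc]
      rw [this] at hmem
      have := hs.2 hmem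
      nlinarith
  obtain ⟨p, hp, hsp⟩ := hend
  obtain ⟨w, hw, hwx⟩ := ih p hp _ hsp
  have hs0 : 0 < s := by linarith
  have hwq : w.1 q = 0 := by
    by_contra hne
    exact absurd (hw q hne) (not_le_of_gt hp)
  -- Solving `g s = v q + s (x - v q)` for `x` gives the weight `s⁻¹` for the exit point and `1 -
  -- s⁻¹` for the apex.
  let u : P → ℝ := fun r => s⁻¹ * w.1 r + (1 - s⁻¹) * (Pi.single q 1 : P → ℝ) r
  have hinv : s⁻¹ ≤ 1 := inv_le_one_of_one_le₀ hs1
  have hu0 : ∀ r, 0 ≤ u r := by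
    intro r
    have e1 : 0 ≤ w.1 r := w.2.1 r
    have e2 : 0 ≤ (Pi.single q 1 : P → ℝ) r := by
      by_cases hr : r = q
      · subst hr; simp
      · simp [hr]
    have e3 : 0 ≤ s⁻¹ := by positivity
    have e4 : 0 ≤ 1 - s⁻¹ := by linarith
    positivity
  have husup : ∀ r, u r ≠ 0 → r = q ∨ w.1 r ≠ 0 := by
    intro r hr
    by_contra hcon
    push Not at hcon
    apply hr
    simp [u, hcon.1, hcon.2]
  have hule : ∀ r, u r ≠ 0 → r ≤ q := fun r hr => by
    rcases husup r hr with rfl | h'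
    · exact le_rfl
    · exact (hw r h').trans hp.le
  refine ⟨⟨u, hu0, ?_, ?_⟩, hule, ?_⟩
  · have e1 : ∑ r, u r = s⁻¹ * ∑ r, w.1 r + (1 - s⁻¹) * ∑ r, (Pi.single q 1 : P → ℝ) r := by
      simp only [u, Finset.sum_add_distrib, Finset.mul_sum]
    rw [e1, w.2.2.1]
    simp
  · intro a ha b hb hne
    rcases husup a ha with rfl | ha'
    · exact Or.inr (hule b hb)
    · rcases husup b hb with rfl | hb'
      · exact Or.inl (hule a ha)
      · exact w.2.2.2 ha' hb' hne
  · have e1 : ∑ r, u r • v r = s⁻¹ • ∑ r, w.1 r • v r +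
        (1 - s⁻¹) • ∑ r, (Pi.single q 1 : P → ℝ) r • v r := by
      simp only [u, Finset.smul_sum, ← Finset.sum_add_distrib, add_smul, smul_smul]
    have e2 : ∑ r, (Pi.single q 1 : P → ℝ) r • v r = v q := by
      rw [Finset.sum_eq_single q]
      · simp
      · intro r _ hr
        simp [hr]
      · simp
    change ∑ r, u r • v r = x
    rw [e1, e2]
    change s⁻¹ • bary v w + _ = x
    rw [hwx]
    simp only [hg, smul_add, smul_smul, inv_mul_cancel₀ hs0.ne', one_smul, sub_smul]
    abel

lemma bary_image_closedCell (p : P) : bary v '' IteratedCone.closedCell p = C p := by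
  refine Set.Subset.antisymm ?_ fun x hx => ?_
  · rintro _ ⟨w, hw, rfl⟩
    exact h.bary_mem hw
  · obtain ⟨w, hw, rfl⟩ := h.exists_bary_eq p x hx
    exact ⟨w, hw, rfl⟩

lemma bary_image_openCell (p : P) :
    bary v '' IteratedCone.openCell p = prolongable (C p) := by
  unfold IteratedCone.openCell
  rw [Set.image_sdiff h.bary_injective, h.bary_image_closedCell, h.prolongable_eq]
  simp only [Set.image_iUnion, h.bary_image_closedCell]

lemma isEmbedding_bary : Topology.IsEmbedding (bary v) :=
  ((IteratedCone.continuous_bary v).isClosedEmbedding h.bary_injective).isEmbedding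

lemma range_bary : Set.range (bary v) = ⋃ p, C p := by
  ext x
  constructor
  · rintro ⟨w, rfl⟩
    obtain ⟨p, -, hp⟩ := w.exists_max
    exact Set.mem_iUnion.2 ⟨p, h.bary_mem hp⟩
  · intro hx
    obtain ⟨p, hp⟩ := Set.mem_iUnion.1 hx
    obtain ⟨w, -, rfl⟩ := h.exists_bary_eq p x hp
    exact ⟨w, rfl⟩

/-- The functional of `sep p` vanishes on the directions of `C p` but not on `v q - v p`. This is
what places the boundary of a cell in cells of smaller dimension. -/
lemma finrank_lt {p q : P} (hpq : p < q) :
    Module.finrank ℝ (vectorSpan ℝ (C p)) < Module.finrank ℝ (vectorSpan ℝ (C q)) := by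
  have hle : vectorSpan ℝ (C p) ≤ vectorSpan ℝ (C q) := vectorSpan_mono ℝ (h.mono p q hpq.le)
  refine Submodule.finrank_lt_finrank_of_lt (lt_of_le_of_ne hle fun heq => ?_)
  obtain ⟨l, hl1, hl2, hl3⟩ := h.sep p
  have h1 : v q - v p ∈ vectorSpan ℝ (C p) := by
    rw [heq]
    exact vsub_mem_vectorSpan ℝ (h.mem q) (h.mono p q hpq.le (h.mem p))
  have h2 : vectorSpan ℝ (C p) ≤ LinearMap.ker l := by
    rw [vectorSpan, Submodule.span_le]
    rintro _ ⟨a, ha, b, hb, rfl⟩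
    simp [hl2 a ha, hl2 b hb]
  have h3 : l (v q - v p) = 0 := h2 h1
  rw [map_sub, hl2 _ (h.mem p), sub_zero] at h3
  exact (hl3 q (not_le_of_gt hpq)).ne h3


lemma exists_cellFamily : ∃ F : CellFamily P E,
    (∀ p, F.chart p '' Metric.closedBall 0 1 = C p) ∧
    ∀ p, F.chart p '' Metric.ball 0 1 = prolongable (C p) := by
  choose f hf1 hf2 hf3 using fun p =>
    exists_embedding_ball (h.isCompact p) (h.convex p) ⟨v p, h.mem p⟩
  refine ⟨⟨fun p => Module.finrank ℝ (vectorSpan ℝ (C p)), f, hf1, ?_, ?_⟩, hf2, hf3⟩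
  · intro p q hpq
    rw [hf3, hf3, Set.disjoint_left]
    intro x hx hx'
    by_cases hqp : q ≤ p
    · exact h.notMem_prolongable (fun hle => hpq (le_antisymm hle hqp)) hx'.1 hx
    · exact h.notMem_prolongable hqp hx.1 hx'
  · intro p
    rintro _ ⟨t, ht, rfl⟩
    have h1 : f p t ∈ C p := hf2 p ▸ ⟨t, Metric.sphere_subset_closedBall ht, rfl⟩
    rcases h.ext p _ h1 with ⟨q, hq, hmem⟩ | hpro
    · refine Set.mem_iUnion₂.2 ⟨q, h.finrank_lt hq, ?_⟩
      rw [hf2]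
      exact hmem
    · rw [← hf3 p] at hpro
      obtain ⟨s, hs, hst⟩ := hpro
      have := (hf1 p).injective hst
      subst this
      rw [Metric.mem_sphere] at ht
      rw [Metric.mem_ball] at hs
      exact absurd ht hs.ne

/-- A space that embeds onto the union of the cells of a cone system is isomorphic to the iterated
cone as a CW complex. -/
theorem exists_cw_iso [Nonempty P] {X : Type} [TopologicalSpace X] (f : X → E)
    (hf : Topology.IsEmbedding f) (hr : Set.range f = ⋃ p, C p) :
    ∃ (_ : Topology.CWComplex (Set.univ : Set X))
      (_ : Topology.CWComplex (Set.univ : Set (IteratedCone P))),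
      openCells X = Set.range (fun p => f ⁻¹' prolongable (C p)) ∧
      openCells (IteratedCone P) = Set.range (IteratedCone.openCell (P := P)) ∧
      ∃ e : X ≃ₜ IteratedCone P, IsCWIso e := by
  obtain ⟨F, hF1, hF2⟩ := h.exists_cellFamily
  have hcar : F.carrier = ⋃ p, C p := by
    unfold CellFamily.carrier
    simp only [hF1]
  have hb := h.isEmbedding_bary
  have hbr := h.range_bary
  have : Nonempty (IteratedCone P) := ⟨IteratedCone.apex (Classical.arbitrary P)⟩
  have : Nonempty X := by
    have h1 : v (Classical.arbitrary P) ∈ Set.range f := hr ▸ Set.mem_iUnion.2 ⟨_, h.mem _⟩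
    exact ⟨h1.choose⟩
  let e : X ≃ₜ IteratedCone P :=
    (hf.toHomeomorph.trans (Homeomorph.setCongr (hr.trans hbr.symm))).trans hb.toHomeomorph.symm
  have he : ∀ x, bary v (e x) = f x := by
    intro x
    have : hb.toHomeomorph (e x) =
        Homeomorph.setCongr (hr.trans hbr.symm) (hf.toHomeomorph x) := by
      simp only [e, Homeomorph.trans_apply, Homeomorph.apply_symm_apply]
    exact congrArg Subtype.val this
  refine ⟨F.cw f hf (hr.trans hcar.symm), F.cw (bary v) hb (hbr.trans hcar.symm), ?_, ?_, e,
    F.isCWIso_cw f hf _ (bary v) hb _ e he⟩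
  · rw [F.openCells_cw f hf (hr.trans hcar.symm)]
    simp only [hF2]
  · rw [F.openCells_cw (bary v) hb (hbr.trans hcar.symm)]
    congr 1
    funext p
    rw [hF2, ← h.bary_image_openCell, Set.preimage_image_eq _ h.bary_injective]

end ConeSystem

end ConeSystem

/-! ### Products of simplices and maximal entropy -/

section Simplices

variable {A ι : Type} [Fintype A] [Fintype ι]

/-- The product of the simplices spanned by the sets `S b`. -/
def simplices (S : ι → Finset A) : Set (ι → A → ℝ) :=
  {y | (∀ b k, 0 ≤ y b k) ∧ (∀ b k, k ∉ S b → y b k = 0) ∧ ∀ b, ∑ k, y b k = 1}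

/-- The points of the product of simplices for which the coordinates at nested sets are
proportional. -/
def compatible (blk : ι → Finset A) : Set (ι → A → ℝ) :=
  {y | y ∈ simplices blk ∧ ∀ b c, blk c ⊆ blk b → ∀ k ∈ blk c, ∀ l ∈ blk c,
    y b k * y c l = y b l * y c k}

/-- The sum of all coordinates of a point of a product of simplices. -/
def total : (ι → A → ℝ) →ₗ[ℝ] (A → ℝ) := ∑ b, LinearMap.proj b

lemma total_apply (y : ι → A → ℝ) (k : A) : total y k = ∑ b, y b k := by
  simp [total]

lemma isCompact_simplices (S : ι → Finset A) : IsCompact (simplices S) := by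
  refine IsCompact.of_isClosed_subset (isCompact_univ_pi fun _ : ι => isCompact_univ_pi
    fun _ : A => isCompact_Icc (a := (0 : ℝ)) (b := 1)) ?_ ?_
  · have : simplices S = {y : ι → A → ℝ | ∀ b k, 0 ≤ y b k} ∩
      ({y | ∀ b k, k ∉ S b → y b k = 0} ∩ {y | ∀ b, ∑ k, y b k = 1}) := rfl
    rw [this]
    simp only [Set.ofPred_forall]
    refine IsClosed.inter ?_ (IsClosed.inter ?_ ?_)
    · exact isClosed_iInter fun b => isClosed_iInter fun k =>
        isClosed_le continuous_const (by fun_prop)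
    · exact isClosed_iInter fun b => isClosed_iInter fun k => isClosed_iInter fun _ =>
        isClosed_eq (by fun_prop) continuous_const
    · exact isClosed_iInter fun b => isClosed_eq (by fun_prop) continuous_const
  · intro y hy b _ k _
    refine ⟨hy.1 b k, ?_⟩
    rw [← hy.2.2 b]
    exact Finset.single_le_sum (fun l _ => hy.1 b l) (Finset.mem_univ k)

lemma convex_simplices (S : ι → Finset A) : Convex ℝ (simplices S) := by
  intro y hy z hz s t hs ht hst
  refine ⟨fun b k => ?_, fun b k hk => ?_, fun b => ?_⟩
  · have h1 := hy.1 b k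
    have h2 := hz.1 b k
    simp only [Pi.add_apply, Pi.smul_apply, smul_eq_mul]
    positivity
  · simp [hy.2.1 b k hk, hz.2.1 b k hk]
  · simp only [Pi.add_apply, Pi.smul_apply, smul_eq_mul, Finset.sum_add_distrib,
      ← Finset.mul_sum, hy.2.2 b, hz.2.2 b]
    linarith

lemma simplices_mono {S T : ι → Finset A} (h : ∀ b, S b ⊆ T b) : simplices S ⊆ simplices T :=
  fun _ hy => ⟨hy.1, fun b k hk => hy.2.1 b k fun hk' => hk (h b hk'), hy.2.2⟩

lemma isCompact_compatible (blk : ι → Finset A) : IsCompact (compatible blk) := by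
  have : compatible blk = simplices blk ∩ {y | ∀ b c, blk c ⊆ blk b → ∀ k ∈ blk c, ∀ l ∈ blk c,
    y b k * y c l = y b l * y c k} := rfl
  rw [this]
  refine (isCompact_simplices blk).inter_right ?_
  simp only [Set.ofPred_forall]
  exact isClosed_iInter fun b => isClosed_iInter fun c => isClosed_iInter fun _ =>
    isClosed_iInter fun k => isClosed_iInter fun _ => isClosed_iInter fun l =>
      isClosed_iInter fun _ => isClosed_eq (by fun_prop) (by fun_prop)

lemma sum_total {S : ι → Finset A} {y : ι → A → ℝ} (hy : y ∈ simplices S) :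
    ∑ k, total y k = Fintype.card ι := by
  simp only [total_apply]
  rw [Finset.sum_comm]
  simp [hy.2.2]

/-- By concavity of `-x log x` its graph lies below the tangent at `z`; the boundary value `a = 0`
is allowed. -/
lemma negMulLog_le {a z : ℝ} (ha : 0 ≤ a) (hz : 0 < z) :
    Real.negMulLog a ≤ Real.negMulLog z + (-Real.log z - 1) * (a - z) := by
  unfold Real.negMulLog
  rcases ha.eq_or_lt with rfl | ha
  · nlinarith
  · have h1 := Real.log_le_sub_one_of_pos (div_pos hz ha)
    rw [Real.log_div hz.ne' ha.ne'] at h1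
    have h2 := mul_le_mul_of_nonneg_left h1 ha.le
    have h3 : a * (z / a - 1) = z - a := by field_simp
    rw [h3] at h2
    nlinarith

/-- Positivity of `z` is only needed at the coordinates that change, since the others contribute
equal terms to both sides. -/
lemma sum_negMulLog_le {u z : A → ℝ} (hu : ∀ k, 0 ≤ u k) (hz : ∀ k, z k ≠ u k → 0 < z k) :
    ∑ k, Real.negMulLog (u k) ≤
      ∑ k, Real.negMulLog (z k) + ∑ k, (-Real.log (z k) - 1) * (u k - z k) := by
  rw [← Finset.sum_add_distrib]
  refine Finset.sum_le_sum fun k _ => ?_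
  by_cases h : z k = u k
  · simp [h]
  · exact negMulLog_le (hu k) (hz k h)

/-- Among the points of a product of simplices with given total there is a compatible one, namely
the one of maximal entropy. -/
lemma exists_compatible [DecidableEq A] [DecidableEq ι] (blk : ι → Finset A) {m : ι → A → ℝ}
    (hm : m ∈ simplices blk) : ∃ y ∈ compatible blk, total y = total m := by
  set K := simplices blk ∩ {y | total y = total m} with hK
  have hcomp : IsCompact K := by
    refine (isCompact_simplices blk).inter_right ?_
    exact isClosed_eq (LinearMap.continuous_of_finiteDimensional total) continuous_const
  have hcont : ContinuousOn (fun y : ι → A → ℝ => ∑ b, ∑ k, Real.negMulLog (y b k)) K := by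
    refine Continuous.continuousOn (continuous_finsetSum _ fun b _ => continuous_finsetSum _
      fun k _ => Real.continuous_negMulLog.comp (by fun_prop))
  obtain ⟨y, hyK, hmax⟩ := hcomp.exists_isMaxOn ⟨m, hm, rfl⟩ hcont
  refine ⟨y, ⟨hyK.1, ?_⟩, hyK.2⟩
  -- If a minor is nonzero, a little mass is moved from `k` to `l` in block `b` and from `l` to `k`
  -- in block `c`. The total is unchanged, and the entropy grows, against the choice of `y`.
  have key : ∀ b c, blk c ⊆ blk b → ∀ k ∈ blk c, ∀ l ∈ blk c,
      ¬ y b l * y c k < y b k * y c l := by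
    intro b c hcb k hk l hl hlt
    obtain ⟨hy0, hyS, hy1⟩ := hyK.1
    have hbc : b ≠ c := by
      rintro rfl
      rw [mul_comm] at hlt
      exact lt_irrefl _ hlt
    have hkl : k ≠ l := by
      rintro rfl
      exact lt_irrefl _ hlt
    have hpos : 0 < y b k * y c l := lt_of_le_of_lt (mul_nonneg (hy0 _ _) (hy0 _ _)) hlt
    have hbk : 0 < y b k := lt_of_le_of_ne (hy0 _ _) (left_ne_zero_of_mul hpos.ne').symm
    have hcl : 0 < y c l := lt_of_le_of_ne (hy0 _ _) (right_ne_zero_of_mul hpos.ne').symm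
    -- a small exchange of mass
    obtain ⟨ε, ⟨⟨hε1, hε2⟩, hε3⟩, hε0⟩ : ∃ ε : ℝ, ((ε < y b k ∧ ε < y c l) ∧
        (y b l + ε) * (y c k + ε) < (y b k - ε) * (y c l - ε)) ∧ 0 < ε := by
      have e1 : ∀ᶠ ε in nhdsWithin (0 : ℝ) (Set.Ioi 0), ε < y b k :=
        (eventually_lt_nhds hbk).filter_mono nhdsWithin_le_nhds
      have e2 : ∀ᶠ ε in nhdsWithin (0 : ℝ) (Set.Ioi 0), ε < y c l :=
        (eventually_lt_nhds hcl).filter_mono nhdsWithin_le_nhds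
      have e3 : ∀ᶠ ε in nhdsWithin (0 : ℝ) (Set.Ioi 0),
          (y b l + ε) * (y c k + ε) < (y b k - ε) * (y c l - ε) := by
        refine Filter.Eventually.filter_mono nhdsWithin_le_nhds ?_
        refine ContinuousAt.eventually_lt ?_ ?_ (by simpa using hlt)
        · exact Continuous.continuousAt (by fun_prop)
        · exact Continuous.continuousAt (by fun_prop)
      exact (((e1.and e2).and e3).and self_mem_nhdsWithin).exists
    set d : A → ℝ := Pi.single l 1 - Pi.single k 1 with hd
    have hdk : d k = -1 := by simp [hd, hkl]
    have hdl : d l = 1 := by simp [hd, hkl.symm]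
    have hd0 : ∀ i, i ≠ k → i ≠ l → d i = 0 := fun i h1 h2 => by simp [hd, h1, h2]
    have hdsum : ∑ i, d i = 0 := by simp [hd]
    have hdlin : ∀ F : A → ℝ, ∑ i, F i * d i = F l - F k := by
      intro F
      simp [hd, mul_sub, Finset.sum_sub_distrib, Pi.single_apply]
    set z : ι → A → ℝ := y + ε • (Pi.single b d - Pi.single c d) with hz
    have hzb : z b = y b + ε • d := by
      simp [hz, hbc]
    have hzc : z c = y c - ε • d := by
      simp [hz, hbc.symm, sub_eq_add_neg]
    have hzo : ∀ a, a ≠ b → a ≠ c → z a = y a := fun a h1 h2 => by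
      simp [hz, h1, h2]
    have hzpos : ∀ a i, z a i ≠ y a i → 0 < z a i := by
      intro a i hne
      by_cases hab : a = b
      · subst hab
        rw [hzb] at hne ⊢
        simp only [Pi.add_apply, Pi.smul_apply, smul_eq_mul] at hne ⊢
        by_cases hik : i = k
        · subst hik; rw [hdk]; linarith
        by_cases hil : i = l
        · subst hil; rw [hdl]; have := hy0 a i; linarith
        · exact absurd (by rw [hd0 i hik hil]; simp) hne
      by_cases hac : a = c
      · subst hac
        rw [hzc] at hne ⊢
        simp only [Pi.sub_apply, Pi.smul_apply, smul_eq_mul] at hne ⊢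
        by_cases hik : i = k
        · subst hik; rw [hdk]; have := hy0 a i; linarith
        by_cases hil : i = l
        · subst hil; rw [hdl]; linarith
        · exact absurd (by rw [hd0 i hik hil]; simp) hne
      · exact absurd (congrFun (hzo a hab hac) i) hne
    have hzK : z ∈ K := by
      refine ⟨⟨fun a i => ?_, fun a i hi => ?_, fun a => ?_⟩, ?_⟩
      · by_cases hne : z a i = y a i
        · rw [hne]; exact hy0 a i
        · exact (hzpos a i hne).le
      · by_cases hab : a = b
        · subst hab
          have h1 : i ≠ k := fun e => hi (e ▸ hcb hk)
          have h2 : i ≠ l := fun e => hi (e ▸ hcb hl)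
          simp [hzb, hd0 i h1 h2, hyS a i hi]
        by_cases hac : a = c
        · subst hac
          have h1 : i ≠ k := fun e => hi (e ▸ hk)
          have h2 : i ≠ l := fun e => hi (e ▸ hl)
          simp [hzc, hd0 i h1 h2, hyS a i hi]
        · rw [hzo a hab hac]; exact hyS a i hi
      · by_cases hab : a = b
        · subst hab
          simp [hzb, Finset.sum_add_distrib, ← Finset.mul_sum, hdsum, hy1]
        by_cases hac : a = c
        · subst hac
          simp [hzc, Finset.sum_sub_distrib, ← Finset.mul_sum, hdsum, hy1]
        · rw [hzo a hab hac]; exact hy1 a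
      · change total z = total m
        rw [← show total y = total m from hyK.2, hz, map_add, map_smul, map_sub]
        have : ∀ a, total (Pi.single a d : ι → A → ℝ) = d := by
          intro a
          ext i
          rw [total_apply, Finset.sum_eq_single a]
          · simp
          · intro a' _ h; simp [h]
          · simp
        rw [this, this]
        simp
    have hle : ∑ b, ∑ k, Real.negMulLog (z b k) ≤ ∑ b, ∑ k, Real.negMulLog (y b k) := hmax hzK
    -- The tangent is taken at the new point `z`, where all changed coordinates are positive,
    -- whereas some coordinates of `y` may vanish. The linear term turns out to be `ε` times the
    -- logarithm of `z b l * z c k / (z b k * z c l)`, which is negative by the choice of `ε`.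
    have hge : ∑ a, ∑ i, Real.negMulLog (y a i) ≤ ∑ a, (∑ i, Real.negMulLog (z a i) +
        ∑ i, (-Real.log (z a i) - 1) * (y a i - z a i)) :=
      Finset.sum_le_sum fun a _ => sum_negMulLog_le (hy0 a) (hzpos a)
    rw [Finset.sum_add_distrib] at hge
    have hb : ∑ i, (-Real.log (z b i) - 1) * (y b i - z b i) =
        ε * (Real.log (z b l) - Real.log (z b k)) := by
      have : ∀ i, (-Real.log (z b i) - 1) * (y b i - z b i) =
          (ε * (Real.log (z b i) + 1)) * d i := by
        intro i
        have : z b i = y b i + ε * d i := by simp [hzb]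
        rw [show y b i - z b i = -(ε * d i) by rw [this]; ring]
        ring
      simp only [this, hdlin]
      ring
    have hc : ∑ i, (-Real.log (z c i) - 1) * (y c i - z c i) =
        -ε * (Real.log (z c l) - Real.log (z c k)) := by
      have : ∀ i, (-Real.log (z c i) - 1) * (y c i - z c i) =
          (-ε * (Real.log (z c i) + 1)) * d i := by
        intro i
        have : z c i = y c i - ε * d i := by simp [hzc]
        rw [show y c i - z c i = ε * d i by rw [this]; ring]
        ring
      simp only [this, hdlin]
      ring
    have hs : ∑ a, ∑ i, (-Real.log (z a i) - 1) * (y a i - z a i) =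
        ε * (Real.log (z b l) - Real.log (z b k)) +
        -ε * (Real.log (z c l) - Real.log (z c k)) := by
      rw [← hb, ← hc]
      refine Finset.sum_eq_add b c hbc (fun a _ ha => ?_) (by simp) (by simp)
      simp [hzo a ha.1 ha.2]
    rw [hs] at hge
    have v1 : z b k = y b k - ε := by simp [hzb, hdk, sub_eq_add_neg]
    have v2 : z b l = y b l + ε := by simp [hzb, hdl]
    have v3 : z c k = y c k + ε := by simp [hzc, hdk]
    have v4 : z c l = y c l - ε := by simp [hzc, hdl]
    have p1 : 0 < z b k := by rw [v1]; linarith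
    have p2 : 0 < z b l := by rw [v2]; have := hy0 b l; linarith
    have p3 : 0 < z c k := by rw [v3]; have := hy0 c k; linarith
    have p4 : 0 < z c l := by rw [v4]; linarith
    rw [← v1, ← v2, ← v3, ← v4] at hε3
    have hlog := Real.log_lt_log (mul_pos p2 p3) hε3
    rw [Real.log_mul p2.ne' p3.ne', Real.log_mul p1.ne' p4.ne'] at hlog
    have := mul_lt_mul_of_pos_left hlog hε0
    nlinarith
  intro b c hcb k hk l hl
  rcases lt_trichotomy (y b k * y c l) (y b l * y c k) with h | h | h
  · exact absurd h (key b c hcb l hl k hk)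
  · exact h
  · exact absurd h (key b c hcb k hk l hl)

end Simplices

/-! ### Faces of a Minkowski sum of simplices -/

section FaceSystem

variable {A ι P : Type} [Fintype A] [Fintype ι] [PartialOrder P]

/-- The stratification of the compatible points of a product of simplices by their supports. -/
structure FaceSystem (blk : ι → Finset A) (S : P → ι → Finset A) : Prop where
  subset : ∀ p b, S p b ⊆ blk b
  nonempty : ∀ p b, (S p b).Nonempty
  weight : ∀ p, ∃ (w : A → ℝ) (W : ι → ℝ), ∀ b, ∀ k ∈ blk b, w k ≤ W b ∧ (w k = W b ↔ k ∈ S p b)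
  le_iff : ∀ p q, p ≤ q ↔ ∀ b, S p b ⊆ S q b
  exists_rep : ∀ y ∈ compatible blk, ∃ (p : P) (g : A → ℝ), (∀ k, 0 < g k) ∧
    (∀ b, ∀ k ∉ S p b, y b k = 0) ∧ ∀ b, ∀ k ∈ S p b, y b k * ∑ l ∈ S p b, g l = g k

namespace FaceSystem

variable {blk : ι → Finset A} {S : P → ι → Finset A} (h : FaceSystem blk S)

include h

omit [Fintype ι] in
lemma eq_of_forall {p q : P} (hpq : ∀ b, S p b = S q b) : p = q :=
  le_antisymm ((h.le_iff p q).2 fun b => (hpq b).subset)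
    ((h.le_iff q p).2 fun b => (hpq b).symm.subset)

lemma exists_support {y : ι → A → ℝ} (hy : y ∈ compatible blk) :
    ∃ p, ∀ b k, y b k ≠ 0 ↔ k ∈ S p b := by
  obtain ⟨p, g, hg, h0, h1⟩ := h.exists_rep y hy
  refine ⟨p, fun b k => ⟨fun hk => ?_, fun hk hy0 => ?_⟩⟩
  · by_contra hkS
    exact hk (h0 b k hkS)
  · have := h1 b k hk
    rw [hy0, zero_mul] at this
    exact (hg k).ne this

/-- The weight of `p` is a supporting functional of the Minkowski sum: its defect from the maximum
is a sum of the nonnegative terms `m b k * (W b - w k)`, which all vanish exactly if the mass of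
each block lies in the support of `p`. -/
lemma exists_functional (p : P) : ∃ (w : A → ℝ) (W : ℝ),
    (∀ m ∈ simplices blk, ∑ k, w k * total m k ≤ W) ∧
    ∀ m ∈ simplices blk, (∑ k, w k * total m k = W ↔ m ∈ simplices (S p)) := by
  obtain ⟨w, W, hw⟩ := h.weight p
  have hsum : ∀ m ∈ simplices blk, ∑ b, W b - ∑ k, w k * total m k =
      ∑ b, ∑ k, m b k * (W b - w k) := by
    intro m hm
    have e1 : ∑ k, w k * total m k = ∑ b, ∑ k, m b k * w k := by
      simp only [total_apply, Finset.mul_sum]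
      rw [Finset.sum_comm]
      simp only [mul_comm]
    rw [e1, ← Finset.sum_sub_distrib]
    refine Finset.sum_congr rfl fun b _ => ?_
    simp only [mul_sub, Finset.sum_sub_distrib, ← Finset.sum_mul, hm.2.2 b, one_mul]
  have hnn : ∀ m ∈ simplices blk, ∀ b k, 0 ≤ m b k * (W b - w k) := by
    intro m hm b k
    by_cases hk : k ∈ blk b
    · exact mul_nonneg (hm.1 b k) (sub_nonneg.2 (hw b k hk).1)
    · rw [hm.2.1 b k hk, zero_mul]
  refine ⟨w, ∑ b, W b, fun m hm => ?_, fun m hm => ?_⟩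
  · rw [← sub_nonneg, hsum m hm]
    exact Finset.sum_nonneg fun b _ => Finset.sum_nonneg fun k _ => hnn m hm b k
  · rw [eq_comm, ← sub_eq_zero, hsum m hm, Finset.sum_eq_zero_iff_of_nonneg
      fun b _ => Finset.sum_nonneg fun k _ => hnn m hm b k]
    constructor
    · intro h0
      refine ⟨hm.1, fun b k hk => ?_, hm.2.2⟩
      by_cases hkb : k ∈ blk b
      · have := (Finset.sum_eq_zero_iff_of_nonneg fun k _ => hnn m hm b k).1
          (h0 b (Finset.mem_univ b)) k (Finset.mem_univ k)
        rcases mul_eq_zero.1 this with h1 | h1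
        · exact h1
        · exact absurd ((hw b k hkb).2.1 (by linarith)) hk
      · exact hm.2.1 b k hkb
    · intro hmS b _
      refine Finset.sum_eq_zero fun k _ => ?_
      by_cases hk : k ∈ S p b
      · rw [(hw b k (h.subset p b hk)).2.2 hk, sub_self, mul_zero]
      · rw [hmS.2.1 b k hk, zero_mul]

lemma simplices_subset (p : P) : simplices (S p) ⊆ simplices blk := simplices_mono (h.subset p)

/-- Whether a point lies over the face of `p` is decided by a functional of its total alone. -/
lemma mem_simplices_of_total_eq {p : P} {y m : ι → A → ℝ} (hy : y ∈ simplices blk)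
    (hm : m ∈ simplices (S p)) (he : total y = total m) : y ∈ simplices (S p) := by
  obtain ⟨w, W, -, hw⟩ := h.exists_functional p
  rw [← hw y hy, he]
  exact (hw m (h.simplices_subset p hm)).2 hm

lemma mem_simplices_iff {y : ι → A → ℝ} (hy : y ∈ compatible blk) {p : P}
    (hp : ∀ b k, y b k ≠ 0 ↔ k ∈ S p b) (q : P) : y ∈ simplices (S q) ↔ p ≤ q := by
  rw [h.le_iff]
  constructor
  · intro hyq b k hk
    by_contra hkq
    exact (hp b k).2 hk (hyq.2.1 b k hkq)
  · intro hpq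
    refine ⟨hy.1.1, fun b k hk => ?_, hy.1.2.2⟩
    by_contra hne
    exact hk (hpq b ((hp b k).1 hne))

/-- Equal totals lie on the same faces, so both points have the same support. On it the logarithm of
a compatible point is `log (g k)` minus a constant of the block. Hence the sum of `(y' - y) (log y'
- log y)` reduces to a pairing with the difference of the totals and vanishes, while all its terms
are nonnegative and vanish only if `y' = y`. -/
lemma total_injOn : Set.InjOn total (compatible blk) := by
  intro y hy y' hy' he
  obtain ⟨p, g, hg, hy0, hyg⟩ := h.exists_rep y hy
  obtain ⟨p', g', hg', hy0', hyg'⟩ := h.exists_rep y' hy'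
  have hyp : y ∈ simplices (S p) := ⟨hy.1.1, hy0, hy.1.2.2⟩
  have hyp' : y' ∈ simplices (S p') := ⟨hy'.1.1, hy0', hy'.1.2.2⟩
  have hpos : ∀ {z : ι → A → ℝ} {r : P} {f : A → ℝ}, (∀ b k, 0 ≤ z b k) → (∀ k, 0 < f k) →
      (∀ b, ∀ k ∈ S r b, z b k * ∑ l ∈ S r b, f l = f k) → ∀ b, ∀ k ∈ S r b, 0 < z b k := by
    intro z r f hz hf hzf b k hk
    refine lt_of_le_of_ne (hz b k) fun h0 => ?_
    have := hzf b k hk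
    rw [← h0, zero_mul] at this
    exact (hf k).ne this
  have hpp : p = p' := by
    have q1 := h.mem_simplices_of_total_eq hy'.1 hyp he.symm
    have q2 := h.mem_simplices_of_total_eq hy.1 hyp' he
    refine h.eq_of_forall fun b => Finset.Subset.antisymm (fun k hk => ?_) fun k hk => ?_
    · by_contra hk'
      exact (hpos hy.1.1 hg hyg b k hk).ne' (q2.2.1 b k hk')
    · by_contra hk'
      exact (hpos hy'.1.1 hg' hyg' b k hk).ne' (q1.2.1 b k hk')
  subst hpp
  have hgs : ∀ {f : A → ℝ}, (∀ k, 0 < f k) → ∀ b, 0 < ∑ l ∈ S p b, f l := fun hf b =>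
    Finset.sum_pos (fun k _ => hf k) (h.nonempty p b)
  have hlog : ∀ {z : ι → A → ℝ} {f : A → ℝ}, (∀ k, 0 < f k) → (∀ b k, 0 ≤ z b k) →
      (∀ b, ∀ k ∈ S p b, z b k * ∑ l ∈ S p b, f l = f k) → ∀ b, ∀ k ∈ S p b,
      Real.log (z b k) = Real.log (f k) - Real.log (∑ l ∈ S p b, f l) := by
    intro z f hf hz hzf b k hk
    rw [← hzf b k hk, Real.log_mul (hpos hz hf hzf b k hk).ne' (hgs hf b).ne']
    ring
  -- the logarithmic gradient of the entropy is monotone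
  have hterm : ∀ b k, 0 ≤ (y' b k - y b k) * (Real.log (y' b k) - Real.log (y b k)) := by
    intro b k
    by_cases hk : k ∈ S p b
    · have h1 := hpos hy.1.1 hg hyg b k hk
      have h2 := hpos hy'.1.1 hg' hyg' b k hk
      rcases le_total (y b k) (y' b k) with hle | hle
      · exact mul_nonneg (by linarith) (by linarith [Real.log_le_log h1 hle])
      · exact mul_nonneg_of_nonpos_of_nonpos (by linarith) (by linarith [Real.log_le_log h2 hle])
    · rw [hy0 b k hk, hy0' b k hk]
      simp
  have hsum : ∑ b, ∑ k, (y' b k - y b k) * (Real.log (y' b k) - Real.log (y b k)) = 0 := by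
    -- The normalizing constants of the blocks drop out, since `y b` and `y' b` have the same sum.
    have e1 : ∀ b, ∑ k, (y' b k - y b k) * (Real.log (y' b k) - Real.log (y b k)) =
        ∑ k, (y' b k - y b k) * (Real.log (g' k) - Real.log (g k)) := by
      intro b
      have e2 : ∀ k, (y' b k - y b k) * (Real.log (y' b k) - Real.log (y b k)) =
          (y' b k - y b k) * (Real.log (g' k) - Real.log (g k)) - (y' b k - y b k) *
          (Real.log (∑ l ∈ S p b, g' l) - Real.log (∑ l ∈ S p b, g l)) := by
        intro k
        by_cases hk : k ∈ S p b
        · rw [hlog hg hy.1.1 hyg b k hk, hlog hg' hy'.1.1 hyg' b k hk]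
          ring
        · rw [hy0 b k hk, hy0' b k hk]
          simp
      simp only [e2]
      rw [Finset.sum_sub_distrib, ← Finset.sum_mul, Finset.sum_sub_distrib, hy.1.2.2 b,
        hy'.1.2.2 b]
      ring
    simp only [e1]
    rw [Finset.sum_comm]
    refine Finset.sum_eq_zero fun k _ => ?_
    rw [← Finset.sum_mul, Finset.sum_sub_distrib]
    have := congrFun he k
    rw [total_apply, total_apply] at this
    rw [this, sub_self, zero_mul]
  ext b k
  have h0 := (Finset.sum_eq_zero_iff_of_nonneg fun k _ => hterm b k).1
    ((Finset.sum_eq_zero_iff_of_nonneg fun b _ => Finset.sum_nonneg fun k _ => hterm b k).1 hsum b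
      (Finset.mem_univ b)) k (Finset.mem_univ k)
  by_cases hk : k ∈ S p b
  · have h1 := hpos hy.1.1 hg hyg b k hk
    have h2 := hpos hy'.1.1 hg' hyg' b k hk
    rcases mul_eq_zero.1 h0 with h3 | h3
    · linarith
    · exact (Real.log_injOn_pos h2 h1 (by linarith)).symm
  · rw [hy0 b k hk, hy0' b k hk]

/-- The cells of total sizes have cone points, given by the totals of the uniform weights. -/
lemma exists_coneSystem [Fintype P] [Nonempty ι] :
    ∃ v, ConeSystem (fun p => total '' simplices (S p)) v := by
  classical
  let u : P → ι → A → ℝ := fun p b k => if k ∈ S p b then ((S p b).card : ℝ)⁻¹ else 0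
  have hcard : ∀ p b, 0 < ((S p b).card : ℝ) := fun p b =>
    Nat.cast_pos.2 (Finset.card_pos.2 (h.nonempty p b))
  have hu : ∀ p, u p ∈ simplices (S p) := by
    intro p
    refine ⟨fun b k => ?_, fun b k hk => if_neg hk, fun b => ?_⟩
    · have := hcard p b
      by_cases hk : k ∈ S p b
      · simp only [u, if_pos hk]; positivity
      · simp only [u, if_neg hk]; exact le_rfl
    · simp only [u, Finset.sum_ite_mem, Finset.univ_inter, Finset.sum_const, nsmul_eq_mul]
      exact mul_inv_cancel₀ (hcard p b).ne'
  have hι : (0 : ℝ) < Fintype.card ι := Nat.cast_pos.2 Fintype.card_pos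
  -- Every total has mass `Fintype.card ι`, so after this scaling all cells lie at height `1`.
  let σ : (A → ℝ) →ₗ[ℝ] ℝ := (Fintype.card ι : ℝ)⁻¹ • ∑ k, LinearMap.proj k
  have hσ : ∀ p, ∀ m ∈ simplices (S p), σ (total m) = 1 := by
    intro p m hm
    have : σ (total m) = (Fintype.card ι : ℝ)⁻¹ * ∑ k, total m k := by simp [σ]
    rw [this, sum_total hm, inv_mul_cancel₀ hι.ne']
  have htc : Continuous (total : (ι → A → ℝ) →ₗ[ℝ] (A → ℝ)) :=
    LinearMap.continuous_of_finiteDimensional total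
  refine ⟨fun p => total (u p), ?_, ?_, ?_, ?_, ⟨σ, ?_⟩, ?_, ?_⟩
  · exact fun p => (isCompact_simplices _).image htc
  · exact fun p => (convex_simplices _).linear_image total
  · exact fun p => ⟨u p, hu p, rfl⟩
  · exact fun p q hpq => Set.image_mono (simplices_mono ((h.le_iff p q).1 hpq))
  · rintro p _ ⟨m, hm, rfl⟩
    exact hσ p m hm
  · intro p
    obtain ⟨w, W, hw1, hw2⟩ := h.exists_functional p
    -- The affine condition that the weight equals its maximum `W` is made linear by means of the
    -- height.
    let l : (A → ℝ) →ₗ[ℝ] ℝ := ∑ k, w k • LinearMap.proj k - W • σ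
    have hl : ∀ q, ∀ m ∈ simplices (S q), l (total m) = ∑ k, w k * total m k - W := by
      intro q m hm
      have : l (total m) = ∑ k, w k * total m k - W * σ (total m) := by simp [l]
      rw [this, hσ q m hm, mul_one]
    refine ⟨l, ?_, ?_, ?_⟩
    · rintro q _ ⟨m, hm, rfl⟩
      rw [hl q m hm]
      linarith [hw1 m (h.simplices_subset q hm)]
    · rintro _ ⟨m, hm, rfl⟩
      rw [hl p m hm, (hw2 m (h.simplices_subset p hm)).2 hm, sub_self]
    · intro q hqp
      rw [hl q _ (hu q)]
      have h1 := hw1 _ (h.simplices_subset q (hu q))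
      have h2 : ∑ k, w k * total (u q) k ≠ W := by
        rw [Ne, hw2 _ (h.simplices_subset q (hu q))]
        intro hmem
        refine hqp ((h.le_iff q p).2 fun b k hk => ?_)
        by_contra hkp
        have := hmem.2.1 b k hkp
        simp only [u, if_pos hk] at this
        exact (inv_pos.2 (hcard q b)).ne' this
      have := lt_of_le_of_ne h1 h2
      linarith
  -- A point of the cell is also the total of a compatible `y`. If the support of `y` is smaller
  -- than that of `q`, the point lies in a proper face; otherwise all coordinates of `y` in the
  -- support of `q` are positive and leave room for prolonging any segment.
  · rintro q _ ⟨m, hm, rfl⟩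
    obtain ⟨y, hy, hym⟩ := exists_compatible blk (h.simplices_subset q hm)
    have hyq := h.mem_simplices_of_total_eq hy.1 hm hym
    obtain ⟨p, hp⟩ := h.exists_support hy
    have hpq := (h.mem_simplices_iff hy hp q).1 hyq
    rcases hpq.lt_or_eq with hlt | rfl
    · exact Or.inl ⟨p, hlt, y, (h.mem_simplices_iff hy hp p).2 le_rfl, hym⟩
    · right
      refine ⟨⟨m, hm, rfl⟩, ?_⟩
      rintro _ ⟨m', hm', rfl⟩
      have hev : ∀ b k, ∀ᶠ ε in nhdsWithin (0 : ℝ) (Set.Ioi 0),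
          0 ≤ y b k + ε * (y b k - m' b k) := by
        intro b k
        by_cases hk : k ∈ S p b
        · have h1 : 0 < y b k := lt_of_le_of_ne (hy.1.1 b k) ((hp b k).2 hk).symm
          have h2 : ContinuousAt (fun ε : ℝ => y b k + ε * (y b k - m' b k)) 0 :=
            Continuous.continuousAt (by fun_prop)
          have h3 : ∀ᶠ ε in nhds (0 : ℝ), 0 < y b k + ε * (y b k - m' b k) :=
            continuousAt_const.eventually_lt h2 (by simpa using h1)
          exact (h3.mono fun _ h => h.le).filter_mono nhdsWithin_le_nhds
        · refine Filter.Eventually.of_forall fun ε => ?_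
          rw [hyq.2.1 b k hk, hm'.2.1 b k hk]
          simp
      have hev' : ∀ᶠ ε in nhdsWithin (0 : ℝ) (Set.Ioi 0),
          ∀ b k, 0 ≤ y b k + ε * (y b k - m' b k) :=
        Filter.eventually_all.2 fun b => Filter.eventually_all.2 fun k => hev b k
      obtain ⟨ε, hε, hε0⟩ := (hev'.and self_mem_nhdsWithin).exists
      refine ⟨ε, hε0, y + ε • (y - m'), ⟨hε, fun b k hk => ?_, fun b => ?_⟩, ?_⟩
      · simp [hyq.2.1 b k hk, hm'.2.1 b k hk]
      · simp [Finset.sum_add_distrib, ← Finset.mul_sum, hyq.2.2 b, hm'.2.2 b]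
      · rw [map_add, map_smul, map_sub, hym]

/-- A space which is identified with the space of compatible points is isomorphic to the iterated
cone over the poset of supports. -/
theorem exists_cw_iso [Fintype P] [Nonempty P] [Nonempty ι] {X : Type} [TopologicalSpace X]
    (f : X → ι → A → ℝ) (hf : Topology.IsEmbedding f) (hr : Set.range f = compatible blk) :
    ∃ (_ : Topology.CWComplex (Set.univ : Set X))
      (_ : Topology.CWComplex (Set.univ : Set (IteratedCone P))),
      openCells X = Set.range (fun p => {x | ∀ b k, f x b k ≠ 0 ↔ k ∈ S p b}) ∧
      openCells (IteratedCone P) = Set.range (IteratedCone.openCell (P := P)) ∧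
      ∃ e : X ≃ₜ IteratedCone P, IsCWIso e := by
  classical
  obtain ⟨v, hv⟩ := h.exists_coneSystem
  have htc : Continuous (total : (ι → A → ℝ) →ₗ[ℝ] (A → ℝ)) :=
    LinearMap.continuous_of_finiteDimensional total
  have hmem : ∀ x, f x ∈ compatible blk := fun x => hr ▸ ⟨x, rfl⟩
  have hcs : CompactSpace (compatible blk) := isCompact_iff_compactSpace.1 (isCompact_compatible blk)
  have hte : Topology.IsEmbedding fun y : compatible blk => total y.1 :=
    ((htc.comp continuous_subtype_val).isClosedEmbedding
      (fun y y' he => Subtype.ext (h.total_injOn y.2 y'.2 he))).isEmbedding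
  have hfe : Topology.IsEmbedding fun x => total (f x) :=
    hte.comp (hf.codRestrict (compatible blk) hmem)
  have hrange : Set.range (fun x => total (f x)) = ⋃ p, total '' simplices (S p) := by
    ext a
    constructor
    · rintro ⟨x, rfl⟩
      obtain ⟨p, hp⟩ := h.exists_support (hmem x)
      exact Set.mem_iUnion.2 ⟨p, f x, (h.mem_simplices_iff (hmem x) hp p).2 le_rfl, rfl⟩
    · intro ha
      obtain ⟨p, m, hm, rfl⟩ := Set.mem_iUnion.1 ha
      obtain ⟨y, hy, hym⟩ := exists_compatible blk (h.simplices_subset p hm)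
      rw [← hr] at hy
      obtain ⟨x, rfl⟩ := hy
      exact ⟨x, hym⟩
  obtain ⟨cX, cP, h1, h2, h3⟩ := hv.exists_cw_iso _ hfe hrange
  refine ⟨cX, cP, ?_, h2, h3⟩
  rw [h1]
  congr 1
  funext p
  rw [hv.prolongable_eq]
  ext x
  obtain ⟨r, hrx⟩ := h.exists_support (hmem x)
  -- The cells containing the image of `x` are those above the support `r` of `x`, so only the cell
  -- of `r` contains it in its relative interior.
  have hC : ∀ q, total (f x) ∈ total '' simplices (S q) ↔ r ≤ q := by
    intro q
    rw [← h.mem_simplices_iff (hmem x) hrx q]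
    constructor
    · rintro ⟨m, hm, he⟩
      exact h.mem_simplices_of_total_eq (hmem x).1 hm he.symm
    · exact fun hx => ⟨_, hx, rfl⟩
  constructor
  · rintro ⟨hx1, hx2⟩
    have hrp : r ≤ p := (hC p).1 hx1
    rcases hrp.lt_or_eq with hlt | rfl
    · exact absurd (Set.mem_iUnion₂.2 ⟨r, hlt, (hC r).2 le_rfl⟩) hx2
    · exact hrx
  · intro hx
    have hrp : r = p := h.eq_of_forall fun b => by
      ext k
      rw [← hrx b k]
      exact hx b k
    subst hrp
    refine ⟨(hC r).2 le_rfl, fun hx2 => ?_⟩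
    obtain ⟨q, hq, hxq⟩ := Set.mem_iUnion₂.1 hx2
    exact absurd ((hC q).1 hxq) (not_le_of_gt hq)

end FaceSystem

end FaceSystem

/-! ### Painted bracketings as families of intervals -/

lemma Icc_inj_of_le {n : ℕ} {a b c d : Fin n} (h : a ≤ b) (h' : c ≤ d)
    (e : Finset.Icc a b = Finset.Icc c d) : a = c ∧ b = d := by
  have h1 := (Finset.Icc_subset_Icc_iff h).1 e.subset
  have h2 := (Finset.Icc_subset_Icc_iff h').1 e.symm.subset
  exact ⟨le_antisymm h2.1 h1.1, le_antisymm h1.2 h2.2⟩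

lemma isWord_Icc {n : ℕ} {a b : Fin n} (h : a ≤ b) : IsWord (Finset.Icc a b) :=
  ⟨Finset.nonempty_Icc.2 h, by rw [Finset.coe_Icc]; exact Set.ordConnected_Icc⟩

lemma IsWord.exists_eq_Icc {n : ℕ} {I : Finset (Fin n)} (h : IsWord I) :
    ∃ a b, a ≤ b ∧ I = Finset.Icc a b := by
  refine ⟨I.min' h.1, I.max' h.1, I.min'_le _ (I.max'_mem h.1), ?_⟩
  ext k
  rw [Finset.mem_Icc]
  constructor
  · exact fun hk => ⟨I.min'_le k hk, I.le_max' k hk⟩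
  · exact fun hk => h.2.out (I.min'_mem h.1) (I.max'_mem h.1) ⟨hk.1, hk.2⟩

namespace PaintedBracketing

variable {n : ℕ} (T : PaintedBracketing n)

/-- The interval from `a` to `b` is an inner bracket. -/
def In (a b : Fin n) : Prop := Finset.Icc a b ∈ T.inner

/-- The interval from `a` to `b` is an outer bracket. -/
def Out (a b : Fin n) : Prop := a ≤ b ∧ Finset.Icc a b ∈ T.outer

/-- The interval from `a` to `b` is a minimal outer bracket. -/
def Min (a b : Fin n) : Prop := T.Out a b ∧ ∀ c d, T.Out c d → a ≤ c → d ≤ b → c = a ∧ d = b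

variable {T}

lemma In.lt {a b : Fin n} (h : T.In a b) : a < b := by
  have h1 := (T.inner_word _ h).2
  by_contra hab
  have h2 : (Finset.Icc a b).card ≤ 1 := Finset.card_le_one.2 fun x hx y hy => by
    rw [Finset.mem_Icc] at hx hy
    order
  omega

lemma disjoint_Icc {a b c d : Fin n} (h : a ≤ b) (h' : c ≤ d)
    (hd : Disjoint (Finset.Icc a b) (Finset.Icc c d)) : b < c ∨ d < a := by
  by_contra hcon
  push Not at hcon
  have h1 : max a c ∈ Finset.Icc a b := Finset.mem_Icc.2 ⟨le_max_left _ _, max_le h hcon.1⟩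
  have h2 : max a c ∈ Finset.Icc c d := Finset.mem_Icc.2 ⟨le_max_right _ _, max_le hcon.2 h'⟩
  exact Finset.disjoint_left.1 hd h1 h2

lemma Out.laminar {a b c d : Fin n} (h : T.Out a b) (h' : T.Out c d) :
    (c ≤ a ∧ b ≤ d) ∨ (a ≤ c ∧ d ≤ b) ∨ b < c ∨ d < a := by
  rcases T.outer_laminar _ h.2 _ h'.2 with e | e | e
  · exact Or.inl ((Finset.Icc_subset_Icc_iff h.1).1 e)
  · exact Or.inr (Or.inl ((Finset.Icc_subset_Icc_iff h'.1).1 e))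
  · exact Or.inr (Or.inr (disjoint_Icc h.1 h'.1 e))

lemma In.laminar {a b c d : Fin n} (h : T.In a b) (h' : T.In c d) :
    (c ≤ a ∧ b ≤ d) ∨ (a ≤ c ∧ d ≤ b) ∨ b < c ∨ d < a := by
  rcases T.inner_laminar _ h _ h' with e | e | e
  · exact Or.inl ((Finset.Icc_subset_Icc_iff h.lt.le).1 e)
  · exact Or.inr (Or.inl ((Finset.Icc_subset_Icc_iff h'.lt.le).1 e))
  · exact Or.inr (Or.inr (disjoint_Icc h.lt.le h'.lt.le e))

lemma exists_min_of_minimal {J : Finset (Fin n)} (h : Minimal (· ∈ T.outer) J) :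
    ∃ a b, T.Min a b ∧ J = Finset.Icc a b := by
  obtain ⟨a, b, hab, rfl⟩ := (T.outer_word _ h.1).exists_eq_Icc
  refine ⟨a, b, ⟨⟨hab, h.1⟩, fun c d hcd hac hdb => ?_⟩, rfl⟩
  have := h.2 hcd.2 ((Finset.Icc_subset_Icc_iff hcd.1).2 ⟨hac, hdb⟩)
  have := (Finset.Icc_subset_Icc_iff hab).1 this
  exact ⟨le_antisymm this.1 hac, le_antisymm hdb this.2⟩

variable (T) in
lemma exists_min (i : Fin n) : ∃ a b, T.Min a b ∧ a ≤ i ∧ i ≤ b := by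
  obtain ⟨J, hJ, hi⟩ := T.cover i
  obtain ⟨a, b, hab, rfl⟩ := exists_min_of_minimal hJ
  exact ⟨a, b, hab, Finset.mem_Icc.1 hi⟩

lemma In.exists_min {c d : Fin n} (h : T.In c d) : ∃ a b, T.Min a b ∧ a ≤ c ∧ d ≤ b := by
  obtain ⟨J, hJ, hi⟩ := T.inner_le _ h
  obtain ⟨a, b, hab, rfl⟩ := exists_min_of_minimal hJ
  exact ⟨a, b, hab, (Finset.Icc_subset_Icc_iff h.lt.le).1 hi⟩

lemma Min.laminar {a b c d : Fin n} (h : T.Min a b) (h' : T.Out c d) :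
    (c ≤ a ∧ b ≤ d) ∨ b < c ∨ d < a := by
  rcases h.1.laminar h' with e | e | e
  · exact Or.inl e
  · obtain ⟨rfl, rfl⟩ := h.2 c d h' e.1 e.2
    exact Or.inl ⟨le_rfl, le_rfl⟩
  · exact Or.inr e

/-- An inner bracket lies in an argument of the operation, and arguments are minimal outer brackets.
So no outer bracket can lie properly inside an inner one. -/
lemma In.laminar_out {a b c d : Fin n} (h : T.In a b) (h' : T.Out c d) :
    (c ≤ a ∧ b ≤ d) ∨ b < c ∨ d < a := by
  obtain ⟨x, y, hxy, hxa, hby⟩ := h.exists_min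
  rcases hxy.laminar h' with e | e | e
  · exact Or.inl ⟨e.1.trans hxa, hby.trans e.2⟩
  · exact Or.inr (Or.inl (hby.trans_lt e))
  · exact Or.inr (Or.inr (e.trans_le hxa))

variable (T) in
lemma exists_univ [NeZero n] : ∃ m, T.Out 0 m ∧ ∀ i, i ≤ m := by
  refine ⟨⊤, ⟨bot_le, ?_⟩, fun i => le_top⟩
  have : Finset.Icc (0 : Fin n) ⊤ = Finset.univ := by
    ext i
    simp
  rw [this]
  exact T.univ_mem

/-- A painted bracketing is given by families of intervals. -/
def ofIntervals [NeZero n] (In Out : Fin n → Fin n → Prop) (hIn : ∀ a b, In a b → a < b)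
    (lamIn : ∀ a b c d, In a b → In c d →
      (c ≤ a ∧ b ≤ d) ∨ (a ≤ c ∧ d ≤ b) ∨ b < c ∨ d < a)
    (lamOut : ∀ a b c d, a ≤ b → c ≤ d → Out a b → Out c d →
      (c ≤ a ∧ b ≤ d) ∨ (a ≤ c ∧ d ≤ b) ∨ b < c ∨ d < a)
    (huniv : Out 0 ⊤)
    (hcover : ∀ i, ∃ a b, (Out a b ∧ ∀ c d, c ≤ d → Out c d → a ≤ c → d ≤ b → c = a ∧ d = b) ∧
      a ≤ i ∧ i ≤ b)
    (hle : ∀ c d, In c d → ∃ a b,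
      (Out a b ∧ ∀ c d, c ≤ d → Out c d → a ≤ c → d ≤ b → c = a ∧ d = b) ∧ a ≤ c ∧ d ≤ b) :
    PaintedBracketing n :=
  have hlam : ∀ a b c d : Fin n, a ≤ b → c ≤ d →
      ((c ≤ a ∧ b ≤ d) ∨ (a ≤ c ∧ d ≤ b) ∨ b < c ∨ d < a) →
      Finset.Icc a b ⊆ Finset.Icc c d ∨ Finset.Icc c d ⊆ Finset.Icc a b ∨
        Disjoint (Finset.Icc a b) (Finset.Icc c d) := by
    intro a b c d hab hcd h
    rcases h with e | e | e
    · exact Or.inl ((Finset.Icc_subset_Icc_iff hab).2 e)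
    · exact Or.inr (Or.inl ((Finset.Icc_subset_Icc_iff hcd).2 e))
    · refine Or.inr (Or.inr (Finset.disjoint_left.2 fun x hx hy => ?_))
      rw [Finset.mem_Icc] at hx hy
      rcases e with e | e <;> order
  have hmin : ∀ a b : Fin n, a ≤ b →
      (Out a b ∧ ∀ c d, c ≤ d → Out c d → a ≤ c → d ≤ b → c = a ∧ d = b) →
      ∀ J : Finset (Fin n), (∃ c d, c ≤ d ∧ Out c d ∧ J = Finset.Icc c d) →
        J ≤ Finset.Icc a b → Finset.Icc a b ≤ J := by
    rintro a b hab ⟨-, h⟩ _ ⟨c, d, hcd, hO, rfl⟩ hsub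
    have h1 := (Finset.Icc_subset_Icc_iff hcd).1 hsub
    obtain ⟨rfl, rfl⟩ := h c d hcd hO h1.1 h1.2
    exact le_rfl
  by
  classical
  exact
  { inner := Finset.univ.filter fun I => ∃ a b, In a b ∧ I = Finset.Icc a b
    outer := Finset.univ.filter fun J => ∃ a b, a ≤ b ∧ Out a b ∧ J = Finset.Icc a b
    inner_word := by
      intro I hI
      obtain ⟨a, b, h, rfl⟩ := (Finset.mem_filter.1 hI).2
      refine ⟨isWord_Icc (hIn a b h).le, ?_⟩
      exact Finset.one_lt_card.2 ⟨a, Finset.left_mem_Icc.2 (hIn a b h).le, b,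
        Finset.right_mem_Icc.2 (hIn a b h).le, (hIn a b h).ne⟩
    inner_laminar := by
      intro I hI J hJ
      obtain ⟨a, b, h, rfl⟩ := (Finset.mem_filter.1 hI).2
      obtain ⟨c, d, h', rfl⟩ := (Finset.mem_filter.1 hJ).2
      exact hlam a b c d (hIn _ _ h).le (hIn _ _ h').le (lamIn a b c d h h')
    outer_word := by
      intro J hJ
      obtain ⟨a, b, hab, h, rfl⟩ := (Finset.mem_filter.1 hJ).2
      exact isWord_Icc hab
    outer_laminar := by
      intro I hI J hJ
      obtain ⟨a, b, hab, h, rfl⟩ := (Finset.mem_filter.1 hI).2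
      obtain ⟨c, d, hcd, h', rfl⟩ := (Finset.mem_filter.1 hJ).2
      exact hlam a b c d hab hcd (lamOut a b c d hab hcd h h')
    univ_mem := by
      refine Finset.mem_filter.2 ⟨Finset.mem_univ _, 0, ⊤, bot_le, huniv, ?_⟩
      ext i
      simp
    cover := by
      intro i
      obtain ⟨a, b, h, hai, hib⟩ := hcover i
      have hab := hai.trans hib
      refine ⟨Finset.Icc a b, ⟨Finset.mem_filter.2 ⟨Finset.mem_univ _, a, b, hab, h.1, rfl⟩,
        fun J hJ hle => ?_⟩, Finset.mem_Icc.2 ⟨hai, hib⟩⟩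
      exact hmin a b hab h J (Finset.mem_filter.1 hJ).2 hle
    inner_le := by
      intro I hI
      obtain ⟨c, d, hcd, rfl⟩ := (Finset.mem_filter.1 hI).2
      obtain ⟨a, b, h, hac, hdb⟩ := hle c d hcd
      have hab := hac.trans ((hIn c d hcd).le.trans hdb)
      refine ⟨Finset.Icc a b, ⟨Finset.mem_filter.2 ⟨Finset.mem_univ _, a, b, hab, h.1, rfl⟩,
        fun J hJ hle => ?_⟩, Finset.Icc_subset_Icc hac hdb⟩
      exact hmin a b hab h J (Finset.mem_filter.1 hJ).2 hle }

section ofIntervals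

variable [NeZero n] {In Out : Fin n → Fin n → Prop} (hIn : ∀ a b, In a b → a < b)
    (lamIn : ∀ a b c d, In a b → In c d →
      (c ≤ a ∧ b ≤ d) ∨ (a ≤ c ∧ d ≤ b) ∨ b < c ∨ d < a)
    (lamOut : ∀ a b c d, a ≤ b → c ≤ d → Out a b → Out c d →
      (c ≤ a ∧ b ≤ d) ∨ (a ≤ c ∧ d ≤ b) ∨ b < c ∨ d < a)
    (huniv : Out 0 ⊤)
    (hcover : ∀ i, ∃ a b, (Out a b ∧ ∀ c d, c ≤ d → Out c d → a ≤ c → d ≤ b → c = a ∧ d = b) ∧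
      a ≤ i ∧ i ≤ b)
    (hle : ∀ c d, In c d → ∃ a b,
      (Out a b ∧ ∀ c d, c ≤ d → Out c d → a ≤ c → d ≤ b → c = a ∧ d = b) ∧ a ≤ c ∧ d ≤ b)

lemma in_ofIntervals (a b : Fin n) :
    (ofIntervals In Out hIn lamIn lamOut huniv hcover hle).In a b ↔ In a b := by
  unfold PaintedBracketing.In ofIntervals
  simp only [Finset.mem_filter, Finset.mem_univ, true_and]
  constructor
  · rintro ⟨c, d, h, e⟩
    have hab : a ≤ b := by
      rw [← Finset.nonempty_Icc, e, Finset.nonempty_Icc]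
      exact (hIn _ _ h).le
    obtain ⟨rfl, rfl⟩ := Icc_inj_of_le hab (hIn _ _ h).le e
    exact h
  · exact fun h => ⟨a, b, h, rfl⟩

lemma out_ofIntervals (a b : Fin n) :
    (ofIntervals In Out hIn lamIn lamOut huniv hcover hle).Out a b ↔ a ≤ b ∧ Out a b := by
  unfold PaintedBracketing.Out ofIntervals
  simp only [Finset.mem_filter, Finset.mem_univ, true_and]
  refine and_congr_right fun hab => ⟨?_, fun h => ⟨a, b, hab, h, rfl⟩⟩
  rintro ⟨c, d, hcd, h, e⟩
  obtain ⟨rfl, rfl⟩ := Icc_inj_of_le hab hcd e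
  exact h

end ofIntervals

lemma le_iff_in_out (T T' : PaintedBracketing n) :
    T ≤ T' ↔ (∀ a b, T'.In a b → T.In a b) ∧ ∀ a b, T'.Out a b → T.Out a b := by
  have h0 : T ≤ T' ↔ T'.inner ⊆ T.inner ∧ T'.outer ⊆ T.outer := Iff.rfl
  rw [h0]
  constructor
  · exact fun h => ⟨fun a b hab => h.1 hab, fun a b hab => ⟨hab.1, h.2 hab.2⟩⟩
  · refine fun h => ⟨fun I hI => ?_, fun J hJ => ?_⟩
    · obtain ⟨a, b, -, rfl⟩ := (T'.inner_word _ hI).1.exists_eq_Icc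
      exact h.1 a b hI
    · obtain ⟨a, b, hab, rfl⟩ := (T'.outer_word _ hJ).exists_eq_Icc
      exact (h.2 a b ⟨hab, hJ⟩).2

/-! ### The gaps that dominate an interval -/

variable (T)

/-- The gap to the left of `k` is one of those at which the smallest bracket containing `i`
and `j` is divided. -/
def GapDom (i j k : Fin n) : Prop :=
  i < k ∧ k ≤ j ∧ ∀ a b, T.In a b ∨ T.Out a b → a < k → k ≤ b → a ≤ i ∧ j ≤ b

/-- The same with the seam, which is represented by `0`, taken into account. -/
def SeamDom [NeZero n] (i j k : Fin n) : Prop :=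
  (k = 0 ∧ ∀ a b, T.Out a b → (a ≤ i ∧ i ≤ b) ∨ (a ≤ j ∧ j ≤ b) → a ≤ i ∧ j ≤ b) ∨
    (T.GapDom i j k ∧ ∀ a b, T.In a b → ¬ (a ≤ i ∧ j ≤ b))

variable {T}

lemma laminar_of_inter {a b c d m : Fin n} (h : T.In a b ∨ T.Out a b) (h' : T.In c d ∨ T.Out c d)
    (hm : a ≤ m ∧ m ≤ b) (hm' : c ≤ m ∧ m ≤ d) : (c ≤ a ∧ b ≤ d) ∨ (a ≤ c ∧ d ≤ b) := by
  rcases h with h | h <;> rcases h' with h' | h'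
  · rcases h.laminar h' with e | e | e | e
    · exact Or.inl e
    · exact Or.inr e
    · order
    · order
  · rcases h.laminar_out h' with e | e | e
    · exact Or.inl e
    · order
    · order
  · rcases h'.laminar_out h with e | e | e
    · exact Or.inr e
    · order
    · order
  · rcases h.laminar h' with e | e | e | e
    · exact Or.inl e
    · exact Or.inr e
    · order
    · order

/-- Otherwise every gap between `i` and `j` lies in a bracket that does not contain both. Let `m` be
the last variable reached from `i` by brackets that miss `j`. The bracket around the gap after `m`
contains `i` by laminarity, misses `j`, and reaches further than `m`. -/
lemma exists_gapDom {i j : Fin n} (hij : i < j) : ∃ k, T.GapDom i j k := by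
  classical
  by_contra hcon
  push Not at hcon
  have hbr : ∀ k, i < k → k ≤ j → ∃ a b, (T.In a b ∨ T.Out a b) ∧ a < k ∧ k ≤ b ∧
      ¬ (a ≤ i ∧ j ≤ b) := by
    intro k hik hkj
    have := hcon k
    unfold GapDom at this
    push Not at this
    obtain ⟨a, b, h1, h2, h3, h4⟩ := this hik hkj
    exact ⟨a, b, h1, h2, h3, fun h => absurd h.2 (not_le_of_gt (h4 h.1))⟩
  -- the largest right end of a bracket that contains `i` but not `j`
  let R : Finset (Fin n) := Finset.univ.filter fun b => b < j ∧ i ≤ b ∧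
    (b = i ∨ ∃ a, (T.In a b ∨ T.Out a b) ∧ a ≤ i)
  have hR : R.Nonempty := ⟨i, by simp [R, hij]⟩
  obtain ⟨m, hmR, hmax⟩ := R.exists_maximal hR
  simp only [R, Finset.mem_filter, Finset.mem_univ, true_and] at hmR
  obtain ⟨hmj, him, hm⟩ := hmR
  -- the gap following `m`
  obtain ⟨k, hmk, hk⟩ : ∃ k, m < k ∧ ∀ l, m < l → k ≤ l := by
    let U : Finset (Fin n) := Finset.univ.filter fun l => m < l
    have hU : U.Nonempty := ⟨j, by simp [U, hmj]⟩
    exact ⟨U.min' hU, (Finset.mem_filter.1 (U.min'_mem hU)).2,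
      fun l hl => U.min'_le l (by simp [U, hl])⟩
  obtain ⟨a, b, hab, hak, hkb, hnot⟩ := hbr k (him.trans_lt hmk) (hk j hmj)
  have ham : a ≤ m := by
    by_contra h
    exact absurd (hk a (not_le.1 h)) (not_le_of_gt hak)
  have hai : a ≤ i := by
    rcases hm with rfl | ⟨c, hc, hci⟩
    · exact ham
    · rcases laminar_of_inter hab hc (m := m) ⟨ham, hmk.le.trans hkb⟩ ⟨hci.trans him, le_rfl⟩
        with e | e
      · exact absurd e.2 (not_le_of_gt (hmk.trans_le hkb))
      · exact e.1.trans hci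
  have hbj : b < j := by
    by_contra h
    exact hnot ⟨hai, not_lt.1 h⟩
  have hbR : b ∈ R := by
    simp only [R, Finset.mem_filter, Finset.mem_univ, true_and]
    exact ⟨hbj, him.trans (hmk.le.trans hkb), Or.inr ⟨a, hab, hai⟩⟩
  have := hmax hbR (hmk.le.trans hkb)
  order

/-- The interval from `i` to `j` lies in the argument of one copy of the operation. -/
def SameArg (T : PaintedBracketing n) (i j : Fin n) : Prop := ∃ a b, T.Min a b ∧ a ≤ i ∧ j ≤ b

lemma sameArg_iff {i j : Fin n} (hij : i ≤ j) : T.SameArg i j ↔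
    ∀ a b, T.Out a b → (a ≤ i ∧ i ≤ b) ∨ (a ≤ j ∧ j ≤ b) → a ≤ i ∧ j ≤ b := by
  constructor
  · rintro ⟨a, b, hab, hai, hjb⟩ c d hcd h
    rcases hab.laminar hcd with e | e | e
    · exact ⟨e.1.trans hai, hjb.trans e.2⟩
    · rcases h with h | h <;> order
    · rcases h with h | h <;> order
  · intro h
    obtain ⟨a, b, hab, hai, hib⟩ := T.exists_min i
    exact ⟨a, b, hab, h a b hab.1 (Or.inl ⟨hai, hib⟩)⟩

lemma seamDom_zero_iff [NeZero n] {i j : Fin n} (hij : i < j) :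
    T.SeamDom i j 0 ↔ T.SameArg i j := by
  rw [sameArg_iff hij.le]
  constructor
  · rintro (h | h)
    · exact h.2
    · exact absurd h.1.1 (not_lt_of_ge (Fin.zero_le i))
  · exact fun h => Or.inl ⟨rfl, h⟩

lemma exists_seamDom [NeZero n] {i j : Fin n} (hij : i < j) : ∃ k, T.SeamDom i j k := by
  by_cases h : T.SameArg i j
  · exact ⟨0, (seamDom_zero_iff hij).2 h⟩
  · obtain ⟨k, hk⟩ := exists_gapDom (T := T) hij
    refine ⟨k, Or.inr ⟨hk, fun a b hab hh => h ?_⟩⟩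
    obtain ⟨c, d, hcd, hca, hbd⟩ := hab.exists_min
    exact ⟨c, d, hcd, hca.trans hh.1, hh.2.trans hbd⟩

/-! ### Weights -/

variable (T) in
/-- The gap to the left of `k` lies in the argument of one copy of the operation. -/
def GapInArg (k : Fin n) : Prop := ∃ a b, T.Min a b ∧ a < k ∧ k ≤ b

open Classical in
variable (T) in
/-- A weight function on the gaps for which the dominating gaps are those of maximal weight. -/
def weight [NeZero n] (k : Fin n) : ℝ :=
  -- The weight acts like the exponent of a distance in a large parameter. Inside an argument each
  -- surrounding inner bracket lowers it below the level `0` of the seam; elsewhere each outer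
  -- bracket that does not surround the gap raises it above that level.
  if k = 0 then 0
  else if T.GapInArg k then
    -((Finset.univ.filter fun q : Fin n × Fin n => T.In q.1 q.2 ∧ q.1 < k ∧ k ≤ q.2).card : ℝ)
  else ((Finset.univ.filter fun q : Fin n × Fin n =>
    T.Out q.1 q.2 ∧ ¬ (q.1 < k ∧ k ≤ q.2)).card : ℝ)

lemma weight_of_gapInArg [NeZero n] {k : Fin n} (h : T.GapInArg k) : T.weight k ≤ 0 ∧
    (T.weight k = 0 → ∀ a b, T.In a b → ¬ (a < k ∧ k ≤ b)) := by
  classical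
  obtain ⟨x, y, -, hxk, -⟩ := id h
  have hk0 : k ≠ 0 := (lt_of_le_of_lt (Fin.zero_le x) hxk).ne'
  unfold weight
  rw [if_neg hk0, if_pos h]
  refine ⟨by simp, fun h0 a b hab hk => ?_⟩
  rw [neg_eq_zero, Nat.cast_eq_zero, Finset.card_eq_zero] at h0
  exact Finset.notMem_empty (a, b) (h0 ▸ Finset.mem_filter.2 ⟨Finset.mem_univ _, hab, hk⟩)

lemma weight_pos [NeZero n] {k : Fin n} (hk0 : k ≠ 0) (h : ¬ T.GapInArg k) :
    0 < T.weight k := by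
  classical
  unfold weight
  rw [if_neg hk0, if_neg h, Nat.cast_pos, Finset.card_pos]
  obtain ⟨a, b, hab, -⟩ := T.exists_min k
  exact ⟨(a, b), Finset.mem_filter.2 ⟨Finset.mem_univ _, hab.1, fun hk => h ⟨a, b, hab, hk⟩⟩⟩

/-- Every bracket around a dominating gap `k` contains `i` and `j`, hence surrounds each gap `l`
between them. So the brackets counted for the two gaps are comparable by inclusion, and equal counts
mean equal sets, which makes `l` dominating as well. -/
lemma GapDom.weight_le [NeZero n] {i j k l : Fin n} (hk : T.GapDom i j k) (hil : i < l)
    (hlj : l ≤ j) : T.weight l ≤ T.weight k ∧ (T.weight l = T.weight k → T.GapDom i j l) := by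
  classical
  have hk0 : k ≠ 0 := (lt_of_le_of_lt (Fin.zero_le i) hk.1).ne'
  have hl0 : l ≠ 0 := (lt_of_le_of_lt (Fin.zero_le i) hil).ne'
  by_cases hl : T.GapInArg l
  · obtain ⟨a, b, hab, hal, hlb⟩ := id hl
    by_cases hkA : T.GapInArg k
    · obtain ⟨c, d, hcd, hck, hkd⟩ := id hkA
      have hc := hk.2.2 c d (Or.inr hcd.1) hck hkd
      have hsub : (Finset.univ.filter fun q : Fin n × Fin n => T.In q.1 q.2 ∧ q.1 < k ∧ k ≤ q.2) ⊆
          (Finset.univ.filter fun q : Fin n × Fin n => T.In q.1 q.2 ∧ q.1 < l ∧ l ≤ q.2) := by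
        intro q hq
        obtain ⟨-, hq1, hq2, hq3⟩ := Finset.mem_filter.1 hq
        have := hk.2.2 _ _ (Or.inl hq1) hq2 hq3
        exact Finset.mem_filter.2 ⟨Finset.mem_univ _, hq1, this.1.trans_lt hil, hlj.trans this.2⟩
      unfold weight
      rw [if_neg hk0, if_neg hl0, if_pos hl, if_pos hkA]
      refine ⟨neg_le_neg (Nat.cast_le.2 (Finset.card_le_card hsub)), fun he => ?_⟩
      rw [neg_inj, Nat.cast_inj] at he
      have heq := Finset.eq_of_subset_of_card_le hsub he.le
      refine ⟨hil, hlj, fun x y hxy hxl hly => ?_⟩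
      rcases hxy with hxy | hxy
      · have : (x, y) ∈ (Finset.univ.filter fun q : Fin n × Fin n =>
            T.In q.1 q.2 ∧ q.1 < k ∧ k ≤ q.2) :=
          heq ▸ Finset.mem_filter.2 ⟨Finset.mem_univ _, hxy, hxl, hly⟩
        obtain ⟨-, -, h1, h2⟩ := Finset.mem_filter.1 this
        exact hk.2.2 x y (Or.inl hxy) h1 h2
      · rcases hcd.laminar hxy with e | e | e
        · exact ⟨e.1.trans hc.1, hc.2.trans e.2⟩
        · order
        · order
    · have h1 := (weight_of_gapInArg hl).1
      have h2 := weight_pos hk0 hkA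
      exact ⟨by linarith, fun he => by linarith⟩
  · by_cases hkA : T.GapInArg k
    · obtain ⟨c, d, hcd, hck, hkd⟩ := id hkA
      have hc := hk.2.2 c d (Or.inr hcd.1) hck hkd
      exact absurd ⟨c, d, hcd, hc.1.trans_lt hil, hlj.trans hc.2⟩ hl
    · have hsub : (Finset.univ.filter fun q : Fin n × Fin n =>
            T.Out q.1 q.2 ∧ ¬ (q.1 < l ∧ l ≤ q.2)) ⊆
          (Finset.univ.filter fun q : Fin n × Fin n =>
            T.Out q.1 q.2 ∧ ¬ (q.1 < k ∧ k ≤ q.2)) := by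
        intro q hq
        obtain ⟨-, hq1, hq2⟩ := Finset.mem_filter.1 hq
        refine Finset.mem_filter.2 ⟨Finset.mem_univ _, hq1, fun hq3 => hq2 ?_⟩
        have := hk.2.2 _ _ (Or.inr hq1) hq3.1 hq3.2
        exact ⟨this.1.trans_lt hil, hlj.trans this.2⟩
      unfold weight
      rw [if_neg hk0, if_neg hl0, if_neg hl, if_neg hkA]
      refine ⟨Nat.cast_le.2 (Finset.card_le_card hsub), fun he => ?_⟩
      rw [Nat.cast_inj] at he
      have heq := Finset.eq_of_subset_of_card_le hsub he.ge
      refine ⟨hil, hlj, fun x y hxy hxl hly => ?_⟩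
      rcases hxy with hxy | hxy
      · obtain ⟨c, d, hcd, hcx, hyd⟩ := hxy.exists_min
        exact absurd ⟨c, d, hcd, hcx.trans_lt hxl, hly.trans hyd⟩ hl
      · by_contra hcon
        have : (x, y) ∈ (Finset.univ.filter fun q : Fin n × Fin n =>
            T.Out q.1 q.2 ∧ ¬ (q.1 < l ∧ l ≤ q.2)) := by
          rw [heq]
          refine Finset.mem_filter.2 ⟨Finset.mem_univ _, hxy, fun h => hcon ?_⟩
          exact hk.2.2 x y (Or.inr hxy) h.1 h.2
        exact (Finset.mem_filter.1 this).2.2 ⟨hxl, hly⟩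

/-- If `i` and `j` lie in one argument, the maximal weight is `0`; it is attained by the seam and by
the gaps in no inner bracket. If not, the dominating gaps lie outside all arguments and have
positive weight, which beats the seam. -/
lemma SeamDom.weight_le [NeZero n] {i j k l : Fin n} (hij : i < j) (hk : T.SeamDom i j k)
    (hl : l = 0 ∨ (i < l ∧ l ≤ j)) :
    T.weight l ≤ T.weight k ∧ (T.weight l = T.weight k → T.SeamDom i j l) := by
  classical
  have hw0 : T.weight 0 = 0 := by simp [weight]
  have hne : ∀ l, i < l → l ≠ 0 := fun l h => (lt_of_le_of_lt (Fin.zero_le i) h).ne'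
  by_cases hs : T.SameArg i j
  · have harg : ∀ l, i < l → l ≤ j → T.GapInArg l := by
      intro l h1 h2
      obtain ⟨a, b, hab, hai, hjb⟩ := hs
      exact ⟨a, b, hab, hai.trans_lt h1, h2.trans hjb⟩
    have hwk : T.weight k = 0 := by
      rcases hk with hk | hk
      · rw [hk.1, hw0]
      · have h1 := weight_of_gapInArg (harg k hk.1.1 hk.1.2.1)
        refine le_antisymm h1.1 ?_
        have hka := harg k hk.1.1 hk.1.2.1
        unfold weight
        rw [if_neg (hne k hk.1.1), if_pos hka]
        rw [Finset.card_eq_zero.2]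
        · simp
        · refine Finset.filter_eq_empty_iff.2 ?_
          rintro ⟨a, b⟩ - ⟨h2, h3, h4⟩
          exact hk.2 a b h2 (hk.1.2.2 a b (Or.inl h2) h3 h4)
    rcases hl with rfl | ⟨hil, hlj⟩
    · exact ⟨by rw [hw0, hwk], fun _ => (seamDom_zero_iff hij).2 hs⟩
    · have h1 := weight_of_gapInArg (harg l hil hlj)
      rw [hwk]
      refine ⟨h1.1, fun h0 => Or.inr ⟨⟨hil, hlj, fun a b hab hal hlb => ?_⟩,
        fun a b hab hh => ?_⟩⟩
      · rcases hab with hab | hab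
        · exact absurd ⟨hal, hlb⟩ (h1.2 h0 a b hab)
        · obtain ⟨c, d, hcd, hci, hjd⟩ := hs
          rcases hcd.laminar hab with e | e | e
          · exact ⟨e.1.trans hci, hjd.trans e.2⟩
          · order
          · order
      · exact h1.2 h0 a b hab ⟨hh.1.trans_lt hil, hlj.trans hh.2⟩
  · have hkg : T.GapDom i j k := by
      rcases hk with hk | hk
      · exact absurd ((sameArg_iff hij.le).2 hk.2) hs
      · exact hk.1
    have hin : ∀ a b, T.In a b → ¬ (a ≤ i ∧ j ≤ b) := by
      intro a b hab hh
      obtain ⟨c, d, hcd, hca, hbd⟩ := hab.exists_min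
      exact hs ⟨c, d, hcd, hca.trans hh.1, hh.2.trans hbd⟩
    rcases hl with rfl | ⟨hil, hlj⟩
    · have hkA : ¬ T.GapInArg k := by
        rintro ⟨a, b, hab, hak, hkb⟩
        exact hs ⟨a, b, hab, hkg.2.2 a b (Or.inr hab.1) hak hkb⟩
      have := weight_pos (hne k hkg.1) hkA
      rw [hw0]
      exact ⟨this.le, fun h => absurd h this.ne⟩
    · have h1 := hkg.weight_le hil hlj
      exact ⟨h1.1, fun h => Or.inr ⟨h1.2 h, hin⟩⟩

/-! ### Brackets in terms of dominating gaps -/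

/-- As soon as an interval sticks out of a bracket `[a, b]`, neither the gaps inside the bracket nor
the seam dominate. Conversely consider the smallest outer bracket around `a` and `b`. If it were
larger than `[a, b]`, what dominates for `(a, b)` would still dominate for an extended interval: the
seam if `[a, b]` lies in an argument, a gap otherwise. -/
lemma out_iff [NeZero n] {a b : Fin n} (hab : a ≤ b) : T.Out a b ↔
    (∀ i < a, ∀ k, k = 0 ∨ (a < k ∧ k ≤ b) → ¬ T.SeamDom i b k) ∧
    ∀ j, b < j → ∀ k, k = 0 ∨ (a < k ∧ k ≤ b) → ¬ T.SeamDom a j k := by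
  constructor
  · intro h
    constructor
    · rintro i hia k hk (hd | hd)
      · have := hd.2 a b h (Or.inr ⟨hab, le_rfl⟩)
        order
      · rcases hk with rfl | hk
        · exact absurd hd.1.1 (not_lt_of_ge (Fin.zero_le i))
        · have := hd.1.2.2 a b (Or.inr h) hk.1 hk.2
          order
    · rintro j hbj k hk (hd | hd)
      · have := hd.2 a b h (Or.inl ⟨le_rfl, hab⟩)
        order
      · rcases hk with rfl | hk
        · exact absurd hd.1.1 (not_lt_of_ge (Fin.zero_le a))
        · have := hd.1.2.2 a b (Or.inr h) hk.1 hk.2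
          order
  · rintro ⟨hL, hR⟩
    obtain ⟨c, d, hcd, hca, had⟩ := T.exists_min a
    by_cases hbd : b ≤ d
    · have h1 : c = a := by
        by_contra hne
        have hlt : c < a := lt_of_le_of_ne hca hne
        exact hL c hlt 0 (Or.inl rfl)
          ((seamDom_zero_iff (hlt.trans_le hab)).2 ⟨c, d, hcd, le_rfl, hbd⟩)
      subst h1
      have h2 : d = b := by
        by_contra hne
        have hlt : b < d := lt_of_le_of_ne hbd (Ne.symm hne)
        exact hR d hlt 0 (Or.inl rfl)
          ((seamDom_zero_iff (hab.trans_lt hlt)).2 ⟨c, d, hcd, le_rfl, le_rfl⟩)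
      subst h2
      exact hcd.1
    · have hlt : a < b := by order
      have hns : ¬ T.SameArg a b := by
        rintro ⟨x, y, hxy, hxa, hby⟩
        rcases hcd.laminar hxy.1 with e | e | e
        · have := hxy.2 c d hcd.1 e.1 e.2
          order
        · order
        · order
      obtain ⟨k, hk⟩ := exists_gapDom (T := T) hlt
      -- the smallest outer bracket that contains `a` and `b`
      obtain ⟨x, y, hxy, hxa, hby, hmin⟩ : ∃ x y, T.Out x y ∧ x ≤ a ∧ b ≤ y ∧
          ∀ x' y', T.Out x' y' → x' ≤ a → b ≤ y' → x' ≤ x ∧ y ≤ y' := by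
        classical
        let U : Finset (Finset (Fin n)) := T.outer.filter fun J => a ∈ J ∧ b ∈ J
        have hU : U.Nonempty := ⟨Finset.univ, by simp [U, T.univ_mem]⟩
        obtain ⟨J, hJ, hJm⟩ := U.exists_minimal hU
        obtain ⟨hJo, haJ, hbJ⟩ := Finset.mem_filter.1 hJ
        obtain ⟨x, y, hxy, rfl⟩ := (T.outer_word J hJo).exists_eq_Icc
        rw [Finset.mem_Icc] at haJ hbJ
        refine ⟨x, y, ⟨hxy, hJo⟩, haJ.1, hbJ.2, fun x' y' h' hxa' hby' => ?_⟩
        have hO : T.Out x y := ⟨hxy, hJo⟩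
        rcases hO.laminar h' with e | e | e | e
        · exact e
        · have h3 : Finset.Icc x' y' ∈ U := Finset.mem_filter.2 ⟨h'.2,
            Finset.mem_Icc.2 ⟨hxa', hab.trans hby'⟩, Finset.mem_Icc.2 ⟨hxa'.trans hab, hby'⟩⟩
          have h4 := hJm h3 ((Finset.Icc_subset_Icc_iff h'.1).2 e)
          exact (Finset.Icc_subset_Icc_iff hxy).1 h4
        · order
        · order
      have hdom : ∀ i j, x ≤ i → i ≤ a → b ≤ j → j ≤ y → T.SeamDom i j k := by
        intro i j hxi hia hbj hjy
        have hnin : ∀ p q, T.In p q → ¬ (p ≤ a ∧ b ≤ q) := by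
          intro p q hpq hh
          obtain ⟨u, v, huv, hup, hqv⟩ := hpq.exists_min
          exact hns ⟨u, v, huv, hup.trans hh.1, hh.2.trans hqv⟩
        refine Or.inr ⟨⟨hia.trans_lt hk.1, hk.2.1.trans hbj, fun p q hpq hpk hkq => ?_⟩,
          fun p q hpq hh => hnin p q hpq ⟨hh.1.trans hia, hbj.trans hh.2⟩⟩
        have h1 := hk.2.2 p q hpq hpk hkq
        rcases hpq with hpq | hpq
        · exact absurd h1 (hnin p q hpq)
        · have := hmin p q hpq h1.1 h1.2
          exact ⟨this.1.trans hxi, hjy.trans this.2⟩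
      have h1 : x = a := by
        by_contra hne
        exact hL x (lt_of_le_of_ne hxa hne) k (Or.inr ⟨hk.1, hk.2.1⟩)
          (hdom x b le_rfl hxa le_rfl hby)
      subst h1
      have h2 : y = b := by
        by_contra hne
        exact hR y (lt_of_le_of_ne hby (Ne.symm hne)) k (Or.inr ⟨hk.1, hk.2.1⟩)
          (hdom x y le_rfl le_rfl hby le_rfl)
      subst h2
      exact hxy

/-- The last condition says that the gaps of `[a, b]` are negligible against the seam, that is, some
inner bracket contains `[a, b]`. The smallest such bracket must be `[a, b]`, because a gap
dominating for `(a, b)` dominates for all larger intervals inside it. -/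
lemma in_iff [NeZero n] {a b : Fin n} (hab : a < b) : T.In a b ↔
    (∀ i < a, ∀ k, a < k → k ≤ b → ¬ T.GapDom i b k) ∧
    (∀ j, b < j → ∀ k, a < k → k ≤ b → ¬ T.GapDom a j k) ∧
    ∀ k, a < k → k ≤ b → ¬ T.SeamDom a b k := by
  constructor
  · intro h
    refine ⟨fun i hia k hak hkb hd => ?_, fun j hbj k hak hkb hd => ?_, fun k hak hkb hd => ?_⟩
    · have := hd.2.2 a b (Or.inl h) hak hkb
      order
    · have := hd.2.2 a b (Or.inl h) hak hkb
      order
    · rcases hd with hd | hd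
      · exact absurd hak (hd.1 ▸ not_lt_of_ge (Fin.zero_le a))
      · exact hd.2 a b h ⟨le_rfl, le_rfl⟩
  · rintro ⟨hL, hR, hS⟩
    obtain ⟨k, hk⟩ := exists_gapDom (T := T) hab
    have hin : ∃ x y, T.In x y ∧ x ≤ a ∧ b ≤ y := by
      by_contra hcon
      push Not at hcon
      exact hS k hk.1 hk.2.1 (Or.inr ⟨hk, fun p q hpq hh =>
        absurd hh.2 (not_le_of_gt (hcon p q hpq hh.1))⟩)
    obtain ⟨x, y, hxy, hxa, hby, hmin⟩ : ∃ x y, T.In x y ∧ x ≤ a ∧ b ≤ y ∧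
        ∀ x' y', T.In x' y' → x' ≤ a → b ≤ y' → x' ≤ x ∧ y ≤ y' := by
      classical
      let U : Finset (Finset (Fin n)) := T.inner.filter fun J => a ∈ J ∧ b ∈ J
      have hU : U.Nonempty := by
        obtain ⟨x, y, hxy, hxa, hby⟩ := hin
        exact ⟨Finset.Icc x y, Finset.mem_filter.2 ⟨hxy, Finset.mem_Icc.2 ⟨hxa, hab.le.trans hby⟩,
          Finset.mem_Icc.2 ⟨hxa.trans hab.le, hby⟩⟩⟩
      obtain ⟨J, hJ, hJm⟩ := U.exists_minimal hU
      obtain ⟨hJo, haJ, hbJ⟩ := Finset.mem_filter.1 hJ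
      obtain ⟨x, y, hxy, rfl⟩ := (T.inner_word J hJo).1.exists_eq_Icc
      rw [Finset.mem_Icc] at haJ hbJ
      refine ⟨x, y, hJo, haJ.1, hbJ.2, fun x' y' h' hxa' hby' => ?_⟩
      have hO : T.In x y := hJo
      rcases hO.laminar h' with e | e | e | e
      · exact e
      · have h3 : Finset.Icc x' y' ∈ U := Finset.mem_filter.2 ⟨h',
          Finset.mem_Icc.2 ⟨hxa', hab.le.trans hby'⟩, Finset.mem_Icc.2 ⟨hxa'.trans hab.le, hby'⟩⟩
        have h4 := hJm h3 ((Finset.Icc_subset_Icc_iff h'.lt.le).2 e)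
        exact (Finset.Icc_subset_Icc_iff hxy).1 h4
      · order
      · order
    have hdom : ∀ i j, x ≤ i → i ≤ a → b ≤ j → j ≤ y → T.GapDom i j k := by
      intro i j hxi hia hbj hjy
      refine ⟨hia.trans_lt hk.1, hk.2.1.trans hbj, fun p q hpq hpk hkq => ?_⟩
      have h1 := hk.2.2 p q hpq hpk hkq
      rcases hpq with hpq | hpq
      · have := hmin p q hpq h1.1 h1.2
        exact ⟨this.1.trans hxi, hjy.trans this.2⟩
      · rcases hxy.laminar_out hpq with e | e | e
        · exact ⟨e.1.trans hxi, hjy.trans e.2⟩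
        · order
        · order
    have h1 : x = a := by
      by_contra hne
      exact hL x (lt_of_le_of_ne hxa hne) k hk.1 hk.2.1 (hdom x b le_rfl hxa le_rfl hby)
    subst h1
    have h2 : y = b := by
      by_contra hne
      exact hR y (lt_of_le_of_ne hby (Ne.symm hne)) k hk.1 hk.2.1
        (hdom x y le_rfl le_rfl hby le_rfl)
    subst h2
    exact hxy

/-- Dominance is a condition on all brackets, so removing brackets enlarges the dominating sets.
Conversely `in_iff` and `out_iff` describe brackets by the absence of dominating gaps. -/
lemma le_iff_dom [NeZero n] (T T' : PaintedBracketing n) : T ≤ T' ↔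
    (∀ i j k, i < j → T.GapDom i j k → T'.GapDom i j k) ∧
      ∀ i j k, i < j → T.SeamDom i j k → T'.SeamDom i j k := by
  rw [le_iff_in_out]
  constructor
  · rintro ⟨hIn, hOut⟩
    have h1 : ∀ i j k, T.GapDom i j k → T'.GapDom i j k := fun i j k h =>
      ⟨h.1, h.2.1, fun a b hab => h.2.2 a b (hab.imp (hIn a b) (hOut a b))⟩
    refine ⟨fun i j k _ => h1 i j k, fun i j k _ h => ?_⟩
    rcases h with h | h
    · exact Or.inl ⟨h.1, fun a b hab => h.2 a b (hOut a b hab)⟩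
    · exact Or.inr ⟨h1 i j k h.1, fun a b hab => h.2 a b (hIn a b hab)⟩
  · rintro ⟨hG, hS⟩
    refine ⟨fun a b hab => ?_, fun a b hab => ?_⟩
    · have h := (in_iff hab.lt).1 hab
      exact (in_iff hab.lt).2 ⟨fun i hi k h1 h2 hd => h.1 i hi k h1 h2 (hG i b k (hi.trans hab.lt) hd),
        fun j hj k h1 h2 hd => h.2.1 j hj k h1 h2 (hG a j k (hab.lt.trans hj) hd),
        fun k h1 h2 hd => h.2.2 k h1 h2 (hS a b k hab.lt hd)⟩
    · have h := (out_iff hab.1).1 hab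
      exact (out_iff hab.1).2 ⟨fun i hi k hk hd => h.1 i hi k hk (hS i b k (hi.trans_le hab.1) hd),
        fun j hj k hk hd => h.2 j hj k hk (hS a j k (hab.1.trans_lt hj) hd)⟩

end PaintedBracketing

/-! ### Painted bracketings from supports -/

/-- The properties of the supports of a compatible family: `s i j` is the support of the
coordinates at the gaps between `i` and `j`, and `t i j` of those at the gaps and the seam. -/
structure SupportSystem {n : ℕ} [NeZero n] (s t : Fin n → Fin n → Fin n → Prop) : Prop where
  s_mem : ∀ i j k, i < j → s i j k → i < k ∧ k ≤ j
  t_mem : ∀ i j k, i < j → t i j k → k = 0 ∨ (i < k ∧ k ≤ j)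
  s_ex : ∀ i j, i < j → ∃ k, s i j k
  t_ex : ∀ i j, i < j → ∃ k, t i j k
  ss : ∀ i j i' j' k l, i ≤ i' → j' ≤ j → i' < k → k ≤ j' → s i j k → i' < l → l ≤ j' →
    (s i' j' l ↔ s i j l)
  ts : ∀ i j i' j' k l, i ≤ i' → j' ≤ j → i' < k → k ≤ j' → t i j k → i' < l → l ≤ j' →
    (s i' j' l ↔ t i j l)
  tt : ∀ i j i' j' k l, i ≤ i' → i' < j' → j' ≤ j → (k = 0 ∨ (i' < k ∧ k ≤ j')) → t i j k →
    (l = 0 ∨ (i' < l ∧ l ≤ j')) → (t i' j' l ↔ t i j l)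

namespace SupportSystem

variable {n : ℕ} [NeZero n] {s t : Fin n → Fin n → Fin n → Prop} (h : SupportSystem s t)

include h

/-- The largest interval that is divided at a given gap. -/
lemma exists_node {k : Fin n} (hk : k ≠ 0) : ∃ a b, a < k ∧ k ≤ b ∧
    ∀ i j, i < k → k ≤ j → (s i j k ↔ a ≤ i ∧ j ≤ b) := by
  classical
  have hk' : 0 < k := lt_of_le_of_ne (Fin.zero_le k) (Ne.symm hk)
  -- The variable `p` is the predecessor of `k`; as `k` is the only gap between them, it is in the
  -- support.
  obtain ⟨p, hpk, hp⟩ : ∃ p, p < k ∧ s p k k := by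
    let U : Finset (Fin n) := Finset.univ.filter fun l => l < k
    have hU : U.Nonempty := ⟨0, by simp [U, hk']⟩
    have hlt : U.max' hU < k := (Finset.mem_filter.1 (U.max'_mem hU)).2
    obtain ⟨l, hl⟩ := h.s_ex _ _ hlt
    have hm := h.s_mem _ _ _ hlt hl
    have : l = k := by
      by_contra hne
      have : l ∈ U := by simp [U, lt_of_le_of_ne hm.2 hne]
      exact absurd (U.le_max' l this) (not_le_of_gt hm.1)
    subst this
    exact ⟨_, hlt, hl⟩
  let U : Finset (Fin n) := Finset.univ.filter fun i => i < k ∧ ∃ j, k ≤ j ∧ s i j k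
  let V : Finset (Fin n) := Finset.univ.filter fun j => k ≤ j ∧ ∃ i, i < k ∧ s i j k
  have hU : U.Nonempty := ⟨p, by simp only [U, Finset.mem_filter, Finset.mem_univ, true_and]
                                 exact ⟨hpk, k, le_rfl, hp⟩⟩
  have hV : V.Nonempty := ⟨k, by simp only [V, Finset.mem_filter, Finset.mem_univ, true_and]
                                 exact ⟨le_rfl, p, hpk, hp⟩⟩
  obtain ⟨-, hak, j1, hj1, hs1⟩ := Finset.mem_filter.1 (U.min'_mem hU)
  obtain ⟨-, hkb, i1, hi1, hs2⟩ := Finset.mem_filter.1 (V.max'_mem hV)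
  set a := U.min' hU with ha
  set b := V.max' hV with hb
  have hmin : ∀ i j, i < k → k ≤ j → s i j k → a ≤ i ∧ j ≤ b := fun i j hi hj hs =>
    ⟨U.min'_le i (by simp only [U, Finset.mem_filter, Finset.mem_univ, true_and]
                     exact ⟨hi, j, hj, hs⟩),
     V.le_max' j (by simp only [V, Finset.mem_filter, Finset.mem_univ, true_and]
                     exact ⟨hj, i, hi, hs⟩)⟩
  have h1 := hmin a j1 hak hj1 hs1
  have h2 := hmin i1 b hi1 hkb hs2
  -- The ends `a` and `b` were chosen separately. A gap in the support for `(a, b)` lies in one of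
  -- the overlapping intervals `[a, j1]` and `[i1, b]`, and the comparison with that interval brings
  -- `k` into the support.
  have hab : s a b k := by
    obtain ⟨l, hl⟩ := h.s_ex a b (hak.trans_le hkb)
    have hm := h.s_mem _ _ _ (hak.trans_le hkb) hl
    by_cases hlj : l ≤ j1
    · exact (h.ss a b a j1 l k le_rfl h1.2 hm.1 hlj hl hak hj1).1 hs1
    · exact (h.ss a b i1 b l k h2.1 le_rfl (by order) hm.2 hl hi1 hkb).1 hs2
  refine ⟨a, b, hak, hkb, fun i j hi hj => ⟨hmin i j hi hj, fun hh => ?_⟩⟩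
  exact (h.ss a b i j k k hh.1 hh.2 hi hj hab hi hj).2 hab

omit h in
/-- The condition for an interval to be an outer bracket. -/
def OutC (t : Fin n → Fin n → Fin n → Prop) (a b : Fin n) : Prop :=
  (∀ i < a, ∀ k, k = 0 ∨ (a < k ∧ k ≤ b) → ¬ t i b k) ∧
    ∀ j, b < j → ∀ k, k = 0 ∨ (a < k ∧ k ≤ b) → ¬ t a j k

omit h [NeZero n] in
/-- The condition for an interval to be an inner bracket. -/
def InC (s t : Fin n → Fin n → Fin n → Prop) (a b : Fin n) : Prop :=
  a < b ∧ (∀ i < a, ∀ k, a < k → k ≤ b → ¬ s i b k) ∧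
    (∀ j, b < j → ∀ k, a < k → k ≤ b → ¬ s a j k) ∧ ∀ k, a < k → k ≤ b → ¬ t a b k

/-- The support for `(i, d)` avoids the gaps of the bracket, so it contains a gap at or to the left
of `c`. This gap survives when the interval is cut off at `m`, so the two supports agree up to `m`,
and the gaps of the bracket stay negligible. -/
lemma bracket_left {c d : Fin n} (hb : InC s t c d ∨ OutC t c d) {i k m : Fin n} (hi : i < c)
    (hk : c < k) (hkm : k ≤ m) (hm : m ≤ d) : ¬ s i m k := by
  have hid : i < d := by order
  have h1 : ∀ l, c < l → l ≤ d → ¬ s i d l := by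
    intro l h1 h2 hs
    rcases hb with hb | hb
    · exact hb.2.1 i hi l h1 h2 hs
    · obtain ⟨l0, hl0⟩ := h.t_ex i d hid
      have hne : ¬ (l0 = 0 ∨ (c < l0 ∧ l0 ≤ d)) := fun hh => hb.1 i hi l0 hh hl0
      have hmem := h.t_mem i d l0 hid hl0
      have hmem' : i < l0 ∧ l0 ≤ d := hmem.resolve_left fun e => hne (Or.inl e)
      have := (h.ts i d i d l0 l le_rfl le_rfl hmem'.1 hmem'.2 hl0 (hi.trans h1) h2).1 hs
      exact hb.1 i hi l (Or.inr ⟨h1, h2⟩) this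
  intro hs
  obtain ⟨l0, hl0⟩ := h.s_ex i d hid
  have hmem := h.s_mem i d l0 hid hl0
  have hl0c : l0 ≤ c := by
    by_contra hh
    exact h1 l0 (not_le.1 hh) hmem.2 hl0
  exact h1 k hk (hkm.trans hm) ((h.ss i d i m l0 k le_rfl hm hmem.1 (by order) hl0
    (hi.trans hk) hkm).1 hs)

lemma bracket_right {c d : Fin n} (hb : InC s t c d ∨ OutC t c d) {j k m : Fin n} (hj : d < j)
    (hk : k ≤ d) (hmk : m < k) (hm : c ≤ m) : ¬ s m j k := by
  have hcj : c < j := by order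
  have h1 : ∀ l, c < l → l ≤ d → ¬ s c j l := by
    intro l h1 h2 hs
    rcases hb with hb | hb
    · exact hb.2.2.1 j hj l h1 h2 hs
    · obtain ⟨l0, hl0⟩ := h.t_ex c j hcj
      have hne : ¬ (l0 = 0 ∨ (c < l0 ∧ l0 ≤ d)) := fun hh => hb.2 j hj l0 hh hl0
      have hmem := h.t_mem c j l0 hcj hl0
      have hmem' : c < l0 ∧ l0 ≤ j := hmem.resolve_left fun e => hne (Or.inl e)
      have := (h.ts c j c j l0 l le_rfl le_rfl hmem'.1 hmem'.2 hl0 h1 (h2.trans hj.le)).1 hs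
      exact hb.2 j hj l (Or.inr ⟨h1, h2⟩) this
  intro hs
  obtain ⟨l0, hl0⟩ := h.s_ex c j hcj
  have hmem := h.s_mem c j l0 hcj hl0
  have hl0d : d < l0 := by
    by_contra hh
    exact h1 l0 hmem.1 (not_lt.1 hh) hl0
  exact h1 k (by order) hk ((h.ss c j m j l0 k hm le_rfl (by order) hmem.2 hl0
    hmk (by order)).1 hs)

/-- The largest interval divided at `k` cannot be extended without losing its gaps. It is an inner
bracket if its gaps are negligible against the seam; otherwise gaps and seam are comparable or the
seam is negligible, and the bracket is outer. -/
lemma node_bracket {k a b : Fin n} (hak : a < k) (hkb : k ≤ b)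
    (hn : ∀ i j, i < k → k ≤ j → (s i j k ↔ a ≤ i ∧ j ≤ b)) : InC s t a b ∨ OutC t a b := by
  have hab := hak.trans_le hkb
  have hs : s a b k := (hn a b hak hkb).2 ⟨le_rfl, le_rfl⟩
  have hL : ∀ i < a, ∀ l, a < l → l ≤ b → ¬ s i b l := by
    intro i hi l h1 h2 hl
    have := (h.ss i b a b l k hi.le le_rfl h1 h2 hl hak hkb).1 hs
    exact absurd ((hn i b (hi.trans hak) hkb).1 this).1 (not_le_of_gt hi)
  have hR : ∀ j, b < j → ∀ l, a < l → l ≤ b → ¬ s a j l := by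
    intro j hj l h1 h2 hl
    have := (h.ss a j a b l k le_rfl hj.le h1 h2 hl hak hkb).1 hs
    exact absurd ((hn a j hak (hkb.trans hj.le)).1 this).2 (not_le_of_gt hj)
  by_cases hin : ∀ l, a < l → l ≤ b → ¬ t a b l
  · exact Or.inl ⟨hab, hL, hR, hin⟩
  · push Not at hin
    obtain ⟨l, h1, h2, hl⟩ := hin
    have htk : t a b k := (h.ts a b a b l k le_rfl le_rfl h1 h2 hl hak hkb).1 hs
    right
    constructor
    · rintro i hi l' (rfl | ⟨h3, h4⟩) hl'
      · have h5 := (h.tt i b a b 0 k hi.le hab le_rfl (Or.inl rfl) hl' (Or.inr ⟨hak, hkb⟩)).1 htk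
        exact hL i hi k hak hkb ((h.ts i b i b k k le_rfl le_rfl (hi.trans hak) hkb h5
          (hi.trans hak) hkb).2 h5)
      · exact hL i hi l' h3 h4 ((h.ts i b i b l' l' le_rfl le_rfl (hi.trans h3) h4 hl'
          (hi.trans h3) h4).2 hl')
    · rintro j hj l' (rfl | ⟨h3, h4⟩) hl'
      · have h5 := (h.tt a j a b 0 k le_rfl hab hj.le (Or.inl rfl) hl' (Or.inr ⟨hak, hkb⟩)).1 htk
        exact hR j hj k hak hkb ((h.ts a j a j k k le_rfl le_rfl hak (hkb.trans hj.le) h5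
          hak (hkb.trans hj.le)).2 h5)
      · exact hR j hj l' h3 h4 ((h.ts a j a j l' l' le_rfl le_rfl h3 (h4.trans hj.le) hl'
          h3 (h4.trans hj.le)).2 hl')

omit h in
/-- `i` and `j` lie in the argument of the same copy of the operation. -/
def Same (t : Fin n → Fin n → Fin n → Prop) (i j : Fin n) : Prop := i = j ∨ t i j 0

lemma same_mono {i j i' j' : Fin n} (hs : Same t i j) (h1 : i ≤ i') (h2 : i' ≤ j') (h3 : j' ≤ j) :
    Same t i' j' := by
  rcases h2.eq_or_lt with rfl | h2
  · exact Or.inl rfl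
  rcases hs with rfl | hs
  · order
  · exact Or.inr ((h.tt i j i' j' 0 0 h1 h2 h3 (Or.inl rfl) hs (Or.inl rfl)).2 hs)

/-- Some member of `t i k` is the seam or a gap on one side of `j`. In the latter case it can be
compared with the seam in the interval on that side, which brings the seam into `t i k`. -/
lemma same_join {i j k : Fin n} (h1 : Same t i j) (h2 : Same t j k) (hij : i ≤ j) (hjk : j ≤ k) :
    Same t i k := by
  rcases hij.eq_or_lt with rfl | hij
  · exact h2
  rcases hjk.eq_or_lt with rfl | hjk
  · exact h1
  have h1 := h1.resolve_left hij.ne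
  have h2 := h2.resolve_left hjk.ne
  obtain ⟨l, hl⟩ := h.t_ex i k (hij.trans hjk)
  right
  rcases h.t_mem i k l (hij.trans hjk) hl with rfl | hm
  · exact hl
  · by_cases hlj : l ≤ j
    · exact (h.tt i k i j l 0 le_rfl hij hjk.le (Or.inr ⟨hm.1, hlj⟩) hl (Or.inl rfl)).1 h1
    · exact (h.tt i k j k l 0 hij.le hjk le_rfl (Or.inr ⟨not_le.1 hlj, hm.2⟩) hl
        (Or.inl rfl)).1 h2

lemma exists_class (i : Fin n) : ∃ a b, a ≤ i ∧ i ≤ b ∧ Same t a b ∧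
    ∀ a' b', a' ≤ i → i ≤ b' → Same t a' b' → a ≤ a' ∧ b' ≤ b := by
  classical
  let U : Finset (Fin n) := Finset.univ.filter fun a => a ≤ i ∧ Same t a i
  let V : Finset (Fin n) := Finset.univ.filter fun b => i ≤ b ∧ Same t i b
  have hU : U.Nonempty := ⟨i, by simp only [U, Finset.mem_filter, Finset.mem_univ, true_and]
                                 exact ⟨le_rfl, Or.inl rfl⟩⟩
  have hV : V.Nonempty := ⟨i, by simp only [V, Finset.mem_filter, Finset.mem_univ, true_and]
                                 exact ⟨le_rfl, Or.inl rfl⟩⟩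
  obtain ⟨-, h1, h2⟩ := Finset.mem_filter.1 (U.min'_mem hU)
  obtain ⟨-, h3, h4⟩ := Finset.mem_filter.1 (V.max'_mem hV)
  refine ⟨_, _, h1, h3, h.same_join h2 h4 h1 h3, fun a' b' ha hb hs => ⟨?_, ?_⟩⟩
  · refine U.min'_le a' ?_
    simp only [U, Finset.mem_filter, Finset.mem_univ, true_and]
    exact ⟨ha, h.same_mono hs le_rfl ha hb⟩
  · refine V.le_max' b' ?_
    simp only [V, Finset.mem_filter, Finset.mem_univ, true_and]
    exact ⟨hb, h.same_mono hs ha hb le_rfl⟩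

lemma class_out {i a b : Fin n} (hai : a ≤ i) (hib : i ≤ b) (hs : Same t a b)
    (hm : ∀ a' b', a' ≤ i → i ≤ b' → Same t a' b' → a ≤ a' ∧ b' ≤ b) : OutC t a b := by
  have hL : ∀ i' < a, ¬ t i' b 0 := fun i' hi' ht =>
    absurd (hm i' b (hi'.le.trans hai) hib (Or.inr ht)).1 (not_le_of_gt hi')
  have hR : ∀ j, b < j → ¬ t a j 0 := fun j hj ht =>
    absurd (hm a j hai (hib.trans hj.le) (Or.inr ht)).2 (not_le_of_gt hj)
  constructor
  · rintro i' hi' k (rfl | ⟨h1, h2⟩) hk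
    · exact hL i' hi' hk
    · have hab := h1.trans_le h2
      exact hL i' hi' ((h.tt i' b a b k 0 hi'.le hab le_rfl (Or.inr ⟨h1, h2⟩) hk (Or.inl rfl)).1
        (hs.resolve_left hab.ne))
  · rintro j hj k (rfl | ⟨h1, h2⟩) hk
    · exact hR j hj hk
    · have hab := h1.trans_le h2
      exact hR j hj ((h.tt a j a b k 0 le_rfl hab hj.le (Or.inr ⟨h1, h2⟩) hk (Or.inl rfl)).1
        (hs.resolve_left hab.ne))

lemma class_min {a b c d : Fin n} (hs : Same t a b) (hcd : c ≤ d) (hO : OutC t c d)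
    (hac : a ≤ c) (hdb : d ≤ b) : c = a ∧ d = b := by
  constructor
  · by_contra hne
    have hlt : a < c := lt_of_le_of_ne hac (Ne.symm hne)
    have := (h.same_mono hs le_rfl (hac.trans hcd) hdb).resolve_left (hlt.trans_le hcd).ne
    exact hO.1 a hlt 0 (Or.inl rfl) this
  · by_contra hne
    have hlt : d < b := lt_of_le_of_ne hdb hne
    have := (h.same_mono hs hac (hcd.trans hdb) le_rfl).resolve_left (hcd.trans_lt hlt).ne
    exact hO.2 b hlt 0 (Or.inl rfl) this

lemma inC_seam {c d : Fin n} (hI : InC s t c d) : t c d 0 := by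
  obtain ⟨k, hk⟩ := h.t_ex c d hI.1
  rcases h.t_mem c d k hI.1 hk with rfl | hm
  · exact hk
  · exact absurd hk (hI.2.2.2 k hm.1 hm.2)

/-- A support system is the one of a painted bracketing. -/
theorem exists_bracketing : ∃ T : PaintedBracketing n, ∀ i j k, i < j →
    (T.GapDom i j k ↔ s i j k) ∧ (T.SeamDom i j k ↔ t i j k) := by
  have hmin : ∀ i, ∃ a b, (OutC t a b ∧
      ∀ c d, c ≤ d → OutC t c d → a ≤ c → d ≤ b → c = a ∧ d = b) ∧ a ≤ i ∧ i ≤ b ∧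
      Same t a b ∧ ∀ a' b', a' ≤ i → i ≤ b' → Same t a' b' → a ≤ a' ∧ b' ≤ b := by
    intro i
    obtain ⟨a, b, hai, hib, hs, hm⟩ := h.exists_class i
    exact ⟨a, b, ⟨h.class_out hai hib hs hm, fun c d hcd hO hac hdb =>
      h.class_min hs hcd hO hac hdb⟩, hai, hib, hs, hm⟩
  -- If two brackets overlap properly, a gap in the support of their union lies in one of them
  -- although the union sticks out of it.
  have hnc : ∀ a b c d : Fin n, a < c → c ≤ b → b < d → InC s t a b → ¬ InC s t c d := by
    intro a b c d h1 h2 h3 hI hI'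
    obtain ⟨k, hk⟩ := h.s_ex a d (by order)
    have hm := h.s_mem a d k (by order) hk
    by_cases hkb : k ≤ b
    · exact hI.2.2.1 d h3 k hm.1 hkb hk
    · exact hI'.2.1 a h1 k (by order) hm.2 hk
  have hnc' : ∀ a b c d : Fin n, a < c → c ≤ b → b < d → OutC t a b → ¬ OutC t c d := by
    intro a b c d h1 h2 h3 hI hI'
    obtain ⟨k, hk⟩ := h.t_ex a d (by order)
    rcases h.t_mem a d k (by order) hk with rfl | hm
    · exact hI.2 d h3 0 (Or.inl rfl) hk
    by_cases hkb : k ≤ b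
    · exact hI.2 d h3 k (Or.inr ⟨hm.1, hkb⟩) hk
    · exact hI'.1 a h1 k (Or.inr ⟨by order, hm.2⟩) hk
  have hlam : ∀ (Q : Fin n → Fin n → Prop),
      (∀ a b c d : Fin n, a < c → c ≤ b → b < d → Q a b → ¬ Q c d) →
      ∀ a b c d, Q a b → Q c d → (c ≤ a ∧ b ≤ d) ∨ (a ≤ c ∧ d ≤ b) ∨ b < c ∨ d < a := by
    intro Q hQ a b c d h1 h2
    by_contra hcon
    push Not at hcon
    obtain ⟨e1, e2, e3, e4⟩ := hcon
    rcases lt_trichotomy a c with hac | rfl | hac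
    · exact hQ a b c d hac e3 (e2 hac.le) h1 h2
    · have := e1 le_rfl
      have := e2 le_rfl
      order
    · exact hQ c d a b hac e4 (e1 hac.le) h2 h1
  let T := PaintedBracketing.ofIntervals (InC s t) (OutC t) (fun a b hI => hI.1)
    (hlam _ hnc) (fun a b c d _ _ => hlam _ hnc' a b c d)
    ⟨fun i hi => absurd hi (not_lt_of_ge (Fin.zero_le i)),
      fun j hj => absurd hj (not_lt_of_ge le_top)⟩
    (fun i => by
      obtain ⟨a, b, h1, h2, h3, -⟩ := hmin i
      exact ⟨a, b, h1, h2, h3⟩)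
    (fun c d hI => by
      obtain ⟨a, b, h1, h2, h3, -, h5⟩ := hmin c
      exact ⟨a, b, h1, h2, (h5 c d le_rfl hI.1.le (Or.inr (h.inC_seam hI))).2⟩)
  have hTI : ∀ a b, T.In a b ↔ InC s t a b := PaintedBracketing.in_ofIntervals _ _ _ _ _ _
  have hTO : ∀ a b, T.Out a b ↔ a ≤ b ∧ OutC t a b := PaintedBracketing.out_ofIntervals _ _ _ _ _ _
  have hTb : ∀ a b, T.In a b ∨ T.Out a b → InC s t a b ∨ OutC t a b := fun a b hab =>
    hab.imp (hTI a b).1 fun hh => ((hTO a b).1 hh).2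
  have hG : ∀ i j k, i < j → (T.GapDom i j k ↔ s i j k) := by
    intro i j k hij
    constructor
    · intro hk
      have hk0 : k ≠ 0 := (lt_of_le_of_lt (Fin.zero_le i) hk.1).ne'
      obtain ⟨a, b, hak, hkb, hn⟩ := h.exists_node hk0
      have hb : T.In a b ∨ T.Out a b := (h.node_bracket hak hkb hn).imp (hTI a b).2
        fun hh => (hTO a b).2 ⟨hak.le.trans hkb, hh⟩
      exact (hn i j hk.1 hk.2.1).2 (hk.2.2 a b hb hak hkb)
    · intro hk
      have hm := h.s_mem i j k hij hk
      refine ⟨hm.1, hm.2, fun c d hcd hck hkd => ?_⟩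
      have hb := hTb c d hcd
      constructor
      -- The interval is first cut off at the end `d` of the bracket, where `k` remains in the
      -- support; then `bracket_left` applies.
      · by_contra hci
        have hci := not_le.1 hci
        refine h.bracket_left hb hci hck (le_min hm.2 hkd) (min_le_right j d) ?_
        exact (h.ss i j i (min j d) k k le_rfl (min_le_left _ _) hm.1 (le_min hm.2 hkd) hk hm.1
          (le_min hm.2 hkd)).2 hk
      · by_contra hdj
        have hdj := not_le.1 hdj
        refine h.bracket_right hb hdj hkd (max_lt hm.1 hck) (le_max_right i c) ?_
        exact (h.ss i j (max i c) j k k (le_max_left _ _) le_rfl (max_lt hm.1 hck) hm.2 hk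
          (max_lt hm.1 hck) hm.2).2 hk
  refine ⟨T, fun i j k hij => ⟨hG i j k hij, ?_⟩⟩
  have hSA : T.SameArg i j ↔ t i j 0 := by
    rw [PaintedBracketing.sameArg_iff hij.le]
    constructor
    · intro hh
      obtain ⟨a, b, h1, h2, h3, h4, -⟩ := hmin i
      have := hh a b ((hTO a b).2 ⟨h2.trans h3, h1.1⟩) (Or.inl ⟨h2, h3⟩)
      exact (h.same_mono h4 this.1 hij.le this.2).resolve_left hij.ne
    · intro ht c d hcd hcase
      have hO := (hTO c d).1 hcd
      rcases hcase with ⟨h1, h2⟩ | ⟨h1, h2⟩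
      · refine ⟨h1, ?_⟩
        by_contra hdj
        have hdj := not_le.1 hdj
        have hcj : c < j := by order
        obtain ⟨l, hl⟩ := h.t_ex c j hcj
        have hne : ¬ (l = 0 ∨ (c < l ∧ l ≤ d)) := fun hh => hO.2.2 j hdj l hh hl
        have hm := (h.t_mem c j l hcj hl).resolve_left fun e => hne (Or.inl e)
        have hdl : d < l := by
          by_contra hh
          exact hne (Or.inr ⟨hm.1, not_lt.1 hh⟩)
        exact hO.2.2 j hdj 0 (Or.inl rfl) ((h.tt c j i j l 0 h1 hij le_rfl
          (Or.inr ⟨by order, hm.2⟩) hl (Or.inl rfl)).1 ht)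
      · refine ⟨?_, h2⟩
        by_contra hci
        have hci := not_le.1 hci
        have hid : i < d := by order
        obtain ⟨l, hl⟩ := h.t_ex i d hid
        have hne : ¬ (l = 0 ∨ (c < l ∧ l ≤ d)) := fun hh => hO.2.1 i hci l hh hl
        have hm := (h.t_mem i d l hid hl).resolve_left fun e => hne (Or.inl e)
        have hlc : l ≤ c := by
          by_contra hh
          exact hne (Or.inr ⟨not_le.1 hh, hm.2⟩)
        exact hO.2.1 i hci 0 (Or.inl rfl) ((h.tt i d i j l 0 le_rfl hij h2
          (Or.inr ⟨hm.1, hlc.trans h1⟩) hl (Or.inl rfl)).1 ht)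
  constructor
  · rintro (hk | hk)
    · obtain ⟨rfl, hk⟩ := hk
      exact hSA.1 ((PaintedBracketing.sameArg_iff hij.le).2 hk)
    -- If `k` were not in `t i j`, the largest interval divided at `k` would be an inner bracket
    -- around `i` and `j`, which the dominance with seam excludes.
    · by_contra hnt
      have hsk := (hG i j k hij).1 hk.1
      have hm := h.s_mem i j k hij hsk
      have hk0 : k ≠ 0 := (lt_of_le_of_lt (Fin.zero_le i) hm.1).ne'
      obtain ⟨a, b, hak, hkb, hn⟩ := h.exists_node hk0
      have hab := (hn i j hm.1 hm.2).1 hsk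
      have hsab : s a b k := (hn a b hak hkb).2 ⟨le_rfl, le_rfl⟩
      refine hk.2 a b ((hTI a b).2 ?_) hab
      by_contra hnI
      have hex : ∃ l, a < l ∧ l ≤ b ∧ t a b l := by
        by_contra hno
        push Not at hno
        rcases h.node_bracket hak hkb hn with hI | hO
        · exact hnI hI
        · refine hnI ⟨hak.trans_le hkb, ?_, ?_, hno⟩
          · intro i' hi' l h1 h2 hl
            exact h.bracket_left (Or.inr hO) hi' h1 h2 le_rfl hl
          · intro j' hj' l h1 h2 hl
            exact h.bracket_right (Or.inr hO) hj' h2 h1 le_rfl hl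
      obtain ⟨l, h1, h2, hl⟩ := hex
      have htab := (h.ts a b a b l k le_rfl le_rfl h1 h2 hl hak hkb).1 hsab
      exact hnt ((h.tt a b i j k k hab.1 hij hab.2 (Or.inr hm) htab (Or.inr hm)).2 htab)
  · intro ht
    rcases h.t_mem i j k hij ht with rfl | hm
    · exact (PaintedBracketing.seamDom_zero_iff hij).2 (hSA.2 ht)
    · refine Or.inr ⟨(hG i j k hij).2 ((h.ts i j i j k k le_rfl le_rfl hm.1 hm.2 ht hm.1 hm.2).2 ht),
        fun c d hcd hh => ?_⟩
      have hI := (hTI c d).1 hcd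
      have h0 := h.inC_seam hI
      have := (h.tt c d i j 0 k hh.1 hij hh.2 (Or.inl rfl) h0 (Or.inr hm)).1 ht
      exact hI.2.2.2 k (hh.1.trans_lt hm.1) (hm.2.trans hh.2) this

end SupportSystem

/-! ### The face system of the multiplihedron -/

section GapSystem

variable {n : ℕ} [NeZero n]

/-- The sets of gaps between `i` and `j`, without and with the seam. -/
def blocks (n : ℕ) [NeZero n] (b : Fin n × Fin n × Bool) : Finset (Fin n) :=
  if b.1 < b.2.1 then
    if b.2.2 then insert 0 (Finset.Ioc b.1 b.2.1) else Finset.Ioc b.1 b.2.1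
  -- The remaining pairs get a simplex that is a single point and carries no information.
  else {0}

lemma mem_blocks_false {i j k : Fin n} (h : i < j) :
    k ∈ blocks n (i, j, false) ↔ i < k ∧ k ≤ j := by
  simp [blocks, h]

lemma mem_blocks_true {i j k : Fin n} (h : i < j) :
    k ∈ blocks n (i, j, true) ↔ k = 0 ∨ (i < k ∧ k ≤ j) := by
  simp [blocks, h]

lemma blocks_of_not_lt {i j : Fin n} {e : Bool} (h : ¬ i < j) : blocks n (i, j, e) = {0} := by
  simp [blocks, h]

open Classical in
/-- The supports that belong to a painted bracketing. -/
def faceSupport (T : PaintedBracketing n) (b : Fin n × Fin n × Bool) : Finset (Fin n) :=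
  if b.1 < b.2.1 then
    if b.2.2 then Finset.univ.filter (T.SeamDom b.1 b.2.1)
    else Finset.univ.filter (T.GapDom b.1 b.2.1)
  else {0}

lemma mem_faceSupport_false {T : PaintedBracketing n} {i j k : Fin n} (h : i < j) :
    k ∈ faceSupport T (i, j, false) ↔ T.GapDom i j k := by
  simp [faceSupport, h]

lemma mem_faceSupport_true {T : PaintedBracketing n} {i j k : Fin n} (h : i < j) :
    k ∈ faceSupport T (i, j, true) ↔ T.SeamDom i j k := by
  simp [faceSupport, h]

lemma faceSupport_of_not_lt {T : PaintedBracketing n} {i j : Fin n} {e : Bool} (h : ¬ i < j) :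
    faceSupport T (i, j, e) = {0} := by
  simp [faceSupport, h]

lemma PaintedBracketing.SeamDom.mem {T : PaintedBracketing n} {i j k : Fin n}
    (hk : T.SeamDom i j k) : k = 0 ∨ (i < k ∧ k ≤ j) := by
  rcases hk with hk | hk
  · exact Or.inl hk.1
  · exact Or.inr ⟨hk.1.1, hk.1.2.1⟩

/-! ### Supports and sizes of compatible families -/

namespace compatible

variable {y : Fin n × Fin n × Bool → Fin n → ℝ} (hy : y ∈ compatible (blocks n))

include hy

/-- Once `y b` is nonzero somewhere on the smaller block, the vanishing minors make `y c` and the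
restriction of `y b` nonzero proportional vectors, so they have the same support. -/
lemma ne_zero_iff {b c : Fin n × Fin n × Bool} (hcb : blocks n c ⊆ blocks n b) {k : Fin n}
    (hk : k ∈ blocks n c) (hyk : y b k ≠ 0) {l : Fin n} (hl : l ∈ blocks n c) :
    y c l ≠ 0 ↔ y b l ≠ 0 := by
  have hck : y c k ≠ 0 := by
    intro h0
    have hall : ∀ m, y c m = 0 := by
      intro m
      by_cases hm : m ∈ blocks n c
      · have := hy.2 b c hcb k hk m hm
        rw [h0, mul_zero] at this
        exact (mul_eq_zero.1 this).resolve_left hyk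
      · exact hy.1.2.1 c m hm
    have := hy.1.2.2 c
    rw [Finset.sum_eq_zero fun m _ => hall m] at this
    exact zero_ne_one this
  have := hy.2 b c hcb k hk l hl
  constructor
  · intro h1 h2
    rw [h2, zero_mul] at this
    exact (mul_ne_zero hyk h1) this
  · intro h1 h2
    rw [h2, mul_zero] at this
    exact (mul_ne_zero h1 hck) this.symm

lemma exists_ne_zero (b : Fin n × Fin n × Bool) : ∃ k, y b k ≠ 0 := by
  by_contra hcon
  push Not at hcon
  have := hy.1.2.2 b
  rw [Finset.sum_eq_zero fun m _ => hcon m] at this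
  exact zero_ne_one this

lemma mem_of_ne_zero {b : Fin n × Fin n × Bool} {k : Fin n} (hk : y b k ≠ 0) :
    k ∈ blocks n b := by
  by_contra h
  exact hk (hy.1.2.1 b k h)

lemma supportSystem : SupportSystem (fun i j k => y (i, j, false) k ≠ 0)
    (fun i j k => y (i, j, true) k ≠ 0) where
  s_mem i j k hij hk := (mem_blocks_false hij).1 (mem_of_ne_zero hy hk)
  t_mem i j k hij hk := (mem_blocks_true hij).1 (mem_of_ne_zero hy hk)
  s_ex i j _ := exists_ne_zero hy _
  t_ex i j _ := exists_ne_zero hy _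
  ss i j i' j' k l h1 h2 h3 h4 hk h5 h6 := by
    have e1 : i' < j' := h3.trans_le h4
    have e2 : i < j := by order
    refine ne_zero_iff hy (fun m hm => ?_) ((mem_blocks_false e1).2 ⟨h3, h4⟩) hk
      ((mem_blocks_false e1).2 ⟨h5, h6⟩)
    have := (mem_blocks_false e1).1 hm
    exact (mem_blocks_false e2).2 ⟨h1.trans_lt this.1, this.2.trans h2⟩
  ts i j i' j' k l h1 h2 h3 h4 hk h5 h6 := by
    have e1 : i' < j' := h3.trans_le h4
    have e2 : i < j := by order
    refine ne_zero_iff hy (fun m hm => ?_) ((mem_blocks_false e1).2 ⟨h3, h4⟩) hk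
      ((mem_blocks_false e1).2 ⟨h5, h6⟩)
    have := (mem_blocks_false e1).1 hm
    exact (mem_blocks_true e2).2 (Or.inr ⟨h1.trans_lt this.1, this.2.trans h2⟩)
  tt i j i' j' k l h1 e1 h2 h3 hk h4 := by
    have e2 : i < j := by order
    refine ne_zero_iff hy (fun m hm => ?_) ((mem_blocks_true e1).2 h3) hk
      ((mem_blocks_true e1).2 h4)
    have := (mem_blocks_true e1).1 hm
    exact (mem_blocks_true e2).2 (this.imp id fun hh => ⟨h1.trans_lt hh.1, hh.2.trans h2⟩)

lemma exists_bracketing : ∃ T : PaintedBracketing n, ∀ b k, y b k ≠ 0 ↔ k ∈ faceSupport T b := by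
  obtain ⟨T, hT⟩ := (supportSystem hy).exists_bracketing
  refine ⟨T, ?_⟩
  rintro ⟨i, j, e⟩ k
  by_cases hij : i < j
  · cases e
    · rw [mem_faceSupport_false hij]
      exact ((hT i j k hij).1).symm
    · rw [mem_faceSupport_true hij]
      exact ((hT i j k hij).2).symm
  · rw [faceSupport_of_not_lt hij, Finset.mem_singleton]
    constructor
    · intro hk
      have := mem_of_ne_zero hy hk
      rwa [blocks_of_not_lt hij, Finset.mem_singleton] at this
    · rintro rfl
      obtain ⟨l, hl⟩ := exists_ne_zero hy (i, j, e)
      have := mem_of_ne_zero hy hl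
      rw [blocks_of_not_lt hij, Finset.mem_singleton] at this
      rwa [← this]

/-- Positive sizes of the gaps, and of the seam, that represent a compatible point. -/
lemma exists_sizes : ∃ g : Fin n → ℝ, (∀ k, 0 < g k) ∧
    ∀ b k l, y b k ≠ 0 → y b l ≠ 0 → g k * y b l = g l * y b k := by
  classical
  have hss := supportSystem hy
  have hnode : ∀ k : Fin n, ∃ ab : Fin n × Fin n, k ≠ 0 → ab.1 < k ∧ k ≤ ab.2 ∧
      ∀ i j, i < k → k ≤ j → (y (i, j, false) k ≠ 0 ↔ ab.1 ≤ i ∧ j ≤ ab.2) := by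
    intro k
    by_cases hk : k = 0
    · exact ⟨(0, 0), fun h => absurd hk h⟩
    · obtain ⟨a, b, h1, h2, h3⟩ := hss.exists_node hk
      exact ⟨(a, b), fun _ => ⟨h1, h2, h3⟩⟩
  choose N hN using hnode
  let Y : Fin n → Bool → Fin n → ℝ := fun k e => y ((N k).1, (N k).2, e)
  -- A gap is measured on the largest interval that it divides. If the seam is visible there along
  -- with the gap, it serves as the unit, in accordance with size `1` for the seam.
  let g : Fin n → ℝ := fun k =>
    if k = 0 then 1
    else if Y k true 0 ≠ 0 ∧ Y k true k ≠ 0 then Y k true k / Y k true 0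
    else Y k false k
  have hpos : ∀ b k, y b k ≠ 0 → 0 < y b k := fun b k hk =>
    lt_of_le_of_ne (hy.1.1 b k) (Ne.symm hk)
  have hgpos : ∀ k, 0 < g k := by
    intro k
    by_cases hk : k = 0
    · simp [g, hk]
    · simp only [g, if_neg hk]
      split_ifs with hq
      · exact div_pos (hpos _ _ hq.2) (hpos _ _ hq.1)
      · obtain ⟨h1, h2, h3⟩ := hN k hk
        exact hpos _ _ ((h3 _ _ h1 h2).2 ⟨le_rfl, le_rfl⟩)
  -- gaps in the same block
  have hgap : ∀ i j k l, i < j → y (i, j, false) k ≠ 0 → y (i, j, false) l ≠ 0 →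
      g k * y (i, j, false) l = g l * y (i, j, false) k := by
    intro i j k l hij hk hl
    have hmk := hss.s_mem i j k hij hk
    have hml := hss.s_mem i j l hij hl
    have hk0 : k ≠ 0 := (lt_of_le_of_lt (Fin.zero_le i) hmk.1).ne'
    have hl0 : l ≠ 0 := (lt_of_le_of_lt (Fin.zero_le i) hml.1).ne'
    have hself : ∀ k, k ≠ 0 → y ((N k).1, (N k).2, false) k ≠ 0 := fun k hk0 => by
      obtain ⟨h1, h2, h3⟩ := hN k hk0
      exact (h3 _ _ h1 h2).2 ⟨le_rfl, le_rfl⟩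
    -- Two gaps in one support divide the same largest interval, so their sizes are measured on one
    -- scale.
    have hle : ∀ k l, k ≠ 0 → l ≠ 0 → i < k → k ≤ j → i < l → l ≤ j → y (i, j, false) k ≠ 0 →
        y (i, j, false) l ≠ 0 → (N l).1 ≤ (N k).1 ∧ (N k).2 ≤ (N l).2 := by
      intro k l hk0 hl0 h1 h2 h3 h4 hk hl
      have hk1 := ((hN k hk0).2.2 i j h1 h2).1 hk
      have hl1 := (hss.ss (N k).1 (N k).2 i j k l hk1.1 hk1.2 h1 h2 (hself k hk0) h3 h4).1 hl
      exact ((hN l hl0).2.2 _ _ (hk1.1.trans_lt h3) (h4.trans hk1.2)).1 hl1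
    have e1 := hle k l hk0 hl0 hmk.1 hmk.2 hml.1 hml.2 hk hl
    have e2 := hle l k hl0 hk0 hml.1 hml.2 hmk.1 hmk.2 hl hk
    have hNN : N l = N k := Prod.ext (le_antisymm e1.1 e2.1) (le_antisymm e2.2 e1.2)
    have hk1 := ((hN k hk0).2.2 i j hmk.1 hmk.2).1 hk
    have hab : (N k).1 < (N k).2 := (hN k hk0).1.trans_le (hN k hk0).2.1
    have hsub : ∀ e, blocks n (i, j, false) ⊆ blocks n ((N k).1, (N k).2, e) := by
      intro e m hm
      have := (mem_blocks_false hij).1 hm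
      have hm' : (N k).1 < m ∧ m ≤ (N k).2 := ⟨hk1.1.trans_lt this.1, this.2.trans hk1.2⟩
      cases e
      · exact (mem_blocks_false hab).2 hm'
      · exact (mem_blocks_true hab).2 (Or.inr hm')
    have hcomp : ∀ e, Y k e k * y (i, j, false) l = Y k e l * y (i, j, false) k := fun e =>
      hy.2 _ _ (hsub e) k ((mem_blocks_false hij).2 hmk) l ((mem_blocks_false hij).2 hml)
    have hYl : Y l = Y k := by simp only [Y, hNN]
    have hiff : ∀ k l : Fin n, i < k → k ≤ j → i < l → l ≤ j → N l = N k →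
        y ((N k).1, (N k).2, false) l ≠ 0 →
        (N k).1 ≤ i → j ≤ (N k).2 → Y k true k ≠ 0 → Y k true l ≠ 0 := by
      intro k l h1 h2 h3 h4 _ h5 h6 h7 hq
      exact (hss.ts (N k).1 (N k).2 (N k).1 (N k).2 k l le_rfl le_rfl (h6.trans_lt h1)
        (h2.trans h7) hq (h6.trans_lt h3) (h4.trans h7)).1 h5
    have hkl : Y k true k ≠ 0 ↔ Y k true l ≠ 0 := by
      constructor
      · refine hiff k l hmk.1 hmk.2 hml.1 hml.2 hNN ?_ hk1.1 hk1.2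
        rw [← hNN]
        exact hself l hl0
      · intro hq
        have := hiff l k hml.1 hml.2 hmk.1 hmk.2 hNN.symm (by rw [hNN]; exact hself k hk0)
          (by rw [hNN]; exact hk1.1) (by rw [hNN]; exact hk1.2) (by rw [hYl]; exact hq)
        rwa [hYl] at this
    simp only [g, if_neg hk0, if_neg hl0, hYl]
    by_cases hq : Y k true 0 ≠ 0 ∧ Y k true k ≠ 0
    · rw [if_pos hq, if_pos ⟨hq.1, hkl.1 hq.2⟩, div_mul_eq_mul_div, div_mul_eq_mul_div,
        hcomp true]
    · rw [if_neg hq, if_neg fun hh => hq ⟨hh.1, hkl.2 hh.2⟩, hcomp false]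
  -- the seam and a gap
  have hseam : ∀ i j l, i < j → y (i, j, true) 0 ≠ 0 → y (i, j, true) l ≠ 0 →
      g 0 * y (i, j, true) l = g l * y (i, j, true) 0 := by
    intro i j l hij h0 hl
    by_cases hl0 : l = 0
    · subst hl0; rfl
    have hml := (hss.t_mem i j l hij hl).resolve_left hl0
    have hls : y (i, j, false) l ≠ 0 :=
      (hss.ts i j i j l l le_rfl le_rfl hml.1 hml.2 hl hml.1 hml.2).2 hl
    have hl1 := ((hN l hl0).2.2 i j hml.1 hml.2).1 hls
    have hab : (N l).1 < (N l).2 := (hN l hl0).1.trans_le (hN l hl0).2.1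
    have hself : y ((N l).1, (N l).2, false) l ≠ 0 :=
      ((hN l hl0).2.2 _ _ (hN l hl0).1 (hN l hl0).2.1).2 ⟨le_rfl, le_rfl⟩
    -- Since the seam and `l` are comparable on `(i, j)`, they are both visible on the largest
    -- interval divided at `l`, so `g l` is the quotient by the seam.
    have hY : Y l true 0 ≠ 0 ∧ Y l true l ≠ 0 := by
      by_cases hY0 : Y l true 0 ≠ 0
      · exact ⟨hY0, (hss.tt _ _ i j 0 l hl1.1 hij hl1.2 (Or.inl rfl) hY0 (Or.inr hml)).1 hl⟩
      · obtain ⟨m, hm⟩ := hss.t_ex _ _ hab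
        have hm0 : m ≠ 0 := by
          rintro rfl
          exact hY0 hm
        have hmm := (hss.t_mem _ _ m hab hm).resolve_left hm0
        have hYl : Y l true l ≠ 0 := (hss.ts _ _ _ _ m l le_rfl le_rfl hmm.1 hmm.2 hm
          (hN l hl0).1 (hN l hl0).2.1).1 hself
        exact absurd ((hss.tt _ _ i j l 0 hl1.1 hij hl1.2 (Or.inr hml) hYl (Or.inl rfl)).1 h0) hY0
    have hsub : blocks n (i, j, true) ⊆ blocks n ((N l).1, (N l).2, true) := by
      intro m hm
      exact (mem_blocks_true hab).2 (((mem_blocks_true hij).1 hm).imp id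
        fun hh => ⟨hl1.1.trans_lt hh.1, hh.2.trans hl1.2⟩)
    have hcomp := hy.2 _ _ hsub 0 ((mem_blocks_true hij).2 (Or.inl rfl)) l
      ((mem_blocks_true hij).2 (Or.inr hml))
    have hg0 : g 0 = 1 := by simp [g]
    have hgl : g l = Y l true l / Y l true 0 := by
      simp only [g, if_neg hl0]
      rw [if_pos hY]
    rw [hg0, hgl, one_mul, div_mul_eq_mul_div, eq_div_iff hY.1, mul_comm]
    exact hcomp
  refine ⟨g, hgpos, ?_⟩
  rintro ⟨i, j, e⟩ k l hk hl
  by_cases hij : i < j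
  · cases e
    · exact hgap i j k l hij hk hl
    · by_cases hk0 : k = 0
      · subst hk0
        exact hseam i j l hij hk hl
      by_cases hl0 : l = 0
      · subst hl0
        exact (hseam i j k hij hl hk).symm
      have hmk := (hss.t_mem i j k hij hk).resolve_left hk0
      have hml := (hss.t_mem i j l hij hl).resolve_left hl0
      have hks : y (i, j, false) k ≠ 0 :=
        (hss.ts i j i j k k le_rfl le_rfl hmk.1 hmk.2 hk hmk.1 hmk.2).2 hk
      have hls : y (i, j, false) l ≠ 0 :=
        (hss.ts i j i j l l le_rfl le_rfl hml.1 hml.2 hl hml.1 hml.2).2 hl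
      have h1 := hgap i j k l hij hks hls
      have hsub : blocks n (i, j, false) ⊆ blocks n (i, j, true) := fun m hm =>
        (mem_blocks_true hij).2 (Or.inr ((mem_blocks_false hij).1 hm))
      have h2 := hy.2 _ _ hsub k ((mem_blocks_false hij).2 hmk) l ((mem_blocks_false hij).2 hml)
      have h3 : (g k * y (i, j, true) l - g l * y (i, j, true) k) * y (i, j, false) k = 0 := by
        linear_combination (-g k) * h2 + y (i, j, true) k * h1
      exact sub_eq_zero.1 ((mul_eq_zero.1 h3).resolve_right hks)
  · have hz : ∀ m, y (i, j, e) m ≠ 0 → m = 0 := fun m hm => by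
      have := mem_of_ne_zero hy hm
      rwa [blocks_of_not_lt hij, Finset.mem_singleton] at this
    rw [hz k hk, hz l hl]

end compatible

lemma faceSystem (n : ℕ) [NeZero n] :
    FaceSystem (blocks n) (faceSupport : PaintedBracketing n → _) where
  subset := by
    rintro T ⟨i, j, e⟩ k hk
    by_cases hij : i < j
    · cases e
      · have := (mem_faceSupport_false hij).1 hk
        exact (mem_blocks_false hij).2 ⟨this.1, this.2.1⟩
      · exact (mem_blocks_true hij).2 ((mem_faceSupport_true hij).1 hk).mem
    · rw [faceSupport_of_not_lt hij] at hk
      rwa [blocks_of_not_lt hij]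
  nonempty := by
    rintro T ⟨i, j, e⟩
    by_cases hij : i < j
    · cases e
      · obtain ⟨k, hk⟩ := PaintedBracketing.exists_gapDom (T := T) hij
        exact ⟨k, (mem_faceSupport_false hij).2 hk⟩
      · obtain ⟨k, hk⟩ := PaintedBracketing.exists_seamDom (T := T) hij
        exact ⟨k, (mem_faceSupport_true hij).2 hk⟩
    · rw [faceSupport_of_not_lt hij]
      exact Finset.singleton_nonempty 0
  weight := by
    intro T
    have key : ∀ b, ∃ W : ℝ, ∀ k ∈ blocks n b,
        T.weight k ≤ W ∧ (T.weight k = W ↔ k ∈ faceSupport T b) := by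
      rintro ⟨i, j, e⟩
      by_cases hij : i < j
      · cases e
        · obtain ⟨k, hk⟩ := PaintedBracketing.exists_gapDom (T := T) hij
          refine ⟨T.weight k, fun l hl => ?_⟩
          have hl' := (mem_blocks_false hij).1 hl
          have h1 := hk.weight_le hl'.1 hl'.2
          refine ⟨h1.1, fun he => (mem_faceSupport_false hij).2 (h1.2 he), fun hm => ?_⟩
          have hm := (mem_faceSupport_false hij).1 hm
          exact le_antisymm h1.1 (hm.weight_le hk.1 hk.2.1).1
        · obtain ⟨k, hk⟩ := PaintedBracketing.exists_seamDom (T := T) hij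
          refine ⟨T.weight k, fun l hl => ?_⟩
          have hl' := (mem_blocks_true hij).1 hl
          have h1 := hk.weight_le hij hl'
          refine ⟨h1.1, fun he => (mem_faceSupport_true hij).2 (h1.2 he), fun hm => ?_⟩
          have hm := (mem_faceSupport_true hij).1 hm
          exact le_antisymm h1.1 (hm.weight_le hij hk.mem).1
      · refine ⟨T.weight 0, fun l hl => ?_⟩
        rw [blocks_of_not_lt hij, Finset.mem_singleton] at hl
        subst hl
        rw [faceSupport_of_not_lt hij]
        simp
    choose W hW using key
    exact ⟨T.weight, W, hW⟩
  le_iff := by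
    intro T T'
    rw [PaintedBracketing.le_iff_dom]
    constructor
    · rintro ⟨h1, h2⟩ ⟨i, j, e⟩ k hk
      by_cases hij : i < j
      · cases e
        · exact (mem_faceSupport_false hij).2 (h1 i j k hij ((mem_faceSupport_false hij).1 hk))
        · exact (mem_faceSupport_true hij).2 (h2 i j k hij ((mem_faceSupport_true hij).1 hk))
      · rw [faceSupport_of_not_lt hij] at hk ⊢
        exact hk
    · intro h
      exact ⟨fun i j k hij hk => (mem_faceSupport_false hij).1
          (h (i, j, false) ((mem_faceSupport_false hij).2 hk)),
        fun i j k hij hk => (mem_faceSupport_true hij).1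
          (h (i, j, true) ((mem_faceSupport_true hij).2 hk))⟩
  exists_rep := by
    intro y hy
    obtain ⟨T, hT⟩ := compatible.exists_bracketing hy
    obtain ⟨g, hg, hgy⟩ := compatible.exists_sizes hy
    refine ⟨T, g, hg, fun b k hk => ?_, fun b k hk => ?_⟩
    · by_contra hne
      exact hk ((hT b k).1 hne)
    · have h1 : ∑ l ∈ faceSupport T b, y b l = 1 := by
        rw [← hy.1.2.2 b]
        refine Finset.sum_subset (Finset.subset_univ _) fun l _ hl => ?_
        by_contra hne
        exact hl ((hT b l).1 hne)
      rw [Finset.mul_sum]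
      calc ∑ l ∈ faceSupport T b, y b k * g l = ∑ l ∈ faceSupport T b, g k * y b l := by
            refine Finset.sum_congr rfl fun l hl => ?_
            rw [hgy b k l ((hT b k).2 hk) ((hT b l).2 hl), mul_comm]
        _ = g k := by rw [← Finset.mul_sum, h1, mul_one]

end GapSystem

/-! ### Betweenness in the tree of components -/

namespace NodalData

variable {n : ℕ} (S : NodalData n) {S' : NodalData n}

/-- The component `x` lies on the path from `a` to `b`. -/
def Btw (a x b : Fin S.numComp) : Prop := x ∈ (S.path a b).support

variable {S} {a b c x y : Fin S.numComp}

lemma path_unique {p : S.tree.Walk a b} (hp : p.IsPath) : p = S.path a b :=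
  (S.isTree.existsUnique_path a b).unique hp (S.path_isPath a b)

lemma path_self (a : Fin S.numComp) : S.path a a = .nil :=
  (path_unique SimpleGraph.Walk.IsPath.nil).symm

lemma path_reverse (a b : Fin S.numComp) : (S.path a b).reverse = S.path b a :=
  path_unique (S.path_isPath a b).reverse

lemma btw_left (a b : Fin S.numComp) : S.Btw a a b := SimpleGraph.Walk.start_mem_support _

lemma btw_right (a b : Fin S.numComp) : S.Btw a b b := SimpleGraph.Walk.end_mem_support _

lemma Btw.symm (h : S.Btw a x b) : S.Btw b x a := by
  unfold Btw at *
  rw [← path_reverse, SimpleGraph.Walk.support_reverse]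
  simpa using h

lemma btw_self_iff : S.Btw a x a ↔ x = a := by
  unfold Btw
  rw [path_self]
  simp

lemma Btw.path_eq (h : S.Btw a x b) : S.path a b = (S.path a x).append (S.path x b) := by
  have h1 := (S.path a b).take_spec h
  have h2 : (S.path a b).takeUntil x h = S.path a x :=
    path_unique ((S.path_isPath a b).takeUntil h)
  have h3 : (S.path a b).dropUntil x h = S.path x b :=
    path_unique ((S.path_isPath a b).dropUntil h)
  rw [h2, h3] at h1
  exact h1.symm

lemma Btw.length (h : S.Btw a x b) :
    (S.path a b).length = (S.path a x).length + (S.path x b).length := by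
  rw [h.path_eq, SimpleGraph.Walk.length_append]

lemma Btw.or (h : S.Btw a x b) : S.Btw a y b ↔ S.Btw a y x ∨ S.Btw x y b := by
  conv_lhs => unfold Btw
  rw [h.path_eq, SimpleGraph.Walk.mem_support_append_iff]
  rfl

lemma eq_of_length (h : (S.path a b).length = 0) : a = b :=
  SimpleGraph.Walk.eq_of_length_eq_zero h

/-- If `x` lies on the path from `a` to `b`, and `y` on the part from `a` to `x`, then `x` lies on
the part from `y` to `b`. -/
lemma Btw.trans_right (h : S.Btw a x b) (h' : S.Btw a y x) : S.Btw y x b := by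
  have hy : S.Btw a y b := h.or.2 (Or.inl h')
  rcases hy.or.1 h with h1 | h1
  · have e1 := h1.length
    have e2 := h'.length
    have : y = x := eq_of_length (by omega)
    exact this ▸ btw_left _ _
  · exact h1

lemma Btw.eq_of (h : S.Btw a x b) (h1 : S.Btw a y x) (h2 : S.Btw x y b) : y = x := by
  have e1 := (h.trans_right h1).length
  have e2 := h2.length
  exact eq_of_length (by omega)

lemma Btw.antisymm (h : S.Btw c a b) (h' : S.Btw c b a) : a = b := by
  have e1 := h.length
  have e2 := h'.length
  exact eq_of_length (by omega)

/-- Let `m` be the last common point of the paths from `a` to `b` and to `c`. The paths from `m` to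
`b` and `c` meet only in `m`, so they join to the path from `b` to `c`. -/
lemma exists_median (a b c : Fin S.numComp) :
    ∃ m, S.Btw a m b ∧ S.Btw a m c ∧ S.Btw b m c := by
  classical
  obtain ⟨m, hm, hmax⟩ := Finset.exists_max_image
    (Finset.univ.filter fun m => S.Btw a m b ∧ S.Btw a m c) (fun m => (S.path a m).length)
    ⟨a, by simp [btw_left]⟩
  simp only [Finset.mem_filter, Finset.mem_univ, true_and] at hm hmax
  refine ⟨m, hm.1, hm.2, ?_⟩
  have key : ∀ y, S.Btw m y b → S.Btw m y c → y = m := by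
    intro y h1 h2
    have e1 := hmax y ⟨hm.1.or.2 (Or.inr h1), hm.2.or.2 (Or.inr h2)⟩
    have h3 : S.Btw a m y := ((hm.1.symm.trans_right h1.symm)).symm
    have e2 := h3.length
    exact (eq_of_length (by omega)).symm
  have hp : ((S.path b m).append (S.path m c)).IsPath := by
    rw [SimpleGraph.Walk.isPath_def, SimpleGraph.Walk.support_append]
    refine List.Nodup.append (S.path_isPath b m).support_nodup
      (S.path_isPath m c).support_nodup.tail ?_
    intro y h1 h2
    have := key y (Btw.symm h1) (List.mem_of_mem_tail h2)
    subst this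
    have h3 := (S.path_isPath y c).support_nodup
    rw [← SimpleGraph.Walk.cons_tail_support] at h3
    exact (List.nodup_cons.1 h3).1 h2
  unfold Btw
  rw [← path_unique hp]
  simp

variable (S) in
/-- The neighbour of `a` in the direction of `b`. -/
def dir (a b : Fin S.numComp) : Fin S.numComp := (S.path a b).snd

lemma not_nil_path (h : a ≠ b) : ¬ (S.path a b).Nil := fun hh => h hh.eq

lemma adj_dir (h : a ≠ b) : S.tree.Adj a (S.dir a b) :=
  SimpleGraph.Walk.adj_snd (not_nil_path h)

lemma btw_dir (a b : Fin S.numComp) : S.Btw a (S.dir a b) b :=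
  SimpleGraph.Walk.getVert_mem_support _ _

lemma path_of_adj (h : S.tree.Adj a b) : S.path a b = .cons h .nil :=
  (path_unique (by simp [h.ne])).symm

lemma btw_of_adj (h : S.tree.Adj a b) : S.Btw a x b ↔ x = a ∨ x = b := by
  unfold Btw
  rw [path_of_adj h]
  simp

lemma dir_of_adj (h : S.tree.Adj a b) : S.dir a b = b := by
  unfold dir
  rw [path_of_adj h]
  simp

lemma Btw.dir_eq (h : S.Btw a x b) (hx : a ≠ x) : S.dir a x = S.dir a b := by
  unfold dir
  rw [h.path_eq]
  simp only [SimpleGraph.Walk.snd]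
  rw [SimpleGraph.Walk.getVert_append']
  have : (S.path a x).length ≠ 0 := fun h0 => hx (eq_of_length h0)
  rw [if_pos (by omega)]

/-- If `a` is not between `b` and `c`, the median of the three lies away from `a`, and both paths
start in its direction. -/
lemma dir_eq_iff (hb : a ≠ b) (hc : a ≠ c) : S.dir a b = S.dir a c ↔ ¬ S.Btw b a c := by
  constructor
  · intro h hbt
    have h1 := (btw_dir a b).symm
    have h2 := btw_dir a c
    rw [← h] at h2
    exact (adj_dir hb).ne' (hbt.eq_of h1 h2)
  · intro h
    obtain ⟨m, h1, h2, h3⟩ := exists_median a b c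
    have hm : a ≠ m := by
      rintro rfl
      exact h h3
    rw [← h1.dir_eq hm, ← h2.dir_eq hm]

lemma dir_map (f : S.tree ≃g S'.tree) (a b : Fin S.numComp) :
    S'.dir (f a) (f b) = f (S.dir a b) := by
  unfold dir
  rw [path_map]
  simp [SimpleGraph.Walk.snd, SimpleGraph.Walk.getVert_map]

lemma btw_map (f : S.tree ≃g S'.tree) {a x b : Fin S.numComp} :
    S'.Btw (f a) (f x) (f b) ↔ S.Btw a x b := by
  unfold Btw
  rw [path_map, SimpleGraph.Walk.support_map]
  constructor
  · intro h
    obtain ⟨y, hy, hyx⟩ := List.mem_map.1 h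
    exact f.injective hyx ▸ hy
  · intro h
    exact List.mem_map.2 ⟨x, h, rfl⟩

/-! ### Special points -/

lemma special_of_eq {i : Fin (n + 1)} (h : S.comp i = a) : S.special a i = S.mark i := by
  simp [special, h]

lemma special_of_ne {i : Fin (n + 1)} (h : S.comp i ≠ a) :
    S.special a i = S.node a (S.dir a (S.comp i)) := by
  simp [special, h, dir]

lemma special_eq_of_not_btw {i j : Fin (n + 1)} (h : ¬ S.Btw (S.comp i) a (S.comp j)) :
    S.special a i = S.special a j := by
  have hi : S.comp i ≠ a := by
    intro hi
    exact h (hi ▸ btw_left _ _)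
  have hj : S.comp j ≠ a := by
    intro hj
    exact h (hj ▸ btw_right _ _)
  rw [special_of_ne hi, special_of_ne hj, (dir_eq_iff hi.symm hj.symm).2 h]

/-- Distinctness of nodes and markings turns all coincidences of special points into statements
about paths in the tree. -/
lemma IsStable.special_eq_iff (hS : S.IsStable) {i j : Fin (n + 1)} (hij : i ≠ j) :
    S.special a i = S.special a j ↔ ¬ S.Btw (S.comp i) a (S.comp j) := by
  refine ⟨fun h hb => ?_, special_eq_of_not_btw⟩
  by_cases hi : S.comp i = a
  · by_cases hj : S.comp j = a
    · rw [special_of_eq hi, special_of_eq hj] at h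
      exact hS.mark_ne_mark i j hij (hi.trans hj.symm) (Circle.ext h)
    · rw [special_of_eq hi, special_of_ne hj] at h
      subst hi
      exact hS.mark_ne_node _ _ (adj_dir (Ne.symm hj)) (Circle.ext h)
  · by_cases hj : S.comp j = a
    · rw [special_of_ne hi, special_of_eq hj] at h
      subst hj
      exact hS.mark_ne_node _ _ (adj_dir (Ne.symm hi)) (Circle.ext h.symm)
    · rw [special_of_ne hi, special_of_ne hj] at h
      refine hS.node_ne_node a _ _ (adj_dir (Ne.symm hi)) (adj_dir (Ne.symm hj)) (fun he => ?_)
        (Circle.ext h)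
      exact (dir_eq_iff (Ne.symm hi) (Ne.symm hj)).1 he hb

lemma ncard_range_special_le (a : Fin S.numComp) :
    (Set.range (S.special a)).ncard ≤ S.numSpecial a := by
  have hsub : Set.range (S.special a) ⊆ (fun i => (S.mark i : ℂ)) '' {i | S.comp i = a} ∪
      (fun b => (S.node a b : ℂ)) '' S.tree.neighborSet a := by
    rintro _ ⟨i, rfl⟩
    by_cases hi : S.comp i = a
    · rw [special_of_eq hi]
      exact Or.inl ⟨i, hi, rfl⟩
    · rw [special_of_ne hi]
      exact Or.inr ⟨_, adj_dir (Ne.symm hi), rfl⟩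
  refine (Set.ncard_le_ncard hsub (Set.toFinite _)).trans ((Set.ncard_union_le _ _).trans ?_)
  exact add_le_add (Set.ncard_image_le (Set.toFinite _)) (Set.ncard_image_le (Set.toFinite _))

lemma IsStable.two_le (hS : S.IsStable) (a : Fin S.numComp) : 2 ≤ S.numSpecial a := by
  by_cases h : a ∈ S.quilted
  · exact hS.stable_quilted a h
  · exact (by norm_num : 2 ≤ 3).trans (hS.stable_unquilted a h)

/-- Behind each node lies a marking: a component farthest from `a` beyond `b` has at least two
special points, and a second node would lead still farther away. -/
lemma IsStable.exists_comp (hS : S.IsStable) (h : S.tree.Adj a b) :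
    ∃ i, S.comp i ≠ a ∧ S.dir a (S.comp i) = b := by
  classical
  obtain ⟨c, hc, hmax⟩ := Finset.exists_max_image
    (Finset.univ.filter fun c => S.Btw a b c) (fun c => (S.path a c).length)
    ⟨b, by simp [btw_right]⟩
  simp only [Finset.mem_filter, Finset.mem_univ, true_and] at hc hmax
  have hca : a ≠ c := by
    rintro rfl
    exact h.ne' (btw_self_iff.1 hc)
  by_cases hi : ∃ i, S.comp i = c
  · obtain ⟨i, rfl⟩ := hi
    exact ⟨i, hca.symm, by rw [← hc.dir_eq h.ne, dir_of_adj h]⟩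
  · exfalso
    have h2 := hS.two_le c
    have h0 : {i | S.comp i = c} = ∅ := by
      ext i
      simpa using fun hh => hi ⟨i, hh⟩
    rw [numSpecial, h0, Set.ncard_empty, zero_add] at h2
    obtain ⟨d, hd, hne⟩ := Set.exists_ne_of_one_lt_ncard (s := S.tree.neighborSet c) h2 (S.dir c a)
    have hd : S.tree.Adj c d := hd
    have hda : d ≠ a := by
      rintro rfl
      exact hne (dir_of_adj hd).symm
    have hb : S.Btw d c a := by
      by_contra hcon
      have := (dir_eq_iff hd.ne hca.symm).2 hcon
      rw [dir_of_adj hd] at this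
      exact hne this
    have e1 := hmax d (hb.symm.or.2 (Or.inl hc))
    have e2 := hb.symm.length
    rw [path_of_adj hd] at e2
    simp at e2
    omega

lemma IsStable.exists_special_node (hS : S.IsStable) (h : S.tree.Adj a b) :
    ∃ i, S.special a i = S.node a b := by
  obtain ⟨i, h1, h2⟩ := hS.exists_comp h
  exact ⟨i, by rw [special_of_ne h1, h2]⟩

/-- Each node is the special point of some marking, so the stability condition may be read off from
the points `z_{α i}`. -/
lemma IsStable.numSpecial_le (hS : S.IsStable) (a : Fin S.numComp) :
    S.numSpecial a ≤ (Set.range (S.special a)).ncard := by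
  have hdisj : Disjoint ((fun i => (S.mark i : ℂ)) '' {i | S.comp i = a})
      ((fun b => (S.node a b : ℂ)) '' S.tree.neighborSet a) := by
    rw [Set.disjoint_left]
    rintro _ ⟨i, rfl, rfl⟩ ⟨b, hb, he⟩
    exact hS.mark_ne_node i b hb (Circle.ext he.symm)
  have e1 : ((fun i => (S.mark i : ℂ)) '' {i | S.comp i = a}).ncard = {i | S.comp i = a}.ncard := by
    refine Set.InjOn.ncard_image ?_
    intro i hi j hj he
    by_contra hne
    exact hS.mark_ne_mark i j hne (hi.trans hj.symm) (Circle.ext he)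
  have e2 : ((fun b => (S.node a b : ℂ)) '' S.tree.neighborSet a).ncard =
      (S.tree.neighborSet a).ncard := by
    refine Set.InjOn.ncard_image ?_
    intro b hb c hc he
    by_contra hne
    exact hS.node_ne_node a b c hb hc hne (Circle.ext he)
  rw [numSpecial, ← e1, ← e2, ← Set.ncard_union_eq hdisj (Set.toFinite _) (Set.toFinite _)]
  refine Set.ncard_le_ncard ?_ (Set.finite_range _)
  rintro _ (⟨i, hi, rfl⟩ | ⟨b, hb, rfl⟩)
  · exact ⟨i, special_of_eq hi⟩
  · exact hS.exists_special_node hb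

/-! ### The order on the components, with the component of `z₀` as the least element -/

variable (S) in
/-- `a` lies on the path from `b` to the component of `z₀`. -/
def Below (a b : Fin S.numComp) : Prop := S.Btw b a (S.comp 0)

variable (S) in
/-- The variable `i` lies behind the component `a`. -/
def Behind (a : Fin S.numComp) (i : Fin n) : Prop := S.Below a (S.comp i.succ)

variable (S) in
/-- The component is quilted, or on the root side of the quilted components. -/
def IsOuter (a : Fin S.numComp) : Prop := a ∈ S.quilted ∨ S.RootSide a

lemma Below.refl (a : Fin S.numComp) : S.Below a a := btw_left _ _

lemma below_root (a : Fin S.numComp) : S.Below (S.comp 0) a := btw_right _ _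

lemma Below.trans (h : S.Below a b) (h' : S.Below b c) : S.Below a c :=
  Btw.or h' |>.2 (Or.inr h)

lemma Below.antisymm (h : S.Below a b) (h' : S.Below b a) : a = b :=
  Btw.antisymm (Btw.symm h) (Btw.symm h')

lemma Below.total (h : S.Below a c) (h' : S.Below b c) : S.Below a b ∨ S.Below b a := by
  rcases (Btw.or h).1 h' with h1 | h1
  · exact Or.inl (Btw.trans_right h h1)
  · exact Or.inr h1

lemma Below.btw (h : S.Below a b) (h' : S.Below b c) : S.Btw c b a :=
  (Btw.trans_right (Btw.symm h') (Btw.symm h)).symm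

lemma rootSide_iff : S.RootSide a ↔ ∀ b, S.Below b a → b ∉ S.quilted := Iff.rfl

lemma Behind.mono {i : Fin n} (h : S.Behind b i) (hab : S.Below a b) : S.Behind a i := hab.trans h

/-- The tree is recovered from the order as its covering relation, so an isomorphism of orders gives
an isomorphism of trees. -/
lemma adj_iff_below : S.tree.Adj a b ↔
    (S.Below a b ∧ a ≠ b ∧ ∀ c, S.Below a c → S.Below c b → c = a ∨ c = b) ∨
    (S.Below b a ∧ b ≠ a ∧ ∀ c, S.Below b c → S.Below c a → c = b ∨ c = a) := by
  have key : ∀ a b : Fin S.numComp, S.Below a b → a ≠ b →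
      (∀ c, S.Below a c → S.Below c b → c = a ∨ c = b) → S.tree.Adj a b := by
    intro a b h1 h2 h3
    have hadj := adj_dir (a := b) (b := a) h2.symm
    have hb := btw_dir b a
    rcases h3 (S.dir b a) (Btw.trans_right h1 hb) ((Btw.or h1).2 (Or.inl hb)) with h | h
    · rw [h] at hadj
      exact hadj.symm
    · exact absurd h hadj.ne'
  have key2 : ∀ a b : Fin S.numComp, S.tree.Adj a b → S.Below a b →
      a ≠ b ∧ ∀ c, S.Below a c → S.Below c b → c = a ∨ c = b := by
    intro a b h h1
    refine ⟨h.ne, fun c h2 h3 => ?_⟩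
    exact ((btw_of_adj h.symm).1 (Below.btw h2 h3)).symm
  constructor
  · intro h
    obtain ⟨m, h1, h2, h3⟩ := exists_median a b (S.comp 0)
    rcases (btw_of_adj h).1 h1 with rfl | rfl
    · exact Or.inl ⟨h3, key2 _ _ h h3⟩
    · exact Or.inr ⟨h2, key2 _ _ h.symm h2⟩
  · rintro (⟨h1, h2, h3⟩ | ⟨h1, h2, h3⟩)
    · exact key a b h1 h2 h3
    · exact (key b a h1 h2 h3).symm

end NodalData

/-! ### The half plane model of the disk -/

/-- The coordinate of `z` in the half plane model of the disk in which `ζ` is the point at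
infinity. -/
def halfPlane (ζ z : ℂ) : ℂ := Complex.I * (ζ + z) / (ζ - z)

/-- The inverse of `halfPlane`. -/
def ofHalfPlane (ζ w : ℂ) : ℂ := ζ * (w - Complex.I) / (w + Complex.I)

section HalfPlane

variable {ζ z w : ℂ}

lemma add_I_ne_zero (hw : 0 ≤ w.im) : w + Complex.I ≠ 0 := by
  intro h
  have := congrArg Complex.im h
  simp at this
  linarith

lemma ofReal_add_I_ne_zero (u : ℝ) : (u : ℂ) + Complex.I ≠ 0 := add_I_ne_zero (by simp)

lemma halfPlane_ofHalfPlane (hζ : ζ ≠ 0) (hw : 0 ≤ w.im) : halfPlane ζ (ofHalfPlane ζ w) = w := by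
  have h := add_I_ne_zero hw
  unfold halfPlane ofHalfPlane
  have e1 : ζ + ζ * (w - Complex.I) / (w + Complex.I) = ζ * (2 * w) / (w + Complex.I) := by
    field_simp
    ring
  have e2 : ζ - ζ * (w - Complex.I) / (w + Complex.I) = ζ * (2 * Complex.I) / (w + Complex.I) := by
    field_simp
    ring
  rw [e1, e2]
  have := Complex.I_ne_zero
  field_simp

lemma ofHalfPlane_ne (hζ : ζ ≠ 0) (hw : 0 ≤ w.im) : ofHalfPlane ζ w ≠ ζ := by
  have h := add_I_ne_zero hw
  intro he
  unfold ofHalfPlane at he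
  rw [div_eq_iff h] at he
  have : ζ * (2 * Complex.I) = 0 := by linear_combination -he
  simp [hζ] at this

lemma ofHalfPlane_halfPlane (hζ : ζ ≠ 0) (hz : z ≠ ζ) : ofHalfPlane ζ (halfPlane ζ z) = z := by
  have h : ζ - z ≠ 0 := sub_ne_zero.2 hz.symm
  unfold halfPlane ofHalfPlane
  have e1 : Complex.I * (ζ + z) / (ζ - z) - Complex.I = Complex.I * (2 * z) / (ζ - z) := by
    field_simp
    ring
  have e2 : Complex.I * (ζ + z) / (ζ - z) + Complex.I = Complex.I * (2 * ζ) / (ζ - z) := by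
    field_simp
    ring
  rw [e1, e2]
  have := Complex.I_ne_zero
  field_simp

lemma halfPlane_im (hz : z ≠ ζ) :
    (halfPlane ζ z).im * Complex.normSq (ζ - z) = Complex.normSq ζ - Complex.normSq z := by
  have h : Complex.normSq (ζ - z) ≠ 0 := by
    rw [Complex.normSq_eq_zero.ne]
    exact sub_ne_zero.2 hz.symm
  unfold halfPlane
  rw [Complex.div_im]
  field_simp
  simp [Complex.normSq_apply]
  ring

lemma halfPlane_eq_ofReal (hζ : ‖ζ‖ = 1) (hz1 : ‖z‖ = 1) (hz : z ≠ ζ) :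
    halfPlane ζ z = ((halfPlane ζ z).re : ℂ) := by
  have h := halfPlane_im hz
  rw [Complex.normSq_eq_norm_sq ζ, Complex.normSq_eq_norm_sq z, hζ, hz1, sub_self] at h
  have h2 : Complex.normSq (ζ - z) ≠ 0 := by
    rw [Complex.normSq_eq_zero.ne]
    exact sub_ne_zero.2 hz.symm
  have := (mul_eq_zero.1 h).resolve_right h2
  exact Complex.ext (by simp) (by simp [this])

lemma norm_ofHalfPlane (hζ : ‖ζ‖ = 1) (u : ℝ) : ‖ofHalfPlane ζ u‖ = 1 := by
  unfold ofHalfPlane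
  rw [norm_div, norm_mul, hζ, one_mul]
  have : ‖(u : ℂ) - Complex.I‖ = ‖(u : ℂ) + Complex.I‖ := by
    rw [← Complex.norm_conj]
    simp
  rw [this, div_self]
  exact norm_ne_zero_iff.2 (ofReal_add_I_ne_zero u)

lemma ofHalfPlane_sub (u v : ℝ) : ofHalfPlane ζ u - ofHalfPlane ζ v =
    ζ * (2 * Complex.I) * (u - v) / ((u + Complex.I) * (v + Complex.I)) := by
  have h1 := ofReal_add_I_ne_zero u
  have h2 := ofReal_add_I_ne_zero v
  unfold ofHalfPlane
  field_simp
  ring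

lemma ofHalfPlane_sub_self (u : ℝ) : ofHalfPlane ζ u - ζ =
    ζ * (-2 * Complex.I) / (u + Complex.I) := by
  have h1 := ofReal_add_I_ne_zero u
  unfold ofHalfPlane
  field_simp
  ring

/-- Twice the oriented area of a triangle. -/
def area (x y z : ℂ) : ℝ := (conj (y - x) * (z - x)).im

lemma area_rotate (x y z : ℂ) : area x y z = area y z x := by
  simp [area]
  ring

lemma area_swap (x y z : ℂ) : area x y z = - area y x z := by
  simp [area]
  ring

lemma area_self (x y : ℂ) : area x x y = 0 := by simp [area]

lemma conj_mul_self_of_norm (hζ : ‖ζ‖ = 1) : conj ζ * ζ = 1 := by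
  rw [mul_comm, Complex.mul_conj, Complex.normSq_eq_norm_sq, hζ]
  simp

lemma inv_mul_aux (u v : ℝ) : ((u : ℂ) - Complex.I)⁻¹ * ((v : ℂ) + Complex.I)⁻¹ =
    ((u : ℂ) + Complex.I) * (v - Complex.I) * (((u ^ 2 + 1) * (v ^ 2 + 1) : ℝ) : ℂ)⁻¹ := by
  have h1 := ofReal_add_I_ne_zero u
  have h2 := ofReal_add_I_ne_zero v
  have e : ∀ x : ℝ, ((x : ℂ) - Complex.I) * (x + Complex.I) = ((x ^ 2 + 1 : ℝ) : ℂ) := by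
    intro x
    push_cast
    linear_combination -Complex.I_sq
  have h3 : ((u : ℂ) - Complex.I) ≠ 0 := by
    intro h0
    have := e u
    rw [h0, zero_mul] at this
    have h4 : (u ^ 2 + 1 : ℝ) ≠ 0 := by positivity
    exact h4 (by exact_mod_cast this.symm)
  have h4 : ((v : ℂ) - Complex.I) ≠ 0 := by
    intro h0
    have := e v
    rw [h0, zero_mul] at this
    have h4 : (v ^ 2 + 1 : ℝ) ≠ 0 := by positivity
    exact h4 (by exact_mod_cast this.symm)
  rw [Complex.ofReal_mul, ← e, ← e]
  field_simp

/-- With the first point at infinity, positive orientation of a triangle on the circle means that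
the coordinates of the other two increase. -/
lemma area_infty (hζ : ‖ζ‖ = 1) (u v : ℝ) : area ζ (ofHalfPlane ζ u) (ofHalfPlane ζ v) =
    4 * (v - u) / ((u ^ 2 + 1) * (v ^ 2 + 1)) := by
  unfold area
  rw [ofHalfPlane_sub_self, ofHalfPlane_sub_self]
  have : conj (ζ * (-2 * Complex.I) / (u + Complex.I)) * (ζ * (-2 * Complex.I) / (v + Complex.I))
      = (conj ζ * ζ) * 4 * (((u : ℂ) - Complex.I)⁻¹ * ((v : ℂ) + Complex.I)⁻¹) := by
    simp only [map_div₀, map_mul, map_add, Complex.conj_I, Complex.conj_ofReal, map_neg, map_ofNat,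
      div_eq_mul_inv]
    ring_nf
    simp
    ring
  rw [this, conj_mul_self_of_norm hζ, inv_mul_aux, ← Complex.ofReal_inv, one_mul, ← mul_assoc,
    Complex.im_mul_ofReal, ← div_eq_mul_inv]
  congr 1
  simp
  ring

lemma area_ofHalfPlane (hζ : ‖ζ‖ = 1) (t u v : ℝ) :
    area (ofHalfPlane ζ t) (ofHalfPlane ζ u) (ofHalfPlane ζ v) =
    4 * ((u - t) * (v - t) * (v - u)) / ((t ^ 2 + 1) * ((u ^ 2 + 1) * (v ^ 2 + 1))) := by
  unfold area
  rw [ofHalfPlane_sub, ofHalfPlane_sub]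
  have : conj (ζ * (2 * Complex.I) * (u - t) / ((u + Complex.I) * (t + Complex.I))) *
      (ζ * (2 * Complex.I) * (v - t) / ((v + Complex.I) * (t + Complex.I)))
      = (conj ζ * ζ) * (4 * (u - t) * (v - t)) * (((t : ℂ) - Complex.I)⁻¹ * ((t : ℂ) + Complex.I)⁻¹)
        * (((u : ℂ) - Complex.I)⁻¹ * ((v : ℂ) + Complex.I)⁻¹) := by
    simp only [map_div₀, map_mul, map_add, Complex.conj_I, Complex.conj_ofReal, map_neg, map_ofNat,
      div_eq_mul_inv, map_sub, mul_inv]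
    ring_nf
    simp
    ring
  have h2 : ((t : ℂ) + Complex.I) * (t - Complex.I) = ((t ^ 2 + 1 : ℝ) : ℂ) := by
    push_cast
    linear_combination -Complex.I_sq
  rw [this, conj_mul_self_of_norm hζ, inv_mul_aux, inv_mul_aux, h2]
  have h3 : ((t ^ 2 + 1 : ℝ) : ℂ) ≠ 0 := by
    have : (t ^ 2 + 1 : ℝ) ≠ 0 := by positivity
    exact_mod_cast this
  have h4 : (1 : ℂ) * (4 * (u - t) * (v - t)) *
      (((t ^ 2 + 1 : ℝ) : ℂ) * (((t ^ 2 + 1) * (t ^ 2 + 1) : ℝ) : ℂ)⁻¹) *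
      (((u : ℂ) + Complex.I) * (v - Complex.I) * (((u ^ 2 + 1) * (v ^ 2 + 1) : ℝ) : ℂ)⁻¹) =
      ((4 * ((u - t) * (v - t)) / ((t ^ 2 + 1) * ((u ^ 2 + 1) * (v ^ 2 + 1))) : ℝ) : ℂ) *
      (((u : ℂ) + Complex.I) * (v - Complex.I)) := by
    push_cast at h3 ⊢
    field_simp
  rw [h4, Complex.im_ofReal_mul]
  have : ((((u : ℂ) + Complex.I) * (v - Complex.I))).im = v - u := by
    simp
    ring
  rw [this]
  ring

end HalfPlane

/-! ### The markings behind a component -/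

namespace NodalData

variable {n : ℕ} {S S' : NodalData n} {a b c : Fin S.numComp} {i j k : Fin n}

variable (S) in
/-- The position of the variable `i` on the component `a`, in the half plane model. -/
def coord (a : Fin S.numComp) (i : Fin n) : ℝ :=
  (halfPlane (S.special a 0) (S.special a i.succ)).re

variable (S) in
/-- The markings of the variables `i` and `j` and the root marking are separated by `a`. -/
def Sep (a : Fin S.numComp) (i j : Fin n) : Prop :=
  S.Behind a i ∧ S.Behind a j ∧ S.special a i.succ ≠ S.special a j.succ

lemma special_ne_zero (a : Fin S.numComp) (i : Fin (n + 1)) : S.special a i ≠ 0 := by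
  intro h
  have := S.norm_special a i
  simp [h] at this

lemma special_of_not_behind (h : ¬ S.Behind a i) : S.special a i.succ = S.special a 0 :=
  special_eq_of_not_btw h

lemma Below.special_eq (h : S.Below a b) (hab : a ≠ b) (hi : S.Behind b i) :
    S.special a i.succ = S.node a (S.dir a b) := by
  have hb : S.Btw a b (S.comp i.succ) := (h.btw hi).symm
  have hne : S.comp i.succ ≠ a := by
    intro he
    rw [he] at hb
    exact hab (btw_self_iff.1 hb).symm
  rw [special_of_ne hne, ← hb.dir_eq hab]

/-- The component that separates `i` from `j` is the last one in front of both. -/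
lemma Sep.below (h : S.Sep a i j) (hi : S.Behind b i) (hj : S.Behind b j) : S.Below b a := by
  rcases Below.total hi h.1 with h1 | h1
  · exact h1
  · by_contra hcon
    have hab : a ≠ b := by
      rintro rfl
      exact hcon h1
    exact h.2.2 ((h1.special_eq hab hi).trans (h1.special_eq hab hj).symm)

lemma Sep.unique (h : S.Sep a i j) (h' : S.Sep b i j) : a = b :=
  (h'.below h.1 h.2.1).antisymm (h.below h'.1 h'.2.1)

lemma coord_eq (h : S.Below a b) (hab : a ≠ b) (hi : S.Behind b i) (hj : S.Behind b j) :
    S.coord a i = S.coord a j := by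
  unfold coord
  rw [h.special_eq hab hi, h.special_eq hab hj]

namespace IsStable

variable (hS : S.IsStable)

include hS

lemma special_ne_iff : S.special a i.succ ≠ S.special a 0 ↔ S.Behind a i := by
  rw [ne_eq, hS.special_eq_iff (Fin.succ_ne_zero i), not_not]
  rfl

lemma exists_sep (hij : i ≠ j) : ∃ a, S.Sep a i j := by
  obtain ⟨m, h1, h2, h3⟩ := exists_median (S.comp i.succ) (S.comp j.succ) (S.comp 0)
  refine ⟨m, h2, h3, fun h => ?_⟩
  exact (hS.special_eq_iff fun h => hij (Fin.succ_injective _ h)).1 h h1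

lemma special_eq_ofHalfPlane (hi : S.Behind a i) :
    S.special a i.succ = ofHalfPlane (S.special a 0) (S.coord a i) := by
  have h := hS.special_ne_iff.2 hi
  unfold coord
  rw [← halfPlane_eq_ofReal (S.norm_special a 0) (S.norm_special a _) h,
    ofHalfPlane_halfPlane (special_ne_zero a 0) h]

lemma coord_eq_iff (hi : S.Behind a i) (hj : S.Behind a j) :
    S.coord a i = S.coord a j ↔ S.special a i.succ = S.special a j.succ := by
  constructor
  · intro h
    rw [hS.special_eq_ofHalfPlane hi, hS.special_eq_ofHalfPlane hj, h]
  · intro h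
    unfold coord
    rw [h]

lemma sep_iff (hi : S.Behind a i) (hj : S.Behind a j) :
    S.Sep a i j ↔ S.coord a i ≠ S.coord a j := by
  rw [ne_eq, hS.coord_eq_iff hi hj]
  exact ⟨fun h => h.2.2, fun h => ⟨hi, hj, h⟩⟩

lemma coord_mono (hij : i ≤ j) (hi : S.Behind a i) (hj : S.Behind a j) :
    S.coord a i ≤ S.coord a j := by
  rcases hij.eq_or_lt with rfl | hij
  · exact le_rfl
  have h : 0 ≤ area (S.special a 0) (S.special a i.succ) (S.special a j.succ) :=
    hS.cyclic a 0 i.succ j.succ (Fin.succ_pos i) (Fin.succ_lt_succ_iff.2 hij)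
  rw [hS.special_eq_ofHalfPlane hi, hS.special_eq_ofHalfPlane hj,
    area_infty (S.norm_special a 0)] at h
  by_contra hlt
  push Not at hlt
  have : 4 * (S.coord a j - S.coord a i) / ((S.coord a i ^ 2 + 1) * (S.coord a j ^ 2 + 1)) < 0 :=
    div_neg_of_neg_of_pos (by linarith) (by positivity)
  linarith

lemma coord_lt (hij : i < j) (h : S.Sep a i j) : S.coord a i < S.coord a j :=
  lt_of_le_of_ne (hS.coord_mono hij.le h.1 h.2.1) ((hS.sep_iff h.1 h.2.1).1 h)

/-- Otherwise `j` would sit at the point at infinity, and the triangle of `i`, `j`, `k` would be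
negatively oriented. -/
lemma behind_of_sep (hij : i < j) (hjk : j < k) (h : S.Sep a i k) : S.Behind a j := by
  by_contra hj
  have h1 : 0 ≤ area (S.special a i.succ) (S.special a j.succ) (S.special a k.succ) :=
    hS.cyclic a i.succ j.succ k.succ (Fin.succ_lt_succ_iff.2 hij) (Fin.succ_lt_succ_iff.2 hjk)
  rw [special_of_not_behind hj, area_swap, hS.special_eq_ofHalfPlane h.1,
    hS.special_eq_ofHalfPlane h.2.1, area_infty (S.norm_special a 0)] at h1
  have h2 := hS.coord_lt (hij.trans hjk) h
  have : 0 < 4 * (S.coord a k - S.coord a i) / ((S.coord a i ^ 2 + 1) * (S.coord a k ^ 2 + 1)) :=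
    div_pos (by linarith) (by positivity)
  linarith

lemma behind_of_le (hij : i ≤ j) (hjk : j ≤ k) (hi : S.Behind a i) (hk : S.Behind a k) :
    S.Behind a j := by
  rcases hij.eq_or_lt with rfl | hij
  · exact hi
  rcases hjk.eq_or_lt with rfl | hjk
  · exact hk
  obtain ⟨b, hb⟩ := hS.exists_sep (hij.trans hjk).ne
  exact (hS.behind_of_sep hij hjk hb).mono (hb.below hi hk)

lemma exists_behind (a : Fin S.numComp) : ∃ i, S.Behind a i := by
  by_contra hcon
  push Not at hcon
  have h1 : Set.range (S.special a) ⊆ {S.special a 0} := by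
    rintro _ ⟨i, rfl⟩
    refine Fin.cases rfl (fun i => ?_) i
    exact special_of_not_behind (hcon i)
  have h2 := (hS.two_le a).trans ((hS.numSpecial_le a).trans
    (Set.ncard_le_ncard h1 (Set.finite_singleton _)))
  rw [Set.ncard_singleton] at h2
  omega

/-- If all variables behind `a` share one position, there are only two special points, which
stability permits on quilted components only. -/
lemma quilted_of_forall (h : ∀ i j, ¬ S.Sep a i j) : a ∈ S.quilted := by
  by_contra ha
  obtain ⟨i, hi⟩ := hS.exists_behind a
  have h1 : Set.range (S.special a) ⊆ {S.special a 0, S.special a i.succ} := by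
    rintro _ ⟨j, rfl⟩
    refine Fin.cases (Or.inl rfl) (fun j => ?_) j
    by_cases hj : S.Behind a j
    · refine Or.inr ?_
      by_contra hne
      exact h j i ⟨hj, hi, hne⟩
    · exact Or.inl (special_of_not_behind hj)
  have h2 := (hS.stable_unquilted a ha).trans ((hS.numSpecial_le a).trans
    (Set.ncard_le_ncard h1 (Set.toFinite _)))
  have h3 := Set.ncard_insert_le (S.special a 0) {S.special a i.succ}
  rw [Set.ncard_singleton] at h3
  omega

/-! ### Quilted components -/

lemma quilted_unique (ha : a ∈ S.quilted) (hb : b ∈ S.quilted) (hi : S.Behind a i)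
    (hj : S.Behind b i) : a = b :=
  (hS.colored i.succ (Fin.succ_ne_zero i)).unique ⟨hi, ha⟩ ⟨hj, hb⟩

lemma exists_quilted (i : Fin n) : ∃ a ∈ S.quilted, S.Behind a i := by
  obtain ⟨a, ⟨h1, h2⟩, -⟩ := hS.colored i.succ (Fin.succ_ne_zero i)
  exact ⟨a, h2, h1⟩

lemma eq_of_below_quilted (h : S.Below a b) (ha : a ∈ S.quilted) (hb : b ∈ S.quilted) : a = b := by
  obtain ⟨i, hi⟩ := hS.exists_behind b
  exact hS.quilted_unique ha hb (hi.mono h) hi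

lemma rootSide_of_below (h : S.Below a b) (hb : b ∈ S.quilted) (hab : a ≠ b) : S.RootSide a := by
  intro c hc hcq
  have := hS.eq_of_below_quilted (Below.trans hc h) hcq hb
  subst this
  exact hab (h.antisymm hc)

lemma isOuter_of_below (h : S.Below a b) (hb : S.IsOuter b) : S.IsOuter a := by
  rcases hb with hb | hb
  · by_cases hab : a = b
    · exact Or.inl (hab ▸ hb)
    · exact Or.inr (hS.rootSide_of_below h hb hab)
  · exact Or.inr fun c hc => hb c (Below.trans hc h)

lemma not_isOuter_of_below (h : S.Below a b) (ha : a ∈ S.quilted) (hab : a ≠ b) :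
    ¬ S.IsOuter b := by
  rintro (hb | hb)
  · exact hab (hS.eq_of_below_quilted h ha hb)
  · exact hb a h ha

lemma below_quilted (ha : S.IsOuter a) (hb : b ∈ S.quilted) (hi : S.Behind a i)
    (hi' : S.Behind b i) : S.Below a b := by
  rcases Below.total hi hi' with h | h
  · exact h
  · rcases ha with ha | ha
    · exact hS.quilted_unique ha hb hi hi' ▸ Below.refl _
    · exact absurd hb (ha b h)

/-- Quilted components are the last outer ones on their paths, so they are determined by the order
and the set of outer components. -/
lemma quilted_iff : a ∈ S.quilted ↔ S.IsOuter a ∧ ∀ b, S.Below a b → S.IsOuter b → b = a := by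
  constructor
  · intro ha
    refine ⟨Or.inl ha, fun b hb ho => ?_⟩
    by_contra hne
    exact hS.not_isOuter_of_below hb ha (Ne.symm hne) ho
  · rintro ⟨h1, h2⟩
    obtain ⟨i, hi⟩ := hS.exists_behind a
    obtain ⟨b, hb, hbi⟩ := hS.exists_quilted i
    exact h2 b (hS.below_quilted h1 hb hi hbi) (Or.inl hb) ▸ hb

/-- The order of the components is determined by the variables behind them, and by which of
them are outer. -/
lemma below_iff : S.Below a b ↔
    (∀ i, S.Behind b i → S.Behind a i) ∧ (S.IsOuter b → S.IsOuter a) := by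
  constructor
  · exact fun h => ⟨fun i hi => hi.mono h, hS.isOuter_of_below h⟩
  · rintro ⟨h1, h2⟩
    obtain ⟨i, hi⟩ := hS.exists_behind b
    rcases Below.total (h1 i hi) hi with h | h
    · exact h
    · by_cases hba : b = a
      · exact hba ▸ Below.refl _
      -- Two comparable components can have the same variables behind them only if the one nearer to
      -- the root sees a single position. Then it is quilted and the farther one is not outer, which
      -- decides the order.
      have hb : b ∈ S.quilted := by
        refine hS.quilted_of_forall fun j k hjk => hjk.2.2 ?_
        rw [h.special_eq hba (h1 j hjk.1), h.special_eq hba (h1 k hjk.2.1)]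
      exact absurd (h2 (Or.inl hb)) (hS.not_isOuter_of_below h hb hba)

lemma isOuter_root : S.IsOuter (S.comp 0) := by
  by_cases h : S.comp 0 ∈ S.quilted
  · exact Or.inl h
  · refine Or.inr fun b hb => ?_
    rw [path_self] at hb
    simp at hb
    exact hb ▸ h

omit hS in
lemma behind_root (i : Fin n) : S.Behind (S.comp 0) i := below_root _

end IsStable

/-! ### Isomorphic trees -/

lemma below_map (f : S.tree ≃g S'.tree) (hc : ∀ i, f (S.comp i) = S'.comp i) :
    S'.Below (f a) (f b) ↔ S.Below a b := by
  unfold Below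
  rw [← hc 0, btw_map]

lemma behind_map (f : S.tree ≃g S'.tree) (hc : ∀ i, f (S.comp i) = S'.comp i) :
    S'.Behind (f a) i ↔ S.Behind a i := by
  unfold Behind
  rw [← hc, below_map f hc]

lemma isOuter_map (f : S.tree ≃g S'.tree) (hc : ∀ i, f (S.comp i) = S'.comp i)
    (hq : ∀ a, f a ∈ S'.quilted ↔ a ∈ S.quilted) : S'.IsOuter (f a) ↔ S.IsOuter a := by
  unfold IsOuter
  rw [rootSide_map f hc hq, hq]

/-! ### The bracketing of a stable disk -/

variable (S) in
/-- The set of variables behind a component. -/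
def behind (a : Fin S.numComp) : Finset (Fin n) := by
  classical exact Finset.univ.filter (S.Behind a)

lemma mem_behind : i ∈ S.behind a ↔ S.Behind a i := by simp [behind]

namespace IsStable

variable (hS : S.IsStable)

include hS

lemma isWord_behind (a : Fin S.numComp) : IsWord (S.behind a) := by
  obtain ⟨i, hi⟩ := hS.exists_behind a
  refine ⟨⟨i, mem_behind.2 hi⟩, ⟨fun j hj k hk l hl => ?_⟩⟩
  have hj := mem_behind.1 hj
  have hk := mem_behind.1 hk
  exact mem_behind.2 (hS.behind_of_le hl.1 hl.2 hj hk)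

lemma behind_subset_iff : S.Below a b ↔
    S.behind b ⊆ S.behind a ∧ (S.IsOuter b → S.IsOuter a) := by
  rw [hS.below_iff]
  simp [Finset.subset_iff, mem_behind]

lemma laminar_behind (a b : Fin S.numComp) : S.behind a ⊆ S.behind b ∨ S.behind b ⊆ S.behind a ∨
    Disjoint (S.behind a) (S.behind b) := by
  by_cases h : Disjoint (S.behind a) (S.behind b)
  · exact Or.inr (Or.inr h)
  · rw [Finset.not_disjoint_iff] at h
    obtain ⟨i, hi, hj⟩ := h
    rcases Below.total (mem_behind.1 hi) (mem_behind.1 hj) with h | h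
    · exact Or.inr (Or.inl (hS.behind_subset_iff.1 h).1)
    · exact Or.inl (hS.behind_subset_iff.1 h).1

lemma exists_sep_of_not_isOuter (h : ¬ S.IsOuter a) : ∃ i j, S.Sep a i j := by
  by_contra hcon
  push Not at hcon
  exact h (Or.inl (hS.quilted_of_forall hcon))

lemma minimal_behind (ha : a ∈ S.quilted) :
    Minimal (fun I => ∃ b, S.IsOuter b ∧ S.behind b = I) (S.behind a) := by
  refine ⟨⟨a, Or.inl ha, rfl⟩, ?_⟩
  rintro _ ⟨b, hb, rfl⟩ hba
  obtain ⟨i, hi⟩ := hS.exists_behind b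
  have := hS.below_quilted hb ha hi (mem_behind.1 (hba (mem_behind.2 hi)))
  exact (hS.behind_subset_iff.1 this).1

open Classical in
/-- The bracketing with one bracket for each component of a stable disk. -/
def bracketing [NeZero n] : PaintedBracketing n where
  inner := Finset.univ.filter fun I => ∃ a, ¬ S.IsOuter a ∧ S.behind a = I
  outer := Finset.univ.filter fun I => ∃ a, S.IsOuter a ∧ S.behind a = I
  inner_word := by
    intro I hI
    obtain ⟨a, ha, rfl⟩ := (Finset.mem_filter.1 hI).2
    refine ⟨hS.isWord_behind a, ?_⟩
    obtain ⟨i, j, hij⟩ := hS.exists_sep_of_not_isOuter ha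
    refine Finset.one_lt_card.2 ⟨i, mem_behind.2 hij.1, j, mem_behind.2 hij.2.1, ?_⟩
    rintro rfl
    exact hij.2.2 rfl
  inner_laminar := by
    intro I hI J hJ
    obtain ⟨a, ha, rfl⟩ := (Finset.mem_filter.1 hI).2
    obtain ⟨b, hb, rfl⟩ := (Finset.mem_filter.1 hJ).2
    exact hS.laminar_behind a b
  outer_word := by
    intro I hI
    obtain ⟨a, ha, rfl⟩ := (Finset.mem_filter.1 hI).2
    exact hS.isWord_behind a
  outer_laminar := by
    intro I hI J hJ
    obtain ⟨a, ha, rfl⟩ := (Finset.mem_filter.1 hI).2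
    obtain ⟨b, hb, rfl⟩ := (Finset.mem_filter.1 hJ).2
    exact hS.laminar_behind a b
  univ_mem := by
    refine Finset.mem_filter.2 ⟨Finset.mem_univ _, S.comp 0, hS.isOuter_root, ?_⟩
    ext i
    simp [mem_behind, behind_root]
  cover := by
    intro i
    obtain ⟨a, ha, hi⟩ := hS.exists_quilted i
    refine ⟨S.behind a, ?_, mem_behind.2 hi⟩
    simpa using hS.minimal_behind ha
  inner_le := by
    intro I hI
    obtain ⟨a, ha, rfl⟩ := (Finset.mem_filter.1 hI).2
    obtain ⟨i, hi⟩ := hS.exists_behind a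
    obtain ⟨b, hb, hbi⟩ := hS.exists_quilted i
    refine ⟨S.behind b, by simpa using hS.minimal_behind hb, ?_⟩
    rcases Below.total hi hbi with h | h
    · exact absurd (hS.isOuter_of_below h (Or.inl hb)) ha
    · exact (hS.behind_subset_iff.1 h).1

lemma mem_inner [NeZero n] {I : Finset (Fin n)} :
    I ∈ hS.bracketing.inner ↔ ∃ a, ¬ S.IsOuter a ∧ S.behind a = I := by
  simp [bracketing]

lemma mem_outer [NeZero n] {I : Finset (Fin n)} :
    I ∈ hS.bracketing.outer ↔ ∃ a, S.IsOuter a ∧ S.behind a = I := by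
  simp [bracketing]

lemma eq_of_behind (h1 : S.behind a = S.behind b) (h2 : S.IsOuter a ↔ S.IsOuter b) : a = b :=
  (hS.behind_subset_iff.2 ⟨h1.symm.subset, h2.2⟩).antisymm
    (hS.behind_subset_iff.2 ⟨h1.subset, h2.1⟩)

/-- Stable disks with the same bracketing have isomorphic trees. -/
lemma exists_treeIso [NeZero n] (hS' : S'.IsStable) (h : hS.bracketing = hS'.bracketing) :
    ∃ f : S.tree ≃g S'.tree, (∀ i, f (S.comp i) = S'.comp i) ∧
      ∀ a, f a ∈ S'.quilted ↔ a ∈ S.quilted := by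
  have key : ∀ {S S' : NodalData n} (hS : S.IsStable) (hS' : S'.IsStable)
      (_ : hS.bracketing = hS'.bracketing) (a : Fin S.numComp),
      ∃ a', S'.behind a' = S.behind a ∧ (S'.IsOuter a' ↔ S.IsOuter a) := by
    intro S S' hS hS' h a
    by_cases ha : S.IsOuter a
    · have := hS.mem_outer.2 ⟨a, ha, rfl⟩
      rw [h, hS'.mem_outer] at this
      obtain ⟨a', h1, h2⟩ := this
      exact ⟨a', h2, by simp [h1, ha]⟩
    · have := hS.mem_inner.2 ⟨a, ha, rfl⟩
      rw [h, hS'.mem_inner] at this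
      obtain ⟨a', h1, h2⟩ := this
      exact ⟨a', h2, by simp [h1, ha]⟩
  choose f hf1 hf2 using key hS hS' h
  choose g hg1 hg2 using key hS' hS h.symm
  -- A component is determined by its set of variables and by being outer, and so is the order.
  -- Edges, positions of markings and quilting are then read off from the order.
  have hbelow : ∀ a b, S'.Below (f a) (f b) ↔ S.Below a b := fun a b => by
    rw [hS.behind_subset_iff, hS'.behind_subset_iff, hf1, hf1, hf2, hf2]
  let e : Fin S.numComp ≃ Fin S'.numComp :=
    { toFun := f
      invFun := g
      left_inv := fun a => hS.eq_of_behind (by rw [hg1, hf1]) (by rw [hg2, hf2])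
      right_inv := fun a => hS'.eq_of_behind (by rw [hf1, hg1]) (by rw [hf2, hg2]) }
  have he : ∀ a, e a = f a := fun _ => rfl
  refine ⟨⟨e, ?_⟩, ?_, ?_⟩
  · intro a b
    rw [adj_iff_below, adj_iff_below, e.forall_congr_right.symm, e.forall_congr_right.symm]
    simp only [he, hbelow]
    simp only [← he, e.injective.ne_iff, e.injective.eq_iff]
  · intro i
    change e (S.comp i) = _
    refine Fin.cases ?_ (fun i => ?_) i
    · refine Below.antisymm ?_ (below_root _)
      have : S'.comp 0 = e (e.symm (S'.comp 0)) := by simp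
      rw [this, he, he, hbelow]
      exact below_root _
    · refine Below.antisymm ?_ ?_
      · change S'.Behind (f (S.comp i.succ)) i
        rw [← mem_behind, hf1, mem_behind]
        exact Below.refl _
      · have h1 : S'.comp i.succ = e (e.symm (S'.comp i.succ)) := by simp
        rw [h1, he, he, hbelow]
        change S.Behind _ i
        rw [← mem_behind, ← hf1, mem_behind, ← he]
        simp only [Equiv.apply_symm_apply]
        exact Below.refl _
  · intro a
    change e a ∈ _ ↔ _
    rw [hS.quilted_iff, hS'.quilted_iff, e.forall_congr_right.symm]
    simp only [he, hbelow, hf2]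
    simp only [← he, e.injective.eq_iff]

lemma sameType_iff [NeZero n] (hS' : S'.IsStable) :
    SameType S S' ↔ hS.bracketing = hS'.bracketing := by
  refine ⟨?_, hS.exists_treeIso hS'⟩
  rintro ⟨f, hc, hq⟩
  have hb : ∀ a, S'.behind (f a) = S.behind a := fun a => by
    ext i
    rw [mem_behind, mem_behind, behind_map f hc]
  have ho : ∀ a, S'.IsOuter (f a) ↔ S.IsOuter a := fun a => isOuter_map f hc hq
  ext I
  · rw [hS.mem_inner, hS'.mem_inner, f.toEquiv.exists_congr_right.symm]
    simp only [RelIso.coe_fn_toEquiv, hb, ho]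
  · rw [hS.mem_outer, hS'.mem_outer, f.toEquiv.exists_congr_right.symm]
    simp only [RelIso.coe_fn_toEquiv, hb, ho]

end IsStable

end NodalData

/-! ### Ratios of distances -/

section Telescope

variable {n : ℕ} [NeZero n]

lemma Fin.ne_zero_of_gap {i k : Fin n} (h : i < k) : k ≠ 0 :=
  ((Fin.zero_le i).trans_lt h).ne'

/-- Subtraction in `Fin n` wraps around, so `k - 1` is the preceding variable only for `k ≠ 0`. -/
lemma Fin.val_pred {k : Fin n} (hk : k ≠ 0) : (k - 1).val + 1 = k.val := by
  rw [Fin.val_sub_one_of_ne_zero hk]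
  have : k.val ≠ 0 := fun h => hk (Fin.ext (by simpa using h))
  omega

lemma Fin.pred_lt {k : Fin n} (hk : k ≠ 0) : k - 1 < k := by
  have := Fin.val_pred hk
  rw [Fin.lt_def]
  omega

lemma Fin.le_pred {i k : Fin n} (hk : i < k) : i ≤ k - 1 := by
  have := Fin.val_pred (Fin.ne_zero_of_gap hk)
  rw [Fin.lt_def] at hk
  rw [Fin.le_def]
  omega

lemma Fin.pred_induction {i : Fin n} {p : Fin n → Prop} (h0 : p i)
    (h1 : ∀ k, i < k → p (k - 1) → p k) {j : Fin n} (hij : i ≤ j) : p j := by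
  obtain ⟨d, hd⟩ : ∃ d, j.val = i.val + d := Nat.exists_eq_add_of_le hij
  induction d generalizing j with
  | zero =>
    have : j = i := Fin.ext (by simpa using hd)
    exact this ▸ h0
  | succ d ih =>
    have hlt : i < j := by
      rw [Fin.lt_def]
      omega
    have := Fin.val_pred (Fin.ne_zero_of_gap hlt)
    exact h1 j hlt (ih (Fin.le_pred hlt) (by omega))

lemma Ioc_eq_insert {i j : Fin n} (hij : i < j) :
    Finset.Ioc i j = insert j (Finset.Ioc i (j - 1)) := by
  have := Fin.val_pred (Fin.ne_zero_of_gap hij)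
  ext k
  simp only [Finset.mem_Ioc, Finset.mem_insert, Fin.lt_def, Fin.le_def, Fin.ext_iff] at *
  omega

lemma sum_Ioc_succ (F : Fin n → ℝ) {i j : Fin n} (hij : i < j) :
    ∑ k ∈ Finset.Ioc i j, F k = F j + ∑ k ∈ Finset.Ioc i (j - 1), F k := by
  rw [Ioc_eq_insert hij, Finset.sum_insert]
  have := Fin.pred_lt (Fin.ne_zero_of_gap hij)
  simp only [Finset.mem_Ioc]
  order

lemma sum_sub_pred (F : Fin n → ℝ) {i j : Fin n} (hij : i ≤ j) :
    ∑ k ∈ Finset.Ioc i j, (F k - F (k - 1)) = F j - F i := by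
  refine Fin.pred_induction (p := fun j => ∑ k ∈ Finset.Ioc i j, (F k - F (k - 1)) = F j - F i)
    (by simp) (fun k hk ih => ?_) hij
  rw [sum_Ioc_succ _ hk, ih]
  ring

end Telescope

/-! ### The ratios of a stable disk -/

namespace NodalData

variable {n : ℕ} [NeZero n] {S S' : NodalData n} {a b c : Fin S.numComp} {i j k : Fin n}

variable (S) in
/-- The height of the seam of `a` in the half plane model. -/
def height (a : Fin S.numComp) : ℝ := (1 - S.radius a) / S.radius a

open Classical in
variable (S) in
/-- The sizes of the gaps on the component `a`, and of the seam if `e = true`, up to a common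
factor. -/
def size (a : Fin S.numComp) (e : Bool) (k : Fin n) : ℝ :=
  if e then
    -- The seam has height zero on the root side. On the leaf side it is infinitely high, so after
    -- normalization it takes all the mass and the gaps get size zero.
    if k = 0 then if a ∈ S.quilted then S.height a else if S.RootSide a then 0 else 1
    else if S.IsOuter a then S.coord a k - S.coord a (k - 1) else 0
  else S.coord a k - S.coord a (k - 1)

lemma size_false : S.size a false k = S.coord a k - S.coord a (k - 1) := by simp [size]

lemma size_outer (h : S.IsOuter a) (hk : k ≠ 0) :
    S.size a true k = S.coord a k - S.coord a (k - 1) := by simp [size, hk, h]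

lemma size_inner (h : ¬ S.IsOuter a) : S.size a true k = if k = 0 then 1 else 0 := by
  have h1 : a ∉ S.quilted := fun hh => h (Or.inl hh)
  have h2 : ¬ S.RootSide a := fun hh => h (Or.inr hh)
  simp [size, h, h1, h2]

lemma size_quilted (h : a ∈ S.quilted) : S.size a true 0 = S.height a := by simp [size, h]

lemma size_rootSide (h : S.RootSide a) : S.size a true 0 = 0 := by
  have : a ∉ S.quilted := h a (btw_left _ _)
  simp [size, h, this]

lemma sum_blocks_true {f : Fin n → ℝ} (hij : i < j) :
    ∑ k ∈ blocks n (i, j, true), f k = f 0 + ∑ k ∈ blocks n (i, j, false), f k := by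
  have : blocks n (i, j, true) = insert 0 (blocks n (i, j, false)) := by simp [blocks, hij]
  rw [this, Finset.sum_insert]
  rw [mem_blocks_false hij]
  exact fun h => absurd h.1 (not_lt_of_ge (Fin.zero_le i))

lemma sum_size_false (hij : i < j) :
    ∑ k ∈ blocks n (i, j, false), S.size a false k = S.coord a j - S.coord a i := by
  simp only [blocks, hij, size_false, if_true]
  exact sum_sub_pred _ hij.le

lemma sum_size_outer (hij : i < j) (h : S.IsOuter a) :
    ∑ k ∈ blocks n (i, j, true), S.size a true k =
      S.size a true 0 + (S.coord a j - S.coord a i) := by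
  rw [sum_blocks_true hij, ← sum_size_false hij]
  congr 1
  refine Finset.sum_congr rfl fun k hk => ?_
  have := (mem_blocks_false hij).1 hk
  rw [size_outer h (Fin.ne_zero_of_gap this.1), size_false]

lemma sum_size_inner (hij : i < j) (h : ¬ S.IsOuter a) :
    ∑ k ∈ blocks n (i, j, true), S.size a true k = 1 := by
  simp only [size_inner h]
  rw [Finset.sum_ite_eq' _ (0 : Fin n), if_pos]
  exact (mem_blocks_true hij).2 (Or.inl rfl)

namespace IsStable

variable (hS : S.IsStable)

include hS

lemma height_pos (ha : a ∈ S.quilted) : 0 < S.height a := by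
  have := hS.radius_mem a ha
  exact div_pos (by linarith [this.2]) this.1

lemma behind_gap (hi : S.Behind a i) (hj : S.Behind a j) (h1 : i < k) (h2 : k ≤ j) :
    S.Behind a (k - 1) ∧ S.Behind a k :=
  ⟨hS.behind_of_le (Fin.le_pred h1) ((Fin.pred_lt (Fin.ne_zero_of_gap h1)).le.trans h2) hi hj,
    hS.behind_of_le h1.le h2 hi hj⟩

lemma gap_nonneg (hi : S.Behind a i) (hj : S.Behind a j) (h1 : i < k) (h2 : k ≤ j) :
    0 ≤ S.coord a k - S.coord a (k - 1) := by
  have h := hS.behind_gap hi hj h1 h2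
  exact sub_nonneg.2 (hS.coord_mono (Fin.pred_lt (Fin.ne_zero_of_gap h1)).le h.1 h.2)

lemma size_zero_nonneg : 0 ≤ S.size a true 0 := by
  by_cases h : S.IsOuter a
  · rcases h with h | h
    · exact size_quilted h ▸ (hS.height_pos h).le
    · exact (size_rootSide h).ge
  · simp [size_inner h]

lemma size_nonneg (hij : i < j) (hi : S.Behind a i) (hj : S.Behind a j) {e : Bool}
    (hk : k ∈ blocks n (i, j, e)) : 0 ≤ S.size a e k := by
  cases e
  · have := (mem_blocks_false hij).1 hk
    rw [size_false]
    exact hS.gap_nonneg hi hj this.1 this.2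
  · rcases (mem_blocks_true hij).1 hk with rfl | h
    · exact hS.size_zero_nonneg
    · by_cases ho : S.IsOuter a
      · rw [size_outer ho (Fin.ne_zero_of_gap h.1)]
        exact hS.gap_nonneg hi hj h.1 h.2
      · rw [size_inner ho]
        split_ifs <;> norm_num

lemma sum_size_pos (hij : i < j) (h : S.Sep a i j) (e : Bool) :
    0 < ∑ k ∈ blocks n (i, j, e), S.size a e k := by
  have h1 := hS.coord_lt hij h
  cases e
  · rw [sum_size_false hij]
    linarith
  · by_cases ho : S.IsOuter a
    · rw [sum_size_outer hij ho]
      have := hS.size_zero_nonneg (a := a)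
      linarith
    · rw [sum_size_inner hij ho]
      exact one_pos

open Classical in
/-- The ratios of the sizes of the gaps and the seam. -/
def ratio (b : Fin n × Fin n × Bool) (k : Fin n) : ℝ :=
  if h : b.1 < b.2.1 then
    if k ∈ blocks n b then
      S.size (hS.exists_sep h.ne).choose b.2.2 k /
        ∑ l ∈ blocks n b, S.size (hS.exists_sep h.ne).choose b.2.2 l
    else 0
  else if k = 0 then 1 else 0

lemma ratio_eq {e : Bool} (hij : i < j) (h : S.Sep a i j) (hk : k ∈ blocks n (i, j, e)) :
    hS.ratio (i, j, e) k = S.size a e k / ∑ l ∈ blocks n (i, j, e), S.size a e l := by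
  have := (hS.exists_sep hij.ne).choose_spec.unique h
  simp only [ratio]
  rw [dif_pos hij, if_pos hk, this]

lemma ratio_eq_zero {b : Fin n × Fin n × Bool} (hk : k ∉ blocks n b) : hS.ratio b k = 0 := by
  unfold ratio
  split_ifs with h1 h2
  · rfl
  · rw [blocks, if_neg h1] at hk
    simp [h2] at hk
  · rfl

lemma ratio_of_not_lt {e : Bool} (hij : ¬ i < j) (k : Fin n) :
    hS.ratio (i, j, e) k = if k = 0 then 1 else 0 := by
  simp [ratio, hij]

/-- On a component, the variables behind a later component have the same position. -/
lemma coord_gap_eq_zero {i' j' : Fin n} (h : S.Sep b i' j') (hab : S.Below a b) (hne : a ≠ b)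
    (h1 : i' < k) (h2 : k ≤ j') : S.coord a k - S.coord a (k - 1) = 0 := by
  have := hS.behind_gap h.1 h.2.1 h1 h2
  rw [coord_eq hab hne this.1 this.2, sub_self]

/-- The component `b` of the smaller block lies behind the component `a` of the larger one. If they
coincide, the sizes agree up to a common factor. If not, the variables of the smaller block have
collapsed to one point of `a`; as to the seam, either `b` is outer and the seam has size zero on
`a`, or the gaps have size zero on `b`. -/
lemma size_mul_size {i' j' : Fin n} {e e' : Bool} (hij : i < j) (hij' : i' < j')
    (ha : S.Sep a i j) (hb : S.Sep b i' j')
    (hsub : blocks n (i', j', e') ⊆ blocks n (i, j, e))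
    {l : Fin n} (hk : k ∈ blocks n (i', j', e')) (hl : l ∈ blocks n (i', j', e')) :
    S.size a e k * S.size b e' l = S.size a e l * S.size b e' k := by
  have hmem : ∀ m, i' < m → m ≤ j' → i < m ∧ m ≤ j := by
    intro m h1 h2
    have hm : m ∈ blocks n (i', j', e') := by
      cases e'
      · exact (mem_blocks_false hij').2 ⟨h1, h2⟩
      · exact (mem_blocks_true hij').2 (Or.inr ⟨h1, h2⟩)
    have := hsub hm
    cases e
    · exact (mem_blocks_false hij).1 this
    · exact ((mem_blocks_true hij).1 this).resolve_left (Fin.ne_zero_of_gap h1)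
  have hjj : j' ≤ j := (hmem j' hij' le_rfl).2
  have hii : i ≤ i' := by
    by_contra hlt
    push Not at hlt
    have hm := (hmem i hlt (by
      have := (hmem j' hij' le_rfl).1
      exact this.le)).1
    exact lt_irrefl _ hm
  have hbelow : S.Below a b := hb.below
    (hS.behind_of_le hii (by order) ha.1 ha.2.1) (hS.behind_of_le (by order) hjj ha.1 ha.2.1)
  have hpos : ∀ m ∈ blocks n (i', j', false), m ≠ 0 := fun m hm =>
    Fin.ne_zero_of_gap ((mem_blocks_false hij').1 hm).1
  have h0 : (0 : Fin n) ∉ blocks n (i, j, false) := fun h =>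
    absurd ((mem_blocks_false hij).1 h).1 (not_lt_of_ge (Fin.zero_le i))
  by_cases hab : a = b
  · subst hab
    cases e <;> cases e'
    · ring
    · exact absurd (hsub ((mem_blocks_true hij').2 (Or.inl rfl))) h0
    · by_cases ho : S.IsOuter a
      · rw [size_outer ho (hpos k hk), size_outer ho (hpos l hl), size_false, size_false]
        ring
      · rw [size_inner ho, size_inner ho, if_neg (hpos k hk), if_neg (hpos l hl)]
        ring
    · ring
  · have hz : ∀ m, i' < m → m ≤ j' → S.size a e m = 0 := by
      intro m h1 h2
      have := hS.coord_gap_eq_zero hb hbelow hab h1 h2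
      cases e
      · rw [size_false, this]
      · by_cases ho : S.IsOuter a
        · rw [size_outer ho (Fin.ne_zero_of_gap h1), this]
        · rw [size_inner ho, if_neg (Fin.ne_zero_of_gap h1)]
    cases e'
    · have hk := (mem_blocks_false hij').1 hk
      have hl := (mem_blocks_false hij').1 hl
      rw [hz k hk.1 hk.2, hz l hl.1 hl.2]
      ring
    · cases e
      · exact absurd (hsub ((mem_blocks_true hij').2 (Or.inl rfl))) h0
      have hseam : ∀ m, i' < m → S.size a true 0 * S.size b true m = 0 := by
        intro m h1
        by_cases ho : S.IsOuter b
        · have : S.RootSide a := by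
            rcases ho with ho | ho
            · exact hS.rootSide_of_below hbelow ho hab
            · exact fun c hc => ho c (Below.trans hc hbelow)
          rw [size_rootSide this, zero_mul]
        · rw [size_inner ho, if_neg (Fin.ne_zero_of_gap h1), mul_zero]
      rcases (mem_blocks_true hij').1 hk with rfl | hk <;>
        rcases (mem_blocks_true hij').1 hl with rfl | hl
      · rfl
      · rw [hseam l hl.1, hz l hl.1 hl.2, zero_mul]
      · rw [hseam k hk.1, hz k hk.1 hk.2, zero_mul]
      · rw [hz k hk.1 hk.2, hz l hl.1 hl.2, zero_mul, zero_mul]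

lemma ratio_mem_compatible : hS.ratio ∈ compatible (blocks n) := by
  refine ⟨⟨?_, fun b k hk => hS.ratio_eq_zero hk, ?_⟩, ?_⟩
  · rintro ⟨i, j, e⟩ k
    by_cases hij : i < j
    · by_cases hk : k ∈ blocks n (i, j, e)
      · obtain ⟨a, ha⟩ := hS.exists_sep hij.ne
        rw [hS.ratio_eq hij ha hk]
        exact div_nonneg (hS.size_nonneg hij ha.1 ha.2.1 hk) (hS.sum_size_pos hij ha e).le
      · exact (hS.ratio_eq_zero hk).ge
    · rw [hS.ratio_of_not_lt hij]
      split_ifs <;> norm_num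
  · rintro ⟨i, j, e⟩
    by_cases hij : i < j
    · obtain ⟨a, ha⟩ := hS.exists_sep hij.ne
      rw [← Finset.sum_subset (Finset.subset_univ (blocks n (i, j, e)))
        fun k _ hk => hS.ratio_eq_zero hk, Finset.sum_congr rfl fun k hk => hS.ratio_eq hij ha hk,
        ← Finset.sum_div]
      exact div_self (hS.sum_size_pos hij ha e).ne'
    · simp [hS.ratio_of_not_lt hij]
  · rintro ⟨i, j, e⟩ ⟨i', j', e'⟩ hsub k hk l hl
    by_cases hij' : i' < j'
    · by_cases hij : i < j
      · obtain ⟨a, ha⟩ := hS.exists_sep hij.ne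
        obtain ⟨b, hb⟩ := hS.exists_sep hij'.ne
        rw [hS.ratio_eq hij ha (hsub hk), hS.ratio_eq hij ha (hsub hl), hS.ratio_eq hij' hb hk,
          hS.ratio_eq hij' hb hl, div_mul_div_comm, div_mul_div_comm,
          hS.size_mul_size hij hij' ha hb hsub hk hl]
      · exfalso
        rw [blocks_of_not_lt hij] at hsub
        have hj : j' ∈ blocks n (i', j', e') := by
          cases e'
          · exact (mem_blocks_false hij').2 ⟨hij', le_rfl⟩
          · exact (mem_blocks_true hij').2 (Or.inr ⟨hij', le_rfl⟩)
        exact Fin.ne_zero_of_gap hij' (Finset.mem_singleton.1 (hsub hj))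
    · rw [blocks_of_not_lt hij', Finset.mem_singleton] at hk hl
      rw [hk, hl]

lemma ratio_ne_zero_iff {e : Bool} (hij : i < j) (h : S.Sep a i j) :
    hS.ratio (i, j, e) k ≠ 0 ↔ k ∈ blocks n (i, j, e) ∧ S.size a e k ≠ 0 := by
  by_cases hk : k ∈ blocks n (i, j, e)
  · rw [hS.ratio_eq hij h hk, ne_eq, div_eq_zero_iff]
    simp [hk, (hS.sum_size_pos hij h e).ne']
  · simp [hS.ratio_eq_zero hk, hk]

lemma exists_of_in {x y : Fin n} (h : hS.bracketing.In x y) :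
    ∃ c, ¬ S.IsOuter c ∧ ∀ i, S.Behind c i ↔ x ≤ i ∧ i ≤ y := by
  obtain ⟨c, h1, h2⟩ := hS.mem_inner.1 h
  refine ⟨c, h1, fun i => ?_⟩
  rw [← mem_behind, h2, Finset.mem_Icc]

lemma exists_of_out {x y : Fin n} (h : hS.bracketing.Out x y) :
    ∃ c, S.IsOuter c ∧ ∀ i, S.Behind c i ↔ x ≤ i ∧ i ≤ y := by
  obtain ⟨c, h1, h2⟩ := hS.mem_outer.1 h.2
  refine ⟨c, h1, fun i => ?_⟩
  rw [← mem_behind, h2, Finset.mem_Icc]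

open Classical in
lemma exists_interval (c : Fin S.numComp) : ∃ x y, (∀ i, S.Behind c i ↔ x ≤ i ∧ i ≤ y) ∧
    (if S.IsOuter c then hS.bracketing.Out x y else hS.bracketing.In x y) := by
  obtain ⟨x, y, hxy, h⟩ := (hS.isWord_behind c).exists_eq_Icc
  refine ⟨x, y, fun i => ?_, ?_⟩
  · rw [← mem_behind, h, Finset.mem_Icc]
  · split_ifs with ho
    · exact ⟨hxy, hS.mem_outer.2 ⟨c, ho, h⟩⟩
    · exact hS.mem_inner.2 ⟨c, ho, h⟩

/-- The bracket of the component that separates `k - 1` from `k` surrounds the gap `k`. The gap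
dominates if and only if this component is `a` itself, that is, if the distance on `a` is nonzero.
-/
lemma gapDom_iff (h : S.Sep a i j) (h1 : i < k) (h2 : k ≤ j) :
    hS.bracketing.GapDom i j k ↔ S.coord a k - S.coord a (k - 1) ≠ 0 := by
  have hk := hS.behind_gap h.1 h.2.1 h1 h2
  have hlt := Fin.pred_lt (Fin.ne_zero_of_gap h1)
  rw [ne_eq, sub_eq_zero, ← ne_eq, ne_comm, ← hS.sep_iff hk.1 hk.2]
  constructor
  · rintro ⟨-, -, h3⟩
    obtain ⟨c, hc⟩ := hS.exists_sep hlt.ne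
    obtain ⟨x, y, hxy, ho⟩ := hS.exists_interval c
    have hx := ((hxy _).1 hc.1).1
    have hy := ((hxy _).1 hc.2.1).2
    have := h3 x y (by split_ifs at ho; exacts [Or.inr ho, Or.inl ho]) (by order) hy
    have hca : S.Below c a := h.below ((hxy i).2 ⟨this.1, by order⟩) ((hxy j).2 ⟨by order, this.2⟩)
    exact (hca.antisymm (hc.below hk.1 hk.2)) ▸ hc
  · intro hs
    refine ⟨h1, h2, fun x y hxy hx hy => ?_⟩
    obtain ⟨c, hc⟩ : ∃ c, ∀ i, S.Behind c i ↔ x ≤ i ∧ i ≤ y := by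
      rcases hxy with hxy | hxy
      · obtain ⟨c, -, hc⟩ := hS.exists_of_in hxy
        exact ⟨c, hc⟩
      · obtain ⟨c, -, hc⟩ := hS.exists_of_out hxy
        exact ⟨c, hc⟩
    have hca : S.Below c a := hs.below ((hc _).2 ⟨Fin.le_pred hx, by order⟩) ((hc _).2 ⟨hx.le, hy⟩)
    exact ⟨((hc i).1 (h.1.mono hca)).1, ((hc j).1 (h.2.1.mono hca)).2⟩

/-- The size of the seam vanishes exactly on the root side, where `a` still lies in front of the
quilted components of `i` and `j` and these differ. -/
lemma sameArg_iff (h : S.Sep a i j) (hij : i < j) :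
    hS.bracketing.SameArg i j ↔ S.size a true 0 ≠ 0 := by
  have hcase : S.size a true 0 ≠ 0 ↔ ¬ S.RootSide a := by
    by_cases ho : S.IsOuter a
    · by_cases hr : S.RootSide a
      · simp [size_rootSide hr, hr]
      · have := ho.resolve_right hr
        simp [size_quilted this, hr, (hS.height_pos this).ne']
    · have : ¬ S.RootSide a := fun hh => ho (Or.inr hh)
      simp [size_inner ho, this]
  rw [hcase, PaintedBracketing.sameArg_iff hij.le]
  constructor
  · intro hall hr
    obtain ⟨c, hc, hci⟩ := hS.exists_quilted i
    obtain ⟨x, y, hxy, ho⟩ := hS.exists_interval c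
    rw [if_pos (show S.IsOuter c from Or.inl hc)] at ho
    have h1 := hall x y ho (Or.inl ((hxy i).1 hci))
    exact hr c (h.below hci ((hxy j).2 ⟨by order, h1.2⟩)) hc
  · intro hr x y hxy hor
    obtain ⟨c, hco, hc⟩ := hS.exists_of_out hxy
    have hca : S.Below c a := by
      have key : ∀ l, S.Behind a l → S.Behind c l → S.Below c a := by
        intro l h1 h2
        by_cases hq : a ∈ S.quilted
        · exact hS.below_quilted hco hq h2 h1
        · rcases Below.total h2 h1 with h3 | h3
          · exact h3
          · exact absurd (hS.isOuter_of_below h3 hco) (by rintro (hh | hh) <;> contradiction)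
      rcases hor with h3 | h3
      · exact key i h.1 ((hc i).2 h3)
      · exact key j h.2.1 ((hc j).2 h3)
    exact ⟨((hc i).1 (h.1.mono hca)).1, ((hc j).1 (h.2.1.mono hca)).2⟩

/-- The support of the ratios is determined by the bracketing. -/
lemma ratio_support (b : Fin n × Fin n × Bool) (k : Fin n) :
    hS.ratio b k ≠ 0 ↔ k ∈ faceSupport hS.bracketing b := by
  obtain ⟨i, j, e⟩ := b
  by_cases hij : i < j
  · obtain ⟨a, ha⟩ := hS.exists_sep hij.ne
    rw [hS.ratio_ne_zero_iff hij ha]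
    cases e
    · rw [mem_blocks_false hij, mem_faceSupport_false hij, size_false]
      constructor
      · exact fun h => (hS.gapDom_iff ha h.1.1 h.1.2).2 h.2
      · exact fun h => ⟨⟨h.1, h.2.1⟩, (hS.gapDom_iff ha h.1 h.2.1).1 h⟩
    · rw [mem_blocks_true hij, mem_faceSupport_true hij]
      by_cases hk : k = 0
      · subst hk
        rw [PaintedBracketing.seamDom_zero_iff hij, hS.sameArg_iff ha hij]
        simp
      · have hsd : hS.bracketing.SeamDom i j k ↔ hS.bracketing.GapDom i j k ∧ S.IsOuter a := by
          unfold PaintedBracketing.SeamDom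
          simp only [hk, false_and, false_or]
          refine and_congr_right fun _ => ⟨fun hI => ?_, fun ho x y hxy hsub => ?_⟩
          · by_contra ho
            obtain ⟨x, y, hxy, hc⟩ := hS.exists_interval a
            rw [if_neg ho] at hc
            exact hI x y hc ⟨((hxy i).1 ha.1).1, ((hxy j).1 ha.2.1).2⟩
          · obtain ⟨c, hco, hc⟩ := hS.exists_of_in hxy
            have := ha.below ((hc i).2 ⟨hsub.1, by order⟩) ((hc j).2 ⟨by order, hsub.2⟩)
            exact hco (hS.isOuter_of_below this ho)
        rw [hsd]
        simp only [hk, false_or]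
        by_cases ho : S.IsOuter a
        · rw [size_outer ho hk]
          constructor
          · exact fun h => ⟨(hS.gapDom_iff ha h.1.1 h.1.2).2 h.2, ho⟩
          · exact fun h => ⟨⟨h.1.1, h.1.2.1⟩, (hS.gapDom_iff ha h.1.1 h.1.2.1).1 h.1⟩
        · simp [size_inner ho, ho, hk]
  · rw [hS.ratio_of_not_lt hij, faceSupport_of_not_lt hij]
    simp

end IsStable

end NodalData

/-! ### Cross-ratios in the half plane model -/

section CrossRatio

variable {ζ : ℂ}

lemma ofHalfPlane_sub' {s t : ℂ} (hs : s + Complex.I ≠ 0) (ht : t + Complex.I ≠ 0) :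
    ofHalfPlane ζ s - ofHalfPlane ζ t =
    ζ * (2 * Complex.I) * (s - t) / ((s + Complex.I) * (t + Complex.I)) := by
  unfold ofHalfPlane
  field_simp
  ring

lemma ofHalfPlane_sub_self' {s : ℂ} (hs : s + Complex.I ≠ 0) :
    ofHalfPlane ζ s - ζ = -(ζ * (2 * Complex.I) / (s + Complex.I)) := by
  unfold ofHalfPlane
  field_simp
  ring

/-- Each difference is the difference of coordinates times factors that depend on single points, and
these cancel. The following lemmas treat the cases in which one of the points is at infinity. -/
lemma crossRatio_ofHalfPlane (hζ : ζ ≠ 0) {s t u v : ℂ} (hs : s + Complex.I ≠ 0)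
    (ht : t + Complex.I ≠ 0) (hu : u + Complex.I ≠ 0) (hv : v + Complex.I ≠ 0) :
    crossRatio (ofHalfPlane ζ s) (ofHalfPlane ζ t) (ofHalfPlane ζ u) (ofHalfPlane ζ v) =
      ((t - u) * (v - s)) / ((s - t) * (u - v)) := by
  unfold crossRatio
  rw [ofHalfPlane_sub' ht hu, ofHalfPlane_sub' hv hs, ofHalfPlane_sub' hs ht, ofHalfPlane_sub' hu hv]
  have hI := Complex.I_ne_zero
  have hK : ζ * (2 * Complex.I) * (ζ * (2 * Complex.I)) /
      ((s + Complex.I) * (t + Complex.I) * ((u + Complex.I) * (v + Complex.I))) ≠ 0 := by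
    simp [hs, ht, hu, hv, hζ]
  rw [← mul_div_mul_left ((t - u) * (v - s)) ((s - t) * (u - v)) hK]
  congr 1 <;> field_simp

lemma crossRatio_infty_left (hζ : ζ ≠ 0) {t u v : ℂ}
    (ht : t + Complex.I ≠ 0) (hu : u + Complex.I ≠ 0) (hv : v + Complex.I ≠ 0) :
    crossRatio ζ (ofHalfPlane ζ t) (ofHalfPlane ζ u) (ofHalfPlane ζ v) = -((t - u) / (u - v)) := by
  unfold crossRatio
  rw [ofHalfPlane_sub' ht hu, ofHalfPlane_sub_self' hv, ofHalfPlane_sub' hu hv,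
    ← neg_sub (ofHalfPlane ζ t), ofHalfPlane_sub_self' ht, neg_neg]
  have hI := Complex.I_ne_zero
  have hK : ζ * (2 * Complex.I) * (ζ * (2 * Complex.I)) /
      ((t + Complex.I) * ((u + Complex.I) * (v + Complex.I))) ≠ 0 := by
    simp [ht, hu, hv, hζ]
  rw [← neg_div, ← mul_div_mul_left _ _ hK]
  congr 1 <;> field_simp

lemma crossRatio_infty_right (hζ : ζ ≠ 0) {s t u : ℂ}
    (hs : s + Complex.I ≠ 0) (ht : t + Complex.I ≠ 0) (hu : u + Complex.I ≠ 0) :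
    crossRatio (ofHalfPlane ζ s) (ofHalfPlane ζ t) (ofHalfPlane ζ u) ζ = -((t - u) / (s - t)) := by
  unfold crossRatio
  rw [ofHalfPlane_sub' ht hu, ofHalfPlane_sub_self' hu, ofHalfPlane_sub' hs ht,
    ← neg_sub (ofHalfPlane ζ s), ofHalfPlane_sub_self' hs, neg_neg]
  have hI := Complex.I_ne_zero
  have hK : -(ζ * (2 * Complex.I) * (ζ * (2 * Complex.I)) /
      ((s + Complex.I) * ((t + Complex.I) * (u + Complex.I)))) ≠ 0 := by
    simp [hs, ht, hu, hζ]
  rw [← neg_div, ← mul_div_mul_left _ _ hK]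
  congr 1 <;> field_simp

lemma crossRatio_infty_third (hζ : ζ ≠ 0) {s t v : ℂ}
    (hs : s + Complex.I ≠ 0) (ht : t + Complex.I ≠ 0) (hv : v + Complex.I ≠ 0) :
    crossRatio (ofHalfPlane ζ s) (ofHalfPlane ζ t) ζ (ofHalfPlane ζ v) = (v - s) / (t - s) := by
  unfold crossRatio
  rw [ofHalfPlane_sub' hv hs, ofHalfPlane_sub_self' ht, ofHalfPlane_sub' hs ht,
    ← neg_sub (ofHalfPlane ζ v), ofHalfPlane_sub_self' hv, neg_neg]
  have hI := Complex.I_ne_zero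
  have hK : -(ζ * (2 * Complex.I) * (ζ * (2 * Complex.I)) /
      ((s + Complex.I) * ((t + Complex.I) * (v + Complex.I)))) ≠ 0 := by
    simp [hs, ht, hv, hζ]
  rw [← mul_div_mul_left (v - s) (t - s) hK]
  congr 1 <;> field_simp
  ring

end CrossRatio

/-- The function `c ↦ 1 / c - 1` from `[0, 1]` to `[0, ∞]`. -/
def odds (c : ℝ) : EReal := ((((ENNReal.ofReal c)⁻¹ - 1 : ENNReal)) : EReal)

/-- The inverse is taken in `ENNReal`, where it is continuous at `0` with value `∞`. -/
lemma continuous_odds : Continuous odds := by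
  unfold odds
  refine continuous_coe_ennreal_ereal.comp ?_
  exact (ENNReal.continuous_sub_right 1).comp (continuous_inv.comp ENNReal.continuous_ofReal)

lemma odds_zero : odds 0 = ⊤ := by simp [odds]

lemma odds_eq {c v : ℝ} (hv : 0 ≤ v) (h : c * (1 + v) = 1) : odds c = v := by
  have hc : 0 < c := by
    by_contra hc
    push Not at hc
    nlinarith
  have : c⁻¹ = 1 + v := inv_eq_of_mul_eq_one_right h
  unfold odds
  rw [← ENNReal.ofReal_inv_of_pos hc, this, ← ENNReal.ofReal_one, ← ENNReal.ofReal_sub _ zero_le_one,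
    add_sub_cancel_left, EReal.coe_ennreal_ofReal, max_eq_left hv]

lemma odds_one : odds 1 = 0 := by
  have := odds_eq (c := 1) le_rfl (by norm_num)
  simpa using this

lemma odds_injOn : Set.InjOn odds (Set.Icc 0 1) := by
  have key : ∀ c ∈ Set.Icc (0 : ℝ) 1, c ≠ 0 → odds c = ((c⁻¹ - 1 : ℝ) : EReal) := by
    intro c hc h0
    have hpos : 0 < c := lt_of_le_of_ne hc.1 h0.symm
    refine odds_eq (sub_nonneg.2 ((one_le_inv₀ hpos).2 hc.2)) ?_
    field_simp
    ring
  intro c hc d hd h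
  by_cases hc0 : c = 0
  · by_cases hd0 : d = 0
    · rw [hc0, hd0]
    · rw [hc0, odds_zero, key d hd hd0] at h
      exact absurd h.symm (EReal.coe_ne_top _)
  · by_cases hd0 : d = 0
    · rw [hd0, odds_zero, key c hc hc0] at h
      exact absurd h (EReal.coe_ne_top _)
    · rw [key c hc hc0, key d hd hd0, EReal.coe_eq_coe_iff] at h
      exact inv_injective (by linarith)

namespace NodalData

variable {n : ℕ} [NeZero n] {S S' : NodalData n} {a b c : Fin S.numComp} {i j k l : Fin n}

/-- The seam is a horocycle at infinity, hence a horizontal line. The power of `w` with respect to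
the seam factors as `|ζ - w|² ((1 - r) - r Im)`, which gives the height `(1 - r) / r`. -/
lemma mem_seam_iff {w : ℂ} (hr : S.radius a ∈ Set.Ioo (0 : ℝ) 1) (hw : w ≠ S.special a 0) :
    w ∈ S.seam a ↔ (halfPlane (S.special a 0) w).im = S.height a := by
  set ζ := S.special a 0
  set r := S.radius a
  have hζ : Complex.normSq ζ = 1 := by
    rw [Complex.normSq_eq_norm_sq, S.norm_special]
    norm_num
  have hN : 0 < Complex.normSq (ζ - w) := Complex.normSq_pos.2 (sub_ne_zero.2 hw.symm)
  have h1 := halfPlane_im hw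
  have h2 : w ∈ S.seam a ↔ Complex.normSq (w - (1 - (r : ℂ)) * ζ) = r ^ 2 := by
    rw [seam, Metric.mem_sphere, dist_eq_norm, Complex.normSq_eq_norm_sq]
    exact (sq_eq_sq₀ (norm_nonneg _) hr.1.le).symm
  have h3 : Complex.normSq (w - (1 - (r : ℂ)) * ζ) - r ^ 2 =
      Complex.normSq (ζ - w) * ((1 - r) - r * (halfPlane ζ w).im) := by
    have h4 : Complex.normSq (w - (1 - (r : ℂ)) * ζ) - r ^ 2 =
      (1 - r) * Complex.normSq (ζ - w) - r * (Complex.normSq ζ - Complex.normSq w)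
        + (Complex.normSq ζ - 1) * (r ^ 2 - 0) := by
      simp [Complex.normSq_apply]
      ring
    rw [h4, hζ, ← hζ, ← h1]
    ring
  rw [h2, ← sub_eq_zero, h3, mul_eq_zero, or_iff_right hN.ne', height, eq_div_iff hr.1.ne']
  constructor <;> intro h <;> linarith

namespace IsStable

variable (hS : S.IsStable)

include hS

/-! ### The cross-ratios in terms of the ratios of distances -/

lemma sum_ratio {x y : Fin n} (h : S.Sep a i j) (hij : i < j) (hix : i ≤ x) (hxy : x ≤ y)
    (hyj : y ≤ j) : ∑ m ∈ Finset.Ioc x y, hS.ratio (i, j, false) m =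
      (S.coord a y - S.coord a x) / (S.coord a j - S.coord a i) := by
  rw [← sum_sub_pred _ hxy, Finset.sum_div, ← sum_size_false hij]
  refine Finset.sum_congr rfl fun m hm => ?_
  have hm := Finset.mem_Ioc.1 hm
  rw [hS.ratio_eq hij h ((mem_blocks_false hij).2 ⟨by order, by order⟩), size_false]

lemma sum_ratio_of_eq {x y x' y' : Fin n} (hij : i < j)
    (hix : i ≤ x) (hxy : x ≤ y) (hyj : y ≤ j)
    (hix' : i ≤ x') (hxy' : x' ≤ y') (hyj' : y' ≤ j)
    (h : ∀ b, S.Sep b i j → S.coord b y - S.coord b x = S.coord b y' - S.coord b x') :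
    ∑ m ∈ Finset.Ioc x y, hS.ratio (i, j, false) m =
      ∑ m ∈ Finset.Ioc x' y', hS.ratio (i, j, false) m := by
  obtain ⟨b, hb⟩ := hS.exists_sep hij.ne
  rw [hS.sum_ratio hb hij hix hxy hyj, hS.sum_ratio hb hij hix' hxy' hyj', h b hb]

lemma sum_ratio_self (hij : i < j) : ∑ m ∈ Finset.Ioc i j, hS.ratio (i, j, false) m = 1 := by
  obtain ⟨b, hb⟩ := hS.exists_sep hij.ne
  have := hS.coord_lt hij hb
  rw [hS.sum_ratio hb hij le_rfl hij.le le_rfl, div_self]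
  linarith

/-- On the component that separates `i` from `j`, the variables behind another component which
has only one of these behind it have the same position. -/
lemma coord_eq_of_sep (h : S.Sep b i j) (hx : S.Behind a i ↔ ¬ S.Behind a j) {x y : Fin n}
    (hxa : S.Behind a x) (hya : S.Behind a y) : S.coord b x = S.coord b y := by
  have hne : b ≠ a := by
    rintro rfl
    exact hx.1 h.1 h.2.1
  have hba : S.Below b a := by
    by_cases hi : S.Behind a i
    · rcases Below.total h.1 hi with h1 | h1
      · exact h1
      · exact absurd (h.2.1.mono h1) (hx.1 hi)
    · have hj : S.Behind a j := by
        by_contra hj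
        exact hi (hx.2 hj)
      rcases Below.total h.2.1 hj with h1 | h1
      · exact h1
      · exact absurd (h.1.mono h1) hi
  exact coord_eq hba hne hxa hya

/-- A component with just one of `i` and `k` behind it lies beyond the component that separates
these two. There `j` has the position of one of them, so a partial sum of ratios is everything or
nothing. This and the next three lemmas give the factors of a cross-ratio when it is evaluated at
such a component. -/
lemma first_eq_one (hij : i < j) (hjk : j < k) (h : ¬ S.Behind a i) (hj : S.Behind a j)
    (hk : S.Behind a k) : ∑ m ∈ Finset.Ioc i j, hS.ratio (i, k, false) m = 1 := by
  rw [← hS.sum_ratio_self (hij.trans hjk)]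
  refine hS.sum_ratio_of_eq (hij.trans hjk) le_rfl hij.le hjk.le le_rfl (by order) le_rfl
    fun b hb => ?_
  rw [hS.coord_eq_of_sep (a := a) hb (by simp [h, hk]) hj hk]

lemma first_eq_zero (hij : i < j) (hjk : j < k) (h : S.Behind a i) (hj : S.Behind a j)
    (hk : ¬ S.Behind a k) : ∑ m ∈ Finset.Ioc i j, hS.ratio (i, k, false) m = 0 := by
  rw [← Finset.sum_empty (f := hS.ratio (i, k, false)), ← Finset.Ioc_self i]
  refine hS.sum_ratio_of_eq (hij.trans hjk) le_rfl hij.le hjk.le le_rfl le_rfl (by order)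
    fun b hb => ?_
  rw [hS.coord_eq_of_sep (a := a) hb (by simp [h, hk]) hj h]

lemma second_eq_one (hij : i < j) (hjk : j < k) (h : S.Behind a i) (hj : S.Behind a j)
    (hk : ¬ S.Behind a k) : ∑ m ∈ Finset.Ioc j k, hS.ratio (i, k, false) m = 1 := by
  rw [← hS.sum_ratio_self (hij.trans hjk)]
  refine hS.sum_ratio_of_eq (hij.trans hjk) hij.le hjk.le le_rfl le_rfl (by order) le_rfl
    fun b hb => ?_
  rw [hS.coord_eq_of_sep (a := a) hb (by simp [h, hk]) hj h]

lemma second_eq_zero (hij : i < j) (hjk : j < k) (h : ¬ S.Behind a i) (hj : S.Behind a j)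
    (hk : S.Behind a k) : ∑ m ∈ Finset.Ioc j k, hS.ratio (i, k, false) m = 0 := by
  rw [← Finset.sum_empty (f := hS.ratio (i, k, false)), ← Finset.Ioc_self i]
  refine hS.sum_ratio_of_eq (hij.trans hjk) hij.le hjk.le le_rfl le_rfl le_rfl (by order)
    fun b hb => ?_
  rw [hS.coord_eq_of_sep (a := a) hb (by simp [h, hk]) hj hk]
  ring

omit [NeZero n] hS in
lemma not_three {p q : ℂ} {i j k l : Fin (n + 1)}
    (h : 3 ≤ ({S.special a i, S.special a j, S.special a k, S.special a l} : Set ℂ).ncard)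
    (hi : S.special a i = p ∨ S.special a i = q) (hj : S.special a j = p ∨ S.special a j = q)
    (hk : S.special a k = p ∨ S.special a k = q) (hl : S.special a l = p ∨ S.special a l = q) :
    False := by
  have hsub : ({S.special a i, S.special a j, S.special a k, S.special a l} : Set ℂ) ⊆ {p, q} := by
    rintro x (rfl | rfl | rfl | rfl) <;> assumption
  have h1 := Set.ncard_le_ncard hsub (Set.toFinite _)
  have h2 := Set.ncard_insert_le p {q}
  rw [Set.ncard_singleton] at h2
  omega

omit [NeZero n] hS in
lemma cross_eq_bot {i j k l : Fin (n + 1)} {c : ℝ}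
    (h : S.special a i = S.special a j ∨ S.special a k = S.special a l) (hc : c = 0) :
    boundaryCrossRatio (S.special a i) (S.special a j) (S.special a k) (S.special a l) =
      -odds c := by
  rw [boundaryCrossRatio, if_pos h, hc, odds_zero, EReal.neg_top]

omit [NeZero n] hS in
lemma cross_eq {i j k l : Fin (n + 1)} {c : ℝ} (v : ℝ)
    (h : S.special a i ≠ S.special a j) (h' : S.special a k ≠ S.special a l)
    (hv : 0 ≤ v) (hcv : c * (1 + v) = 1)
    (hcr : crossRatio (S.special a i) (S.special a j) (S.special a k) (S.special a l) =
      ((-v : ℝ) : ℂ)) :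
    boundaryCrossRatio (S.special a i) (S.special a j) (S.special a k) (S.special a l) =
      -odds c := by
  rw [boundaryCrossRatio, if_neg (by tauto), hcr, Complex.ofReal_re, odds_eq hv hcv, EReal.coe_neg]

/-- The cross-ratio of four points, the first of which is the point at infinity. -/
lemma cross_of_infty {p : Fin (n + 1)} {F : ℝ} (hp : S.special a p = S.special a 0)
    (hjk : j < k) (hkl : k < l) (hF : S.Behind a j → S.Behind a k → F = 1)
    (h : 3 ≤ ({S.special a p, S.special a j.succ, S.special a k.succ, S.special a l.succ} :
      Set ℂ).ncard) :
    boundaryCrossRatio (S.special a p) (S.special a j.succ) (S.special a k.succ)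
      (S.special a l.succ) = -odds (F * ∑ m ∈ Finset.Ioc k l, hS.ratio (j, l, false) m) := by
  have hζ := special_ne_zero a 0
  by_cases hk : S.Behind a k
  · by_cases hj : S.Behind a j
    · rw [hF hj hk, one_mul]
      have hjk' := hS.coord_mono hjk.le hj hk
      have ejj := hS.special_eq_ofHalfPlane hj
      have ekk := hS.special_eq_ofHalfPlane hk
      by_cases hl : S.Behind a l
      · have hkl' := hS.coord_mono hkl.le hk hl
        have ell := hS.special_eq_ofHalfPlane hl
        have hne : S.coord a j ≠ S.coord a l := by
          intro he
          refine not_three h (Or.inl hp) (Or.inr rfl) (Or.inr ?_) (Or.inr ?_)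
          · exact (hS.coord_eq_iff hk hj).1 (by linarith)
          · exact (hS.coord_eq_iff hl hj).1 he.symm
        have hlt : S.coord a j < S.coord a l := lt_of_le_of_ne (by linarith) hne
        rw [hS.sum_ratio ((hS.sep_iff hj hl).2 hne) (hjk.trans hkl) hjk.le hkl.le le_rfl]
        by_cases he : S.coord a k = S.coord a l
        · exact cross_eq_bot (Or.inr ((hS.coord_eq_iff hk hl).1 he)) (by rw [he, sub_self, zero_div])
        · have hkl'' : 0 < S.coord a l - S.coord a k := sub_pos.2 (lt_of_le_of_ne hkl' he)
          -- If `v` is minus the cross-ratio, `1 + v` is the quotient of the distances from `j` to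
          -- `l` and from `k` to `l`, the inverse of the partial sum.
          refine cross_eq ((S.coord a k - S.coord a j) / (S.coord a l - S.coord a k)) ?_ ?_
            (div_nonneg (by linarith) hkl''.le) ?_ ?_
          · rw [hp]
            exact (hS.special_ne_iff.2 hj).symm
          · rwa [ne_eq, ← hS.coord_eq_iff hk hl]
          · have : 0 < S.coord a l - S.coord a j := by linarith
            field_simp
            ring
          · rw [hp, ejj, ekk, ell, crossRatio_infty_left hζ (ofReal_add_I_ne_zero _)
              (ofReal_add_I_ne_zero _) (ofReal_add_I_ne_zero _)]
            push_cast
            rw [← neg_sub (S.coord a k : ℂ) (S.coord a j : ℂ), ← neg_sub (S.coord a l : ℂ), neg_div_neg_eq]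
      · have hlz := special_of_not_behind hl
        rw [hS.second_eq_one hjk hkl hj hk hl]
        refine cross_eq 0 ?_ ?_ le_rfl (by norm_num) ?_
        · rw [hp]
          exact (hS.special_ne_iff.2 hj).symm
        · rw [hlz]
          exact hS.special_ne_iff.2 hk
        · rw [hp, hlz, crossRatio, sub_self, mul_zero, zero_div]
          simp
    · by_cases hl : S.Behind a l
      · refine cross_eq_bot (Or.inl ?_) ?_
        · rw [hp, special_of_not_behind hj]
        · rw [hS.second_eq_zero hjk hkl hj hk hl, mul_zero]
      · exact (not_three h (Or.inl hp) (Or.inl (special_of_not_behind hj)) (Or.inr rfl)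
          (Or.inl (special_of_not_behind hl))).elim
  · by_cases hj : S.Behind a j
    · by_cases hl : S.Behind a l
      · exact absurd (hS.behind_of_le hjk.le hkl.le hj hl) hk
      · exact (not_three h (Or.inl hp) (Or.inr rfl) (Or.inl (special_of_not_behind hk))
          (Or.inl (special_of_not_behind hl))).elim
    · exact (not_three h (Or.inl hp) (Or.inl (special_of_not_behind hj))
        (Or.inl (special_of_not_behind hk)) (Or.inr rfl)).elim

/-- The cross-ratio of four points, the first of which is not the point at infinity. -/
lemma cross_of_behind (hi : S.Behind a i) (hij : i < j) (hjk : j < k) (hkl : k < l)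
    (h : 3 ≤ ({S.special a i.succ, S.special a j.succ, S.special a k.succ, S.special a l.succ} :
      Set ℂ).ncard) :
    boundaryCrossRatio (S.special a i.succ) (S.special a j.succ) (S.special a k.succ)
      (S.special a l.succ) = -odds ((∑ m ∈ Finset.Ioc i j, hS.ratio (i, k, false) m) *
        ∑ m ∈ Finset.Ioc k l, hS.ratio (j, l, false) m) := by
  have hζ := special_ne_zero a 0
  by_cases hj : S.Behind a j
  swap
  · have hk : ¬ S.Behind a k := fun hk => hj (hS.behind_of_le hij.le hjk.le hi hk)
    have hl : ¬ S.Behind a l := fun hl => hj (hS.behind_of_le hij.le (hjk.trans hkl).le hi hl)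
    exact (not_three h (Or.inr rfl) (Or.inl (special_of_not_behind hj))
      (Or.inl (special_of_not_behind hk)) (Or.inl (special_of_not_behind hl))).elim
  by_cases hk : S.Behind a k
  swap
  · have hl : ¬ S.Behind a l := fun hl => hk (hS.behind_of_le hjk.le hkl.le hj hl)
    refine cross_eq_bot (Or.inr ?_) ?_
    · rw [special_of_not_behind hk, special_of_not_behind hl]
    · rw [hS.first_eq_zero hij hjk hi hj hk, zero_mul]
  have hij' := hS.coord_mono hij.le hi hj
  have hjk' := hS.coord_mono hjk.le hj hk
  have eii := hS.special_eq_ofHalfPlane hi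
  have ejj := hS.special_eq_ofHalfPlane hj
  have ekk := hS.special_eq_ofHalfPlane hk
  have hik : S.coord a i ≠ S.coord a k := by
    intro he
    exact not_three h (Or.inl rfl) (Or.inl ((hS.coord_eq_iff hj hi).1 (by linarith)))
      (Or.inl ((hS.coord_eq_iff hk hi).1 he.symm)) (Or.inr rfl)
  have hik' : 0 < S.coord a k - S.coord a i := sub_pos.2 (lt_of_le_of_ne (by linarith) hik)
  rw [hS.sum_ratio ((hS.sep_iff hi hk).2 hik) (hij.trans hjk) le_rfl hij.le hjk.le]
  by_cases hl : S.Behind a l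
  · have hkl' := hS.coord_mono hkl.le hk hl
    have ell := hS.special_eq_ofHalfPlane hl
    have hjl : S.coord a j ≠ S.coord a l := by
      intro he
      exact not_three h (Or.inl rfl) (Or.inr ((hS.coord_eq_iff hj hl).1 he))
        (Or.inr ((hS.coord_eq_iff hk hl).1 (by linarith))) (Or.inr rfl)
    have hjl' : 0 < S.coord a l - S.coord a j := sub_pos.2 (lt_of_le_of_ne (by linarith) hjl)
    rw [hS.sum_ratio ((hS.sep_iff hj hl).2 hjl) (hjk.trans hkl) hjk.le hkl.le le_rfl]
    by_cases he : S.coord a i = S.coord a j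
    · exact cross_eq_bot (Or.inl ((hS.coord_eq_iff hi hj).1 he)) (by rw [he]; simp)
    by_cases he' : S.coord a k = S.coord a l
    · exact cross_eq_bot (Or.inr ((hS.coord_eq_iff hk hl).1 he')) (by rw [he']; simp)
    have h1 : 0 < S.coord a j - S.coord a i := sub_pos.2 (lt_of_le_of_ne hij' he)
    have h2 : 0 < S.coord a l - S.coord a k := sub_pos.2 (lt_of_le_of_ne hkl' he')
    -- Here `1 + v` is the inverse of the product of the two sums by Ptolemy's identity `(k - j)(l -
    -- i) + (j - i)(l - k) = (k - i)(l - j)` for the coordinates.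
    refine cross_eq (((S.coord a k - S.coord a j) * (S.coord a l - S.coord a i)) /
      ((S.coord a j - S.coord a i) * (S.coord a l - S.coord a k))) ?_ ?_ ?_ ?_ ?_
    · rwa [ne_eq, ← hS.coord_eq_iff hi hj]
    · rwa [ne_eq, ← hS.coord_eq_iff hk hl]
    · exact div_nonneg (mul_nonneg (by linarith) (by linarith)) (mul_pos h1 h2).le
    · field_simp
      ring
    · rw [eii, ejj, ekk, ell, crossRatio_ofHalfPlane hζ (ofReal_add_I_ne_zero _)
        (ofReal_add_I_ne_zero _) (ofReal_add_I_ne_zero _) (ofReal_add_I_ne_zero _)]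
      push_cast
      rw [← neg_div, ← neg_mul, neg_sub, ← neg_sub (S.coord a j : ℂ) (S.coord a i : ℂ),
        ← neg_sub (S.coord a l : ℂ) (S.coord a k : ℂ), neg_mul_neg]
  · have hlz := special_of_not_behind hl
    rw [hS.second_eq_one hjk hkl hj hk hl, mul_one]
    by_cases he : S.coord a i = S.coord a j
    · exact cross_eq_bot (Or.inl ((hS.coord_eq_iff hi hj).1 he)) (by rw [he]; simp)
    have h1 : 0 < S.coord a j - S.coord a i := sub_pos.2 (lt_of_le_of_ne hij' he)
    refine cross_eq ((S.coord a k - S.coord a j) / (S.coord a j - S.coord a i)) ?_ ?_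
      (div_nonneg (by linarith) h1.le) ?_ ?_
    · rwa [ne_eq, ← hS.coord_eq_iff hi hj]
    · rw [hlz]
      exact hS.special_ne_iff.2 hk
    · field_simp
      ring
    · rw [hlz, eii, ejj, ekk, crossRatio_infty_right hζ (ofReal_add_I_ne_zero _)
        (ofReal_add_I_ne_zero _) (ofReal_add_I_ne_zero _)]
      push_cast
      rw [← neg_sub (S.coord a k : ℂ) (S.coord a j : ℂ), ← neg_sub (S.coord a j : ℂ) (S.coord a i : ℂ),
        neg_div_neg_eq]

omit [NeZero n] in
lemma exists_three {i j k : Fin (n + 1)} (hij : i < j) (hjk : j < k) (l : Fin (n + 1)) :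
    ∃ a, 3 ≤ ({S.special a i, S.special a j, S.special a k, S.special a l} : Set ℂ).ncard := by
  obtain ⟨m, h1, h2, h3⟩ := exists_median (S.comp i) (S.comp j) (S.comp k)
  refine ⟨m, (Set.two_lt_ncard_iff (Set.toFinite _)).2
    ⟨S.special m i, S.special m j, S.special m k, by simp, by simp, by simp, ?_, ?_, ?_⟩⟩
  · exact fun h => (hS.special_eq_iff hij.ne).1 h h1
  · exact fun h => (hS.special_eq_iff (hij.trans hjk).ne).1 h h2
  · exact fun h => (hS.special_eq_iff hjk.ne).1 h h3

/-- All admissible components give the same value, so the supremum is that of a constant nonempty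
family. -/
lemma rho_zero (hjk : j < k) (hkl : k < l) : S.rho 0 j.succ k.succ l.succ =
    -odds (∑ m ∈ Finset.Ioc k l, hS.ratio (j, l, false) m) := by
  obtain ⟨a, ha⟩ := hS.exists_three (Fin.succ_pos j) (Fin.succ_lt_succ_iff.2 hjk) l.succ
  have : Nonempty {a : Fin S.numComp // 3 ≤ ({S.special a 0, S.special a j.succ,
      S.special a k.succ, S.special a l.succ} : Set ℂ).ncard} := ⟨⟨a, ha⟩⟩
  unfold rho
  rw [iSup_congr fun b => hS.cross_of_infty (F := 1) rfl hjk hkl (fun _ _ => rfl) b.2, iSup_const,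
    one_mul]

lemma rho_succ (hij : i < j) (hjk : j < k) (hkl : k < l) :
    S.rho i.succ j.succ k.succ l.succ =
    -odds ((∑ m ∈ Finset.Ioc i j, hS.ratio (i, k, false) m) *
        ∑ m ∈ Finset.Ioc k l, hS.ratio (j, l, false) m) := by
  obtain ⟨a, ha⟩ := hS.exists_three (Fin.succ_lt_succ_iff.2 hij) (Fin.succ_lt_succ_iff.2 hjk) l.succ
  have : Nonempty {a : Fin S.numComp // 3 ≤ ({S.special a i.succ, S.special a j.succ,
      S.special a k.succ, S.special a l.succ} : Set ℂ).ncard} := ⟨⟨a, ha⟩⟩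
  unfold rho
  rw [iSup_congr fun b => ?_, iSup_const]
  by_cases hi : S.Behind b.1 i
  · exact hS.cross_of_behind hi hij hjk hkl b.2
  · exact hS.cross_of_infty (special_of_not_behind hi) hjk hkl
      (fun h1 h2 => hS.first_eq_one hij hjk hi h1 h2) b.2

/-- On a quilted component the value is the height `h` of the seam divided by the distance `D` of
the variables, and `1 - h / (h + D)` is the share of the gaps. The values `0` and `∞` on other
components correspond to shares `1` and `0`. -/
lemma seamRatioAt_eq (hij : i < j) (h : S.Sep a i j) :
    S.seamRatioAt a i.succ j.succ = odds (1 - hS.ratio (i, j, true) 0) := by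
  have hD : 0 < S.coord a j - S.coord a i := sub_pos.2 (hS.coord_lt hij h)
  rw [hS.ratio_eq hij h ((mem_blocks_true hij).2 (Or.inl rfl))]
  unfold seamRatioAt
  by_cases hq : a ∈ S.quilted
  · have hζ := special_ne_zero a 0
    have hh := hS.height_pos hq
    rw [if_pos hq, sum_size_outer hij (Or.inl hq), size_quilted hq]
    have hval : odds (1 - S.height a / (S.height a + (S.coord a j - S.coord a i))) =
        ((S.height a / (S.coord a j - S.coord a i) : ℝ) : EReal) := by
      refine odds_eq (div_nonneg hh.le hD.le) ?_
      field_simp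
      ring
    rw [hval]
    have : Nonempty {w : ℂ // w ∈ S.seam a ∧ w ≠ S.special a 0} := by
      have him : (0 : ℝ) ≤ (((S.height a : ℝ) : ℂ) * Complex.I).im := by simpa using hh.le
      have hne := ofHalfPlane_ne hζ him
      refine ⟨⟨ofHalfPlane (S.special a 0) ((S.height a : ℝ) * Complex.I), ?_, hne⟩⟩
      rw [mem_seam_iff (hS.radius_mem a hq) hne, halfPlane_ofHalfPlane hζ him]
      simp
    rw [iSup_congr fun w => ?_, iSup_const]
    obtain ⟨w, hw, hne⟩ := w
    rw [mem_seam_iff (hS.radius_mem a hq) hne] at hw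
    have him : (0 : ℝ) ≤ (halfPlane (S.special a 0) w).im := hw ▸ hh.le
    change ((crossRatio _ _ _ w).im : EReal) = _
    rw [EReal.coe_eq_coe_iff, ← ofHalfPlane_halfPlane hζ hne, hS.special_eq_ofHalfPlane h.1,
      hS.special_eq_ofHalfPlane h.2.1, crossRatio_infty_third hζ (ofReal_add_I_ne_zero _)
      (ofReal_add_I_ne_zero _) (add_I_ne_zero him), ← Complex.ofReal_sub, Complex.div_ofReal_im,
      Complex.sub_im, Complex.ofReal_im, sub_zero, hw]
  · rw [if_neg hq]
    by_cases hr : S.RootSide a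
    · rw [if_pos hr, size_rootSide hr, zero_div, sub_zero, odds_one]
    · have ho : ¬ S.IsOuter a := by
        rintro (hh | hh) <;> contradiction
      rw [if_neg hr, sum_size_inner hij ho, size_inner ho]
      simp [odds_zero]

lemma seamRatio_eq (hij : i < j) :
    S.seamRatio i.succ j.succ = odds (1 - hS.ratio (i, j, true) 0) := by
  have hiff : ∀ a, (S.special a 0 ≠ S.special a i.succ ∧ S.special a 0 ≠ S.special a j.succ ∧
      S.special a i.succ ≠ S.special a j.succ) ↔ S.Sep a i j := by
    intro a
    rw [ne_comm, hS.special_ne_iff, ne_comm, hS.special_ne_iff]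
    rfl
  obtain ⟨a, ha⟩ := hS.exists_sep hij.ne
  have : Nonempty {a : Fin S.numComp // S.special a 0 ≠ S.special a i.succ ∧
      S.special a 0 ≠ S.special a j.succ ∧ S.special a i.succ ≠ S.special a j.succ} :=
    ⟨⟨a, (hiff a).2 ha⟩⟩
  unfold seamRatio
  refine (iSup_congr (g := fun _ => odds (1 - hS.ratio (i, j, true) 0)) fun b => ?_).trans iSup_const
  exact hS.seamRatioAt_eq hij ((hiff b.1).1 b.2)

end IsStable

end NodalData

/-! ### Stable disks with the same ratios are isomorphic -/

/-- The affine map `w ↦ r w + m` of the half plane is an automorphism of the disk. -/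
lemma exists_diskAut {ζ ζ' : ℂ} (hζ : ‖ζ‖ = 1) (hζ' : ‖ζ'‖ = 1) {r : ℝ} (hr : 0 < r) (m : ℝ) :
    ∃ φ : DiskAut, φ.app ζ = ζ' ∧
      ∀ w : ℂ, 0 ≤ w.im → φ.app (ofHalfPlane ζ w) = ofHalfPlane ζ' (r * w + m) := by
  -- A square root `σ` of `ζ * ζ'` permits the symmetric form `ζ = σ * conj η`, `ζ' = σ * η`, which
  -- gives a matrix in `SU(1,1)`.
  obtain ⟨σ, hσ⟩ := IsAlgClosed.exists_pow_nat_eq (ζ * ζ') (n := 2) two_pos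
  have hσ1 : ‖σ‖ = 1 := by
    have : ‖σ‖ ^ 2 = 1 := by rw [← norm_pow, hσ, norm_mul, hζ, hζ', one_mul]
    exact (pow_eq_one_iff_of_nonneg (norm_nonneg _) two_ne_zero).1 this
  obtain ⟨η, hηdef⟩ : ∃ η, η = conj σ * ζ' := ⟨_, rfl⟩
  have hη1 : ‖η‖ = 1 := by simp [hηdef, hσ1, hζ']
  have eσ : conj σ * σ = 1 := conj_mul_self_of_norm hσ1
  have eη : conj η * η = 1 := conj_mul_self_of_norm hη1
  have e' : ζ' = σ * η := by
    rw [hηdef]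
    linear_combination (-ζ') * eσ
  have e : ζ = σ * conj η := by
    have hne : ζ' ≠ 0 := by
      intro h0
      simp [h0] at hζ'
    have : ζ * ζ' = (σ * conj η) * ζ' := by
      rw [← hσ]
      linear_combination (-σ ^ 2) * eη - σ * conj η * e'
    exact mul_right_cancel₀ hne this
  have hηc : conj η ≠ 0 := fun h0 => by simp [h0] at eη
  have hσ0 : σ ≠ 0 := fun h0 => by simp [h0] at hσ1
  -- The determinant of the unscaled matrix is `4 r`, which fixes this factor.
  set s : ℝ := (2 * Real.sqrt r)⁻¹
  have hs : s ^ 2 * (4 * r) = 1 := by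
    have : Real.sqrt r ^ 2 = r := Real.sq_sqrt hr.le
    have h0 : Real.sqrt r ≠ 0 := (Real.sqrt_pos.2 hr).ne'
    simp only [s]
    field_simp
    rw [this]
    field_simp
    norm_num
  have hs0 : (s : ℂ) ≠ 0 := by
    intro h0
    have : s = 0 := by exact_mod_cast h0
    simp [this] at hs
  have hr0 : (r : ℂ) ≠ 0 := by exact_mod_cast hr.ne'
  let φ : DiskAut :=
    { a := s * Complex.I * η * (Complex.I * (r + 1) - m)
      b := s * Complex.I * σ * (Complex.I * (r - 1) + m)
      det := by
        have h1 : Complex.normSq η = 1 := by rw [Complex.normSq_eq_norm_sq, hη1, one_pow]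
        have h2 : Complex.normSq σ = 1 := by rw [Complex.normSq_eq_norm_sq, hσ1, one_pow]
        simp only [map_mul, h1, h2, Complex.normSq_I, Complex.normSq_ofReal]
        simp [Complex.normSq_apply]
        linear_combination hs }
  have hb : conj φ.b = -(s * Complex.I * conj σ * (-(Complex.I * (r - 1)) + m)) := by
    simp [φ]
  have ha : conj φ.a = s * Complex.I * conj η * (Complex.I * (r + 1) + m) := by
    simp [φ]
    ring
  refine ⟨φ, ?_, fun w hw => ?_⟩
  · have hnum : φ.a * ζ + φ.b = -2 * s * r * σ := by
      simp only [φ]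
      rw [e]
      linear_combination (s * Complex.I * σ * (Complex.I * (r + 1) - m)) * eη +
        2 * s * σ * r * Complex.I_sq
    have hden : conj φ.b * ζ + conj φ.a = -2 * s * r * conj η := by
      rw [ha, hb, e]
      linear_combination (-(s * Complex.I * conj η * (-(Complex.I * (r - 1)) + m))) * eσ +
        2 * s * conj η * r * Complex.I_sq
    unfold DiskAut.app
    rw [hnum, hden, e', div_eq_iff (by simp [hs0, hr0, hηc])]
    linear_combination (2 * s * r * σ) * eη
  · have hw1 := add_I_ne_zero hw
    have hw2 : (r * w + m : ℂ) + Complex.I ≠ 0 := by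
      apply add_I_ne_zero
      simp
      positivity
    have hnum : φ.a * ofHalfPlane ζ w + φ.b =
        -2 * s * σ * (r * w + m - Complex.I) / (w + Complex.I) := by
      simp only [φ, ofHalfPlane]
      rw [e]
      field_simp
      linear_combination (Complex.I * (w - Complex.I) * (Complex.I * (r + 1) - m)) * eη +
        2 * (r * w + m - Complex.I) * Complex.I_sq
    have hden : conj φ.b * ofHalfPlane ζ w + conj φ.a =
        -2 * s * conj η * (r * w + m + Complex.I) / (w + Complex.I) := by
      rw [ha, hb, ofHalfPlane, e]
      field_simp
      linear_combination (-Complex.I * (w - Complex.I) * (-(Complex.I * (r - 1)) + m)) * eσ +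
        2 * (r * w + m + Complex.I) * Complex.I_sq
    unfold DiskAut.app
    rw [hnum, hden, ofHalfPlane, e']
    have h2 : (-2 * s * conj η * (r * w + m + Complex.I) / (w + Complex.I) : ℂ) ≠ 0 := by
      simp [hs0, hηc, hw1, hw2]
    rw [div_eq_iff h2]
    field_simp
    linear_combination (r * w + m - Complex.I) * eη

namespace NodalData

variable {n : ℕ} [NeZero n] {S S' : NodalData n} {a b c : Fin S.numComp} {i j k l : Fin n}

omit [NeZero n] in
lemma zero_mem_seam (hr : 0 ≤ S.radius a) : S.special a 0 ∈ S.seam a := by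
  rw [seam, Metric.mem_sphere, dist_eq_norm]
  have : S.special a 0 - (1 - (S.radius a : ℂ)) * S.special a 0 = S.radius a * S.special a 0 := by
    ring
  rw [this, norm_mul, norm_special, mul_one, Complex.norm_real, Real.norm_of_nonneg hr]

namespace IsStable

variable (hS : S.IsStable) (hS' : S'.IsStable)

include hS hS'

lemma sep_map (f : S.tree ≃g S'.tree) (hc : ∀ i, f (S.comp i) = S'.comp i) :
    S'.Sep (f a) i j ↔ S.Sep a i j := by
  by_cases hij : i = j
  · subst hij
    simp [Sep]
  · have h : i.succ ≠ j.succ := fun h => hij (Fin.succ_injective _ h)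
    unfold Sep
    rw [behind_map f hc, behind_map f hc, ne_eq, ne_eq, hS.special_eq_iff h, hS'.special_eq_iff h,
      ← hc, ← hc, btw_map]

lemma bracketing_eq_of_ratio (h : hS.ratio = hS'.ratio) : hS.bracketing = hS'.bracketing := by
  refine (faceSystem n).eq_of_forall fun b => Finset.ext fun k => ?_
  rw [← hS.ratio_support, ← hS'.ratio_support, h]

/-- The positions on corresponding components are related by an affine map. -/
lemma exists_affine (h : hS.ratio = hS'.ratio) (f : S.tree ≃g S'.tree)
    (hc : ∀ i, f (S.comp i) = S'.comp i) (hq : ∀ a, f a ∈ S'.quilted ↔ a ∈ S.quilted)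
    (a : Fin S.numComp) : ∃ r m : ℝ, 0 < r ∧
      (∀ i, S.Behind a i → S'.coord (f a) i = r * S.coord a i + m) ∧
      (a ∈ S.quilted → S'.height (f a) = r * S.height a) := by
  obtain ⟨x, y, hxy, -⟩ := hS.exists_interval a
  obtain ⟨i₀, hi₀⟩ := hS.exists_behind a
  have hle : x ≤ y := ((hxy i₀).1 hi₀).1.trans ((hxy i₀).1 hi₀).2
  have hx : S.Behind a x := (hxy x).2 ⟨le_rfl, hle⟩
  have hy : S.Behind a y := (hxy y).2 ⟨hle, le_rfl⟩
  by_cases hs : S.Sep a x y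
  · have hlt : x < y := by
      refine lt_of_le_of_ne hle ?_
      rintro rfl
      exact hs.2.2 rfl
    have hs' := (hS.sep_map hS' f hc).2 hs
    have hD : 0 < S.coord a y - S.coord a x := sub_pos.2 (hS.coord_lt hlt hs)
    have hD' : 0 < S'.coord (f a) y - S'.coord (f a) x := sub_pos.2 (hS'.coord_lt hlt hs')
    -- The affine map is fixed by the first and last variable behind `a`; equality of the ratios
    -- makes it match the other variables and the seam.
    refine ⟨(S'.coord (f a) y - S'.coord (f a) x) / (S.coord a y - S.coord a x),
      S'.coord (f a) x - (S'.coord (f a) y - S'.coord (f a) x) / (S.coord a y - S.coord a x) *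
        S.coord a x, div_pos hD' hD, fun i hi => ?_, fun hqa => ?_⟩
    · have hi := (hxy i).1 hi
      have h1 := hS.sum_ratio hs hlt le_rfl hi.1 hi.2
      have h2 := hS'.sum_ratio hs' hlt le_rfl hi.1 hi.2
      rw [h, h2] at h1
      field_simp at h1 ⊢
      linear_combination h1
    · have h1 := hS.ratio_eq hlt hs ((mem_blocks_true hlt).2 (Or.inl rfl))
      have h2 := hS'.ratio_eq hlt hs' ((mem_blocks_true hlt).2 (Or.inl rfl))
      have hh := hS.height_pos hqa
      have hh' := hS'.height_pos ((hq a).2 hqa)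
      rw [sum_size_outer hlt (Or.inl hqa), size_quilted hqa] at h1
      rw [sum_size_outer hlt (Or.inl ((hq a).2 hqa)), size_quilted ((hq a).2 hqa)] at h2
      rw [h, h2] at h1
      field_simp at h1 ⊢
      linear_combination h1
  · have hcx : S.coord a x = S.coord a y := by
      by_contra hne
      exact hs ((hS.sep_iff hx hy).2 hne)
    have hconst : ∀ i, S.Behind a i → S.coord a i = S.coord a x := by
      intro i hi
      have hi' := (hxy i).1 hi
      have h1 := hS.coord_mono hi'.1 hx hi
      have h2 := hS.coord_mono hi'.2 hi hy
      linarith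
    have hns : ∀ i j, ¬ S.Sep a i j := by
      intro i j hij
      exact (hS.sep_iff hij.1 hij.2.1).1 hij (by rw [hconst i hij.1, hconst j hij.2.1])
    have hqa : a ∈ S.quilted := hS.quilted_of_forall hns
    have hh := hS.height_pos hqa
    have hh' := hS'.height_pos ((hq a).2 hqa)
    -- With a single position on `a`, only the seam is left to fix the scale.
    refine ⟨S'.height (f a) / S.height a,
      S'.coord (f a) x - S'.height (f a) / S.height a * S.coord a x, div_pos hh' hh,
      fun i hi => ?_, fun _ => by field_simp⟩
    rw [hconst i hi]
    have h1 := hns i x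
    rw [← hS.sep_map hS' f hc, hS'.sep_iff ((behind_map f hc).2 hi) ((behind_map f hc).2 hx),
      not_not] at h1
    rw [h1]
    ring

/-- Stable disks with the same ratios of distances are isomorphic. -/
theorem iso_of_ratio_eq (h : hS.ratio = hS'.ratio) : Iso S S' := by
  obtain ⟨f, hc, hq⟩ := hS.exists_treeIso hS' (hS.bracketing_eq_of_ratio hS' h)
  choose r m hr hrm hrh using hS.exists_affine hS' h f hc hq
  choose φ hφ0 hφ using fun a => exists_diskAut (S.norm_special a 0) (S'.norm_special (f a) 0)
    (hr a) (m a)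
  have key : ∀ a i, (φ a).app (S.special a i) = S'.special (f a) i := by
    intro a i
    refine Fin.cases (hφ0 a) (fun i => ?_) i
    by_cases hi : S.Behind a i
    · rw [hS.special_eq_ofHalfPlane hi, hφ a _ (by simp),
        hS'.special_eq_ofHalfPlane ((behind_map f hc).2 hi), hrm a i hi]
      push_cast
      rfl
    · rw [special_of_not_behind hi, hφ0,
        special_of_not_behind fun hh => hi ((behind_map f hc).1 hh)]
  refine ⟨f, φ, hc, fun i => ?_, fun a b hab => ?_, hq, fun a ha => ?_⟩
  · rw [← special_of_eq rfl, key, special_of_eq (hc i).symm]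
  -- A node is the special point of any marking behind it, so it is preserved along with these.
  · obtain ⟨i, h1, h2⟩ := hS.exists_comp hab
    have h3 : S'.comp i ≠ f a := fun hh => h1 (f.injective ((hc i).trans hh))
    have h4 := key a i
    rw [special_of_ne h1, h2, special_of_ne h3, ← hc, dir_map, h2] at h4
    exact h4
  · have ha' := (hq a).2 ha
    have hζ := special_ne_zero a 0
    have hζ' := special_ne_zero (f a) 0
    have hR := hS.radius_mem a ha
    have hR' := hS'.radius_mem (f a) ha'
    have hh := hS.height_pos ha
    have hh' := hS'.height_pos ha'
    apply Set.Subset.antisymm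
    · rintro _ ⟨w, hw, rfl⟩
      by_cases hne : w = S.special a 0
      · rw [hne, hφ0]
        exact zero_mem_seam hR'.1.le
      · rw [mem_seam_iff hR hne] at hw
        have him : 0 ≤ (halfPlane (S.special a 0) w).im := hw ▸ hh.le
        have him' : 0 ≤ ((r a : ℂ) * halfPlane (S.special a 0) w + m a).im := by
          simp [hw]
          exact mul_nonneg (hr a).le hh.le
        have hne' := ofHalfPlane_ne hζ' him'
        rw [← ofHalfPlane_halfPlane hζ hne, hφ a _ him, mem_seam_iff hR' hne',
          halfPlane_ofHalfPlane hζ' him', hrh a ha]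
        simp [hw]
    · intro w hw
      by_cases hne : w = S'.special (f a) 0
      · exact ⟨S.special a 0, zero_mem_seam hR.1.le, by rw [hφ0, hne]⟩
      · rw [mem_seam_iff hR' hne, hrh a ha] at hw
        have hr0 : (r a : ℂ) ≠ 0 := by exact_mod_cast (hr a).ne'
        set W : ℂ := (halfPlane (S'.special (f a) 0) w - m a) / r a
        have hW : W.im = S.height a := by
          have := (hr a).ne'
          simp only [W, Complex.div_ofReal_im, Complex.sub_im, hw, Complex.ofReal_im]
          field_simp
          ring
        have him : 0 ≤ W.im := hW ▸ hh.le
        have hne2 := ofHalfPlane_ne hζ him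
        refine ⟨ofHalfPlane (S.special a 0) W, ?_, ?_⟩
        · rw [mem_seam_iff hR hne2, halfPlane_ofHalfPlane hζ him, hW]
        · have : (r a : ℂ) * W + m a = halfPlane (S'.special (f a) 0) w := by
            simp only [W]
            field_simp
            ring
          rw [hφ a _ him, this, ofHalfPlane_halfPlane hζ' hne]

end IsStable

end NodalData

/-! ### Trees as Hasse diagrams -/

/-- The Hasse diagram of a finite order with a least element, in which the elements below any
given one form a chain, is a tree. -/
lemma isTree_hasse {V : Type} [Finite V] [PartialOrder V] [OrderBot V]
    (h : ∀ v a b : V, a ≤ v → b ≤ v → a ≤ b ∨ b ≤ a) : (SimpleGraph.hasse V).IsTree := by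
  classical
  have hpar : ∀ v : V, ∃ p, v ≠ ⊥ → p ⋖ v := by
    intro v
    by_cases hv : v = ⊥
    · exact ⟨v, fun hh => absurd hv hh⟩
    · obtain ⟨p, -, hp⟩ := exists_le_covBy_of_lt (bot_lt_iff_ne_bot.2 hv)
      exact ⟨p, fun _ => hp⟩
  choose p hp using hpar
  have huniq : ∀ v q, q ⋖ v → q = p v := by
    intro v q hq
    have hv : v ≠ ⊥ := by
      rintro rfl
      exact not_lt_bot hq.lt
    rcases h v q (p v) hq.le (hp v hv).le with h1 | h1
    · exact (hq.eq_or_eq h1 (hp v hv).le).resolve_right (hp v hv).ne |>.symm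
    · exact ((hp v hv).eq_or_eq h1 hq.le).resolve_right hq.ne
  have hreach : ∀ v : V, (SimpleGraph.hasse V).Reachable v ⊥ := by
    intro v
    induction v using WellFoundedLT.induction with
    | ind v ih =>
      by_cases hv : v = ⊥
      · rw [hv]
      · have hadj : (SimpleGraph.hasse V).Adj v (p v) := Or.inr (hp v hv)
        exact hadj.reachable.trans (ih _ (hp v hv).lt)
  have hconn : (SimpleGraph.hasse V).Connected :=
    { preconnected := fun v w => (hreach v).trans (hreach w).symm
      nonempty := ⟨⊥⟩ }
  rw [SimpleGraph.isTree_iff_connected_and_card]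
  refine ⟨hconn, le_antisymm ?_ hconn.card_vert_le_card_edgeSet_add_one⟩
  -- An edge is determined by its upper end, whose parent is unique. A connected graph with fewer
  -- edges than vertices is a tree.
  have hsub : (SimpleGraph.hasse V).edgeSet ⊆ (fun v => s(v, p v)) '' {v : V | v ≠ ⊥} := by
    intro e
    induction e using Sym2.ind with
    | _ v w =>
      rintro (hvw | hvw)
      · refine ⟨w, ?_, ?_⟩
        · rintro rfl
          exact not_lt_bot hvw.lt
        · simp only
          rw [← huniq w v hvw, Sym2.eq_swap]
      · refine ⟨v, ?_, ?_⟩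
        · rintro rfl
          exact not_lt_bot hvw.lt
        · simp only
          rw [← huniq v w hvw]
  have h1 : Nat.card (SimpleGraph.hasse V).edgeSet ≤ {v : V | v ≠ ⊥}.ncard :=
    (Set.ncard_le_ncard hsub (Set.toFinite _)).trans (Set.ncard_image_le (Set.toFinite _))
  have h2 := Set.ncard_add_ncard_compl {v : V | v ≠ ⊥} (Set.toFinite _) (Set.toFinite _)
  have h3 : {v : V | v ≠ ⊥}ᶜ = {⊥} := by
    ext v
    simp
  rw [h3, Set.ncard_singleton] at h2
  omega

/-! ### The tree of a bracketing -/

namespace PaintedBracketing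

variable {n : ℕ} [NeZero n]

/-- The brackets of a bracketing, with the inner ones marked `true`. -/
def Bracket (T : PaintedBracketing n) : Type :=
  {v : Fin n × (Fin n)ᵒᵈ × Bool // (v.2.2 = true → T.In v.1 (OrderDual.ofDual v.2.1)) ∧
    (v.2.2 = false → T.Out v.1 (OrderDual.ofDual v.2.1))}

variable {T : PaintedBracketing n}

namespace Bracket

instance : PartialOrder T.Bracket := inferInstanceAs (PartialOrder {v : _ // _})

instance : Finite T.Bracket := by
  unfold Bracket
  have : Finite ((Fin n)ᵒᵈ) := inferInstanceAs (Finite (Fin n))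
  infer_instance

/-- The first variable of a bracket. -/
def lo (v : T.Bracket) : Fin n := v.1.1

/-- The last variable of a bracket. -/
def hi (v : T.Bracket) : Fin n := OrderDual.ofDual v.1.2.1

/-- Whether a bracket is an inner one. -/
def isInner (v : T.Bracket) : Bool := v.1.2.2

/-- The outer bracket with the given ends. -/
def ofOut {a b : Fin n} (h : T.Out a b) : T.Bracket :=
  ⟨(a, OrderDual.toDual b, false), by simp, fun _ => h⟩

/-- The inner bracket with the given ends. -/
def ofIn {a b : Fin n} (h : T.In a b) : T.Bracket :=
  ⟨(a, OrderDual.toDual b, true), fun _ => h, by simp⟩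

/-- The bracket contains a variable. -/
def Has (v : T.Bracket) (i : Fin n) : Prop := v.lo ≤ i ∧ i ≤ v.hi

variable {v w x : T.Bracket} {i j k : Fin n}

/-- Larger elements are smaller intervals, and an outer bracket precedes the inner bracket with the
same ends. So the root is the least element, as for components. -/
lemma le_iff : v ≤ w ↔ v.lo ≤ w.lo ∧ w.hi ≤ v.hi ∧ (v.isInner = true → w.isInner = true) := by
  change (v.1 ≤ w.1) ↔ _
  rw [Prod.le_def, Prod.le_def]
  change _ ∧ w.hi ≤ v.hi ∧ v.isInner ≤ w.isInner ↔ _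
  rw [Bool.le_iff_imp]
  rfl

lemma isIn (h : v.isInner = true) : T.In v.lo v.hi := v.2.1 h

lemma isOut (h : v.isInner = false) : T.Out v.lo v.hi := v.2.2 h

lemma in_or_out (v : T.Bracket) : T.In v.lo v.hi ∨ T.Out v.lo v.hi := by
  cases h : v.isInner
  · exact Or.inr (isOut h)
  · exact Or.inl (isIn h)

lemma lo_le_hi (v : T.Bracket) : v.lo ≤ v.hi := by
  rcases v.in_or_out with h | h
  · exact h.lt.le
  · exact h.1

lemma has_lo (v : T.Bracket) : v.Has v.lo := ⟨le_rfl, v.lo_le_hi⟩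

lemma has_hi (v : T.Bracket) : v.Has v.hi := ⟨v.lo_le_hi, le_rfl⟩

lemma Has.mono (h : w.Has i) (hvw : v ≤ w) : v.Has i :=
  ⟨(le_iff.1 hvw).1.trans h.1, h.2.trans (le_iff.1 hvw).2.1⟩

lemma Has.total (h : v.Has i) (h' : w.Has i) : v ≤ w ∨ w ≤ v := by
  obtain ⟨h1, h2⟩ := h
  obtain ⟨h3, h4⟩ := h'
  rw [le_iff, le_iff]
  cases hv : v.isInner <;> cases hw : w.isInner
  · rcases (isOut hv).laminar (isOut hw) with e | e | e | e
    · exact Or.inr ⟨e.1, e.2, by simp⟩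
    · exact Or.inl ⟨e.1, e.2, by simp⟩
    · order
    · order
  · rcases (isIn hw).laminar_out (isOut hv) with e | e | e
    · exact Or.inl ⟨e.1, e.2, by simp⟩
    · order
    · order
  · rcases (isIn hv).laminar_out (isOut hw) with e | e | e
    · exact Or.inr ⟨e.1, e.2, by simp⟩
    · order
    · order
  · rcases (isIn hv).laminar (isIn hw) with e | e | e | e
    · exact Or.inr ⟨e.1, e.2, by simp⟩
    · exact Or.inl ⟨e.1, e.2, by simp⟩
    · order
    · order

lemma ext' (h1 : v.lo = w.lo) (h2 : v.hi = w.hi) (h3 : v.isInner = w.isInner) : v = w :=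
  le_antisymm (le_iff.2 ⟨h1.le, h2.ge, fun h => h3 ▸ h⟩) (le_iff.2 ⟨h1.ge, h2.le, fun h => h3 ▸ h⟩)

instance : OrderBot T.Bracket where
  bot := ofOut T.exists_univ.choose_spec.1
  bot_le v := le_iff.2 ⟨Fin.zero_le _, T.exists_univ.choose_spec.2 _, by
    intro h
    exact absurd h (by simp [ofOut, isInner])⟩

lemma has_bot (i : Fin n) : (⊥ : T.Bracket).Has i :=
  ⟨Fin.zero_le _, T.exists_univ.choose_spec.2 _⟩

lemma chain (v a b : T.Bracket) (ha : a ≤ v) (hb : b ≤ v) : a ≤ b ∨ b ≤ a :=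
  (v.has_lo.mono ha).total (v.has_lo.mono hb)

variable (T) in
lemma exists_leaf (i : Fin n) : ∃ t : T.Bracket, ∀ v, v ≤ t ↔ v.Has i := by
  obtain ⟨t, ht⟩ := (Set.toFinite {v : T.Bracket | v.Has i}).exists_maximal ⟨⊥, has_bot i⟩
  refine ⟨t, fun v => ⟨fun h => ht.1.mono h, fun h => ?_⟩⟩
  rcases h.total ht.1 with h1 | h1
  · exact h1
  · exact ht.2 h h1

variable (T) in
/-- The smallest bracket that contains a variable. -/
def leaf (i : Fin n) : T.Bracket := (exists_leaf T i).choose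

lemma le_leaf_iff : v ≤ leaf T i ↔ v.Has i := (exists_leaf T i).choose_spec v

lemma has_leaf (i : Fin n) : (leaf T i).Has i := le_leaf_iff.1 le_rfl

lemma le_of_covBy (h : v ⋖ w) (hx : v < x) (hwi : w.Has i) (hxi : x.Has i) : w ≤ x := by
  rcases hwi.total hxi with h1 | h1
  · exact h1
  · exact (h.eq_or_eq hx.le h1).resolve_left hx.ne' ▸ le_rfl

/-- The brackets that are the arguments of the operation. -/
def IsArg (v : T.Bracket) : Prop := v.isInner = false ∧ T.Min v.lo v.hi

lemma IsArg.eq (hv : v.IsArg) (hw : w.IsArg) (hi : v.Has i) (hi' : w.Has i) : v = w := by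
  obtain ⟨h1, h2⟩ := hi
  obtain ⟨h3, h4⟩ := hi'
  have e1 := (hv.2.laminar hw.2.1).resolve_right (by rintro (h | h) <;> order)
  have e2 := (hw.2.laminar hv.2.1).resolve_right (by rintro (h | h) <;> order)
  exact ext' (le_antisymm e2.1 e1.1) (le_antisymm e1.2 e2.2) (hv.1.trans hw.1.symm)

variable (T) in
lemma exists_isArg (i : Fin n) : ∃ v : T.Bracket, v.IsArg ∧ v.Has i := by
  obtain ⟨a, b, h, h1, h2⟩ := T.exists_min i
  exact ⟨ofOut h.1, ⟨rfl, h⟩, h1, h2⟩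

lemma exists_isArg_lt (hv : v.isInner = true) : ∃ w : T.Bracket, w.IsArg ∧ w ≤ v := by
  obtain ⟨a, b, h, h1, h2⟩ := (isIn hv).exists_min
  exact ⟨ofOut h.1, ⟨rfl, h⟩, le_iff.2 ⟨h1, h2, fun _ => hv⟩⟩

lemma isArg_of_sameArg (hv : v.isInner = false) (h : T.SameArg v.lo v.hi) : v.IsArg := by
  obtain ⟨a, b, hab, h1, h2⟩ := h
  rcases hab.laminar (isOut hv) with e | e | e
  · have e1 : a = v.lo := le_antisymm h1 e.1
    have e2 : b = v.hi := le_antisymm e.2 h2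
    subst e1 e2
    exact ⟨hv, hab⟩
  · have := v.lo_le_hi
    order
  · have := v.lo_le_hi
    order

lemma isArg_of_eq (h : v.lo = v.hi) : v.IsArg := by
  cases hv : v.isInner
  · refine ⟨hv, isOut hv, fun c d hcd h1 h2 => ?_⟩
    have := hcd.1
    constructor <;> order
  · exact absurd h (isIn hv).lt.ne

/-- A gap of a bracket lies in a smaller bracket if it is not one of those at which the bracket is
divided. -/
lemma exists_lt_iff (h1 : v.lo < k) (h2 : k ≤ v.hi) :
    (∃ x, v < x ∧ x.lo < k ∧ k ≤ x.hi) ↔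
      ¬ (if v.isInner then T.GapDom v.lo v.hi k else T.SeamDom v.lo v.hi k) := by
  have hk0 : k ≠ 0 := Fin.ne_zero_of_gap h1
  have hgap : ¬ T.GapDom v.lo v.hi k → ∃ x, v < x ∧ x.lo < k ∧ k ≤ x.hi := by
    intro h
    unfold GapDom at h
    push Not at h
    obtain ⟨a, b, hab, h3, h4, h5⟩ := h h1 h2
    have key : ∀ x : T.Bracket, x.lo = a → x.hi = b → ∃ x : T.Bracket, v < x ∧ x.lo < k ∧ k ≤ x.hi := by
      rintro x rfl rfl
      refine ⟨x, lt_of_le_not_ge ?_ ?_, h3, h4⟩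
      · rcases Has.total (v := v) (w := x) (i := k) ⟨h1.le, h2⟩ ⟨h3.le, h4⟩ with h6 | h6
        · exact h6
        · have := le_iff.1 h6
          exact absurd this.2.1 (h5 this.1).not_ge
      · intro h6
        have := le_iff.1 h6
        exact absurd this.2.1 (h5 this.1).not_ge
    rcases hab with hab | hab
    · exact key (ofIn hab) rfl rfl
    · exact key (ofOut hab) rfl rfl
  have hgap' : ∀ x, v < x → x.lo < k → k ≤ x.hi → T.GapDom v.lo v.hi k → v.lo = x.lo ∧ v.hi = x.hi ∧
      v.isInner = false ∧ x.isInner = true := by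
    intro x hx h3 h4 hg
    have h5 := hg.2.2 _ _ x.in_or_out h3 h4
    have h6 := le_iff.1 hx.le
    have e1 := le_antisymm h6.1 h5.1
    have e2 := le_antisymm h5.2 h6.2.1
    refine ⟨e1, e2, ?_⟩
    have hne : v.isInner ≠ x.isInner := fun h => hx.ne (ext' e1 e2 h)
    cases hv : v.isInner <;> cases hxi : x.isInner <;> simp_all
  cases hv : v.isInner
  · simp only [Bool.false_eq_true, if_false]
    constructor
    · rintro ⟨x, hx, h3, h4⟩ hs
      have hs : T.GapDom v.lo v.hi k ∧ ∀ a b, T.In a b → ¬ (a ≤ v.lo ∧ v.hi ≤ b) :=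
        hs.resolve_left fun hh => hk0 hh.1
      obtain ⟨e1, e2, -, e4⟩ := hgap' x hx h3 h4 hs.1
      exact hs.2 _ _ (isIn e4) ⟨e1.ge, e2.le⟩
    · intro hs
      by_cases hg : T.GapDom v.lo v.hi k
      · have : ∃ a b, T.In a b ∧ a ≤ v.lo ∧ v.hi ≤ b := by
          by_contra hcon
          push Not at hcon
          exact hs (Or.inr ⟨hg, fun a b hab hh => absurd hh.2 (hcon a b hab hh.1).not_ge⟩)
        obtain ⟨a, b, hab, h3, h4⟩ := this
        refine ⟨ofIn hab, lt_of_le_not_ge ?_ fun h5 => ?_, h3.trans_lt h1, h2.trans h4⟩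
        · rcases Has.total (v := v) (w := ofIn hab) (i := v.lo) v.has_lo
            ⟨h3, v.lo_le_hi.trans h4⟩ with h6 | h6
          · exact h6
          · have := (le_iff.1 h6).2.2 rfl
            rw [hv] at this
            simp at this
        · have := (le_iff.1 h5).2.2 rfl
          rw [hv] at this
          simp at this
      · exact hgap hg
  · simp only [if_true]
    constructor
    · rintro ⟨x, hx, h3, h4⟩ hg
      have := (hgap' x hx h3 h4 hg).2.2.1
      rw [hv] at this
      simp at this
    · exact hgap

end Bracket

end PaintedBracketing

/-! ### The disk with given ratios -/

namespace PaintedBracketing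

namespace Bracket

variable {n : ℕ} [NeZero n] {T : PaintedBracketing n} {v w x : T.Bracket} {i j k : Fin n}
  {y : Fin n × Fin n × Bool → Fin n → ℝ}

/-- The distance between the variables `k - 1` and `k` on the component of a bracket. -/
def gap (y : Fin n × Fin n × Bool → Fin n → ℝ) (v : T.Bracket) (k : Fin n) : ℝ :=
  -- On an outer bracket the ratios with the seam are used, so that gaps and `seamHeight` have a
  -- common scale; on an inner one those would vanish.
  y (v.lo, v.hi, !v.isInner) k

/-- The position of a variable on the component of a bracket. -/
def pos (y : Fin n × Fin n × Bool → Fin n → ℝ) (v : T.Bracket) (i : Fin n) : ℝ :=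
  ∑ k ∈ Finset.Ioc v.lo i, gap y v k

/-- The height of the seam on the component of a bracket. -/
def seamHeight (y : Fin n × Fin n × Bool → Fin n → ℝ) (v : T.Bracket) : ℝ :=
  y (v.lo, v.hi, true) 0

lemma pos_sub_pred (h : v.lo < k) : pos y v k - pos y v (k - 1) = gap y v k := by
  unfold pos
  rw [sum_Ioc_succ _ h]
  ring

lemma pos_sub (hi : v.lo ≤ i) (hij : i ≤ j) :
    pos y v j - pos y v i = ∑ k ∈ Finset.Ioc i j, gap y v k := by
  rw [← sum_sub_pred _ hij]
  refine Finset.sum_congr rfl fun k hk => pos_sub_pred ?_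
  exact hi.trans_lt (Finset.mem_Ioc.1 hk).1

section

variable (hy : y ∈ compatible (blocks n))

include hy

lemma pos_mono (hi : v.lo ≤ i) (hij : i ≤ j) : pos y v i ≤ pos y v j := by
  rw [← sub_nonneg, pos_sub hi hij]
  exact Finset.sum_nonneg fun k _ => hy.1.1 _ k

variable (hT : ∀ b k, y b k ≠ 0 ↔ k ∈ faceSupport T b)

include hT

omit hy in
lemma gap_eq_zero_iff (h1 : v.lo < k) (h2 : k ≤ v.hi) :
    gap y v k = 0 ↔ ∃ x, v < x ∧ x.lo < k ∧ k ≤ x.hi := by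
  have hlt := h1.trans_le h2
  rw [exists_lt_iff h1 h2, ← not_iff_not, not_not, ← ne_eq, gap, hT]
  cases v.isInner
  · rw [Bool.not_false, mem_faceSupport_true hlt]
    simp
  · rw [Bool.not_true, mem_faceSupport_false hlt]
    simp

omit hy in
lemma pos_eq_of_lt (hx : v < x) (hi : x.Has i) (hj : x.Has j) : pos y v i = pos y v j := by
  have key : ∀ i j : Fin n, x.Has i → x.Has j → i ≤ j → pos y v i = pos y v j := by
    intro i j hi hj hij
    have hvi := hi.mono hx.le
    have hvj := hj.mono hx.le
    rw [eq_comm, ← sub_eq_zero, pos_sub hvi.1 hij]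
    refine Finset.sum_eq_zero fun k hk => ?_
    have hk := Finset.mem_Ioc.1 hk
    exact (gap_eq_zero_iff hT (hvi.1.trans_lt hk.1) (hk.2.trans hvj.2)).2
      ⟨x, hx, hi.1.trans_lt hk.1, hk.2.trans hj.2⟩
  rcases le_total i j with h | h
  · exact key i j hi hj h
  · exact (key j i hj hi h).symm

/-- All gaps between `i` and `j` vanish, so each lies in a smaller bracket. Brackets around
neighbouring gaps share a variable and are therefore nested, so the larger one covers both; going
from `i` to `j` yields one bracket. -/
lemma exists_of_pos_eq (hi : v.Has i) (hj : v.Has j) (hij : i < j) (h : pos y v i = pos y v j) :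
    ∃ x, v < x ∧ x.Has i ∧ x.Has j := by
  have hz : ∀ k, i < k → k ≤ j → ∃ x, v < x ∧ x.lo < k ∧ k ≤ x.hi := by
    intro k h1 h2
    have h3 := pos_sub_pred (y := y) (hi.1.trans_lt h1)
    have h4 := pos_mono hy hi.1 (Fin.le_pred h1)
    have h5 := pos_mono hy (hi.1.trans h1.le) h2
    have h6 := pos_mono hy (hi.1.trans (Fin.le_pred h1)) (Fin.pred_lt (Fin.ne_zero_of_gap h1)).le
    refine (gap_eq_zero_iff hT (hi.1.trans_lt h1) (h2.trans hj.2)).1 ?_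
    rw [← h3]
    linarith
  refine (Fin.pred_induction (p := fun k => k ≤ j → i = k ∨ ∃ x, v < x ∧ x.Has i ∧ x.Has k)
    (fun _ => Or.inl rfl) (fun k hk ih hkj => ?_) hij.le le_rfl).resolve_left hij.ne
  have hlt := Fin.pred_lt (Fin.ne_zero_of_gap hk)
  obtain ⟨x, hx, h1, h2⟩ := hz k hk hkj
  have h3 : x.Has (k - 1) := ⟨Fin.le_pred h1, hlt.le.trans h2⟩
  have h4 : x.Has k := ⟨h1.le, h2⟩
  refine Or.inr ?_
  rcases ih (hlt.le.trans hkj) with h5 | ⟨x', hx', h5, h6⟩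
  · exact ⟨x, hx, h5 ▸ h3, h4⟩
  · rcases h3.total h6 with h7 | h7
    · exact ⟨x, hx, h5.mono h7, h4⟩
    · exact ⟨x', hx', h5, h4.mono h7⟩

lemma exists_of_pos_eq' (hi : v.Has i) (hj : v.Has j) (hij : i ≠ j) (h : pos y v i = pos y v j) :
    ∃ x, v < x ∧ x.Has i ∧ x.Has j := by
  rcases lt_or_gt_of_ne hij with h1 | h1
  · exact exists_of_pos_eq hy hT hi hj h1 h
  · obtain ⟨x, h2, h3, h4⟩ := exists_of_pos_eq hy hT hj hi h1 h.symm
    exact ⟨x, h2, h4, h3⟩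

lemma seamHeight_pos (hv : v.IsArg) : 0 < seamHeight y v := by
  refine lt_of_le_of_ne (hy.1.1 _ _) (Ne.symm ?_)
  rw [seamHeight, hT]
  by_cases h : v.lo < v.hi
  · rw [mem_faceSupport_true h, seamDom_zero_iff h]
    exact ⟨_, _, hv.2, le_rfl, le_rfl⟩
  · rw [faceSupport_of_not_lt h]
    simp

end

end Bracket

end PaintedBracketing

open PaintedBracketing PaintedBracketing.Bracket

section Model

variable {n : ℕ} [NeZero n] (T : PaintedBracketing n) (y : Fin n × Fin n × Bool → Fin n → ℝ)

/-- The boundary point with the given coordinate. -/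
def boundaryPoint (u : ℝ) : Circle := 
  ⟨ofHalfPlane 1 u, mem_sphere_zero_iff_norm.2 (norm_ofHalfPlane (by simp) u)⟩

/-- An enumeration of the brackets. -/
def enum : Fin (Nat.card T.Bracket) ≃ T.Bracket := (Finite.equivFin T.Bracket).symm

open Classical in
/-- The disk with one component for each bracket. -/
def model : NodalData n where
  numComp := Nat.card T.Bracket
  tree := (SimpleGraph.hasse T.Bracket).comap (enum T)
  isTree := (SimpleGraph.Iso.isTree_iff (SimpleGraph.Iso.comap (enum T) _)).2 (isTree_hasse chain)
  comp := Fin.cases ((enum T).symm ⊥) fun i => (enum T).symm (leaf T i)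
  mark := Fin.cases 1 fun i => boundaryPoint (pos y (leaf T i) i)
  -- The special point towards the root is `1` on every component. A node away from the root has the
  -- position of any variable behind it, for instance the first.
  node a b := if enum T a < enum T b then boundaryPoint (pos y (enum T a) (enum T b).lo) else 1
  quilted := {a | (enum T a).IsArg}
  -- This inverts the formula `(1 - r) / r` for the height of the seam.
  radius a := (1 + seamHeight y (enum T a))⁻¹

variable {T y} {a b : Fin (model T y).numComp} {i j k : Fin n}

/-- The bracket of a component of the model. -/
def br (a : Fin (model T y).numComp) : T.Bracket := enum T a

lemma br_injective : Function.Injective (br (T := T) (y := y)) := (enum T).injective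

lemma br_surjective : Function.Surjective (br (T := T) (y := y)) := (enum T).surjective

lemma br_zero : br ((model T y).comp 0) = ⊥ := (enum T).apply_symm_apply _

lemma br_succ (i : Fin n) : br ((model T y).comp i.succ) = leaf T i := (enum T).apply_symm_apply _

lemma model_adj : (model T y).tree.Adj a b ↔ br a ⋖ br b ∨ br b ⋖ br a := Iff.rfl

lemma mem_quilted : a ∈ (model T y).quilted ↔ (br a).IsArg := Iff.rfl

lemma boundaryPoint_coe (u : ℝ) : (boundaryPoint u : ℂ) = ofHalfPlane 1 u := rfl

lemma boundaryPoint_ne_one (u : ℝ) : boundaryPoint u ≠ 1 := by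
  intro h
  have := congrArg (fun z : Circle => (z : ℂ)) h
  simp only [boundaryPoint_coe, Circle.coe_one] at this
  exact ofHalfPlane_ne one_ne_zero (by simp) this

lemma boundaryPoint_inj {u v : ℝ} (h : boundaryPoint u = boundaryPoint v) : u = v := by
  have := congrArg (fun z : Circle => halfPlane 1 (z : ℂ)) h
  simp only [boundaryPoint_coe] at this
  rw [halfPlane_ofHalfPlane one_ne_zero (by simp), halfPlane_ofHalfPlane one_ne_zero (by simp)] at this
  exact_mod_cast this

lemma model_node_of_lt (h : br a < br b) :
    (model T y).node a b = boundaryPoint (pos y (br a) (br b).lo) := if_pos h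

lemma model_node_of_not_lt (h : ¬ br a < br b) : (model T y).node a b = 1 := if_neg h

lemma model_mark_zero : (model T y).mark 0 = 1 := rfl

lemma model_mark_succ (i : Fin n) :
    (model T y).mark i.succ = boundaryPoint (pos y (leaf T i) i) := rfl

open NodalData

/-- By induction along the order: the path to the root from a component begins with the edge to its
unique parent. -/
lemma model_below : (model T y).Below a b ↔ br a ≤ br b := by
  obtain ⟨v, hv⟩ : ∃ v, br b = v := ⟨_, rfl⟩
  induction v using WellFoundedLT.induction generalizing a b with
  | ind v ih =>
    by_cases h0 : br b = ⊥
    · obtain rfl : b = (model T y).comp 0 := br_injective (h0.trans br_zero.symm)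
      rw [Below, btw_self_iff, br_zero, le_bot_iff, ← br_zero (y := y), br_injective.eq_iff]
    · obtain ⟨p, -, hp⟩ := exists_le_covBy_of_lt (bot_lt_iff_ne_bot.2 h0)
      obtain ⟨c, rfl⟩ := br_surjective (y := y) p
      have ih' : ∀ a, (model T y).Below a c ↔ br a ≤ br c := fun a => ih _ (hv ▸ hp.lt) rfl
      have hadj : (model T y).tree.Adj b c := model_adj.2 (Or.inr hp)
      have hpath : (model T y).path b ((model T y).comp 0) =
          .cons hadj ((model T y).path c ((model T y).comp 0)) := by
        refine (path_unique ?_).symm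
        rw [SimpleGraph.Walk.cons_isPath_iff]
        exact ⟨(model T y).path_isPath _ _, fun h => hp.lt.not_ge ((ih' b).1 h)⟩
      have hiff : (model T y).Below a b ↔ a = b ∨ (model T y).Below a c := by
        unfold Below NodalData.Btw
        rw [hpath]
        simp
      rw [hiff, ih']
      constructor
      · rintro (rfl | h)
        · exact le_rfl
        · exact h.trans hp.le
      · intro h
        rcases h.eq_or_lt with h | h
        · exact Or.inl (br_injective h)
        · rcases chain _ _ _ h.le hp.le with h1 | h1
          · exact Or.inr h1
          · exact Or.inr ((hp.eq_or_eq h1 h.le).resolve_right h.ne).le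

lemma model_behind : (model T y).Behind a i ↔ (br a).Has i := by
  rw [Behind, model_below, br_succ, le_leaf_iff]

lemma model_special_zero (a : Fin (model T y).numComp) : (model T y).special a 0 = 1 := by
  by_cases h : (model T y).comp 0 = a
  · rw [special_of_eq h, model_mark_zero, Circle.coe_one]
  · rw [special_of_ne h, model_node_of_not_lt, Circle.coe_one]
    have : (model T y).Below ((model T y).dir a ((model T y).comp 0)) a := btw_dir _ _
    exact (model_below.1 this).not_gt

lemma model_isOuter : (model T y).IsOuter a ↔ (br a).isInner = false := by
  unfold IsOuter
  rw [mem_quilted, rootSide_iff]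
  constructor
  · rintro (h | h)
    · exact h.1
    · by_contra hv
      obtain ⟨w, hw, hle⟩ := exists_isArg_lt (by simpa using hv)
      obtain ⟨b, rfl⟩ := br_surjective (y := y) w
      exact h b (model_below.2 hle) hw
  · intro hv
    by_cases h : (br a).IsArg
    · exact Or.inl h
    · refine Or.inr fun b hb hq => h ?_
      have hle := model_below.1 hb
      have hq : (br b).IsArg := hq
      have h1 := le_iff.1 hle
      exact isArg_of_sameArg hv ⟨_, _, hq.2, h1.1, h1.2.1⟩

variable (hT : ∀ b k, y b k ≠ 0 ↔ k ∈ faceSupport T b)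

include hT

lemma model_special (h : (model T y).Behind a i) :
    (model T y).special a i.succ = ofHalfPlane 1 (pos y (br a) i) := by
  by_cases hc : (model T y).comp i.succ = a
  · rw [special_of_eq hc, model_mark_succ, boundaryPoint_coe, ← hc, br_succ]
  · have hb := btw_dir a ((model T y).comp i.succ)
    have h1 : (model T y).Below a ((model T y).dir a ((model T y).comp i.succ)) :=
      Btw.trans_right h hb.symm
    have h2 : (model T y).Behind ((model T y).dir a ((model T y).comp i.succ)) i :=
      (Btw.or h).2 (Or.inl hb.symm)
    have hlt : br a < br ((model T y).dir a ((model T y).comp i.succ)) :=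
      lt_of_le_of_ne (model_below.1 h1) (br_injective.ne (adj_dir (Ne.symm hc)).ne)
    rw [special_of_ne hc, model_node_of_lt hlt, boundaryPoint_coe,
      pos_eq_of_lt hT hlt (has_lo _) (model_behind.1 h2)]

variable (hy : y ∈ compatible (blocks n))

include hy

lemma model_isStable : (model T y).IsStable := by
  have hmark : ∀ i j : Fin n, i ≠ j → (model T y).comp i.succ = (model T y).comp j.succ →
      (model T y).mark i.succ ≠ (model T y).mark j.succ := by
    intro i j hij hc h
    have hl : leaf T i = leaf T j := by rw [← br_succ (y := y), hc, br_succ]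
    have hj : (leaf T i).Has j := hl ▸ has_leaf j
    rw [model_mark_succ, model_mark_succ, ← hl] at h
    obtain ⟨x, hx, hxi, -⟩ := exists_of_pos_eq' hy hT (has_leaf i) hj hij (boundaryPoint_inj h)
    exact hx.not_ge (le_leaf_iff.2 hxi)
  have hchild : ∀ a b c : Fin (model T y).numComp, br a ⋖ br b → br a ⋖ br c → b ≠ c →
      (model T y).node a b ≠ (model T y).node a c := by
    intro a b c hb hc hne h
    have hne' : br b ≠ br c := br_injective.ne hne
    rw [model_node_of_lt hb.lt, model_node_of_lt hc.lt] at h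
    -- Two distinct covers of a bracket are disjoint, so no smaller bracket contains variables of
    -- both.
    have key : ∀ x, br a < x → x.Has (br b).lo → x.Has (br c).lo → False := by
      intro x hx h1 h2
      rcases chain x _ _ (le_of_covBy hb hx (has_lo _) h1) (le_of_covBy hc hx (has_lo _) h2)
        with h3 | h3
      · exact hne' ((hc.eq_or_eq hb.le h3).resolve_left hb.lt.ne')
      · exact hne' ((hb.eq_or_eq hc.le h3).resolve_left hc.lt.ne').symm
    by_cases he : (br b).lo = (br c).lo
    · exact key _ hb.lt (has_lo _) (he ▸ has_lo _)
    · obtain ⟨x, hx, h1, h2⟩ := exists_of_pos_eq' hy hT ((has_lo _).mono hb.le)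
        ((has_lo _).mono hc.le) he (boundaryPoint_inj h)
      exact key x hx h1 h2
  have hcyc : ∀ (a : Fin (model T y).numComp) (j k : Fin n), j < k →
      0 ≤ area 1 ((model T y).special a j.succ) ((model T y).special a k.succ) := by
    intro a j k hjk
    by_cases hj : (model T y).Behind a j
    · by_cases hk : (model T y).Behind a k
      · rw [model_special hT hj, model_special hT hk, area_infty (by simp)]
        have := pos_mono hy (model_behind.1 hj).1 hjk.le
        exact div_nonneg (by linarith) (by positivity)
      · rw [special_of_not_behind hk, model_special_zero, area_rotate, area_rotate, area_self]
    · rw [special_of_not_behind hj, model_special_zero, area_self]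
  refine ⟨?_, ?_, ?_, ?_, ?_, ?_, ?_, ?_⟩
  · intro i j
    refine Fin.cases ?_ (fun i => ?_) i <;> refine Fin.cases ?_ (fun j => ?_) j
    · exact fun h => absurd rfl h
    · exact fun _ _ => (boundaryPoint_ne_one _).symm
    · exact fun _ _ => boundaryPoint_ne_one _
    · exact fun h hc => hmark i j (fun h' => h (by rw [h'])) hc
  · intro a b c hb hc hne
    rcases model_adj.1 hb with hb | hb <;> rcases model_adj.1 hc with hc | hc
    · exact hchild a b c hb hc hne
    · rw [model_node_of_lt hb.lt, model_node_of_not_lt hc.lt.not_gt]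
      exact boundaryPoint_ne_one _
    · rw [model_node_of_lt hc.lt, model_node_of_not_lt hb.lt.not_gt]
      exact (boundaryPoint_ne_one _).symm
    · refine absurd (br_injective ?_) hne
      rcases chain _ _ _ hb.le hc.le with h | h
      · exact ((hb.eq_or_eq h hc.le).resolve_right hc.lt.ne).symm
      · exact (hc.eq_or_eq h hb.le).resolve_right hb.lt.ne
  · intro i b
    refine Fin.cases ?_ (fun i => ?_) i
    · intro hb
      rcases model_adj.1 hb with hb | hb
      · rw [model_node_of_lt hb.lt, model_mark_zero]
        exact (boundaryPoint_ne_one _).symm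
      · rw [br_zero] at hb
        exact absurd hb.lt not_lt_bot
    · intro hb
      rcases model_adj.1 hb with hb | hb
      · rw [model_node_of_lt hb.lt, model_mark_succ]
        intro h
        have h := boundaryPoint_inj h
        rw [br_succ] at h hb
        by_cases he : i = (br b).lo
        · exact hb.lt.not_ge (le_leaf_iff.2 (he ▸ has_lo _))
        · obtain ⟨x, hx, h1, -⟩ := exists_of_pos_eq' hy hT (has_leaf i)
            ((has_lo _).mono hb.le) he h
          exact hx.not_ge (le_leaf_iff.2 h1)
      · rw [model_node_of_not_lt hb.lt.not_gt, model_mark_succ]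
        exact boundaryPoint_ne_one _
  · intro a ha
    have h : 0 < seamHeight y (enum T a) := seamHeight_pos hy hT (mem_quilted.1 ha)
    exact ⟨inv_pos.2 (by linarith), inv_lt_one_of_one_lt₀ (by linarith)⟩
  · intro i
    refine Fin.cases (fun h => absurd rfl h) (fun i _ => ?_) i
    obtain ⟨v, hv, hvi⟩ := exists_isArg T i
    obtain ⟨a, rfl⟩ := br_surjective (y := y) v
    refine ⟨a, ⟨model_behind.2 hvi, hv⟩, ?_⟩
    rintro b ⟨hb, hq⟩
    exact br_injective (IsArg.eq (mem_quilted.1 hq) hv (model_behind.1 hb) hvi)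
  · intro a i j k
    change _ → _ → 0 ≤ area _ _ _
    refine Fin.cases ?_ (fun i => ?_) i <;> refine Fin.cases ?_ (fun j => ?_) j <;>
      refine Fin.cases ?_ (fun k => ?_) k <;> intro hij hjk
    any_goals first
      | exact absurd hij (lt_irrefl _)
      | exact absurd hij (Fin.not_lt_zero _)
      | exact absurd hjk (Fin.not_lt_zero _)
    · rw [model_special_zero]
      exact hcyc a j k (Fin.succ_lt_succ_iff.1 hjk)
    · have hij := Fin.succ_lt_succ_iff.1 hij
      have hjk := Fin.succ_lt_succ_iff.1 hjk
      by_cases hi : (model T y).Behind a i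
      · by_cases hk : (model T y).Behind a k
        · have hj : (model T y).Behind a j := by
            rw [model_behind] at *
            exact ⟨hi.1.trans hij.le, hjk.le.trans hk.2⟩
          rw [model_special hT hi, model_special hT hj, model_special hT hk,
            area_ofHalfPlane (by simp)]
          have hi := (model_behind.1 hi).1
          have h1 := pos_mono hy hi hij.le
          have h2 := pos_mono hy (hi.trans hij.le) hjk.le
          refine div_nonneg (mul_nonneg (by norm_num) ?_) (by positivity)
          exact mul_nonneg (mul_nonneg (by linarith) (by linarith)) (by linarith)
        · rw [special_of_not_behind hk, model_special_zero, ← area_rotate]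
          exact hcyc a i j hij
      · rw [special_of_not_behind hi, model_special_zero]
        exact hcyc a j k hjk
  · intro a _
    have hlo := model_behind.2 (has_lo (br a))
    refine le_trans ?_ (ncard_range_special_le a)
    refine (Set.one_lt_ncard_iff (Set.finite_range _)).2 ⟨_, _, ⟨0, rfl⟩, ⟨(br a).lo.succ, rfl⟩, ?_⟩
    rw [model_special_zero, model_special hT hlo]
    exact (ofHalfPlane_ne one_ne_zero (by simp)).symm
  · intro a ha
    have hlo := model_behind.2 (has_lo (br a))
    have hhi := model_behind.2 (has_hi (br a))
    have hlt : (br a).lo ≠ (br a).hi := fun h => ha (isArg_of_eq h)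
    refine le_trans ?_ (ncard_range_special_le a)
    refine (Set.two_lt_ncard_iff (Set.finite_range _)).2
      ⟨_, _, _, ⟨0, rfl⟩, ⟨(br a).lo.succ, rfl⟩, ⟨(br a).hi.succ, rfl⟩, ?_, ?_, ?_⟩
    · rw [model_special_zero, model_special hT hlo]
      exact (ofHalfPlane_ne one_ne_zero (by simp)).symm
    · rw [model_special_zero, model_special hT hhi]
      exact (ofHalfPlane_ne one_ne_zero (by simp)).symm
    · rw [model_special hT hlo, model_special hT hhi]
      intro h
      have := boundaryPoint_inj (Circle.ext h)
      obtain ⟨x, hx, h1, h2⟩ := exists_of_pos_eq' hy hT (has_lo _) (has_hi _) hlt this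
      have h3 := le_iff.1 hx.le
      have e1 : (br a).lo = x.lo := le_antisymm h3.1 h1.1
      have e2 : (br a).hi = x.hi := le_antisymm h2.2 h3.2.1
      -- The bracket `x` has the same ends as that of `a`, so it must be its inner copy. Then the
      -- outer bracket of `a` is an argument and `a` is quilted.
      cases hv : (br a).isInner <;> cases hxi : x.isInner
      · exact hx.ne (ext' e1 e2 (hv.trans hxi.symm))
      · obtain ⟨p, q, hpq, h4, h5⟩ := (isIn hxi).exists_min
        rw [← e1] at h4
        rw [← e2] at h5
        exact ha (isArg_of_sameArg hv ⟨p, q, hpq, h4, h5⟩)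
      · have := h3.2.2 hv
        rw [hxi] at this
        simp at this
      · exact hx.ne (ext' e1 e2 (hv.trans hxi.symm))

lemma model_coord (h : (model T y).Behind a i) : (model T y).coord a i = pos y (br a) i := by
  unfold coord
  rw [model_special_zero, model_special hT h, halfPlane_ofHalfPlane one_ne_zero (by simp),
    Complex.ofReal_re]

/-- The sizes on the model are proportional to the given ratios. -/
lemma model_size_mul (hS : (model T y).IsStable) {e : Bool} (hij : i < j)
    (h : (model T y).Sep a i j) {k l : Fin n}
    (hk : k ∈ blocks n (i, j, e)) (hl : l ∈ blocks n (i, j, e)) :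
    (model T y).size a e k * y (i, j, e) l = (model T y).size a e l * y (i, j, e) k := by
  have hi := model_behind.1 h.1
  have hj := model_behind.1 h.2.1
  have hlt : (br a).lo < (br a).hi := hi.1.trans_lt (hij.trans_le hj.2)
  have hgap : ∀ k, i < k → k ≤ j →
      (model T y).coord a k - (model T y).coord a (k - 1) = gap y (br a) k := by
    intro k h1 h2
    have hb := hS.behind_gap h.1 h.2.1 h1 h2
    rw [model_coord hT hy hb.1, model_coord hT hy hb.2, pos_sub_pred (hi.1.trans_lt h1)]
  have hsub : ∀ k, i < k ∧ k ≤ j → (br a).lo < k ∧ k ≤ (br a).hi := fun k hk =>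
    ⟨hi.1.trans_lt hk.1, hk.2.trans hj.2⟩
  cases e
  · have hk' := (mem_blocks_false hij).1 hk
    have hl' := (mem_blocks_false hij).1 hl
    rw [size_false, size_false, hgap k hk'.1 hk'.2, hgap l hl'.1 hl'.2]
    refine hy.2 ((br a).lo, (br a).hi, !(br a).isInner) (i, j, false) (fun m hm => ?_) k hk l hl
    have hm := hsub m ((mem_blocks_false hij).1 hm)
    cases (br a).isInner
    · exact (mem_blocks_true hlt).2 (Or.inr hm)
    · exact (mem_blocks_false hlt).2 hm
  · by_cases ho : (model T y).IsOuter a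
    · have hv := model_isOuter.1 ho
      have hsize : ∀ k ∈ blocks n (i, j, true),
          (model T y).size a true k = y ((br a).lo, (br a).hi, true) k := by
        intro k hk
        rcases (mem_blocks_true hij).1 hk with rfl | hk
        · by_cases hq : a ∈ (model T y).quilted
          · have hpos := seamHeight_pos hy hT (mem_quilted.1 hq)
            rw [size_quilted hq]
            change (1 - (1 + seamHeight y (br a))⁻¹) / (1 + seamHeight y (br a))⁻¹ =
              seamHeight y (br a)
            have : 1 + seamHeight y (br a) ≠ 0 := by linarith
            field_simp
            ring
          · rw [size_rootSide (ho.resolve_left hq)]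
            by_contra hne
            have := (hT _ _).1 (Ne.symm hne)
            rw [mem_faceSupport_true hlt, seamDom_zero_iff hlt] at this
            exact hq (isArg_of_sameArg hv this)
        · rw [size_outer ho (Fin.ne_zero_of_gap hk.1), hgap k hk.1 hk.2, gap, hv, Bool.not_false]
      rw [hsize k hk, hsize l hl]
      refine hy.2 _ (i, j, true) (fun m hm => ?_) k hk l hl
      exact (mem_blocks_true hlt).2 (((mem_blocks_true hij).1 hm).imp id (hsub m))
    · have hv : (br a).isInner = true := by
        have := fun hh => ho (model_isOuter.2 hh)
        simpa using this
      have hz : ∀ k, k ≠ 0 → y (i, j, true) k = 0 := by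
        intro k hk0
        by_contra hne
        have := (hT _ _).1 hne
        rw [mem_faceSupport_true hij] at this
        have := this.resolve_left fun hh => hk0 hh.1
        exact this.2 _ _ (isIn hv) ⟨hi.1, hj.2⟩
      rw [size_inner ho, size_inner ho]
      by_cases hk0 : k = 0 <;> by_cases hl0 : l = 0
      · rw [hk0, hl0]
      · simp [hl0, hz l hl0]
      · simp [hk0, hz k hk0]
      · simp [hk0, hl0]

/-- The ratios of the model are the given ones. -/
theorem model_ratio (hS : (model T y).IsStable) : hS.ratio = y := by
  funext ⟨i, j, e⟩ k
  by_cases hk : k ∈ blocks n (i, j, e)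
  · have hsum : ∑ l ∈ blocks n (i, j, e), y (i, j, e) l = 1 := by
      rw [← hy.1.2.2 (i, j, e)]
      exact Finset.sum_subset (Finset.subset_univ _) fun l _ hl => hy.1.2.1 _ l hl
    by_cases hij : i < j
    · obtain ⟨a, ha⟩ := hS.exists_sep hij.ne
      rw [hS.ratio_eq hij ha hk, div_eq_iff (hS.sum_size_pos hij ha e).ne', Finset.mul_sum]
      calc (model T y).size a e k = ∑ l ∈ blocks n (i, j, e), (model T y).size a e k * y (i, j, e) l := by
            rw [← Finset.mul_sum, hsum, mul_one]
        _ = _ := Finset.sum_congr rfl fun l hl => by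
            rw [model_size_mul hT hy hS hij ha hk hl, mul_comm]
    · rw [blocks_of_not_lt hij] at hk hsum
      rw [Finset.mem_singleton.1 hk, hS.ratio_of_not_lt hij, if_pos rfl]
      simpa using hsum.symm
  · rw [hS.ratio_eq_zero hk, hy.1.2.1 _ k hk]

end Model

/-! ### The moduli space as the space of compatible ratios -/

section Moduli

variable {n : ℕ} [NeZero n]

/-- The variable that belongs to a marking. -/
def toVar : Fin (n + 1) → Fin n := Fin.cases 0 id

/-- The product of ratios that determines a cross-ratio. -/
def crossProduct (y : Fin n × Fin n × Bool → Fin n → ℝ) (q : Fin 4 ↪o Fin (n + 1)) : ℝ :=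
  -- If the first marking is `z₀`, it is at infinity and the first factor is absent.
  (if q 0 = 0 then 1 else ∑ m ∈ Finset.Ioc (toVar (q 0)) (toVar (q 1)),
    y (toVar (q 0), toVar (q 2), false) m) *
    ∑ m ∈ Finset.Ioc (toVar (q 2)) (toVar (q 3)), y (toVar (q 1), toVar (q 3), false) m

/-- The cross-ratios as functions of the ratios. -/
def crossRatios (y : Fin n × Fin n × Bool → Fin n → ℝ) :
    ((Fin 4 ↪o Fin (n + 1)) → EReal) × ((Fin 2 ↪o Fin n) → EReal) :=
  (fun q => -odds (crossProduct y q), fun q => odds (1 - y (q 0, q 1, true) 0))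

lemma continuous_crossRatios : Continuous (crossRatios (n := n)) := by
  refine Continuous.prodMk (continuous_pi fun q => ?_) (continuous_pi fun q => ?_)
  · refine continuous_neg.comp (continuous_odds.comp ?_)
    unfold crossProduct
    split_ifs <;> fun_prop
  · exact continuous_odds.comp (by fun_prop)

lemma exists_succ_of_lt {p q : Fin (n + 1)} (h : p < q) : ∃ i : Fin n, q = i.succ :=
  Fin.exists_succ_eq.2 (Fin.ne_zero_of_lt h) |>.imp fun _ h => h.symm

lemma embedding_mk (S : StableDisk n) :
    Moduli.embedding n (Quot.mk _ S) = crossRatios S.2.ratio := by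
  refine Prod.ext (funext fun q => ?_) (funext fun q => ?_)
  · change S.1.rho (q 0) (q 1) (q 2) (q 3) = -odds (crossProduct S.2.ratio q)
    have h01 : q 0 < q 1 := q.strictMono (by decide)
    have h12 : q 1 < q 2 := q.strictMono (by decide)
    have h23 : q 2 < q 3 := q.strictMono (by decide)
    unfold crossProduct
    generalize q 0 = p at *
    obtain ⟨j, hj⟩ := exists_succ_of_lt h01
    obtain ⟨k, hk⟩ := exists_succ_of_lt h12
    obtain ⟨l, hl⟩ := exists_succ_of_lt h23
    rw [hj] at h01
    rw [hj, hk, Fin.succ_lt_succ_iff] at h12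
    rw [hk, hl, Fin.succ_lt_succ_iff] at h23
    rw [hj, hk, hl]
    by_cases hp : p = 0
    · rw [hp, S.2.rho_zero h12 h23, if_pos rfl, one_mul]
      rfl
    · obtain ⟨i, rfl⟩ := Fin.exists_succ_eq.2 hp
      rw [S.2.rho_succ (Fin.succ_lt_succ_iff.1 h01) h12 h23, if_neg hp]
      rfl
  · exact S.2.seamRatio_eq (q.strictMono (by decide))

/-! ### Recovering the ratios from the cross-ratios -/

namespace compatible

variable {y y' : Fin n × Fin n × Bool → Fin n → ℝ} (hy : y ∈ compatible (blocks n))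
  (hy' : y' ∈ compatible (blocks n)) {i j k l : Fin n}

include hy

lemma sum_mem_Icc (b : Fin n × Fin n × Bool) (s : Finset (Fin n)) :
    ∑ k ∈ s, y b k ∈ Set.Icc (0 : ℝ) 1 := by
  refine ⟨Finset.sum_nonneg fun k _ => hy.1.1 b k, ?_⟩
  rw [← hy.1.2.2 b]
  exact Finset.sum_le_sum_of_subset_of_nonneg (Finset.subset_univ s) fun k _ _ => hy.1.1 b k

lemma sum_blocks (b : Fin n × Fin n × Bool) : ∑ k ∈ blocks n b, y b k = 1 := by
  rw [← hy.1.2.2 b]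
  exact Finset.sum_subset (Finset.subset_univ _) fun l _ hl => hy.1.2.1 _ l hl

lemma sum_Ioc_self (hij : i < j) : ∑ k ∈ Finset.Ioc i j, y (i, j, false) k = 1 := by
  have := sum_blocks hy (i, j, false)
  simpa [blocks, hij] using this

/-- The ratios with the seam are determined by those without it and the size of the seam. -/
lemma apply_true (hij : i < j) (h1 : i < k) (h2 : k ≤ j) :
    y (i, j, true) k = (1 - y (i, j, true) 0) * y (i, j, false) k := by
  have hsub : blocks n (i, j, false) ⊆ blocks n (i, j, true) := fun m hm =>
    (mem_blocks_true hij).2 (Or.inr ((mem_blocks_false hij).1 hm))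
  have hk := (mem_blocks_false hij).2 ⟨h1, h2⟩
  have e1 := sum_blocks hy (i, j, true)
  rw [NodalData.sum_blocks_true hij] at e1
  calc y (i, j, true) k = ∑ l ∈ blocks n (i, j, false), y (i, j, true) k * y (i, j, false) l := by
        rw [← Finset.mul_sum, sum_blocks hy, mul_one]
    _ = ∑ l ∈ blocks n (i, j, false), y (i, j, true) l * y (i, j, false) k :=
        Finset.sum_congr rfl fun l hl => hy.2 _ _ hsub k hk l hl
    _ = _ := by
        rw [← Finset.sum_mul]
        congr 1
        linarith

include hy'

/-- Cross-ratios that involve `z₀` give the sums of ratios from a gap to the end of a block, and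
differences of these give the single ratios. The ratio of the seam is seen directly, and
`apply_true` supplies the rest. -/
lemma crossRatios_injOn (h : crossRatios y = crossRatios y') : y = y' := by
  have hsum : ∀ i j k : Fin n, i < j → i ≤ k → k ≤ j →
      ∑ m ∈ Finset.Ioc k j, y (i, j, false) m = ∑ m ∈ Finset.Ioc k j, y' (i, j, false) m := by
    intro i j k hij hik hkj
    rcases hik.eq_or_lt with rfl | hik
    · rw [sum_Ioc_self hy hij, sum_Ioc_self hy' hij]
    rcases hkj.eq_or_lt with rfl | hkj
    · simp
    let q : Fin 4 ↪o Fin (n + 1) := OrderEmbedding.ofStrictMono ![0, i.succ, k.succ, j.succ] (by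
      refine Fin.strictMono_iff_lt_succ.2 fun m => ?_
      fin_cases m
      · exact Fin.succ_pos i
      · exact Fin.succ_lt_succ_iff.2 hik
      · exact Fin.succ_lt_succ_iff.2 hkj)
    have h1 : -odds (crossProduct y q) = -odds (crossProduct y' q) :=
      congrFun (congrArg Prod.fst h) q
    have h2 : ∀ y : Fin n × Fin n × Bool → Fin n → ℝ,
        crossProduct y q = ∑ m ∈ Finset.Ioc k j, y (i, j, false) m := by
      intro y
      have h0 : q 0 = 0 := rfl
      unfold crossProduct
      rw [if_pos h0, one_mul]
      rfl
    rw [h2, h2] at h1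
    exact odds_injOn (sum_mem_Icc hy _ _) (sum_mem_Icc hy' _ _) (neg_injective h1)
  have hfalse : ∀ i j k : Fin n, i < k → k ≤ j → y (i, j, false) k = y' (i, j, false) k := by
    intro i j k hik hkj
    have hij := hik.trans_le hkj
    have h1 := hsum i j k hij hik.le hkj
    have hlt := Fin.pred_lt (Fin.ne_zero_of_gap hik)
    have h2 := hsum i j (k - 1) hij (Fin.le_pred hik) (hlt.le.trans hkj)
    have h3 : Finset.Ioc (k - 1) j = insert k (Finset.Ioc k j) := by
      have := Fin.val_pred (Fin.ne_zero_of_gap hik)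
      ext m
      simp only [Finset.mem_Ioc, Finset.mem_insert, Fin.lt_def, Fin.le_def, Fin.ext_iff] at *
      omega
    rw [h3, Finset.sum_insert (by simp), Finset.sum_insert (by simp)] at h2
    linarith
  have htrue : ∀ i j : Fin n, i < j → y (i, j, true) 0 = y' (i, j, true) 0 := by
    intro i j hij
    let q : Fin 2 ↪o Fin n := OrderEmbedding.ofStrictMono ![i, j] (by
      refine Fin.strictMono_iff_lt_succ.2 fun m => ?_
      fin_cases m
      exact hij)
    have h1 : odds (1 - y (i, j, true) 0) = odds (1 - y' (i, j, true) 0) :=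
      congrFun (congrArg Prod.snd h) q
    have key : ∀ y : Fin n × Fin n × Bool → Fin n → ℝ, y ∈ compatible (blocks n) →
        1 - y (i, j, true) 0 ∈ Set.Icc (0 : ℝ) 1 := by
      intro y hy
      have := sum_mem_Icc hy (i, j, true) {0}
      rw [Finset.sum_singleton] at this
      exact ⟨by linarith [this.2], by linarith [this.1]⟩
    have := odds_injOn (key y hy) (key y' hy') h1
    linarith
  funext ⟨i, j, e⟩ k
  by_cases hk : k ∈ blocks n (i, j, e)
  · by_cases hij : i < j
    · cases e
      · have := (mem_blocks_false hij).1 hk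
        exact hfalse i j k this.1 this.2
      · rcases (mem_blocks_true hij).1 hk with rfl | hk
        · exact htrue i j hij
        · rw [apply_true hy hij hk.1 hk.2, apply_true hy' hij hk.1 hk.2, htrue i j hij,
            hfalse i j k hk.1 hk.2]
    · have h1 := sum_blocks hy (i, j, e)
      have h2 := sum_blocks hy' (i, j, e)
      rw [blocks_of_not_lt hij, Finset.sum_singleton] at h1 h2
      rw [blocks_of_not_lt hij, Finset.mem_singleton] at hk
      rw [hk, h1, h2]
  · rw [hy.1.2.1 _ k hk, hy'.1.2.1 _ k hk]

end compatible

/-- The ratios of an isomorphism class of stable disks. -/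
def Moduli.ratio : Moduli n → (Fin n × Fin n × Bool → Fin n → ℝ) :=
  Quot.lift (fun S => S.2.ratio) fun S S' h =>
    -- Isomorphic disks have the same cross-ratios, and these determine the ratios.
    compatible.crossRatios_injOn S.2.ratio_mem_compatible S'.2.ratio_mem_compatible (by
      rw [← embedding_mk, ← embedding_mk]
      exact congrArg _ (Quot.sound h))

lemma Moduli.ratio_mk (S : StableDisk n) : Moduli.ratio (Quot.mk _ S) = S.2.ratio := rfl

lemma Moduli.range_ratio : Set.range (Moduli.ratio (n := n)) = compatible (blocks n) := by
  apply Set.Subset.antisymm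
  · rintro _ ⟨x, rfl⟩
    induction x using Quot.ind with
    | mk S => exact S.2.ratio_mem_compatible
  · intro y hy
    obtain ⟨T, hT⟩ := compatible.exists_bracketing hy
    exact ⟨Quot.mk _ ⟨model T y, model_isStable hT hy⟩, model_ratio hT hy (model_isStable hT hy)⟩

lemma Moduli.ratio_injective : Function.Injective (Moduli.ratio (n := n)) := by
  intro x x'
  induction x using Quot.ind with
  | mk S =>
    induction x' using Quot.ind with
    | mk S' => exact fun h => Quot.sound (S.2.iso_of_ratio_eq S'.2 h)

/-- The topology is induced by the composition of `ratio` with `crossRatios`, and the latter is a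
closed embedding of the compact set of compatible families, so `ratio` alone induces it. -/
lemma Moduli.isEmbedding_ratio : Topology.IsEmbedding (Moduli.ratio (n := n)) := by
  have hmem : ∀ x : Moduli n, x.ratio ∈ compatible (blocks n) := fun x => by
    rw [← Moduli.range_ratio]
    exact ⟨x, rfl⟩
  let g : Moduli n → compatible (blocks n) := fun x => ⟨x.ratio, hmem x⟩
  have hcompact : CompactSpace (compatible (blocks n)) :=
    isCompact_iff_compactSpace.1 (isCompact_compatible (blocks n))
  have hclosed : Topology.IsClosedEmbedding
      (fun y : compatible (blocks n) => crossRatios (n := n) y.1) :=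
    Topology.IsClosedEmbedding.of_continuous_injective_isClosedMap
      (continuous_crossRatios.comp continuous_subtype_val)
      (fun y y' h => Subtype.ext (compatible.crossRatios_injOn y.2 y'.2 h))
      (continuous_crossRatios.comp continuous_subtype_val).isClosedMap
  have hcomp : (fun y : compatible (blocks n) => crossRatios (n := n) y.1) ∘ g =
      Moduli.embedding n := by
    funext x
    induction x using Quot.ind with
    | mk S => exact (embedding_mk S).symm
  have hg : Topology.IsInducing g := by
    rw [← hclosed.isInducing.of_comp_iff, hcomp]
    exact ⟨rfl⟩
  exact ⟨Topology.IsInducing.subtypeVal.comp hg, Moduli.ratio_injective⟩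

/-- The stratum of a disk consists of the disks with the same bracketing. -/
lemma Moduli.stratum_eq (S : StableDisk n) : Moduli.stratum S =
    {x | ∀ b k, x.ratio b k ≠ 0 ↔ k ∈ faceSupport S.2.bracketing b} := by
  ext x
  induction x using Quot.ind with
  | mk S' =>
    have hiff : (∀ b k, (Moduli.ratio (Quot.mk _ S' : Moduli n)) b k ≠ 0 ↔
        k ∈ faceSupport S.2.bracketing b) ↔ S.2.bracketing = S'.2.bracketing := by
      rw [Moduli.ratio_mk]
      constructor
      · intro h
        refine (faceSystem n).eq_of_forall fun b => Finset.ext fun k => ?_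
        rw [← h, S'.2.ratio_support]
      · intro h b k
        rw [h, S'.2.ratio_support]
    refine Iff.trans ?_ hiff.symm
    constructor
    · rintro ⟨S'', h1, h2⟩
      have h3 : S''.2.ratio = S'.2.ratio := congrArg Moduli.ratio h2
      rw [(S.2.sameType_iff S''.2).1 h1]
      exact S''.2.bracketing_eq_of_ratio S'.2 h3
    · intro h
      exact ⟨S', (S.2.sameType_iff S'.2).2 h, rfl⟩

instance : Nonempty (PaintedBracketing n) := by
  have hw : IsWord (Finset.univ : Finset (Fin n)) :=
    ⟨Finset.univ_nonempty, by rw [Finset.coe_univ]; exact Set.ordConnected_univ⟩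
  have hmin : Minimal (· ∈ ({Finset.univ} : Finset (Finset (Fin n)))) Finset.univ :=
    ⟨Finset.mem_singleton_self _, fun J hJ _ => (Finset.mem_singleton.1 hJ).ge⟩
  exact ⟨{ inner := ∅
           outer := {Finset.univ}
           inner_word := by simp
           inner_laminar := by simp [Laminar]
           outer_word := by
            intro J hJ
            exact Finset.mem_singleton.1 hJ ▸ hw
           outer_laminar := by simp [Laminar]
           univ_mem := Finset.mem_singleton_self _
           cover := fun i => ⟨Finset.univ, hmin, Finset.mem_univ i⟩
           inner_le := by simp }⟩

/-- Applied to the cell of a bracketing, this provides a disk with that bracketing. -/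
lemma openCells_nonempty {X : Type} [TopologicalSpace X]
    [Topology.CWComplex (Set.univ : Set X)] {e : Set X} (he : e ∈ openCells X) : e.Nonempty := by
  obtain ⟨d, c, rfl⟩ := he
  exact ⟨_, Topology.RelCWComplex.map_zero_mem_openCell d c⟩

end Moduli

end Quilt

end

theorem theorem1p1 (n : ℕ) (hn : 2 ≤ n) :
    ∃ (_ : Topology.CWComplex (Set.univ : Set (Quilt.Moduli n)))
      (_ : Topology.CWComplex (Set.univ : Set (Quilt.Multiplihedron n))),
      Quilt.openCells (Quilt.Moduli n) = Quilt.Moduli.strata n ∧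
      Quilt.openCells (Quilt.Multiplihedron n) = Quilt.Multiplihedron.cells n ∧
      ∃ h : Quilt.Moduli n ≃ₜ Quilt.Multiplihedron n, Quilt.IsCWIso h := by
  have : NeZero n := ⟨by omega⟩
  obtain ⟨cX, cP, h1, h2, h3⟩ := (Quilt.faceSystem n).exists_cw_iso Quilt.Moduli.ratio
    Quilt.Moduli.isEmbedding_ratio Quilt.Moduli.range_ratio
  refine ⟨cX, cP, ?_, h2, h3⟩
  -- Cells are indexed by bracketings and strata by disks; the two families coincide because each
  -- bracketing is that of a disk.
  have key : ∀ T : Quilt.PaintedBracketing n, ∃ S : Quilt.StableDisk n, S.2.bracketing = T := by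
    intro T
    obtain ⟨x, hx⟩ := Quilt.openCells_nonempty (h1 ▸ ⟨T, rfl⟩ : {x : Quilt.Moduli n | ∀ b k,
      x.ratio b k ≠ 0 ↔ k ∈ Quilt.faceSupport T b} ∈ Quilt.openCells (Quilt.Moduli n))
    induction x using Quot.ind with
    | mk S =>
      refine ⟨S, (Quilt.faceSystem n).eq_of_forall fun b => Finset.ext fun k => ?_⟩
      rw [← S.2.ratio_support]
      exact hx b k
  rw [h1]
  ext e
  constructor
  · rintro ⟨T, rfl⟩
    obtain ⟨S, rfl⟩ := key T
    exact ⟨S, Quilt.Moduli.stratum_eq S⟩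
  · rintro ⟨S, rfl⟩
    exact ⟨S.2.bracketing, (Quilt.Moduli.stratum_eq S).symm⟩
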